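/- A \emph{map} is a connected multigraph (loops and multiple edges allowed) embedded in the oriented sphere, considered up to orientation-preserving homeomorphism of the sphere; a \emph{rooted} map is a map with a distinguished oriented edge $st$ (the \emph{root edge}), where $s$ is its initial and $t$ its final vertex. A map is \emph{4-regular} if every vertex is incident to exactly four half-edges. Let $\vec{\mathcal M}$ be the class of rooted 4-regular maps (shadows of connected link-diagrams, i.e. crossing information is disregarded) whose underlying graph has no $K_4$ minor. For $R\in\vec{\mathcal M}$ let $R^-$ be $R$ with its root edge deleted. Consider the following subclasses of $\vec{\mathcal M}$: (i) $\mathcal U$: the maps with $s=t$ (loop composition); (ii) $\mathcal S$: the maps such that $R^-$ is connected and has a bridge (series composition); (iii) $\mathcal P$: the maps with $s\ne t$ such that $R^-$ is connected and bridgeless, and either $R^--\{s,t\}$ is disconnected or $s,t$ are joined by at least three edges of $R$ (parallel composition); (iv) $\mathcal F$: the maps with $s\neq t$ such that $R^-$ is connected and bridgeless, $R^--\{s,t\}$ is (non-empty and) connected, and $s,t$ are joined by exactly two edges of $R$ (remaining composition). Let $\vec M(z),U(z),S(z),P(z),F(z)$ be the generating functions of $\vec{\mathcal M},\mathcal U,\mathcal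 S,\mathcal P,\mathcal F$, where $z$ marks the edges different from the root edge; that is, the coefficient of $z^n$ is the number of maps of the class with $n+1$ edges. Then, as formal power series, \begin{align*} \vec M &= U+S+P+F,\\ U &= 2z^2\vec M+2z,\\ S &= z(\vec M-S)\vec M,\\ P &= z^3(1+z\vec M)^3+zF\vec M,\\ F &= (z+z^2\vec M)^2\bigl(F+2z(z+z^2\vec M)^2\bigr). \end{align*} -/

import Mathlib

/-- `G` has `H` as a minor: pairwise disjoint connected branch sets, one for each vertex of `H`,
with an edge of `G` between the branch sets of any two adjacent vertices of `H`. -/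
def HasGraphMinor {W V : Type*} (H : SimpleGraph W) (G : SimpleGraph V) : Prop :=
  ∃ B : W → Set V,
    (∀ w, (G.induce (B w)).Connected) ∧
    (∀ w w', w ≠ w' → Disjoint (B w) (B w')) ∧
    (∀ w w', H.Adj w w' → ∃ u ∈ B w, ∃ v ∈ B w', G.Adj u v)

/-- The orbits (cycles, fixed points included) of a permutation. -/
abbrev PermOrbits {D : Type*} (f : Equiv.Perm D) : Type _ :=
  Quotient (Equiv.Perm.SameCycle.setoid f)

/-- A rooted map: a connected multigraph (loops and multiple edges allowed) embedded in the
oriented sphere, given by its half-edges `D`, with a distinguished half-edge.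
`rot` sends a half-edge to the next one around its vertex, `flip` sends a half-edge to the
other half of its edge. Vertices, edges and faces are the orbits of `rot`, `flip` and
`rot * flip`, and the surface is the sphere by Euler's formula.
The root edge is oriented away from the vertex of the half-edge `root`. -/
@[ext]
structure RootedMap (D : Type*) where
  rot : Equiv.Perm D
  flip : Equiv.Perm D
  root : D
  flip_flip : ∀ d, flip (flip d) = d
  flip_ne : ∀ d, flip d ≠ d
  transitive : ∀ d d' : D, ∃ g ∈ Subgroup.closure {rot, flip}, g d = d'
  euler : Nat.card (PermOrbits rot) + Nat.card (PermOrbits (rot * flip)) =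
    Nat.card (PermOrbits flip) + 2

namespace RootedMap

variable {D : Type*} (R : RootedMap D)

abbrev Vertex : Type _ := PermOrbits R.rot

abbrev Edge : Type _ := PermOrbits R.flip

/-- The vertex at which a half-edge is attached. -/
def vert (d : D) : R.Vertex := Quotient.mk _ d

/-- The edge to which a half-edge belongs. -/
def edge (d : D) : R.Edge := Quotient.mk _ d

theorem edge_flip (d : D) : R.edge (R.flip d) = R.edge d :=
  Quotient.sound (Equiv.Perm.sameCycle_apply_left.2 (Equiv.Perm.SameCycle.refl _ _))

/-- The root edge. -/
def rootEdge : R.Edge := R.edge R.root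

/-- The initial vertex of the root edge. -/
def s : R.Vertex := R.vert R.root

/-- The final vertex of the root edge. -/
def t : R.Vertex := R.vert (R.flip R.root)

/-- Adjacency in the multigraph obtained by deleting the edges in `A` (all vertices are kept). -/
def graphMinus (A : Set R.Edge) : SimpleGraph R.Vertex where
  Adj u v := u ≠ v ∧ ∃ d, R.edge d ∉ A ∧ R.vert d = u ∧ R.vert (R.flip d) = v
  symm := ⟨by
    rintro u v ⟨h, d, hd, hu, hv⟩
    exact ⟨h.symm, R.flip d, by rwa [R.edge_flip], hv, by rwa [R.flip_flip]⟩⟩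
  loopless := ⟨fun _ h => h.1 rfl⟩

/-- Every vertex is incident to exactly four half-edges. -/
def IsFourRegular : Prop := ∀ v : R.Vertex, {d : D | R.vert d = v}.ncard = 4

/-- The underlying graph has no `K₄` minor (loops and multiplicities do not matter for this). -/
def IsK4MinorFree : Prop := ¬ HasGraphMinor (⊤ : SimpleGraph (Fin 4)) (R.graphMinus ∅)

/-- Adjacency in the multigraph `R⁻`, that is, `R` without its root edge. -/
def network : SimpleGraph R.Vertex := R.graphMinus {R.rootEdge}

/-- `R⁻` has a bridge: an edge whose deletion from `R⁻` disconnects its two ends. -/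
def NetworkHasBridge : Prop :=
  ∃ d, R.edge d ≠ R.rootEdge ∧
    ¬ (R.graphMinus {R.rootEdge, R.edge d}).Reachable (R.vert d) (R.vert (R.flip d))

/-- `R⁻` is connected and has no bridge. -/
def NetworkTwoEdgeConnected : Prop := R.network.Connected ∧ ¬ R.NetworkHasBridge

/-- Adjacency in `R⁻ - {s, t}`. -/
def innerGraph : SimpleGraph ({R.s, R.t}ᶜ : Set R.Vertex) := R.network.induce {R.s, R.t}ᶜ

/-- The number of edges of `R` (the root edge included) that join `s` and `t`. -/
noncomputable def numRootParallel : ℕ :=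
  {e : R.Edge | ∃ d, R.edge d = e ∧ R.vert d = R.s ∧ R.vert (R.flip d) = R.t}.ncard

/-- All rooted `K₄`-minor-free 4-regular maps. -/
def ClassM : Prop := R.IsFourRegular ∧ R.IsK4MinorFree

/-- Loop composition. -/
def ClassU : Prop := R.ClassM ∧ R.s = R.t

/-- Series composition. -/
def ClassS : Prop := R.ClassM ∧ R.network.Connected ∧ R.NetworkHasBridge

/-- Parallel composition (the graph `R⁻ - {s, t}` without vertices is not disconnected). -/
def ClassP : Prop :=
  R.ClassM ∧ R.s ≠ R.t ∧ R.NetworkTwoEdgeConnected ∧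
    (¬ R.innerGraph.Preconnected ∨ 3 ≤ R.numRootParallel)

/-- The remaining composition. -/
def ClassF : Prop :=
  R.ClassM ∧ R.s ≠ R.t ∧ R.NetworkTwoEdgeConnected ∧
    R.innerGraph.Connected ∧ R.numRootParallel = 2

/-- Isomorphism of rooted maps: a bijection of the half-edges that respects the cyclic orders
around the vertices (hence the orientation of the sphere), the edges and the root. -/
def Iso {D' : Type*} (R : RootedMap D) (R' : RootedMap D') : Prop :=
  ∃ f : D ≃ D', (∀ d, f (R.rot d) = R'.rot (f d)) ∧ (∀ d, f (R.flip d) = R'.flip (f d)) ∧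
    f R.root = R'.root

/-- Isomorphism as an equivalence relation on the rooted maps with half-edges `D`. -/
def isoSetoid (D : Type*) : Setoid (RootedMap D) where
  r R R' := R.Iso R'
  iseqv :=
    { refl := fun _ => ⟨Equiv.refl _, fun _ => rfl, fun _ => rfl, rfl⟩
      symm := by
        rintro R R' ⟨f, h1, h2, h3⟩
        refine ⟨f.symm, fun d => ?_, fun d => ?_, ?_⟩
        · rw [Equiv.symm_apply_eq, h1, Equiv.apply_symm_apply]
        · rw [Equiv.symm_apply_eq, h2, Equiv.apply_symm_apply]
        · rw [Equiv.symm_apply_eq, h3]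
      trans := by
        rintro R R' R'' ⟨f, h1, h2, h3⟩ ⟨g, k1, k2, k3⟩
        exact ⟨f.trans g, fun d => by simp [h1, k1], fun d => by simp [h2, k2],
          by simp [h3, k3]⟩ }

/-- The isomorphism classes of rooted maps with `n + 1` edges (`n` non-root edges) that lie in
the class `C`. Every such map can be labelled by the `2 * (n + 1)` elements of
`Fin (2 * (n + 1))`. -/
abbrev IsoClasses (C : ∀ ⦃D : Type⦄, RootedMap D → Prop) (n : ℕ) : Type :=
  Quotient ((isoSetoid (Fin (2 * (n + 1)))).comap
    (Subtype.val : {R : RootedMap (Fin (2 * (n + 1))) // C R} → RootedMap (Fin (2 * (n + 1)))))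

instance instFiniteRootedMap [Finite D] : Finite (RootedMap D) :=
  Finite.of_injective (fun R : RootedMap D => (R.rot, R.flip, R.root)) fun R R' h => by
    simp only [Prod.mk.injEq] at h
    exact RootedMap.ext h.1 h.2.1 h.2.2

/-- There are finitely many maps of each size, so that `Nat.card` really counts them. -/
theorem finite_isoClasses (C : ∀ ⦃D : Type⦄, RootedMap D → Prop) (n : ℕ) :
    Finite (IsoClasses C n) :=
  inferInstance

/-- The generating function of a class of rooted maps; the variable marks the non-root edges. -/
noncomputable def genFun (C : ∀ ⦃D : Type⦄, RootedMap D → Prop) : PowerSeries ℤ :=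
  PowerSeries.mk fun n => (Nat.card (IsoClasses C n) : ℤ)

noncomputable def genM : PowerSeries ℤ := genFun fun _ R => R.ClassM

noncomputable def genU : PowerSeries ℤ := genFun fun _ R => R.ClassU

noncomputable def genS : PowerSeries ℤ := genFun fun _ R => R.ClassS

noncomputable def genP : PowerSeries ℤ := genFun fun _ R => R.ClassP

noncomputable def genF : PowerSeries ℤ := genFun fun _ R => R.ClassF

end RootedMap

/-!
A rooted map is handled through its half-edges. Edge cuts of a 4-regular map are even, so deleting
the root edge never disconnects the map, and a bridge of the remaining network is the same as a cut
with two edges that contains the root edge. The basic operation is the substitution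
`RootedMap.sub`, which replaces an edge by the network of a second map. Euler's formula and the
absence of a `K₄` minor pass both ways between a substitution and its two parts (`planar_sub_iff`,
`hasK4_sub_iff`). A *chain* (`RootedMap.IsLink`) is an edge in which something may have been
substituted. The following decompositions give the equations; `M` counts all `K₄`-free maps.

* A map whose network has a bridge is in a unique way a series composition whose second part is
  bridgeless (`Net.not_bridgeless_iff_series`, `Net.gf_series`). This gives `S = X * (M - S) * M`.
* In a map whose root edge is a loop, the two ends of the loop are consecutive at their vertex, in
  one of two mirror-symmetric ways, since otherwise it would separate the other two half-edges, and
  cuts with one edge do not exist. The other two half-edges are the ends of a chain, hence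
  `U = 2 * X * (1 + X * M)`.
* The remaining maps form the class `Net.Core`. Structure theorem (`IsCore.isDip_or_isMate`):
  either all three other edges at `s` start chains to `t`, or one of them starts a chain to `t` and
  the other two start chains to a common third vertex. To prove it, the chains at `s` are replaced
  by edges. If `s` then had three different neighbours, `R - s`, which is connected, would either
  have a triangle minor rooted at them, and `R` a `K₄` minor, or a vertex that separates the three
  from each other, which needs more than four half-edges by parity
  (`hasRootedTriangle_or_separated`, `Reduced.false_of_three`).
* By planarity a chain from `s` to `t`, if there is just one, is next to the root edge, on one of
  its two sides (`IsMap4.digon`, `IsCore.link_position`). The two sides are exchanged by reflection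
  (`Net.gf_core`), so that the chain may be assumed to follow the root edge (`Net.Fan`).
  Substituting in its edge accounts for a factor `1 + X * M` between the maps where it is an edge
  (`Net.EdgeFan`) and all maps of `Net.Fan` (`Net.gf_fan`).
* If the chain is an edge, then it bounds a digon with the root edge, and the vertex `s` can be
  removed by joining the four edges that end there in two pairs. The inverse operation (`RootedMap.pinch`) pinches the
  root edge and its neighbour at a new vertex. By the structure theorem, it leads to a `K₄`-free map
  exactly if the network of the smaller map is either a `Fan` or a series composition that ends with
  one (`Net.gf_edgeFan_pinchedProp`). The smaller map has a loop as its root edge if and only if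
  the larger one has three chains from `s` to `t`.

The class `F` consists of the maps of `Net.Core` with a single chain from `s` to `t`, provided that
this chain is an edge, and `P` contains the others (`Net.coreParallel_iff`,
`Net.not_coreParallel_iff`). If `D` and `E` count the maps of `Fan` with three chains and
with one chain from `s` to `t`, this results in `D = X ^ 3 * (1 + X * M) ^ 3`,
`E = X ^ 2 * (1 + X * M) ^ 2 * (D + E)`, `P + F = D + 2 * E` and `2 * E = (1 + X * M) * F`.
-/

open Equiv.Perm
open Equiv (Perm swap)

/-! ### Cycles of permutations and Euler's inequality -/

namespace Equiv.Perm

variable {D : Type*}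

/-- The number of cycles of a permutation, fixed points included. -/
noncomputable def numCycles (f : Perm D) : ℕ := Nat.card (PermOrbits f)

theorem SameCycle.mem_of_forall_mem [Finite D] {f : Perm D} {S : Set D} (hS : ∀ d ∈ S, f d ∈ S)
    {a b : D} (h : f.SameCycle a b) (ha : a ∈ S) : b ∈ S := by
  obtain ⟨n, rfl⟩ := h.exists_nat_pow_eq
  clear h
  induction n with
  | zero => simpa
  | succ n ih => rw [pow_succ', mul_apply]; exact hS _ ih

theorem SameCycle.rel_of_forall [Finite D] {f : Perm D} {r : Setoid D} (h : ∀ d, r d (f d))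
    {a b : D} (hab : f.SameCycle a b) : r a b :=
  hab.mem_of_forall_mem (S := {b | r a b}) (fun d hd => r.trans hd (h d)) (r.refl a)

variable [DecidableEq D]

theorem SameCycle.mul_swap_of_not [Finite D] {f : Perm D} {x y : D} (h : ¬ f.SameCycle x y) :
    (f * swap x y).SameCycle x y := by
  classical
  have hex : ∃ k, 0 < k ∧ (f ^ k) x = x := ⟨orderOf f, orderOf_pos f, by simp [pow_orderOf_eq_one]⟩
  obtain ⟨hk0, hk⟩ := Nat.find_spec hex
  have hmin := fun i (hi : i < Nat.find hex) => Nat.find_min hex hi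
  set k := Nat.find hex
  have key : ∀ i, i + 1 ≤ k → (f * swap x y).SameCycle y ((f ^ (i + 1)) x) := by
    intro i
    induction i with
    | zero => intro _; exact ⟨1, by simp⟩
    | succ i ih =>
      intro hi
      have h1 := ih (by omega)
      have hx : (f ^ (i + 1)) x ≠ x := fun hx => hmin (i + 1) (by omega) ⟨by omega, hx⟩
      have hy : (f ^ (i + 1)) x ≠ y := fun hy => h ⟨(i + 1 : ℕ), by rw [zpow_natCast]; exact hy⟩
      have h2 : (f * swap x y) ((f ^ (i + 1)) x) = (f ^ (i + 1 + 1)) x := by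
        rw [mul_apply, swap_apply_of_ne_of_ne hx hy, ← mul_apply, ← pow_succ']
      rw [← h2]
      exact sameCycle_apply_right.2 h1
  have := key (k - 1) (by omega)
  rw [Nat.sub_add_cancel hk0, hk] at this
  exact this.symm

theorem SameCycle.not_mul_swap [Finite D] {f : Perm D} {x y : D} (h : f.SameCycle x y)
    (hne : x ≠ y) : ¬ (f * swap x y).SameCycle x y := by
  classical
  have hex : ∃ k : ℕ, (f ^ k) x = y := h.exists_nat_pow_eq
  have hj := Nat.find_spec hex
  have hmin := fun i (hi : i < Nat.find hex) => Nat.find_min hex hi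
  set j := Nat.find hex
  have hj0 : 0 < j := Nat.pos_of_ne_zero fun h0 => hne (by rw [h0] at hj; simpa using hj)
  have hx : ∀ i, 0 < i → i ≤ j → (f ^ i) x ≠ x := by
    intro i hi0 hij hix
    refine hmin (j - i) (by omega) ?_
    conv_lhs => rw [← hix]
    rw [← mul_apply, ← pow_add, Nat.sub_add_cancel hij, hj]
  intro hs
  have := hs.symm.mem_of_forall_mem (S := {d | ∃ i, 0 < i ∧ i ≤ j ∧ d = (f ^ i) x}) ?_
    ⟨j, hj0, le_rfl, hj.symm⟩
  · obtain ⟨i, h0, hi, hix⟩ := this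
    exact hx i h0 hi hix.symm
  · rintro _ ⟨i, h0, hi, rfl⟩
    rcases hi.lt_or_eq with hlt | rfl
    · refine ⟨i + 1, by omega, hlt, ?_⟩
      rw [mul_apply, swap_apply_of_ne_of_ne (hx i h0 hi) (hmin i hlt), ← mul_apply, ← pow_succ']
    · exact ⟨1, by omega, hj0, by rw [hj]; simp⟩

end Equiv.Perm

namespace Setoid

variable {D : Type*}

/-- The equivalence relation obtained from `r` by merging the classes of `x` and `y`. -/
def mergePair (r : Setoid D) (x y : D) : Setoid D where
  r u v := r u v ∨ ((r u x ∨ r u y) ∧ (r v x ∨ r v y))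
  iseqv :=
    { refl := fun u => Or.inl (r.refl u)
      symm := by
        rintro u v (h | ⟨h, h'⟩)
        · exact Or.inl (r.symm h)
        · exact Or.inr ⟨h', h⟩
      trans := by
        rintro u v w (h | ⟨h, h'⟩) (k | ⟨k, k'⟩)
        · exact Or.inl (r.trans h k)
        · exact Or.inr ⟨k.imp (r.trans h) (r.trans h), k'⟩
        · exact Or.inr ⟨h, h'.imp (r.trans (r.symm k)) (r.trans (r.symm k))⟩
        · exact Or.inr ⟨h, k'⟩ }

theorem mergePair_apply {r : Setoid D} {x y u v : D} :
    r.mergePair x y u v ↔ r u v ∨ ((r u x ∨ r u y) ∧ (r v x ∨ r v y)) := Iff.rfl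

theorem le_mergePair (r : Setoid D) (x y : D) : r ≤ r.mergePair x y := fun _ _ h => Or.inl h

theorem mergePair_rel (r : Setoid D) (x y : D) : r.mergePair x y x y :=
  Or.inr ⟨Or.inl (r.refl x), Or.inr (r.refl y)⟩

theorem mergePair_le {r r' : Setoid D} {x y : D} (h : r ≤ r') (hxy : r' x y) :
    r.mergePair x y ≤ r' := by
  have key : ∀ u, r u x ∨ r u y → r' u x := by
    rintro u (hu | hu)
    · exact h hu
    · exact r'.trans (h hu) (r'.symm hxy)
  rintro u v (huv | ⟨hu, hv⟩)
  · exact h huv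
  · exact r'.trans (key u hu) (r'.symm (key v hv))

theorem mergePair_eq_self {r : Setoid D} {x y : D} (h : r x y) : r.mergePair x y = r :=
  le_antisymm (mergePair_le le_rfl h) (le_mergePair r x y)

theorem sup_mergePair (s r : Setoid D) (x y : D) :
    s ⊔ r.mergePair x y = (s ⊔ r).mergePair x y := by
  refine le_antisymm (sup_le ?_ ?_) (mergePair_le ?_ ?_)
  · exact le_sup_left.trans (le_mergePair _ _ _)
  · exact mergePair_le (le_sup_right.trans (le_mergePair _ _ _)) (mergePair_rel _ _ _)
  · exact sup_le_sup_left (le_mergePair _ _ _) _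
  · exact le_sup_right (a := s) (mergePair_rel r x y)

theorem card_quotient_mergePair [Finite D] {r : Setoid D} {x y : D} (h : ¬ r x y) :
    Nat.card (Quotient (r.mergePair x y)) + 1 = Nat.card (Quotient r) := by
  classical
  have e : {q : Quotient r // q ≠ Quotient.mk r y} ≃ Quotient (r.mergePair x y) := by
    refine Equiv.ofBijective
      (fun q => Quotient.map' (s₂ := r.mergePair x y) id (fun _ _ h => Or.inl h) q.1) ⟨?_, ?_⟩
    · rintro ⟨q, hq⟩ ⟨q', hq'⟩ hqq
      induction q using Quotient.inductionOn with | _ u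
      induction q' using Quotient.inductionOn with | _ v
      have hu : ¬ r u y := fun hu => hq (Quotient.sound hu)
      have hv : ¬ r v y := fun hv => hq' (Quotient.sound hv)
      have : r.mergePair x y u v := Quotient.exact hqq
      refine Subtype.ext (Quotient.sound ?_)
      rcases this with h1 | ⟨h1, h2⟩
      · exact h1
      · exact r.trans (h1.resolve_right hu) (r.symm (h2.resolve_right hv))
    · intro q
      induction q using Quotient.inductionOn with | _ u
      by_cases hu : r u y
      · exact ⟨⟨Quotient.mk r x, fun hxy => h (Quotient.exact hxy)⟩,
          Quotient.sound (Or.inr ⟨Or.inl (r.refl x), Or.inr hu⟩)⟩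
      · exact ⟨⟨Quotient.mk r u, fun h' => hu (Quotient.exact h')⟩, rfl⟩
  have : Fintype (Quotient r) := Fintype.ofFinite _
  rw [← Nat.card_congr e, Nat.card_eq_fintype_card, Nat.card_eq_fintype_card,
    Fintype.card_subtype_compl]
  have : 0 < Fintype.card (Quotient r) := Fintype.card_pos_iff.2 ⟨Quotient.mk r x⟩
  simp only [Fintype.card_unique]
  omega

end Setoid

namespace Equiv.Perm

variable {D : Type*}

section MulSwap

variable [DecidableEq D] [Finite D]

theorem setoid_mul_swap {f : Perm D} {x y : D} (h : ¬ f.SameCycle x y) :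
    SameCycle.setoid (f * swap x y) = (SameCycle.setoid f).mergePair x y := by
  have hxy := SameCycle.mul_swap_of_not h
  refine le_antisymm ?_ (Setoid.mergePair_le ?_ hxy)
  · intro u v huv
    refine SameCycle.rel_of_forall (fun d => ?_) huv
    rw [Setoid.mergePair_apply]
    change f.SameCycle _ _ ∨ ((f.SameCycle _ _ ∨ f.SameCycle _ _) ∧
      (f.SameCycle _ _ ∨ f.SameCycle _ _))
    rw [mul_apply, sameCycle_apply_right, sameCycle_apply_left, sameCycle_apply_left]
    by_cases hx : d = x
    · subst hx; rw [swap_apply_left]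
      exact Or.inr ⟨Or.inl (SameCycle.refl _ _), Or.inr (SameCycle.refl _ _)⟩
    by_cases hy : d = y
    · subst hy; rw [swap_apply_right]
      exact Or.inr ⟨Or.inr (SameCycle.refl _ _), Or.inl (SameCycle.refl _ _)⟩
    rw [swap_apply_of_ne_of_ne hx hy]
    exact Or.inl (SameCycle.refl _ _)
  · intro u v huv
    refine SameCycle.rel_of_forall (r := SameCycle.setoid (f * swap x y)) (fun d => ?_) huv
    change (f * swap x y).SameCycle _ _
    by_cases hx : d = x
    · subst hx
      have : f d = (f * swap d y) y := by simp
      rw [this, sameCycle_apply_right]; exact hxy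
    by_cases hy : d = y
    · subst hy
      have : f d = (f * swap x d) x := by simp
      rw [this, sameCycle_apply_right]; exact hxy.symm
    have : f d = (f * swap x y) d := by rw [mul_apply, swap_apply_of_ne_of_ne hx hy]
    rw [this, sameCycle_apply_right]

theorem numCycles_mul_swap_of_not {f : Perm D} {x y : D} (h : ¬ f.SameCycle x y) :
    (f * swap x y).numCycles + 1 = f.numCycles := by
  rw [numCycles, PermOrbits, setoid_mul_swap h]
  exact Setoid.card_quotient_mergePair h

theorem numCycles_mul_swap_of_sameCycle {f : Perm D} {x y : D} (h : f.SameCycle x y)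
    (hne : x ≠ y) : (f * swap x y).numCycles = f.numCycles + 1 := by
  have := numCycles_mul_swap_of_not (h.not_mul_swap hne)
  rw [mul_assoc, swap_mul_self, mul_one] at this
  exact this.symm

theorem numCycles_mul_swap_le (f : Perm D) (x y : D) :
    (f * swap x y).numCycles ≤ f.numCycles + 1 := by
  by_cases h : f.SameCycle x y
  · by_cases hne : x = y
    · subst hne; rw [swap_self]; exact Nat.le_succ _
    · exact (numCycles_mul_swap_of_sameCycle h hne).le
  · have := numCycles_mul_swap_of_not h; omega

end MulSwap

theorem numCycles_one : (1 : Perm D).numCycles = Nat.card D := by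
  refine (Nat.card_congr (Equiv.ofBijective (Quotient.mk _) ⟨fun x y h => ?_, ?_⟩)).symm
  · exact sameCycle_one.1 (Quotient.exact h)
  · exact Quotient.mk_surjective

theorem numCycles_permCongr {E : Type*} (e : D ≃ E) (f : Perm D) :
    (e.permCongr f).numCycles = f.numCycles := by
  refine (Nat.card_congr (Quotient.congr e fun a b => ?_)).symm
  have h : ∀ n : ℤ, ((e.permCongr f) ^ n) (e a) = e ((f ^ n) a) := fun n => by
    have : (e.permCongr f) ^ n = e.permCongr (f ^ n) := by
      have := map_zpow e.permCongrHom f n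
      exact this.symm
    rw [this]; simp [permCongr_apply]
  change (∃ n : ℤ, _) ↔ (∃ n : ℤ, _)
  simp only [h, EmbeddingLike.apply_eq_iff_eq]

theorem numCycles_inv (f : Perm D) : (f⁻¹).numCycles = f.numCycles :=
  Nat.card_congr (Quotient.congr (Equiv.refl D) fun _ _ => sameCycle_inv)

theorem numCycles_mul_comm (f g : Perm D) : (f * g).numCycles = (g * f).numCycles := by
  rw [← numCycles_permCongr f (g * f)]
  congr 1
  ext x; simp

section Sum

variable {E : Type*}

theorem sameCycle_sumCongr_inl {f : Perm D} {g : Perm E} {a b : D} :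
    (sumCongr f g).SameCycle (Sum.inl a) (Sum.inl b) ↔ f.SameCycle a b := by
  have h : ∀ n : ℤ, ((sumCongr f g) ^ n) = sumCongr (f ^ n) (g ^ n) := fun n =>
    (map_zpow (sumCongrHom D E) (f, g) n).symm
  change (∃ n : ℤ, _) ↔ (∃ n : ℤ, _)
  simp [h]

theorem sameCycle_sumCongr_inr {f : Perm D} {g : Perm E} {a b : E} :
    (sumCongr f g).SameCycle (Sum.inr a) (Sum.inr b) ↔ g.SameCycle a b := by
  have h : ∀ n : ℤ, ((sumCongr f g) ^ n) = sumCongr (f ^ n) (g ^ n) := fun n =>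
    (map_zpow (sumCongrHom D E) (f, g) n).symm
  change (∃ n : ℤ, _) ↔ (∃ n : ℤ, _)
  simp [h]

theorem not_sameCycle_sumCongr_inl_inr {f : Perm D} {g : Perm E} {a : D} {b : E} :
    ¬ (sumCongr f g).SameCycle (Sum.inl a) (Sum.inr b) := by
  have h : ∀ n : ℤ, ((sumCongr f g) ^ n) = sumCongr (f ^ n) (g ^ n) := fun n =>
    (map_zpow (sumCongrHom D E) (f, g) n).symm
  rintro ⟨n, hn⟩
  simp [h] at hn

theorem numCycles_sumCongr [Finite D] [Finite E] (f : Perm D) (g : Perm E) :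
    (sumCongr f g).numCycles = f.numCycles + g.numCycles := by
  rw [numCycles, numCycles, numCycles, ← Nat.card_sum]
  refine (Nat.card_congr (Equiv.ofBijective (Sum.elim
    (Quotient.map' (s₂ := SameCycle.setoid (sumCongr f g)) Sum.inl
      fun _ _ h => sameCycle_sumCongr_inl.2 h)
    (Quotient.map' (s₂ := SameCycle.setoid (sumCongr f g)) Sum.inr
      fun _ _ h => sameCycle_sumCongr_inr.2 h)) ⟨?_, ?_⟩)).symm
  · rintro (q | q) (q' | q') h <;> induction q using Quotient.inductionOn with | _ u <;>
      induction q' using Quotient.inductionOn with | _ v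
    · exact congrArg Sum.inl (Quotient.sound (sameCycle_sumCongr_inl.1 (Quotient.exact h)))
    · exact (not_sameCycle_sumCongr_inl_inr (f := f) (g := g) (Quotient.exact h)).elim
    · exact (not_sameCycle_sumCongr_inl_inr (f := f) (g := g) (Quotient.exact h.symm)).elim
    · exact congrArg Sum.inr (Quotient.sound (sameCycle_sumCongr_inr.1 (Quotient.exact h)))
  · intro q
    induction q using Quotient.inductionOn with | _ u
    rcases u with u | u
    · exact ⟨Sum.inl (Quotient.mk _ u), rfl⟩
    · exact ⟨Sum.inr (Quotient.mk _ u), rfl⟩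

end Sum

/-- Euler's inequality for a pair of permutations, in terms of the number of orbits of the group
that they generate. It holds for `α = 1`, and multiplying `α` by the transposition of a fixed
point with another point preserves it. -/
theorem numCycles_add_le [Finite D] (ρ α : Perm D) :
    ρ.numCycles + α.numCycles + (ρ * α).numCycles ≤ Nat.card D +
      2 * Nat.card (Quotient (SameCycle.setoid ρ ⊔ SameCycle.setoid α)) := by
  classical
  induction hn : {d | α d ≠ d}.ncard using Nat.strong_induction_on generalizing α with
  | _ n ih =>
    subst hn
    by_cases h1 : ∀ d, α d = d
    · obtain rfl : α = 1 := by ext d; simp [h1]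
      have : SameCycle.setoid ρ ⊔ SameCycle.setoid (1 : Perm D) = SameCycle.setoid ρ := by
        refine sup_eq_left.2 fun a b hab => ?_
        rw [sameCycle_one.1 hab]
      rw [this, numCycles_one, mul_one]
      change _ ≤ _ + 2 * ρ.numCycles
      omega
    · push Not at h1
      obtain ⟨x, hx⟩ := h1
      set z := α x with hz
      set α' := α * swap x z with hα'
      have hαα' : α = α' * swap x z := by rw [hα', mul_assoc, swap_mul_self, mul_one]
      have hlt : {d | α' d ≠ d}.ncard < {d | α d ≠ d}.ncard := by
        refine Set.ncard_lt_ncard ⟨?_, ?_⟩ (Set.toFinite _)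
        · intro d hd
          by_cases hdx : d = x
          · subst hdx; exact hx
          by_cases hdz : d = z
          · refine (hd ?_).elim
            rw [hdz, hα', mul_apply, swap_apply_right]
          · have : α' d = α d := by rw [hα', mul_apply, swap_apply_of_ne_of_ne hdx hdz]
            rwa [Set.mem_ofPred_eq, this] at hd
        · intro hsub
          have : z ∈ {d | α d ≠ d} := fun h => hx (α.injective h)
          exact hsub this (by rw [hα', mul_apply, swap_apply_right])
      have hIH := ih _ hlt α' rfl
      have hsame : α.SameCycle x z := ⟨1, by simp [hz]⟩
      have hns : ¬ α'.SameCycle x z := hsame.not_mul_swap (Ne.symm hx)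
      have hset : SameCycle.setoid ρ ⊔ SameCycle.setoid α =
          (SameCycle.setoid ρ ⊔ SameCycle.setoid α').mergePair x z := by
        conv_lhs => rw [hαα', setoid_mul_swap hns, Setoid.sup_mergePair]
      have hc : α.numCycles + 1 = α'.numCycles := by
        conv_lhs => rw [hαα']
        exact numCycles_mul_swap_of_not hns
      have hprod : ρ * α = (ρ * α') * swap x z := by rw [mul_assoc, ← hαα']
      by_cases hs : (SameCycle.setoid ρ ⊔ SameCycle.setoid α') x z
      · rw [hset, Setoid.mergePair_eq_self hs, hprod]
        have := numCycles_mul_swap_le (ρ * α') x z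
        omega
      · rw [hset]
        have h2 := Setoid.card_quotient_mergePair hs
        have h3 : ¬ (ρ * α').SameCycle x z := by
          intro h
          refine hs (h.rel_of_forall fun d => ?_)
          rw [mul_apply]
          exact Setoid.trans' _
            (le_sup_right (a := SameCycle.setoid ρ) (b := SameCycle.setoid α')
              (show α'.SameCycle d (α' d) from sameCycle_apply_right.2 (SameCycle.refl _ _)))
            (le_sup_left (a := SameCycle.setoid ρ) (b := SameCycle.setoid α')
              (show ρ.SameCycle (α' d) (ρ (α' d)) from
                sameCycle_apply_right.2 (SameCycle.refl _ _)))
        have h4 := numCycles_mul_swap_of_not h3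
        rw [← hprod] at h4
        omega

/-- The group generated by `ρ` and `α` acts transitively (for finite `D`). -/
def _root_.IsConn (ρ α : Perm D) : Prop :=
  ∀ S : Set D, S.Nonempty → (∀ d ∈ S, ρ d ∈ S) → (∀ d ∈ S, α d ∈ S) → S = _root_.Set.univ

/-- Euler's inequality for connected maps. -/
theorem _root_.IsConn.numCycles_add_le [Finite D] {ρ α : Perm D} (h : IsConn ρ α) :
    ρ.numCycles + α.numCycles + (ρ * α).numCycles ≤ Nat.card D + 2 := by
  have h1 := Perm.numCycles_add_le ρ α
  have h2 : Nat.card (Quotient (SameCycle.setoid ρ ⊔ SameCycle.setoid α)) ≤ 1 := by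
    refine Finite.card_le_one_iff_subsingleton.2 ⟨fun p q => ?_⟩
    induction p using Quotient.inductionOn with | _ u
    induction q using Quotient.inductionOn with | _ v
    refine Quotient.sound ?_
    have := h {w | (SameCycle.setoid ρ ⊔ SameCycle.setoid α) u w}
      ⟨u, (SameCycle.setoid ρ ⊔ SameCycle.setoid α).refl u⟩
      (fun d hd => Setoid.trans' _ hd (le_sup_left (a := SameCycle.setoid ρ)
        (show ρ.SameCycle d (ρ d) from sameCycle_apply_right.2 (SameCycle.refl _ _))))
      (fun d hd => Setoid.trans' _ hd (le_sup_right (a := SameCycle.setoid ρ)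
        (show α.SameCycle d (α d) from sameCycle_apply_right.2 (SameCycle.refl _ _))))
    have hv : v ∈ {w | (SameCycle.setoid ρ ⊔ SameCycle.setoid α) u w} := by rw [this]; trivial
    exact hv
  omega

/-- An involution without fixed points has half as many cycles as points. -/
theorem two_mul_numCycles [Finite D] {α : Perm D} (h : ∀ d, α (α d) = d) (hne : ∀ d, α d ≠ d) :
    2 * α.numCycles = Nat.card D := by
  classical
  have hsc : ∀ a b, α.SameCycle a b → b = a ∨ b = α a := fun a b hab =>
    hab.mem_of_forall_mem (S := {b | b = a ∨ b = α a})
      (by rintro _ (rfl | rfl); exacts [Or.inr rfl, Or.inl (h _)]) (Or.inl rfl)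
  have e : PermOrbits α × Bool ≃ D := by
    refine Equiv.ofBijective (fun q => if q.2 then Quotient.out q.1 else α (Quotient.out q.1))
      ⟨?_, fun d => ?_⟩
    · rintro ⟨q, b⟩ ⟨q', b'⟩ hq
      have h1 : ∀ (q : PermOrbits α) (b : Bool),
          (Quotient.mk _ (if b then Quotient.out q else α (Quotient.out q)) : PermOrbits α) = q := by
        intro q b
        cases b
        · refine Eq.trans (Quotient.sound ?_) (Quotient.out_eq q)
          exact sameCycle_apply_left.2 (SameCycle.refl _ _)
        · exact Quotient.out_eq q
      have hqq : q = q' := by rw [← h1 q b, ← h1 q' b']; exact congrArg _ hq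
      subst hqq
      cases b <;> cases b' <;> simp_all
      exact hne _ hq.symm
    · have := hsc (Quotient.out (Quotient.mk (SameCycle.setoid α) d)) d
        (Quotient.exact (s := SameCycle.setoid α)
        (Quotient.out_eq (Quotient.mk (SameCycle.setoid α) d)))
      rcases this with hd | hd
      · exact ⟨(Quotient.mk _ d, true), hd.symm⟩
      · exact ⟨(Quotient.mk _ d, false), hd.symm⟩
  rw [← Nat.card_congr e, Nat.card_prod, numCycles]
  simp [mul_comm]

end Equiv.Perm

/-! ### 4-regular maps as pairs of permutations, and edge cuts -/

section FourRegular

open Equiv (swap_apply_left swap_apply_right swap_apply_of_ne_of_ne swap_apply_eq_iff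
  mul_swap_eq_swap_mul)
open Equiv (swap_mul_self swap_mul_self_mul)

variable {D E : Type*}

/-- A possibly disconnected 4-regular map of any genus: `α` is an involution without fixed points
and the cycles of `ρ` have length four. -/
structure IsMap4 (ρ α : Perm D) : Prop where
  flip_flip : ∀ d, α (α d) = d
  flip_ne : ∀ d, α d ≠ d
  rot4 : ∀ d, ρ (ρ (ρ (ρ d))) = d
  rot2_ne : ∀ d, ρ (ρ d) ≠ d

/-- A set of half-edges that is a union of vertices. -/
def IsVertexSet (ρ : Perm D) (K : Set D) : Prop := ∀ d, ρ d ∈ K ↔ d ∈ K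

/-- The half-edges in `K` whose other half is not in `K`. -/
def bdry (α : Perm D) (K : Set D) : Set D := {d ∈ K | α d ∉ K}

theorem IsVertexSet.of_forall_mem [Finite D] {ρ : Perm D} {K : Set D} (h : ∀ d ∈ K, ρ d ∈ K) :
    IsVertexSet ρ K := fun _ => ⟨fun hd =>
  (sameCycle_apply_left.2 (SameCycle.refl ρ _)).mem_of_forall_mem h hd, h _⟩

theorem IsVertexSet.mem_iff [Finite D] {ρ : Perm D} {K : Set D} (h : IsVertexSet ρ K) {a b : D}
    (hab : ρ.SameCycle a b) : a ∈ K ↔ b ∈ K :=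
  ⟨hab.mem_of_forall_mem fun d hd => (h d).2 hd, hab.symm.mem_of_forall_mem fun d hd => (h d).2 hd⟩

theorem IsVertexSet.compl {ρ : Perm D} {K : Set D} (h : IsVertexSet ρ K) : IsVertexSet ρ Kᶜ :=
  fun d => not_congr (h d)

theorem IsVertexSet.union {ρ : Perm D} {K L : Set D} (h : IsVertexSet ρ K)
    (h' : IsVertexSet ρ L) : IsVertexSet ρ (K ∪ L) := fun d => or_congr (h d) (h' d)

theorem IsVertexSet.inter {ρ : Perm D} {K L : Set D} (h : IsVertexSet ρ K)
    (h' : IsVertexSet ρ L) : IsVertexSet ρ (K ∩ L) := fun d => and_congr (h d) (h' d)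

theorem IsVertexSet.diff {ρ : Perm D} {K L : Set D} (h : IsVertexSet ρ K)
    (h' : IsVertexSet ρ L) : IsVertexSet ρ (K \ L) := fun d => and_congr (h d) (not_congr (h' d))

theorem IsVertexSet.empty {ρ : Perm D} : IsVertexSet ρ ∅ := fun _ => Iff.rfl

/-- The half-edges around the vertex of `d`. -/
def vertexOf (ρ : Perm D) (d : D) : Set D := {e | ρ.SameCycle d e}

theorem mem_vertexOf {ρ : Perm D} {d e : D} : e ∈ vertexOf ρ d ↔ ρ.SameCycle d e := Iff.rfl

theorem isVertexSet_vertexOf (ρ : Perm D) (d : D) : IsVertexSet ρ (vertexOf ρ d) :=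
  fun _ => sameCycle_apply_right

theorem self_mem_vertexOf (ρ : Perm D) (d : D) : d ∈ vertexOf ρ d := SameCycle.refl _ _

theorem even_ncard_of_involution [Finite D] {S : Set D} (f : D → D) (hS : ∀ d ∈ S, f d ∈ S)
    (hf : ∀ d ∈ S, f (f d) = d) (hne : ∀ d ∈ S, f d ≠ d) : Even S.ncard := by
  let g : S → S := fun d => ⟨f d, hS d d.2⟩
  have hg : Function.Involutive g := fun d => Subtype.ext (hf d d.2)
  have := two_mul_numCycles (α := hg.toPerm) hg fun d h => hne d d.2 (congrArg Subtype.val h)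
  rw [← Nat.card_coe_set_eq, ← this]
  exact even_two_mul _

namespace IsMap4

variable {ρ α : Perm D} {K : Set D}

theorem rot_ne (h : IsMap4 ρ α) (d : D) : ρ d ≠ d := fun hd => h.rot2_ne d (by rw [hd, hd])

theorem rot3_ne (h : IsMap4 ρ α) (d : D) : ρ (ρ (ρ d)) ≠ d := fun hd =>
  h.rot_ne d (by conv_lhs => rw [← hd, h.rot4])

theorem sameCycle_iff [Finite D] (h : IsMap4 ρ α) {a b : D} :
    ρ.SameCycle a b ↔ b = a ∨ b = ρ a ∨ b = ρ (ρ a) ∨ b = ρ (ρ (ρ a)) := by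
  constructor
  · intro hab
    refine hab.mem_of_forall_mem
      (S := {b | b = a ∨ b = ρ a ∨ b = ρ (ρ a) ∨ b = ρ (ρ (ρ a))}) ?_ (Or.inl rfl)
    rintro d (rfl | rfl | rfl | rfl)
    exacts [Or.inr (Or.inl rfl), Or.inr (Or.inr (Or.inl rfl)), Or.inr (Or.inr (Or.inr rfl)),
      Or.inl (h.rot4 _)]
  · rintro (rfl | rfl | rfl | rfl) <;> simp [SameCycle.refl]

/-- Every edge cut of a 4-regular map is even. -/
theorem even_bdry [Finite D] (h : IsMap4 ρ α) (hK : IsVertexSet ρ K) :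
    Even (bdry α K).ncard := by
  have h1 : Even K.ncard := even_ncard_of_involution (fun d => ρ (ρ d))
    (fun d hd => (hK _).2 ((hK _).2 hd)) (fun d _ => h.rot4 d) fun d _ => h.rot2_ne d
  have h2 : Even (K \ bdry α K).ncard := by
    refine even_ncard_of_involution α ?_ (fun d _ => h.flip_flip d) fun d _ => h.flip_ne d
    rintro d ⟨hd, hd'⟩
    have : α d ∈ K := by by_contra hc; exact hd' ⟨hd, hc⟩
    exact ⟨this, fun hb => hb.2 (by rwa [h.flip_flip])⟩
  have h3 := Set.ncard_sdiff_add_ncard_of_subset (s := bdry α K) (t := K) (fun d hd => hd.1)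
    (Set.toFinite _)
  rw [← h3, Nat.even_add] at h1
  exact h1.1 h2

theorem bdry_eq_empty_of_subset_singleton [Finite D] (h : IsMap4 ρ α) (hK : IsVertexSet ρ K)
    {a : D} (ha : bdry α K ⊆ {a}) : bdry α K = ∅ := by
  rcases Set.subset_singleton_iff_eq.1 ha with h1 | h1
  · exact h1
  · have := h.even_bdry hK
    rw [h1, Set.ncard_singleton] at this
    exact absurd this (by decide)

theorem exists_bdry_eq_pair [Finite D] (h : IsMap4 ρ α) (hK : IsVertexSet ρ K)
    {a b c : D} (ha : bdry α K ⊆ {a, b, c}) (ha' : a ∈ bdry α K) :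
    ∃ d, d ≠ a ∧ bdry α K = {a, d} := by
  have h1 := h.even_bdry hK
  have h2 : (bdry α K).ncard ≤ 3 := by
    refine (Set.ncard_le_ncard ha (Set.toFinite _)).trans ?_
    refine (Set.ncard_insert_le _ _).trans ?_
    have := Set.ncard_insert_le b {c}
    rw [Set.ncard_singleton] at this
    omega
  have h3 : 0 < (bdry α K).ncard := (Set.ncard_pos (Set.toFinite _)).2 ⟨a, ha'⟩
  have h4 : (bdry α K).ncard = 2 := by
    obtain ⟨k, hk⟩ := h1; omega
  obtain ⟨x, y, hxy, he⟩ := Set.ncard_eq_two.1 h4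
  rw [he] at ha' ⊢
  rcases ha' with rfl | rfl
  · exact ⟨y, hxy.symm, rfl⟩
  · exact ⟨x, hxy, Set.pair_comm _ _⟩

end IsMap4

namespace IsConn

variable {ρ α : Perm D} {K : Set D}

theorem bdry_nonempty (hc : IsConn ρ α) (hK : IsVertexSet ρ K) (hne : K.Nonempty)
    (hu : Kᶜ.Nonempty) : (bdry α K).Nonempty := by
  by_contra hb
  have : K = Set.univ := hc K hne (fun d hd => (hK d).2 hd) fun d hd => by
    by_contra hd'; exact hb ⟨d, hd, hd'⟩
  obtain ⟨d, hd⟩ := hu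
  exact hd (this ▸ trivial)

/-- Deleting an edge from a connected 4-regular map does not disconnect it. -/
theorem eq_univ_of_off [Finite D] (hc : IsConn ρ α) (h : IsMap4 ρ α) (a : D) {S : Set D}
    (hne : S.Nonempty) (hρ : ∀ d ∈ S, ρ d ∈ S) (hα : ∀ d ∈ S, d ≠ a → d ≠ α a → α d ∈ S) :
    S = Set.univ := by
  have hS := IsVertexSet.of_forall_mem hρ
  have hsub : ∀ d ∈ bdry α S, d = a ∨ d = α a := by
    intro d hd
    by_contra! hcon
    exact hd.2 (hα d hd.1 hcon.1 hcon.2)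
  have hb : bdry α S = ∅ := by
    by_cases ha : a ∈ bdry α S
    · refine h.bdry_eq_empty_of_subset_singleton hS (a := a) fun d hd => ?_
      rcases hsub d hd with rfl | rfl
      · rfl
      · exact (ha.2 hd.1).elim
    · refine h.bdry_eq_empty_of_subset_singleton hS (a := α a) fun d hd => ?_
      rcases hsub d hd with rfl | rfl
      · exact (ha hd).elim
      · rfl
  refine hc S hne hρ fun d hd => ?_
  by_contra hd'
  have : d ∈ bdry α S := ⟨hd, hd'⟩
  rw [hb] at this
  exact this

theorem numCycles_add_le_map [Finite D] (hc : IsConn ρ α) (h : IsMap4 ρ α) :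
    ρ.numCycles + (ρ * α).numCycles ≤ α.numCycles + 2 := by
  have h1 := hc.numCycles_add_le
  have h2 := two_mul_numCycles h.flip_flip h.flip_ne
  omega

/-- If both sides of an edge lie in the same face, then the genus is positive, since the edge can
be deleted. -/
theorem numCycles_add_le_of_sameCycle [Finite D] [DecidableEq D] (hc : IsConn ρ α)
    (h : IsMap4 ρ α) {a : D} (ha : (ρ * α).SameCycle a (α a)) :
    ρ.numCycles + (ρ * α).numCycles ≤ α.numCycles := by
  have hc' : IsConn ρ (α * swap a (α a)) := by
    intro S hne hρ hα
    refine hc.eq_univ_of_off h a hne hρ fun d hd h1 h2 => ?_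
    have := hα d hd
    rwa [mul_apply, swap_apply_of_ne_of_ne h1 h2] at this
  have h1 := hc'.numCycles_add_le
  rw [← mul_assoc, numCycles_mul_swap_of_sameCycle ha (h.flip_ne a).symm,
    numCycles_mul_swap_of_sameCycle (f := α) ⟨1, by simp⟩ (h.flip_ne a).symm] at h1
  have h2 := two_mul_numCycles h.flip_flip h.flip_ne
  omega

end IsConn

/-- Euler's formula for a connected map. -/
def Planar (ρ α : Perm D) : Prop := ρ.numCycles + (ρ * α).numCycles = α.numCycles + 2

/-! ### Substituting a map into an edge of another map -/

section Sub

variable [DecidableEq D] [DecidableEq E]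

/-- The edges `{h, α h}` and `{g, β g}` are cut and reglued to `{h, g}` and `{α h, β g}`. -/
def subFlip (α : Perm D) (h : D) (β : Perm E) (g : E) : Perm (D ⊕ E) :=
  swap (Sum.inl h) (Sum.inr (β g)) * sumCongr α β * swap (Sum.inl h) (Sum.inr (β g))

variable {ρ α : Perm D} {σ β : Perm E} {h : D} {g : E}

theorem subFlip_inl_self (hβ : IsMap4 σ β) :
    subFlip α h β g (Sum.inl h) = Sum.inr g := by
  rw [subFlip, mul_apply, mul_apply, swap_apply_left, sumCongr_apply, Sum.map_inr, hβ.flip_flip,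
    swap_apply_of_ne_of_ne (by simp) (by simpa using (hβ.flip_ne g).symm)]

theorem subFlip_inl_flip (hα : IsMap4 ρ α) :
    subFlip α h β g (Sum.inl (α h)) = Sum.inr (β g) := by
  rw [subFlip, mul_apply, mul_apply,
    swap_apply_of_ne_of_ne (x := Sum.inl (α h)) (by simpa using hα.flip_ne h) (by simp),
    sumCongr_apply, Sum.map_inl, hα.flip_flip, swap_apply_left]

theorem subFlip_inl (hα : IsMap4 ρ α) {d : D} (h1 : d ≠ h) (h2 : d ≠ α h) :
    subFlip α h β g (Sum.inl d) = Sum.inl (α d) := by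
  rw [subFlip, mul_apply, mul_apply,
    swap_apply_of_ne_of_ne (x := Sum.inl d) (by simpa using h1) (by simp),
    sumCongr_apply, Sum.map_inl, swap_apply_of_ne_of_ne _ (by simp)]
  rw [Ne, Sum.inl.injEq]
  rintro rfl
  exact h2 (hα.flip_flip d).symm

theorem subFlip_subFlip (hα : IsMap4 ρ α) (hβ : IsMap4 σ β) (d : D ⊕ E) :
    subFlip α h β g (subFlip α h β g d) = d := by
  have : sumCongr α β * sumCongr α β = 1 := by
    ext d
    rcases d with d | d <;> simp [hα.flip_flip, hβ.flip_flip]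
  rw [← mul_apply, subFlip]
  simp only [mul_assoc, swap_mul_self_mul]
  rw [← mul_assoc (sumCongr α β), this, one_mul, swap_mul_self, one_apply]

theorem subFlip_inr_self (hα : IsMap4 ρ α) (hβ : IsMap4 σ β) :
    subFlip α h β g (Sum.inr g) = Sum.inl h := by
  rw [← subFlip_inl_self (g := g) hβ, subFlip_subFlip hα hβ]

theorem subFlip_inr_flip (hα : IsMap4 ρ α) (hβ : IsMap4 σ β) :
    subFlip α h β g (Sum.inr (β g)) = Sum.inl (α h) := by
  rw [← subFlip_inl_flip (β := β) (g := g) hα, subFlip_subFlip hα hβ]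

theorem subFlip_inr {d : E} (h1 : d ≠ g) (h2 : d ≠ β g) :
    subFlip α h β g (Sum.inr d) = Sum.inr (β d) := by
  rw [subFlip, mul_apply, mul_apply,
    swap_apply_of_ne_of_ne (x := Sum.inr d) (by simp) (by simpa using h2),
    sumCongr_apply, Sum.map_inr, swap_apply_of_ne_of_ne (by simp)]
  rw [Ne, Sum.inr.injEq]
  intro hd
  exact h1 (β.injective hd)

theorem subFlip_eq (hα : IsMap4 ρ α) :
    subFlip α h β g = sumCongr α β * swap (Sum.inl (α h)) (Sum.inr g) *
      swap (Sum.inl h) (Sum.inr (β g)) := by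
  rw [subFlip, mul_swap_eq_swap_mul (sumCongr α β)]
  simp [hα.flip_flip]

theorem IsMap4.sub (hα : IsMap4 ρ α) (hβ : IsMap4 σ β) :
    IsMap4 (sumCongr ρ σ) (subFlip α h β g) where
  flip_flip := subFlip_subFlip hα hβ
  flip_ne d hd := by
    rw [subFlip, mul_apply, mul_apply, swap_apply_eq_iff] at hd
    generalize swap (Sum.inl h) (Sum.inr (β g)) d = e at hd
    rcases e with e | e
    · exact hα.flip_ne e (by simpa using hd)
    · exact hβ.flip_ne e (by simpa using hd)
  rot4 d := by rcases d with d | d <;> simp [hα.rot4, hβ.rot4]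
  rot2_ne d := by rcases d with d | d <;> simp [hα.rot2_ne, hβ.rot2_ne]

theorem numCycles_subFlip [Finite D] [Finite E] :
    (subFlip α h β g).numCycles = α.numCycles + β.numCycles := by
  rw [subFlip, mul_assoc, numCycles_mul_comm, mul_assoc, swap_mul_self, mul_one,
    numCycles_sumCongr]

/-- The number of faces after a substitution. -/
theorem numCycles_faces_sub [Finite D] [Finite E] (hα : IsMap4 ρ α) :
    (((ρ * α).SameCycle h (α h) ∧ (σ * β).SameCycle g (β g)) ∧
      (sumCongr ρ σ * subFlip α h β g).numCycles = (ρ * α).numCycles + (σ * β).numCycles) ∨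
    (¬ ((ρ * α).SameCycle h (α h) ∧ (σ * β).SameCycle g (β g)) ∧
      (sumCongr ρ σ * subFlip α h β g).numCycles + 2 =
        (ρ * α).numCycles + (σ * β).numCycles) := by
  have h0 : sumCongr ρ σ * subFlip α h β g = sumCongr (ρ * α) (σ * β) *
      swap (Sum.inl (α h)) (Sum.inr g) * swap (Sum.inl h) (Sum.inr (β g)) := by
    rw [subFlip_eq hα, ← mul_assoc, ← mul_assoc, sumCongr_mul]
  have h1 : ¬ (sumCongr (ρ * α) (σ * β)).SameCycle (Sum.inl (α h)) (Sum.inr g) :=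
    not_sameCycle_sumCongr_inl_inr
  have h2 := numCycles_mul_swap_of_not h1
  rw [numCycles_sumCongr] at h2
  have h3 : (sumCongr (ρ * α) (σ * β) * swap (Sum.inl (α h)) (Sum.inr g)).SameCycle
      (Sum.inl h) (Sum.inr (β g)) ↔
      ((ρ * α).SameCycle h (α h) ∧ (σ * β).SameCycle g (β g)) := by
    have := setoid_mul_swap h1
    change SameCycle.setoid _ _ _ ↔ _
    rw [this, Setoid.mergePair_apply]
    change (SameCycle _ _ _ ∨ ((SameCycle _ _ _ ∨ SameCycle _ _ _) ∧
      (SameCycle _ _ _ ∨ SameCycle _ _ _))) ↔ _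
    rw [sameCycle_comm (x := Sum.inr (β g)) (y := Sum.inl (α h)), sameCycle_sumCongr_inl,
      sameCycle_sumCongr_inr, sameCycle_comm (x := β g)]
    simp [not_sameCycle_sumCongr_inl_inr]
  by_cases hb : (ρ * α).SameCycle h (α h) ∧ (σ * β).SameCycle g (β g)
  · refine Or.inl ⟨hb, ?_⟩
    have := numCycles_mul_swap_of_sameCycle (h3.2 hb) (by simp)
    rw [h0]; omega
  · refine Or.inr ⟨hb, ?_⟩
    have := numCycles_mul_swap_of_not (fun hs => hb (h3.1 hs))
    rw [h0]; omega

theorem IsConn.sub [Finite D] [Finite E] (hα : IsMap4 ρ α) (hβ : IsMap4 σ β)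
    (c1 : IsConn ρ α) (c2 : IsConn σ β) : IsConn (sumCongr ρ σ) (subFlip α h β g) := by
  intro S hne hρ hA
  have k1 : (Sum.inl ⁻¹' S : Set D).Nonempty → Sum.inl ⁻¹' S = (Set.univ : Set D) := fun h1 =>
    c1.eq_univ_of_off hα h h1 (fun d hd => hρ _ hd) fun d hd e1 e2 => by
      have := hA _ hd; rwa [subFlip_inl hα e1 e2] at this
  have k2 : (Sum.inr ⁻¹' S : Set E).Nonempty → Sum.inr ⁻¹' S = (Set.univ : Set E) := fun h1 =>
    c2.eq_univ_of_off hβ g h1 (fun d hd => hρ _ hd) fun d hd e1 e2 => by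
      have := hA _ hd; rwa [subFlip_inr e1 e2] at this
  have key : Sum.inl ⁻¹' S = (Set.univ : Set D) ∧ Sum.inr ⁻¹' S = (Set.univ : Set E) := by
    obtain ⟨d | d, hd⟩ := hne
    · have h1 := k1 ⟨d, hd⟩
      have : Sum.inl h ∈ S := by change h ∈ Sum.inl ⁻¹' S; rw [h1]; trivial
      have h2 := hA _ this
      rw [subFlip_inl_self hβ] at h2
      exact ⟨h1, k2 ⟨g, h2⟩⟩
    · have h1 := k2 ⟨d, hd⟩
      have : Sum.inr g ∈ S := by change g ∈ Sum.inr ⁻¹' S; rw [h1]; trivial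
      have h2 := hA _ this
      rw [subFlip_inr_self hα hβ] at h2
      exact ⟨k1 ⟨h, h2⟩, h1⟩
  refine Set.eq_univ_of_forall ?_
  rintro (d | d)
  · change d ∈ Sum.inl ⁻¹' S; rw [key.1]; trivial
  · change d ∈ Sum.inr ⁻¹' S; rw [key.2]; trivial

theorem IsConn.of_sub_left (hα : IsMap4 ρ α) (hβ : IsMap4 σ β)
    (c : IsConn (sumCongr ρ σ) (subFlip α h β g)) : IsConn ρ α := by
  intro S hne hρ hA
  by_cases hh : h ∈ S
  · have := c (Sum.inl '' S ∪ Set.range Sum.inr) (hne.elim fun d hd => ⟨_, Or.inl ⟨d, hd, rfl⟩⟩)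
      ?_ ?_
    · refine Set.eq_univ_of_forall fun d => ?_
      have hd : (Sum.inl d : D ⊕ E) ∈ Sum.inl '' S ∪ Set.range Sum.inr := this ▸ trivial
      simpa using hd
    · rintro _ (⟨d, hd, rfl⟩ | ⟨d, rfl⟩)
      · exact Or.inl ⟨_, hρ d hd, rfl⟩
      · exact Or.inr ⟨_, rfl⟩
    · rintro _ (⟨d, hd, rfl⟩ | ⟨d, rfl⟩)
      · by_cases e1 : d = h
        · subst e1; rw [subFlip_inl_self hβ]; exact Or.inr ⟨_, rfl⟩
        by_cases e2 : d = α h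
        · subst e2; rw [subFlip_inl_flip hα]; exact Or.inr ⟨_, rfl⟩
        rw [subFlip_inl hα e1 e2]; exact Or.inl ⟨_, hA d hd, rfl⟩
      · by_cases e1 : d = g
        · subst e1; rw [subFlip_inr_self hα hβ]; exact Or.inl ⟨_, hh, rfl⟩
        by_cases e2 : d = β g
        · subst e2; rw [subFlip_inr_flip hα hβ]; exact Or.inl ⟨_, hA _ hh, rfl⟩
        rw [subFlip_inr e1 e2]; exact Or.inr ⟨_, rfl⟩
  · have := c (Sum.inl '' S) (hne.image _) ?_ ?_
    · have hd : (Sum.inr g : D ⊕ E) ∈ Sum.inl '' S := this ▸ trivial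
      simp at hd
    · rintro _ ⟨d, hd, rfl⟩
      exact ⟨_, hρ d hd, rfl⟩
    · rintro _ ⟨d, hd, rfl⟩
      have e1 : d ≠ h := by rintro rfl; exact hh hd
      have e2 : d ≠ α h := by
        rintro rfl
        have := hA _ hd
        rw [hα.flip_flip] at this
        exact hh this
      rw [subFlip_inl hα e1 e2]
      exact ⟨_, hA d hd, rfl⟩

theorem IsConn.of_sub_right (hα : IsMap4 ρ α) (hβ : IsMap4 σ β)
    (c : IsConn (sumCongr ρ σ) (subFlip α h β g)) : IsConn σ β := by
  refine IsConn.of_sub_left (h := g) (g := h) (ρ := σ) (σ := ρ) hβ hα fun S hne hρ hA => ?_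
  have := c (Sum.swap ⁻¹' S) ?_ ?_ ?_
  · refine Set.eq_univ_of_forall fun d => ?_
    have hd : Sum.swap d ∈ Sum.swap ⁻¹' S := this ▸ trivial
    simpa using hd
  · obtain ⟨d, hd⟩ := hne
    exact ⟨Sum.swap d, by simpa using hd⟩
  · rintro (d | d) hd <;> exact hρ _ hd
  · rintro (d | d) hd <;> rw [Set.mem_preimage] at hd ⊢ <;> have hd' := hA _ hd
    · by_cases e1 : d = h
      · subst e1; rw [subFlip_inl_self hβ]; rw [Sum.swap_inl, subFlip_inr_self hβ hα] at hd'; exact hd'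
      by_cases e2 : d = α h
      · subst e2; rw [subFlip_inl_flip hα]; rw [Sum.swap_inl, subFlip_inr_flip hβ hα] at hd'; exact hd'
      rw [subFlip_inl hα e1 e2]; rw [Sum.swap_inl, subFlip_inr e1 e2] at hd'; exact hd'
    · by_cases e1 : d = g
      · subst e1; rw [subFlip_inr_self hα hβ]; rw [Sum.swap_inr, subFlip_inl_self hα] at hd'; exact hd'
      by_cases e2 : d = β g
      · subst e2; rw [subFlip_inr_flip hα hβ]; rw [Sum.swap_inr, subFlip_inl_flip hβ] at hd'; exact hd'
      rw [subFlip_inr e1 e2]; rw [Sum.swap_inr, subFlip_inl hβ e1 e2] at hd'; exact hd'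

theorem planar_sub_iff [Finite D] [Finite E] (hα : IsMap4 ρ α) (hβ : IsMap4 σ β)
    (c1 : IsConn ρ α) (c2 : IsConn σ β) :
    Planar (sumCongr ρ σ) (subFlip α h β g) ↔ Planar ρ α ∧ Planar σ β := by
  have h1 := c1.numCycles_add_le_map hα
  have h2 := c2.numCycles_add_le_map hβ
  rw [Planar, Planar, Planar, numCycles_subFlip, numCycles_sumCongr]
  rcases numCycles_faces_sub (σ := σ) (β := β) (h := h) (g := g) hα with ⟨⟨h3, h4⟩, h5⟩ | ⟨_, h5⟩
  · have h6 := c1.numCycles_add_le_of_sameCycle hα h3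
    have h7 := c2.numCycles_add_le_of_sameCycle hβ h4
    omega
  · omega

end Sub

end FourRegular

/-! ### Connected vertex sets and `K₄` minors on half-edges -/

section Minor

variable {D E : Type*}

/-- The vertex set `X`, given by its half-edges, is nonempty and induces a connected subgraph. -/
def IsVertexConn (ρ α : Perm D) (X : Set D) : Prop :=
  X.Nonempty ∧ ∀ S ⊆ X, S.Nonempty → IsVertexSet ρ S → (∀ d ∈ S, α d ∈ X → α d ∈ S) → S = X

/-- `B` is a system of branch sets of a `K₄` minor. -/
structure IsK4Branch (ρ α : Perm D) (B : Fin 4 → Set D) : Prop where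
  vertexSet : ∀ i, IsVertexSet ρ (B i)
  conn : ∀ i, IsVertexConn ρ α (B i)
  disj : ∀ i j, i ≠ j → ∀ d, d ∈ B i → d ∉ B j
  adj : ∀ i j, i ≠ j → ∃ d ∈ B i, α d ∈ B j

/-- The existence of a `K₄` minor. -/
def HasK4 (ρ α : Perm D) : Prop := ∃ B, IsK4Branch ρ α B

section Transfer

variable {ρ α : Perm D} {σ β : Perm E} {ι : E → D}

theorem isVertexSet_range (hι : ∀ e, ι (σ e) = ρ (ι e)) : IsVertexSet ρ (Set.range ι) := fun d =>
  ⟨fun ⟨e, he⟩ => ⟨σ.symm e, ρ.injective (by rw [← hι, Equiv.apply_symm_apply, he])⟩,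
    fun ⟨e, he⟩ => ⟨σ e, by rw [hι, he]⟩⟩

theorem IsVertexSet.preimage (hι : ∀ e, ι (σ e) = ρ (ι e)) {K : Set D} (hK : IsVertexSet ρ K) :
    IsVertexSet σ (ι ⁻¹' K) := fun e => by
  rw [Set.mem_preimage, hι]; exact hK _

theorem IsVertexSet.image (hι : ∀ e, ι (σ e) = ρ (ι e)) (hinj : Function.Injective ι) {K : Set E}
    (hK : IsVertexSet σ K) : IsVertexSet ρ (ι '' K) := by
  intro d
  constructor
  · rintro ⟨e, he, hd⟩
    obtain ⟨e', rfl⟩ := (isVertexSet_range hι d).1 ⟨e, hd⟩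
    rw [← hι] at hd
    exact ⟨e', (hK _).1 (hinj hd ▸ he), rfl⟩
  · rintro ⟨e, he, rfl⟩
    exact ⟨σ e, (hK _).2 he, hι e⟩

/-- A `K₄` minor of a map is also one of the map obtained by replacing some of its edges, all of
them incident to the vertex of `u`, by connections through a connected set of new vertices.
This set is added to the branch set of `u`. -/
theorem HasK4.lift [Finite E] (hinj : Function.Injective ι) (hι : ∀ e, ι (σ e) = ρ (ι e))
    (hα : ∀ d, α (α d) = d)
    (hflip : ∀ e, α (ι e) = ι (β e) ∨ (α (ι e) ∉ Set.range ι ∧ α (ι (β e)) ∉ Set.range ι))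
    (hW : IsVertexConn ρ α (Set.range ι)ᶜ) (u : E)
    (hu : ∀ e, α (ι e) ∉ Set.range ι → σ.SameCycle u e ∨ σ.SameCycle u (β e))
    (hu' : ∃ e, σ.SameCycle u e ∧ α (ι e) ∉ Set.range ι)
    (h : HasK4 σ β) : HasK4 ρ α := by
  obtain ⟨B, hB⟩ := h
  have hWv := (isVertexSet_range hι).compl
  have hmem : ∀ (P : Prop) (X : Set E) (e : E),
      ι e ∈ ι '' X ∪ {d | d ∉ Set.range ι ∧ P} ↔ e ∈ X := by
    intro P X e
    constructor
    · rintro (⟨e', he', h⟩ | ⟨h, _⟩)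
      · rwa [← hinj h]
      · exact (h ⟨e, rfl⟩).elim
    · exact fun h => Or.inl ⟨e, h, rfl⟩
  refine ⟨fun i => ι '' B i ∪ {d | d ∉ Set.range ι ∧ u ∈ B i}, ?_, ?_, ?_, ?_⟩
  · intro i
    refine ((hB.vertexSet i).image hι hinj).union fun d => and_congr (hWv d) Iff.rfl
  · intro i
    refine ⟨(hB.conn i).1.elim fun e he => ⟨ι e, Or.inl ⟨e, he, rfl⟩⟩, ?_⟩
    intro S hS hne hSv hSc
    have hpre := hSv.preimage hι
    have hsub : ι ⁻¹' S ⊆ B i := fun e he => (hmem _ _ e).1 (hS he)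
    by_cases huB : u ∈ B i
    · have hWS : (∃ d ∈ S, d ∉ Set.range ι) → (Set.range ι)ᶜ ⊆ S := by
        rintro ⟨d, hd, hdr⟩
        have := hW.2 (S ∩ (Set.range ι)ᶜ) Set.inter_subset_right ⟨d, hd, hdr⟩ (hSv.inter hWv)
          fun d hd hd' => ⟨hSc d hd.1 (Or.inr ⟨hd', huB⟩), hd'⟩
        rw [← this]
        exact Set.inter_subset_left
      have hWex : ∃ d ∈ S, d ∉ Set.range ι := by
        by_contra! hcon
        obtain ⟨d, hd⟩ := hne
        obtain ⟨e, rfl⟩ := hcon d hd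
        have h1 := (hB.conn i).2 (ι ⁻¹' S) hsub ⟨e, hd⟩ hpre fun e he he' => by
          rcases hflip e with h1 | ⟨h1, -⟩
          · have := hSc _ he (by rw [h1]; exact (hmem _ _ _).2 he')
            rwa [h1] at this
          · exact (h1 (hcon _ (hSc _ he (Or.inr ⟨h1, huB⟩)))).elim
        obtain ⟨e', he', h2⟩ := hu'
        have h3 : e' ∈ ι ⁻¹' S := (hpre.mem_iff he').1 (by rw [h1]; exact huB)
        exact h2 (hcon _ (hSc _ h3 (Or.inr ⟨h2, huB⟩)))
      have hW1 := hWS hWex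
      have h1 : ι ⁻¹' S = B i := by
        refine (hB.conn i).2 _ hsub ?_ hpre fun e he he' => ?_
        · obtain ⟨e', he', h2⟩ := hu'
          have h3 := hSc _ (hW1 h2) (by
            rw [hα]
            exact (hmem _ _ _).2 (((hB.vertexSet i).mem_iff he').1 huB))
          rw [hα] at h3
          exact ⟨e', h3⟩
        · rcases hflip e with h1 | ⟨-, h1⟩
          · have := hSc _ he (by rw [h1]; exact (hmem _ _ _).2 he')
            rwa [h1] at this
          · have := hSc _ (hW1 h1) (by rw [hα]; exact (hmem _ _ _).2 he')
            rwa [hα] at this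
      refine hS.antisymm ?_
      rintro d (⟨e, he, rfl⟩ | ⟨hd, -⟩)
      · rw [← h1] at he; exact he
      · exact hW1 hd
    · have hS' : ∀ d ∈ S, ∃ e ∈ B i, ι e = d := fun d hd => by
        rcases hS hd with h | ⟨-, h⟩
        · exact h
        · exact (huB h).elim
      have h1 : ι ⁻¹' S = B i := by
        refine (hB.conn i).2 _ hsub ?_ hpre fun e he he' => ?_
        · obtain ⟨d, hd⟩ := hne
          obtain ⟨e, -, rfl⟩ := hS' d hd
          exact ⟨e, hd⟩
        · rcases hflip e with h1 | ⟨h1, -⟩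
          · have := hSc _ he (by rw [h1]; exact (hmem _ _ _).2 he')
            rwa [h1] at this
          · rcases hu e h1 with h2 | h2
            · exact (huB (((hB.vertexSet i).mem_iff h2).2 (hsub he))).elim
            · exact (huB (((hB.vertexSet i).mem_iff h2).2 he')).elim
      refine hS.antisymm ?_
      rintro d (⟨e, he, rfl⟩ | ⟨-, h⟩)
      · rw [← h1] at he; exact he
      · exact (huB h).elim
  · rintro i j hij d (⟨e, he, rfl⟩ | ⟨h1, h2⟩) hd
    · exact hB.disj i j hij e he ((hmem _ _ _).1 hd)
    · rcases hd with ⟨e, -, rfl⟩ | ⟨-, h3⟩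
      · exact h1 ⟨e, rfl⟩
      · exact hB.disj i j hij u h2 h3
  · intro i j hij
    obtain ⟨e, he, he'⟩ := hB.adj i j hij
    rcases hflip e with h1 | ⟨h1, h2⟩
    · exact ⟨ι e, Or.inl ⟨e, he, rfl⟩, by rw [h1]; exact Or.inl ⟨_, he', rfl⟩⟩
    · rcases hu e h1 with h3 | h3
      · have huB := ((hB.vertexSet i).mem_iff h3).2 he
        exact ⟨α (ι (β e)), Or.inr ⟨h2, huB⟩, by rw [hα]; exact Or.inl ⟨_, he', rfl⟩⟩
      · have huB := ((hB.vertexSet j).mem_iff h3).2 he'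
        exact ⟨ι e, Or.inl ⟨e, he, rfl⟩, Or.inr ⟨h1, huB⟩⟩

/-- A `K₄` minor all of whose branch sets meet the part `E` of a map restricts to a `K₄` minor of
`E` with some additional edges, provided that the vertices of `E` with neighbours outside are
pairwise adjacent (or equal). -/
theorem IsK4Branch.restrict [Finite E] (hinj : Function.Injective ι)
    (hι : ∀ e, ι (σ e) = ρ (ι e)) (hα : ∀ d, α (α d) = d)
    (hflip : ∀ e, α (ι e) = ι (β e) ∨ α (ι e) ∉ Set.range ι)
    (hA : ∀ e e', α (ι e) ∉ Set.range ι → α (ι e') ∉ Set.range ι →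
      σ.SameCycle e e' ∨ ∃ d, σ.SameCycle e d ∧ σ.SameCycle (β d) e')
    {B : Fin 4 → Set D} (hB : IsK4Branch ρ α B) (hne : ∀ i, ∃ e, ι e ∈ B i) : HasK4 σ β := by
  have hWv := (isVertexSet_range hι).compl
  have hpre := fun i => (hB.vertexSet i).preimage hι
  -- a branch set that leaves `E` does so at one of the attached half-edges
  have hexit : ∀ i, (∃ d ∈ B i, d ∉ Set.range ι) → ∃ e, ι e ∈ B i ∧ α (ι e) ∉ Set.range ι := by
    rintro i ⟨d, hd, hdr⟩
    by_contra! hcon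
    have := (hB.conn i).2 (B i ∩ Set.range ι) Set.inter_subset_left
      ((hne i).elim fun e he => ⟨ι e, he, ⟨e, rfl⟩⟩) ((hB.vertexSet i).inter (isVertexSet_range hι))
      (by
        rintro _ ⟨hd, ⟨e, rfl⟩⟩ hd'
        exact ⟨hd', hcon e hd⟩)
    rw [← this] at hd
    exact hdr hd.2
  have hadj : ∀ i j, i ≠ j → ∀ e e', ι e ∈ B i → ι e' ∈ B j → α (ι e) ∉ Set.range ι →
      α (ι e') ∉ Set.range ι → ∃ d ∈ ι ⁻¹' B i, β d ∈ ι ⁻¹' B j := by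
    intro i j hij e e' he he' h1 h2
    rcases hA e e' h1 h2 with h | ⟨d, h3, h4⟩
    · exact (hB.disj i j hij _ (((hpre i).mem_iff h).1 he) he').elim
    · exact ⟨d, ((hpre i).mem_iff h3).1 he, ((hpre j).mem_iff h4).2 he'⟩
  refine ⟨fun i => ι ⁻¹' B i, hpre, fun i => ⟨hne i, ?_⟩, fun i j hij e he => hB.disj i j hij _ he,
    ?_⟩
  · intro S hS hSne hSv hSc
    have hsub : ι '' S ⊆ B i := by rintro _ ⟨e, he, rfl⟩; exact hS he
    by_cases hatt : ∃ e ∈ S, α (ι e) ∉ Set.range ι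
    · obtain ⟨e, he, hatt⟩ := hatt
      have := (hB.conn i).2 (ι '' S ∪ (B i ∩ (Set.range ι)ᶜ)) (Set.union_subset hsub
        Set.inter_subset_left) ⟨ι e, Or.inl ⟨e, he, rfl⟩⟩
        ((hSv.image hι hinj).union ((hB.vertexSet i).inter hWv)) ?_
      · refine hS.antisymm fun e' he' => ?_
        rw [Set.mem_preimage, ← this] at he'
        rcases he' with ⟨e'', h, h'⟩ | ⟨-, h⟩
        · rwa [← hinj h']
        · exact (h ⟨e', rfl⟩).elim
      · rintro _ (⟨e', he', rfl⟩ | ⟨hd, hdr⟩) hd'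
        · rcases hflip e' with h | h
          · rw [h] at hd' ⊢
            exact Or.inl ⟨_, hSc _ he' hd', rfl⟩
          · exact Or.inr ⟨hd', h⟩
        · rename_i d
          by_cases hr : α d ∈ Set.range ι
          · obtain ⟨e', he'⟩ := hr
            rw [← he'] at hd' ⊢
            have h1 : α (ι e') ∉ Set.range ι := by rw [he', hα]; exact hdr
            refine Or.inl ⟨e', ?_, rfl⟩
            rcases hA e e' hatt h1 with h2 | ⟨d', h2, h3⟩
            · exact (hSv.mem_iff h2).1 he
            · exact (hSv.mem_iff h3).1 (hSc _ ((hSv.mem_iff h2).1 he)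
                (((hpre i).mem_iff h3).2 hd'))
          · exact Or.inr ⟨hd', hr⟩
    · push Not at hatt
      have := (hB.conn i).2 (ι '' S) hsub (hSne.image _) (hSv.image hι hinj) ?_
      · rw [← this, Set.preimage_image_eq _ hinj]
      · rintro _ ⟨e, he, rfl⟩ hd
        rcases hflip e with h | h
        · rw [h] at hd ⊢
          exact ⟨_, hSc _ he hd, rfl⟩
        · exact (h (hatt e he)).elim
  · intro i j hij
    obtain ⟨d, hd, hd'⟩ := hB.adj i j hij
    by_cases h1 : d ∈ Set.range ι <;> by_cases h2 : α d ∈ Set.range ι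
    · obtain ⟨e, rfl⟩ := h1
      rcases hflip e with h | h
      · rw [h] at hd'; exact ⟨e, hd, hd'⟩
      · exact (h h2).elim
    · obtain ⟨e, rfl⟩ := h1
      obtain ⟨e', h3, h4⟩ := hexit j ⟨_, hd', h2⟩
      exact hadj i j hij e e' hd h3 h2 h4
    · obtain ⟨e', he'⟩ := h2
      obtain ⟨e, h3, h4⟩ := hexit i ⟨_, hd, h1⟩
      rw [← he'] at hd'
      exact hadj i j hij e e' h3 hd' h4 (by rw [he', hα]; exact h1)
    · obtain ⟨e, h3, h4⟩ := hexit i ⟨_, hd, h1⟩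
      obtain ⟨e', h5, h6⟩ := hexit j ⟨_, hd', h2⟩
      exact hadj i j hij e e' h3 h5 h4 h6

/-- The two sides of a cut with two edges cannot both contain a branch set of a `K₄` minor. -/
theorem IsK4Branch.not_both_sides (hα : ∀ d, α (α d) = d) {B : Fin 4 → Set D}
    (hB : IsK4Branch ρ α B) {W : Set D} (hWv : IsVertexSet ρ W) {b₁ b₂ : D}
    (hb : ∀ d ∈ W, α d ∉ W → d = b₁ ∨ d = b₂) {i j : Fin 4} (hi : B i ⊆ W) (hj : B j ⊆ Wᶜ) :
    False := by
  have hij : i ≠ j := by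
    rintro rfl
    obtain ⟨d, hd⟩ := (hB.conn i).1
    exact hj hd (hi hd)
  obtain ⟨b, hbi, hbj⟩ := hB.adj i j hij
  -- name the cut edges so that `b₁` joins the two branch sets
  wlog hb1 : b = b₁ generalizing b₁ b₂
  · exact this (fun d h h' => (hb d h h').symm)
      ((hb b (hi hbi) (hj hbj)).resolve_left hb1)
  subst hb1
  have hdis := fun i j hij d => hB.disj i j hij d
  have key : ∀ k, k ≠ i → k ≠ j → (b₂ ∈ B k ∧ b₂ ∈ W) ∨ (α b₂ ∈ B k ∧ B k ⊆ Wᶜ ∧ b₂ ∈ W) := by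
    intro k hki hkj
    by_cases hcross : B k ⊆ Wᶜ
    · obtain ⟨d, hd, hd'⟩ := hB.adj k i hki
      rcases hb (α d) (hi hd') (by rw [hα]; exact hcross hd) with h | h
      · rw [← h, hα] at hbj
        exact (hdis k j hkj d hd hbj).elim
      · exact Or.inr ⟨by rwa [← h, hα], hcross, h ▸ hi hd'⟩
    · left
      by_cases hW' : B k ⊆ W
      · obtain ⟨d, hd, hd'⟩ := hB.adj k j hkj
        rcases hb d (hW' hd) (hj hd') with h | h
        · exact (hdis k i hki d hd (h ▸ hbi)).elim
        · subst h; exact ⟨hd, hW' hd⟩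
      · by_contra hcon
        rw [Set.not_subset] at hcross hW'
        obtain ⟨d, hd, hdW⟩ := hcross
        have hdW : d ∈ W := by simpa using hdW
        have := (hB.conn k).2 (B k ∩ W) Set.inter_subset_left ⟨d, hd, hdW⟩
          ((hB.vertexSet k).inter hWv) (by
            rintro e ⟨he, heW⟩ he'
            refine ⟨he', ?_⟩
            by_contra hc
            rcases hb e heW hc with h | h
            · exact hdis k i hki e he (h ▸ hbi)
            · subst h; exact hcon ⟨he, heW⟩)
        obtain ⟨e, he, he'⟩ := hW'
        rw [← this] at he
        exact he' he.2
  have hkl : ∀ i j : Fin 4, i ≠ j → ∃ k l, k ≠ l ∧ k ≠ i ∧ k ≠ j ∧ l ≠ i ∧ l ≠ j := by decide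
  obtain ⟨k, l, hkl, hki, hkj, hli, hlj⟩ := hkl i j hij
  have fin : ∀ k l, k ≠ l → k ≠ i → k ≠ j → l ≠ i → l ≠ j → b₂ ∈ B k → α b₂ ∈ B l →
      B l ⊆ Wᶜ → False := by
    intro k l hkl hki hkj hli hlj h1 h2 h3
    obtain ⟨d, hd, hd'⟩ := hB.adj i l (Ne.symm hli)
    rcases hb d (hi hd) (h3 hd') with h | h
    · subst h; exact hdis l j hlj _ hd' hbj
    · subst h; exact hdis k i hki _ h1 hd
  rcases key k hki hkj with h1 | h1 <;> rcases key l hli hlj with h2 | h2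
  · exact hdis k l hkl _ h1.1 h2.1
  · exact fin k l hkl hki hkj hli hlj h1.1 h2.1 h2.2.1
  · exact fin l k hkl.symm hli hlj hki hkj h2.1 h1.1 h1.2.1
  · exact hdis k l hkl _ h1.1 h2.1

end Transfer

section Sub

variable [DecidableEq D] [DecidableEq E] [Finite D] [Finite E]
  {ρ α : Perm D} {σ β : Perm E} {h : D} {g : E}

theorem isVertexConn_range_inr (hβ : IsMap4 σ β) (c : IsConn σ β) :
    IsVertexConn (sumCongr ρ σ) (subFlip α h β g) (Set.range Sum.inr) := by
  refine ⟨⟨Sum.inr g, g, rfl⟩, fun S hS hne hSv hSc => hS.antisymm ?_⟩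
  have : (Sum.inr ⁻¹' S : Set E) = Set.univ := by
    refine c.eq_univ_of_off hβ g ?_ (fun d hd => (hSv (Sum.inr d)).2 hd) fun d hd h1 h2 => ?_
    · obtain ⟨d, hd⟩ := hne
      obtain ⟨e, rfl⟩ := hS hd
      exact ⟨e, hd⟩
    · have := hSc _ hd (by rw [subFlip_inr h1 h2]; exact ⟨_, rfl⟩)
      rwa [subFlip_inr h1 h2] at this
  rintro _ ⟨e, rfl⟩
  change e ∈ Sum.inr ⁻¹' S
  rw [this]; trivial

theorem isVertexConn_range_inl (hα : IsMap4 ρ α) (c : IsConn ρ α) :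
    IsVertexConn (sumCongr ρ σ) (subFlip α h β g) (Set.range Sum.inl) := by
  refine ⟨⟨Sum.inl h, h, rfl⟩, fun S hS hne hSv hSc => hS.antisymm ?_⟩
  have : (Sum.inl ⁻¹' S : Set D) = Set.univ := by
    refine c.eq_univ_of_off hα h ?_ (fun d hd => (hSv (Sum.inl d)).2 hd) fun d hd h1 h2 => ?_
    · obtain ⟨d, hd⟩ := hne
      obtain ⟨e, rfl⟩ := hS hd
      exact ⟨e, hd⟩
    · have := hSc _ hd (by rw [subFlip_inl hα h1 h2]; exact ⟨_, rfl⟩)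
      rwa [subFlip_inl hα h1 h2] at this
  rintro _ ⟨e, rfl⟩
  change e ∈ Sum.inl ⁻¹' S
  rw [this]; trivial

theorem compl_range_inl : (Set.range (Sum.inl : D → D ⊕ E))ᶜ = Set.range Sum.inr :=
  Set.isCompl_range_inl_range_inr.compl_eq

theorem compl_range_inr : (Set.range (Sum.inr : E → D ⊕ E))ᶜ = Set.range Sum.inl :=
  Set.isCompl_range_inl_range_inr.symm.compl_eq

theorem subFlip_inl_cases (hα : IsMap4 ρ α) (hβ : IsMap4 σ β) (d : D) :
    ((d = h ∨ d = α h) ∧ subFlip α h β g (Sum.inl d) ∉ Set.range Sum.inl ∧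
      subFlip α h β g (Sum.inl (α d)) ∉ Set.range Sum.inl) ∨
    ((d ≠ h ∧ d ≠ α h) ∧ subFlip α h β g (Sum.inl d) = Sum.inl (α d)) := by
  by_cases h1 : d = h
  · subst h1
    left; rw [subFlip_inl_self hβ, subFlip_inl_flip hα]; simp
  by_cases h2 : d = α h
  · subst h2
    left; rw [hα.flip_flip, subFlip_inl_self hβ, subFlip_inl_flip hα]; simp
  exact Or.inr ⟨⟨h1, h2⟩, subFlip_inl hα h1 h2⟩

theorem subFlip_inr_cases (hα : IsMap4 ρ α) (hβ : IsMap4 σ β) (d : E) :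
    ((d = g ∨ d = β g) ∧ subFlip α h β g (Sum.inr d) ∉ Set.range Sum.inr ∧
      subFlip α h β g (Sum.inr (β d)) ∉ Set.range Sum.inr) ∨
    ((d ≠ g ∧ d ≠ β g) ∧ subFlip α h β g (Sum.inr d) = Sum.inr (β d)) := by
  by_cases h1 : d = g
  · subst h1
    left; rw [subFlip_inr_self hα hβ, subFlip_inr_flip hα hβ]; simp
  by_cases h2 : d = β g
  · subst h2
    left; rw [hβ.flip_flip, subFlip_inr_self hα hβ, subFlip_inr_flip hα hβ]; simp
  exact Or.inr ⟨⟨h1, h2⟩, subFlip_inr h1 h2⟩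

/-- A substitution has a `K₄` minor if and only if one of its two parts has one. -/
theorem hasK4_sub_iff (hα : IsMap4 ρ α) (hβ : IsMap4 σ β) (c1 : IsConn ρ α) (c2 : IsConn σ β) :
    HasK4 (sumCongr ρ σ) (subFlip α h β g) ↔ HasK4 ρ α ∨ HasK4 σ β := by
  have hA := hα.sub (h := h) (g := g) hβ
  have e1 : ∀ d, d = h ∨ d = α h → ρ.SameCycle h d ∨ ρ.SameCycle h (α d) := by
    rintro d (rfl | rfl)
    · exact Or.inl (SameCycle.refl _ _)
    · exact Or.inr (by rw [hα.flip_flip])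
  have e2 : ∀ d, d = g ∨ d = β g → σ.SameCycle g d ∨ σ.SameCycle g (β d) := by
    rintro d (rfl | rfl)
    · exact Or.inl (SameCycle.refl _ _)
    · exact Or.inr (by rw [hβ.flip_flip])
  constructor
  · rintro ⟨B, hB⟩
    by_cases k1 : ∀ i, ∃ e, Sum.inl e ∈ B i
    · left
      refine hB.restrict (ι := Sum.inl) Sum.inl_injective (fun _ => rfl) hA.flip_flip
        (fun d => ?_) ?_ k1
      · rcases subFlip_inl_cases (h := h) (g := g) hα hβ d with h1 | h1
        · exact Or.inr h1.2.1
        · exact Or.inl h1.2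
      · intro d d' hd hd'
        rcases subFlip_inl_cases (h := h) (g := g) hα hβ d with ⟨h1, -⟩ | h1
        · rcases subFlip_inl_cases (h := h) (g := g) hα hβ d' with ⟨h2, -⟩ | h2
          · rcases h1 with rfl | rfl <;> rcases h2 with rfl | rfl
            · exact Or.inl (SameCycle.refl _ _)
            · exact Or.inr ⟨d, SameCycle.refl _ _, SameCycle.refl _ _⟩
            · exact Or.inr ⟨_, SameCycle.refl _ _, by rw [hα.flip_flip]⟩
            · exact Or.inl (SameCycle.refl _ _)
          · rw [h2.2] at hd'; exact (hd' ⟨_, rfl⟩).elim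
        · rw [h1.2] at hd; exact (hd ⟨_, rfl⟩).elim
    by_cases k2 : ∀ i, ∃ e, Sum.inr e ∈ B i
    · right
      refine hB.restrict (ι := Sum.inr) Sum.inr_injective (fun _ => rfl) hA.flip_flip
        (fun d => ?_) ?_ k2
      · rcases subFlip_inr_cases (h := h) (g := g) hα hβ d with h1 | h1
        · exact Or.inr h1.2.1
        · exact Or.inl h1.2
      · intro d d' hd hd'
        rcases subFlip_inr_cases (h := h) (g := g) hα hβ d with ⟨h1, -⟩ | h1
        · rcases subFlip_inr_cases (h := h) (g := g) hα hβ d' with ⟨h2, -⟩ | h2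
          · rcases h1 with rfl | rfl <;> rcases h2 with rfl | rfl
            · exact Or.inl (SameCycle.refl _ _)
            · exact Or.inr ⟨d, SameCycle.refl _ _, SameCycle.refl _ _⟩
            · exact Or.inr ⟨_, SameCycle.refl _ _, by rw [hβ.flip_flip]⟩
            · exact Or.inl (SameCycle.refl _ _)
          · rw [h2.2] at hd'; exact (hd' ⟨_, rfl⟩).elim
        · rw [h1.2] at hd; exact (hd ⟨_, rfl⟩).elim
    push Not at k1 k2
    obtain ⟨i, hi⟩ := k1
    obtain ⟨j, hj⟩ := k2
    refine (hB.not_both_sides (W := Set.range Sum.inr) (i := i) (j := j) (b₁ := Sum.inr g)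
      (b₂ := Sum.inr (β g)) hA.flip_flip (isVertexSet_range (σ := σ) fun _ => rfl) ?_ ?_ ?_).elim
    · rintro _ ⟨d, rfl⟩ hd
      rcases subFlip_inr_cases (h := h) (g := g) hα hβ d with ⟨rfl | rfl, -⟩ | h1
      · exact Or.inl rfl
      · exact Or.inr rfl
      · rw [h1.2] at hd; exact (hd ⟨_, rfl⟩).elim
    · rintro (d | d) hd
      · exact (hi d hd).elim
      · exact ⟨d, rfl⟩
    · rintro (d | d) hd
      · simp
      · exact (hj d hd).elim
  · rintro (h1 | h1)
    · refine h1.lift (ι := Sum.inl) Sum.inl_injective (fun _ => rfl) hA.flip_flip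
        (fun d => ?_) ?_ h (fun d hd => ?_) ⟨h, SameCycle.refl _ _, ?_⟩
      · rcases subFlip_inl_cases (h := h) (g := g) hα hβ d with h1 | h1
        · exact Or.inr h1.2
        · exact Or.inl h1.2
      · rw [compl_range_inl]; exact isVertexConn_range_inr hβ c2
      · rcases subFlip_inl_cases (h := h) (g := g) hα hβ d with h1 | h1
        · exact e1 d h1.1
        · rw [h1.2] at hd; exact (hd ⟨_, rfl⟩).elim
      · rw [subFlip_inl_self hβ]; simp
    · refine h1.lift (ι := Sum.inr) Sum.inr_injective (fun _ => rfl) hA.flip_flip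
        (fun d => ?_) ?_ g (fun d hd => ?_) ⟨g, SameCycle.refl _ _, ?_⟩
      · rcases subFlip_inr_cases (h := h) (g := g) hα hβ d with h1 | h1
        · exact Or.inr h1.2
        · exact Or.inl h1.2
      · rw [compl_range_inr]; exact isVertexConn_range_inl hα c1
      · rcases subFlip_inr_cases (h := h) (g := g) hα hβ d with h1 | h1
        · exact e2 d h1.1
        · rw [h1.2] at hd; exact (hd ⟨_, rfl⟩).elim
      · rw [subFlip_inr_self hα hβ]; simp

end Sub

end Minor

/-! ### Rooted maps in terms of half-edges -/

section HalfEdges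

variable {D E : Type*}

section Equivalences

variable {ρ α : Perm D} {σ β : Perm E} {e : D ≃ E}

theorem symm_comm_of_comm (h : ∀ d, e (ρ d) = σ (e d)) (d : E) : e.symm (σ d) = ρ (e.symm d) := by
  rw [Equiv.symm_apply_eq, h, Equiv.apply_symm_apply]

theorem numCycles_congr (h : ∀ d, e (ρ d) = σ (e d)) : ρ.numCycles = σ.numCycles := by
  rw [← numCycles_permCongr e ρ]
  congr 1
  ext d
  rw [Equiv.permCongr_apply, h, Equiv.apply_symm_apply]

theorem planar_congr (h : ∀ d, e (ρ d) = σ (e d)) (h' : ∀ d, e (α d) = β (e d)) :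
    Planar ρ α ↔ Planar σ β := by
  rw [Planar, Planar, numCycles_congr h, numCycles_congr h', numCycles_congr (e := e)
    (ρ := ρ * α) (σ := σ * β) fun d => by rw [mul_apply, h, h', mul_apply]]

theorem IsConn.congr (h : ∀ d, e (ρ d) = σ (e d)) (h' : ∀ d, e (α d) = β (e d))
    (c : IsConn ρ α) : IsConn σ β := by
  intro S hne h1 h2
  have := c (e ⁻¹' S) (hne.elim fun d hd => ⟨e.symm d, by simpa using hd⟩)
    (fun d hd => by rw [Set.mem_preimage, h]; exact h1 _ hd)
    (fun d hd => by rw [Set.mem_preimage, h']; exact h2 _ hd)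
  refine Set.eq_univ_of_forall fun d => ?_
  have hd : e.symm d ∈ e ⁻¹' S := this ▸ trivial
  simpa using hd

theorem IsMap4.congr (h : ∀ d, e (ρ d) = σ (e d)) (h' : ∀ d, e (α d) = β (e d))
    (m : IsMap4 ρ α) : IsMap4 σ β where
  flip_flip d := by
    obtain ⟨d, rfl⟩ := e.surjective d
    rw [← h', ← h', m.flip_flip]
  flip_ne d := by
    obtain ⟨d, rfl⟩ := e.surjective d
    rw [← h', e.injective.ne_iff]; exact m.flip_ne d
  rot4 d := by
    obtain ⟨d, rfl⟩ := e.surjective d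
    rw [← h, ← h, ← h, ← h, m.rot4]
  rot2_ne d := by
    obtain ⟨d, rfl⟩ := e.surjective d
    rw [← h, ← h, e.injective.ne_iff]; exact m.rot2_ne d

theorem sameCycle_congr (h : ∀ d, e (ρ d) = σ (e d)) {a b : D} :
    σ.SameCycle (e a) (e b) ↔ ρ.SameCycle a b := by
  have : σ = e.permCongr ρ := by
    ext d
    rw [Equiv.permCongr_apply, h, Equiv.apply_symm_apply]
  rw [this]
  have h : ∀ n : ℤ, ((e.permCongr ρ) ^ n) (e a) = e ((ρ ^ n) a) := fun n => by
    have : (e.permCongr ρ) ^ n = e.permCongr (ρ ^ n) := (map_zpow e.permCongrHom ρ n).symm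
    rw [this]; simp
  change (∃ n : ℤ, _) ↔ (∃ n : ℤ, _)
  simp only [h, EmbeddingLike.apply_eq_iff_eq]

theorem HasK4.congr (h : ∀ d, e (ρ d) = σ (e d)) (h' : ∀ d, e (α d) = β (e d))
    (m : HasK4 ρ α) : HasK4 σ β := by
  obtain ⟨B, hB⟩ := m
  have k := symm_comm_of_comm h
  have k' := symm_comm_of_comm h'
  refine ⟨fun i => e.symm ⁻¹' B i, fun i => (hB.vertexSet i).preimage k, fun i => ⟨?_, ?_⟩, ?_, ?_⟩
  · obtain ⟨d, hd⟩ := (hB.conn i).1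
    exact ⟨e d, by simpa using hd⟩
  · intro S hS hne hSv hSc
    have := (hB.conn i).2 (e ⁻¹' S) (fun d hd => by simpa using hS hd)
      (hne.elim fun d hd => ⟨e.symm d, by simpa using hd⟩) (hSv.preimage h) fun d hd hd' => by
        rw [Set.mem_preimage, h']
        refine hSc _ hd ?_
        rw [← h', Set.mem_preimage, Equiv.symm_apply_apply]
        exact hd'
    rw [← this, ← Set.preimage_comp]
    simp
  · exact fun i j hij d => hB.disj i j hij _
  · intro i j hij
    obtain ⟨d, hd, hd'⟩ := hB.adj i j hij
    exact ⟨e d, by simpa using hd, by rw [← h']; simpa using hd'⟩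

end Equivalences

theorem SimpleGraph.Reachable.of_forall_adj {V : Type*} {G : SimpleGraph V} {P : V → Prop}
    (h : ∀ u v, G.Adj u v → P u → P v) {u v : V} (huv : G.Reachable u v) (hu : P u) : P v := by
  rw [SimpleGraph.reachable_iff_reflTransGen] at huv
  induction huv with
  | refl => exact hu
  | tail _ hab ih => exact h _ _ hab ih

namespace RootedMap

section Basic

variable (R : RootedMap D)

theorem vert_eq_iff {d e : D} : R.vert d = R.vert e ↔ R.rot.SameCycle d e :=
  ⟨fun h => Quotient.exact h, fun h => Quotient.sound h⟩

theorem vert_surjective : Function.Surjective R.vert := Quotient.mk_surjective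

theorem flip_sameCycle_iff {d e : D} : R.flip.SameCycle d e ↔ e = d ∨ e = R.flip d := by
  constructor
  · rintro ⟨n, rfl⟩
    have h2 : R.flip ^ 2 = 1 := by ext d; simp [pow_two, R.flip_flip]
    rcases Int.even_or_odd' n with ⟨k, rfl | rfl⟩
    · left; rw [zpow_mul, zpow_ofNat, h2, one_zpow, one_apply]
    · right; rw [zpow_add, zpow_mul, zpow_ofNat, h2, one_zpow, one_mul, zpow_one]
  · rintro (rfl | rfl)
    · exact SameCycle.refl _ _
    · exact sameCycle_apply_right.2 (SameCycle.refl _ _)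

theorem edge_eq_iff {d e : D} : R.edge d = R.edge e ↔ e = d ∨ e = R.flip d :=
  ⟨fun h => R.flip_sameCycle_iff.1 (Quotient.exact h),
    fun h => Quotient.sound (R.flip_sameCycle_iff.2 h)⟩

theorem isConn [Finite D] : IsConn R.rot R.flip := by
  intro S hne hρ hα
  refine Set.eq_univ_of_forall fun d => ?_
  obtain ⟨d₀, h₀⟩ := hne
  obtain ⟨g, hg, rfl⟩ := R.transitive d₀ d
  have key : ∀ d, g d ∈ S ↔ d ∈ S := by
    induction hg using Subgroup.closure_induction with
    | mem x hx =>
      rcases hx with rfl | rfl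
      · exact IsVertexSet.of_forall_mem hρ
      · exact IsVertexSet.of_forall_mem hα
    | one => exact fun _ => Iff.rfl
    | mul x y _ _ hx hy => exact fun d => (hx _).trans (hy d)
    | inv x _ hx => exact fun d => by rw [← hx, ← mul_apply, mul_inv_cancel, one_apply]
  exact (key d₀).2 h₀

theorem isPlanar : Planar R.rot R.flip := R.euler

theorem isMap4_of_isFourRegular [Finite D] (h : R.IsFourRegular) : IsMap4 R.rot R.flip := by
  have key : ∀ d n, (R.rot ^ n) d = d ↔ 4 ∣ n := by
    intro d n
    have hc : R.rot.IsCycleOn {e | R.rot.SameCycle d e} := by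
      refine ⟨⟨fun x hx => sameCycle_apply_right.2 hx, R.rot.injective.injOn, fun x hx =>
        ⟨R.rot.symm x, ?_, by simp⟩⟩, fun x hx y hy => SameCycle.trans (SameCycle.symm hx) hy⟩
      exact sameCycle_symm_apply_right.2 hx
    have hs : {e | R.rot.SameCycle d e} = {e | R.vert e = R.vert d} := by
      ext e
      rw [Set.mem_ofPred_eq, Set.mem_ofPred_eq, vert_eq_iff, sameCycle_comm]
    have hcard := h (R.vert d)
    have hf : {e | R.vert e = R.vert d}.Finite := Set.toFinite _
    rw [hs, ← hf.coe_toFinset] at hc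
    rw [hc.pow_apply_eq (by simp), ← Set.ncard_eq_toFinset_card _ hf, hcard]
  refine ⟨R.flip_flip, R.flip_ne, fun d => ?_, fun d hd => ?_⟩
  · simpa [pow_succ] using (key d 4).2 (dvd_refl 4)
  · have := (key d 2).1 (by simpa [pow_succ] using hd)
    omega

theorem isFourRegular_of_isMap4 [Finite D] (h : IsMap4 R.rot R.flip) : R.IsFourRegular := by
  intro v
  obtain ⟨d, rfl⟩ := R.vert_surjective v
  have : {e | R.vert e = R.vert d} =
      {d, R.rot d, R.rot (R.rot d), R.rot (R.rot (R.rot d))} := by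
    ext e
    rw [Set.mem_ofPred_eq, vert_eq_iff, sameCycle_comm, h.sameCycle_iff]
    rfl
  rw [this, Set.ncard_insert_of_notMem, Set.ncard_insert_of_notMem, Set.ncard_pair]
  · exact (h.rot_ne _).symm
  · rintro (h1 | h1)
    · exact h.rot_ne _ h1.symm
    · exact h.rot2_ne _ h1.symm
  · rintro (h1 | h1 | h1)
    · exact h.rot_ne _ h1.symm
    · exact h.rot2_ne _ h1.symm
    · exact h.rot3_ne _ h1.symm

theorem isFourRegular_iff [Finite D] : R.IsFourRegular ↔ IsMap4 R.rot R.flip :=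
  ⟨R.isMap4_of_isFourRegular, R.isFourRegular_of_isMap4⟩

theorem isVertexSet_preimage_vert [Finite D] (B : Set R.Vertex) :
    IsVertexSet R.rot (R.vert ⁻¹' B) := fun d => by
  have : R.vert (R.rot d) = R.vert d :=
    R.vert_eq_iff.2 (sameCycle_apply_left.2 (SameCycle.refl _ _))
  rw [Set.mem_preimage, Set.mem_preimage, this]

theorem preimage_image_vert [Finite D] {K : Set D} (hK : IsVertexSet R.rot K) :
    R.vert ⁻¹' (R.vert '' K) = K := by
  ext d
  constructor
  · rintro ⟨e, he, hd⟩
    exact (hK.mem_iff (R.vert_eq_iff.1 hd)).1 he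
  · exact fun hd => ⟨d, hd, rfl⟩

theorem isVertexConn_of_connected [Finite D] {B : Set R.Vertex} (A : Set R.Edge)
    (h : ((R.graphMinus A).induce B).Connected) :
    IsVertexConn R.rot R.flip (R.vert ⁻¹' B) := by
  constructor
  · obtain ⟨⟨v, hv⟩⟩ := h.nonempty
    obtain ⟨d, rfl⟩ := R.vert_surjective v
    exact ⟨d, hv⟩
  · intro S hS hne hSv hSc
    obtain ⟨d, hd⟩ := hne
    refine hS.antisymm fun e he => ?_
    have := (h.preconnected ⟨R.vert d, hS hd⟩ ⟨R.vert e, he⟩).of_forall_adj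
      (P := fun v => ∀ x, R.vert x = v.1 → x ∈ S) ?_ fun x hx =>
        (hSv.mem_iff (R.vert_eq_iff.1 hx)).2 hd
    · exact this e rfl
    · rintro ⟨u, hu⟩ ⟨v, hv⟩ ⟨_, x, -, hxu, hxv⟩ hP y hy
      have hyx : R.flip x ∈ S := hSc x (hP x hxu) (by rw [Set.mem_preimage, hxv]; exact hv)
      exact (hSv.mem_iff (R.vert_eq_iff.1 (hy.trans hxv.symm))).2 hyx

theorem connected_of_isVertexConn [Finite D] {K : Set D} (hK : IsVertexSet R.rot K)
    (h : IsVertexConn R.rot R.flip K) (A : Set R.Edge)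
    (hA : ∀ d ∈ K, R.flip d ∈ K → R.edge d ∉ A) :
    ((R.graphMinus A).induce (R.vert '' K)).Connected := by
  have hmem : ∀ d, R.vert d ∈ R.vert '' K ↔ d ∈ K := fun d => by
    conv_rhs => rw [← R.preimage_image_vert hK]
    rfl
  have : Nonempty (R.vert '' K : Set R.Vertex) := (h.1.image _).to_subtype
  refine ⟨?_⟩
  rintro ⟨u, hu⟩ ⟨v, hv⟩
  obtain ⟨d, rfl⟩ := R.vert_surjective u
  obtain ⟨e, rfl⟩ := R.vert_surjective v
  set G := (R.graphMinus A).induce (R.vert '' K)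
  have := h.2 {x | ∃ hx : R.vert x ∈ R.vert '' K, G.Reachable ⟨R.vert d, hu⟩ ⟨R.vert x, hx⟩}
    (fun x ⟨hx, _⟩ => (hmem x).1 hx) ⟨d, hu, SimpleGraph.Reachable.refl _⟩ ?_ ?_
  · have he : e ∈ K := (hmem e).1 hv
    rw [← this] at he
    exact he.2
  · refine IsVertexSet.of_forall_mem ?_
    rintro x ⟨hx, hr⟩
    have h1 : R.vert (R.rot x) = R.vert x :=
      R.vert_eq_iff.2 (sameCycle_apply_left.2 (SameCycle.refl _ _))
    refine ⟨h1 ▸ hx, ?_⟩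
    convert hr using 2
  · rintro x ⟨hx, hr⟩ hx'
    refine ⟨(hmem _).2 hx', ?_⟩
    by_cases heq : R.vert x = R.vert (R.flip x)
    · convert hr using 2
      exact heq.symm
    · refine hr.trans (SimpleGraph.Adj.reachable ?_)
      exact ⟨heq, x, hA x ((hmem x).1 hx) hx', rfl, rfl⟩

theorem isK4MinorFree_iff [Finite D] : R.IsK4MinorFree ↔ ¬ HasK4 R.rot R.flip := by
  refine not_congr ⟨?_, ?_⟩
  · rintro ⟨B, h1, h2, h3⟩
    refine ⟨fun i => R.vert ⁻¹' B i, fun i => R.isVertexSet_preimage_vert _,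
      fun i => R.isVertexConn_of_connected ∅ (h1 i),
      fun i j hij d hd hd' => (h2 i j hij).le_bot ⟨hd, hd'⟩, fun i j hij => ?_⟩
    obtain ⟨u, hu, v, hv, _, d, -, rfl, rfl⟩ := h3 i j hij
    exact ⟨d, hu, hv⟩
  · rintro ⟨B, hB⟩
    have hd : ∀ i j, i ≠ j → Disjoint (R.vert '' B i) (R.vert '' B j) := by
      intro i j hij
      rw [Set.disjoint_left]
      rintro _ ⟨d, hd, rfl⟩ ⟨e, he, hde⟩
      exact hB.disj i j hij d hd (((hB.vertexSet j).mem_iff (R.vert_eq_iff.1 hde)).1 he)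
    refine ⟨fun i => R.vert '' B i, fun i =>
      R.connected_of_isVertexConn (hB.vertexSet i) (hB.conn i) ∅ (by simp), hd, ?_⟩
    intro i j hij
    obtain ⟨d, hd1, hd2⟩ := hB.adj i j hij
    refine ⟨_, ⟨d, hd1, rfl⟩, _, ⟨_, hd2, rfl⟩, fun h => ?_, d, by simp, rfl, rfl⟩
    exact (hd i j hij).le_bot ⟨⟨d, hd1, rfl⟩, ⟨_, hd2, h.symm⟩⟩

end Basic

/-- The rooted map given by two permutations and a root. -/
def ofPerms [Finite D] {ρ α : Perm D} (m : IsMap4 ρ α) (c : IsConn ρ α) (p : Planar ρ α)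
    (r : D) : RootedMap D where
  rot := ρ
  flip := α
  root := r
  flip_flip := m.flip_flip
  flip_ne := m.flip_ne
  transitive d d' := by
    have := c {e | ∃ g ∈ Subgroup.closure {ρ, α}, g d = e} ⟨d, 1, one_mem _, rfl⟩ ?_ ?_
    · exact (this.symm ▸ Set.mem_univ d' :)
    · rintro _ ⟨g, hg, rfl⟩
      exact ⟨ρ * g, mul_mem (Subgroup.subset_closure (Or.inl rfl)) hg, rfl⟩
    · rintro _ ⟨g, hg, rfl⟩
      exact ⟨α * g, mul_mem (Subgroup.subset_closure (Or.inr rfl)) hg, rfl⟩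
  euler := p

/-- The half-edge form of `RootedMap.IsFourRegular`. -/
abbrev Is4 (R : RootedMap D) : Prop := IsMap4 R.rot R.flip

section Sub

open scoped Classical in
/-- The map obtained from `R` by replacing the edge of the half-edge `h` by the map `R'` without
its root edge. -/
noncomputable def sub [Finite D] [Finite E] (R : RootedMap D) (h : D) (R' : RootedMap E)
    (m : R.Is4) (m' : R'.Is4) : RootedMap (D ⊕ E) :=
  ofPerms (m.sub (h := h) (g := R'.root) m') (R.isConn.sub m m' R'.isConn)
    ((planar_sub_iff m m' R.isConn R'.isConn).2 ⟨R.isPlanar, R'.isPlanar⟩) (Sum.inl R.root)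

variable [Finite D] [Finite E] {R : RootedMap D} {h : D} {R' : RootedMap E} {m : R.Is4}
  {m' : R'.Is4}

@[simp] theorem sub_root : (R.sub h R' m m').root = Sum.inl R.root := rfl

@[simp] theorem sub_rot_inl (d : D) : (R.sub h R' m m').rot (Sum.inl d) = Sum.inl (R.rot d) := rfl

@[simp] theorem sub_rot_inr (d : E) : (R.sub h R' m m').rot (Sum.inr d) = Sum.inr (R'.rot d) := rfl

@[simp] theorem sub_flip_inl_self : (R.sub h R' m m').flip (Sum.inl h) = Sum.inr R'.root := by
  classical exact subFlip_inl_self m'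

@[simp] theorem sub_flip_inl_flip :
    (R.sub h R' m m').flip (Sum.inl (R.flip h)) = Sum.inr (R'.flip R'.root) := by
  classical exact subFlip_inl_flip m

theorem sub_flip_inl {d : D} (h1 : d ≠ h) (h2 : d ≠ R.flip h) :
    (R.sub h R' m m').flip (Sum.inl d) = Sum.inl (R.flip d) := by
  classical exact subFlip_inl m h1 h2

@[simp] theorem sub_flip_inr_root : (R.sub h R' m m').flip (Sum.inr R'.root) = Sum.inl h := by
  classical exact subFlip_inr_self m m'

@[simp] theorem sub_flip_inr_flip :
    (R.sub h R' m m').flip (Sum.inr (R'.flip R'.root)) = Sum.inl (R.flip h) := by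
  classical exact subFlip_inr_flip m m'

theorem sub_flip_inr {d : E} (h1 : d ≠ R'.root) (h2 : d ≠ R'.flip R'.root) :
    (R.sub h R' m m').flip (Sum.inr d) = Sum.inr (R'.flip d) := by
  classical exact subFlip_inr h1 h2

theorem is4_sub : (R.sub h R' m m').Is4 := by
  classical exact m.sub m'

theorem hasK4_sub : HasK4 (R.sub h R' m m').rot (R.sub h R' m m').flip ↔
    HasK4 R.rot R.flip ∨ HasK4 R'.rot R'.flip := by
  classical exact hasK4_sub_iff m m' R.isConn R'.isConn

end Sub

/-- The decomposition of the map `R` along a cut consisting of the edges of the half-edges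
`k₁, k₂ ∈ K`: the part inside `K` is rooted at `k₁`. -/
structure Splitting [Finite D] (R : RootedMap D) (K : Set D) (k₁ k₂ : D) where
  out : RootedMap (Kᶜ : Set D)
  inn : RootedMap K
  out4 : out.Is4
  inn4 : inn.Is4
  hk₁ : k₁ ∈ K
  hk₂ : k₂ ∈ K
  hf₁ : R.flip k₁ ∈ Kᶜ
  hf₂ : R.flip k₂ ∈ Kᶜ
  out_rot : ∀ d, (out.rot d : D) = R.rot d
  out_flip : ∀ d : (Kᶜ : Set D), (d : D) ≠ R.flip k₁ → (d : D) ≠ R.flip k₂ →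
    (out.flip d : D) = R.flip d
  out_flip_cut : out.flip ⟨R.flip k₁, hf₁⟩ = ⟨R.flip k₂, hf₂⟩
  out_root : (out.root : D) = R.root
  inn_rot : ∀ d, (inn.rot d : D) = R.rot d
  inn_flip : ∀ d : K, (d : D) ≠ k₁ → (d : D) ≠ k₂ → (inn.flip d : D) = R.flip d
  inn_root : inn.root = ⟨k₁, hk₁⟩
  inn_flip_root : inn.flip inn.root = ⟨k₂, hk₂⟩
  iso : R.Iso (out.sub ⟨R.flip k₁, hf₁⟩ inn out4 inn4)

theorem exists_splitting [Finite D] (R : RootedMap D) (m : R.Is4) {K : Set D} {k₁ k₂ : D}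
    (hK : IsVertexSet R.rot K) (hr : R.root ∉ K) (hb : bdry R.flip K = {k₁, k₂}) (hne : k₁ ≠ k₂) :
    Nonempty (R.Splitting K k₁ k₂) := by
  classical
  have hb1 : k₁ ∈ bdry R.flip K := by rw [hb]; exact Or.inl rfl
  have hb2 : k₂ ∈ bdry R.flip K := by rw [hb]; exact Or.inr rfl
  obtain ⟨hk1, hf1⟩ := hb1
  obtain ⟨hk2, hf2⟩ := hb2
  have hin : ∀ d ∈ K, d ≠ k₁ → d ≠ k₂ → R.flip d ∈ K := by
    intro d hd h1 h2
    by_contra hc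
    have : d ∈ bdry R.flip K := ⟨hd, hc⟩
    rw [hb] at this
    exact this.elim h1 h2
  have hout : ∀ d ∉ K, d ≠ R.flip k₁ → d ≠ R.flip k₂ → R.flip d ∉ K := by
    intro d hd h1 h2 hc
    refine hd ?_
    rw [← R.flip_flip d]
    exact hin _ hc (fun h => h1 (by rw [← h, R.flip_flip])) fun h => h2 (by rw [← h, R.flip_flip])
  have hff : R.flip k₁ ≠ R.flip k₂ := R.flip.injective.ne hne
  have hfk : ∀ d ∈ K, ∀ e ∉ K, d ≠ e := fun d hd e he h => he (h ▸ hd)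
  -- the two cut edges are reglued inside `K` and outside `K`
  set α : Perm D := swap (R.flip k₁) k₂ * R.flip * swap (R.flip k₁) k₂ with hα
  have a0 : ∀ d, d ≠ k₁ → d ≠ k₂ → d ≠ R.flip k₁ → d ≠ R.flip k₂ → α d = R.flip d := by
    intro d h1 h2 h3 h4
    rw [hα, mul_apply, mul_apply, Equiv.swap_apply_of_ne_of_ne h3 h2,
      Equiv.swap_apply_of_ne_of_ne]
    · exact R.flip.injective.ne h1
    · intro h; exact h4 (by rw [← h, R.flip_flip])
  have a1 : α k₁ = k₂ := by
    rw [hα, mul_apply, mul_apply, Equiv.swap_apply_of_ne_of_ne (hfk _ hk1 _ hf1) hne,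
      Equiv.swap_apply_left]
  have a3 : α (R.flip k₁) = R.flip k₂ := by
    rw [hα, mul_apply, mul_apply, Equiv.swap_apply_left,
      Equiv.swap_apply_of_ne_of_ne hff.symm (R.flip_ne _)]
  have aα : ∀ d, α (α d) = d := by
    intro d
    rw [hα]
    simp only [mul_apply, Equiv.swap_apply_self, R.flip_flip]
  have a2 : α k₂ = k₁ := by rw [← a1, aα]
  have a4 : α (R.flip k₂) = R.flip k₁ := by rw [← a3, aα]
  have aK : ∀ d ∈ K, α d ∈ K := by
    intro d hd
    by_cases h1 : d = k₁
    · rw [h1, a1]; exact hk2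
    by_cases h2 : d = k₂
    · rw [h2, a2]; exact hk1
    rw [a0 d h1 h2 (hfk _ hd _ hf1) (hfk _ hd _ hf2)]
    exact hin d hd h1 h2
  have hKα : IsVertexSet α K := IsVertexSet.of_forall_mem aK
  have ane : ∀ d, α d ≠ d := by
    intro d hd
    rw [hα, mul_apply, mul_apply, Equiv.swap_apply_eq_iff] at hd
    exact R.flip_ne _ hd
  let ρo : Perm (Kᶜ : Set D) := R.rot.subtypePerm hK.compl
  let ρi : Perm K := R.rot.subtypePerm hK
  let αo : Perm (Kᶜ : Set D) := α.subtypePerm hKα.compl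
  let αi : Perm K := α.subtypePerm hKα
  have mo : IsMap4 ρo αo := ⟨fun d => Subtype.ext (aα d), fun d h => ane d (congrArg Subtype.val h),
    fun d => Subtype.ext (m.rot4 d), fun d h => m.rot2_ne d (congrArg Subtype.val h)⟩
  have mi : IsMap4 ρi αi := ⟨fun d => Subtype.ext (aα d), fun d h => ane d (congrArg Subtype.val h),
    fun d => Subtype.ext (m.rot4 d), fun d h => m.rot2_ne d (congrArg Subtype.val h)⟩
  let e : (Kᶜ : Set D) ⊕ K ≃ D := (Equiv.sumComm _ _).trans (Equiv.Set.sumCompl K)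
  have el : ∀ d, e (Sum.inl d) = d := fun d => by simp [e]
  have er : ∀ d, e (Sum.inr d) = d := fun d => by simp [e]
  let h : (Kᶜ : Set D) := ⟨R.flip k₁, hf1⟩
  let g : K := ⟨k₁, hk1⟩
  have eαo : αo h = ⟨R.flip k₂, hf2⟩ := Subtype.ext a3
  have eαi : αi g = ⟨k₂, hk2⟩ := Subtype.ext a1
  have hrot : ∀ d, e (sumCongr ρo ρi d) = R.rot (e d) := by
    rintro (d | d)
    · rw [el]; exact el _
    · rw [er]; exact er _
  have hflip : ∀ d, e (subFlip αo h αi g d) = R.flip (e d) := by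
    rintro (d | d)
    · rw [el]
      by_cases h1 : d = h
      · subst h1
        rw [subFlip_inl_self mi, er]; exact (R.flip_flip _).symm
      by_cases h2 : d = αo h
      · subst h2
        rw [subFlip_inl_flip mo, er, eαi, eαo]; exact (R.flip_flip _).symm
      rw [subFlip_inl mo h1 h2, el]
      refine a0 _ (hfk _ hk1 _ d.2).symm (hfk _ hk2 _ d.2).symm (fun hh => h1 (Subtype.ext hh))
        fun hh => h2 (eαo ▸ Subtype.ext hh)
    · rw [er]
      by_cases h1 : d = g
      · subst h1
        rw [subFlip_inr_self mo mi, el]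
      by_cases h2 : d = αi g
      · subst h2
        rw [subFlip_inr_flip mo mi, el, eαi, eαo]
      rw [subFlip_inr h1 h2, er]
      exact a0 _ (fun hh => h1 (Subtype.ext hh)) (fun hh => h2 (eαi ▸ Subtype.ext hh))
        (hfk _ d.2 _ hf1) (hfk _ d.2 _ hf2)
  have cc : IsConn (sumCongr ρo ρi) (subFlip αo h αi g) :=
    R.isConn.congr (e := e.symm) (symm_comm_of_comm hrot) (symm_comm_of_comm hflip)
  have co := cc.of_sub_left mo mi
  have ci := cc.of_sub_right mo mi
  have pp := (planar_sub_iff (h := h) (g := g) mo mi co ci).1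
    ((planar_congr hrot hflip).2 R.isPlanar)
  refine ⟨⟨ofPerms mo co pp.1 ⟨R.root, hr⟩, ofPerms mi ci pp.2 g, mo, mi, hk1, hk2, hf1, hf2,
    fun d => rfl, fun d h1 h2 => a0 _ (hfk _ hk1 _ d.2).symm (hfk _ hk2 _ d.2).symm h1 h2,
    eαo, rfl, fun d => rfl,
    fun d h1 h2 => a0 _ h1 h2 (hfk _ d.2 _ hf1) (hfk _ d.2 _ hf2), rfl, eαi, e.symm, ?_, ?_, ?_⟩⟩
  · exact symm_comm_of_comm hrot
  · convert symm_comm_of_comm hflip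
    simp only [sub, ofPerms]
    congr 1 <;> exact Subsingleton.elim _ _
  · rw [Equiv.symm_apply_eq]
    exact (el ⟨R.root, hr⟩).symm

end RootedMap

end HalfEdges

/-! ### Rooted triangle minors -/

section Cutvertices

open Relation (ReflTransGen)

variable {V : Type*} {Adj : V → V → Prop}

/-- `u` and `w` are joined by a path inside `X`. -/
def PathIn (Adj : V → V → Prop) (X : Set V) : V → V → Prop :=
  ReflTransGen fun u w => Adj u w ∧ u ∈ X ∧ w ∈ X

/-- The connected component of `p` in the subgraph induced by `X`. -/
def compIn (Adj : V → V → Prop) (X : Set V) (p : V) : Set V := {w | PathIn Adj X p w}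

/-- `X` is nonempty and induces a connected subgraph. -/
def IsConnSet (Adj : V → V → Prop) (X : Set V) : Prop :=
  X.Nonempty ∧ ∀ u ∈ X, ∀ w ∈ X, PathIn Adj X u w

theorem PathIn.symm (hs : ∀ u w, Adj u w → Adj w u) {X : Set V} {u w : V}
    (h : PathIn Adj X u w) : PathIn Adj X w u := by
  induction h with
  | refl => exact ReflTransGen.refl
  | tail _ h ih => exact ReflTransGen.head ⟨hs _ _ h.1, h.2.2, h.2.1⟩ ih

theorem PathIn.mem {X : Set V} {u w : V} (h : PathIn Adj X u w) (hu : u ∈ X) : w ∈ X := by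
  induction h with
  | refl => exact hu
  | tail _ h _ => exact h.2.2

theorem PathIn.mono {X Y : Set V} (hXY : X ⊆ Y) {u w : V} (h : PathIn Adj X u w) :
    PathIn Adj Y u w := by
  induction h with
  | refl => exact ReflTransGen.refl
  | tail _ h ih => exact ReflTransGen.tail ih ⟨h.1, hXY h.2.1, hXY h.2.2⟩

theorem mem_compIn_self (X : Set V) (p : V) : p ∈ compIn Adj X p := ReflTransGen.refl

theorem compIn_subset {X : Set V} {p : V} (hp : p ∈ X) : compIn Adj X p ⊆ X :=
  fun _ h => PathIn.mem h hp

theorem mem_compIn_of_adj {X : Set V} {p u w : V} (hp : p ∈ X) (hu : u ∈ compIn Adj X p)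
    (hw : w ∈ X) (h : Adj u w) : w ∈ compIn Adj X p :=
  ReflTransGen.tail hu ⟨h, compIn_subset hp hu, hw⟩

theorem isConnSet_compIn (hs : ∀ u w, Adj u w → Adj w u) {X : Set V} {p : V} (hp : p ∈ X) :
    IsConnSet Adj (compIn Adj X p) := by
  have key : ∀ w, PathIn Adj X p w → PathIn Adj (compIn Adj X p) p w := by
    intro w hw
    induction hw with
    | refl => exact ReflTransGen.refl
    | tail h1 h2 ih =>
      exact ReflTransGen.tail ih ⟨h2.1, h1, mem_compIn_of_adj hp h1 h2.2.2 h2.1⟩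
  exact ⟨⟨p, mem_compIn_self X p⟩, fun u hu w hw =>
    ReflTransGen.trans ((key u hu).symm hs) (key w hw)⟩

theorem IsConnSet.exists_adj {X S : Set V} (h : IsConnSet Adj X) {u w : V} (hu : u ∈ X)
    (huS : u ∈ S) (hw : w ∈ X) (hwS : w ∉ S) :
    ∃ a ∈ X ∩ S, ∃ b ∈ X \ S, Adj a b := by
  by_contra! hcon
  have key : ∀ w, PathIn Adj X u w → w ∈ S := by
    intro w hw
    induction hw with
    | refl => exact huS
    | tail _ h2 ih =>
      by_contra hb
      exact hcon _ ⟨h2.2.1, ih⟩ _ ⟨h2.2.2, hb⟩ h2.1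
  exact hwS (key w (h.2 u hu w hw))

/-- `L` is a connected set joining the root `p` to the neighbours of `v`; it is empty if
`p = v`. -/
def IsLeg (Adj : V → V → Prop) (H : Set V) (v p : V) (L : Set V) : Prop :=
  (p = v ∧ L = ∅) ∨ (p ≠ v ∧ p ∈ L ∧ L ⊆ H ∧ v ∉ L ∧ IsConnSet Adj L ∧ ∃ u ∈ L, Adj u v)

theorem IsLeg.isConnSet_insert (hs : ∀ u w, Adj u w → Adj w u) {H : Set V} {v p : V} {L : Set V}
    (h : IsLeg Adj H v p L) : IsConnSet Adj (insert v L) ∧ p ∈ insert v L := by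
  rcases h with ⟨rfl, rfl⟩ | ⟨-, hp, -, -, hc, u, hu, huv⟩
  · refine ⟨⟨⟨p, Or.inl rfl⟩, ?_⟩, Or.inl rfl⟩
    rintro u (rfl | hu) w (rfl | hw)
    · exact ReflTransGen.refl
    · exact hw.elim
    · exact hu.elim
    · exact hu.elim
  · refine ⟨⟨⟨v, Or.inl rfl⟩, ?_⟩, Or.inr hp⟩
    have key : ∀ w ∈ insert v L, PathIn Adj (insert v L) u w := by
      rintro w (rfl | hw)
      · exact ReflTransGen.single ⟨huv, Or.inr hu, Or.inl rfl⟩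
      · exact (hc.2 u hu w hw).mono (Set.subset_insert _ _)
    exact fun a ha b hb => ReflTransGen.trans ((key a ha).symm hs) (key b hb)

/-- Three legs from `v` to the three roots, disjoint except at `v`. -/
theorem exists_tripod [Finite V] (hs : ∀ u w, Adj u w → Adj w u) {H : Set V}
    (hH : IsConnSet Adj H) {a b c : V} (ha : a ∈ H) (hb : b ∈ H) (hc : c ∈ H) :
    ∃ v ∈ H, ∃ A B C : Set V, IsLeg Adj H v a A ∧ IsLeg Adj H v b B ∧ IsLeg Adj H v c C ∧
      Disjoint A B ∧ Disjoint A C ∧ Disjoint B C := by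
  classical
  -- a minimal connected set containing `a` and `b`
  have hex : ∃ n, ∃ S ⊆ H, IsConnSet Adj S ∧ a ∈ S ∧ b ∈ S ∧ S.ncard = n :=
    ⟨_, H, subset_rfl, hH, ha, hb, rfl⟩
  obtain ⟨S, hSH, hS, haS, hbS, hn⟩ := Nat.find_spec hex
  have hmin : ∀ T ⊂ S, IsConnSet Adj T → a ∈ T → b ∉ T := fun T hT hTc haT hbT =>
    Nat.find_min hex (hn ▸ Set.ncard_lt_ncard hT (Set.toFinite _))
      ⟨T, hT.1.trans hSH, hTc, haT, hbT, rfl⟩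
  -- connect `c` to it
  obtain ⟨v, hvS, C, hC, hCS⟩ : ∃ v ∈ S, ∃ C, IsLeg Adj H v c C ∧ Disjoint C S := by
    by_cases hcS : c ∈ S
    · exact ⟨c, hcS, ∅, Or.inl ⟨rfl, rfl⟩, Set.empty_disjoint _⟩
    · have hcX : c ∈ H \ S := ⟨hc, hcS⟩
      have hsub := compIn_subset (Adj := Adj) hcX
      obtain ⟨u, hu, w, hw, huw⟩ := hH.exists_adj hc (mem_compIn_self (Adj := Adj) (H \ S) c) ha
        (fun h => (hsub h).2 haS)
      have hwS : w ∈ S := by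
        by_contra hwS
        exact hw.2 (mem_compIn_of_adj hcX hu.2 ⟨hw.1, hwS⟩ huw)
      refine ⟨w, hwS, compIn Adj (H \ S) c, Or.inr ⟨?_, mem_compIn_self _ _, fun x hx => (hsub hx).1,
        fun h => (hsub h).2 hwS, isConnSet_compIn hs hcX, u, hu.2, huw⟩, ?_⟩
      · rintro rfl; exact hcS hwS
      · exact Set.disjoint_left.2 fun x hx hx' => (hsub hx).2 hx'
  have leg : ∀ p ∈ S, ∃ L, IsLeg Adj H v p L ∧ L ⊆ S ∧ L ⊆ compIn Adj (S \ {v}) p := by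
    intro p hp
    by_cases hpv : p = v
    · exact ⟨∅, Or.inl ⟨hpv, rfl⟩, Set.empty_subset _, Set.empty_subset _⟩
    · have hpX : p ∈ S \ {v} := ⟨hp, hpv⟩
      have hsub := compIn_subset (Adj := Adj) hpX
      obtain ⟨u, hu, w, hw, huw⟩ := hS.exists_adj hp (mem_compIn_self (Adj := Adj) (S \ {v}) p) hvS
        (fun h => (hsub h).2 rfl)
      have hwv : w = v := by
        by_contra hwv
        exact hw.2 (mem_compIn_of_adj hpX hu.2 ⟨hw.1, hwv⟩ huw)
      subst hwv
      exact ⟨_, Or.inr ⟨hpv, mem_compIn_self _ _, fun x hx => hSH (hsub hx).1,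
        fun h => (hsub h).2 rfl, isConnSet_compIn hs hpX, u, hu.2, huw⟩, fun x hx => (hsub hx).1,
        subset_rfl⟩
  obtain ⟨A, hA, hAS, hAc⟩ := leg a haS
  obtain ⟨B, hB, hBS, hBc⟩ := leg b hbS
  refine ⟨v, hSH hvS, A, B, C, hA, hB, hC, ?_, ?_, ?_⟩
  · rcases hA with ⟨-, rfl⟩ | ⟨hav, -⟩
    · exact Set.empty_disjoint _
    rcases hB with ⟨-, rfl⟩ | ⟨hbv, -⟩
    · exact Set.disjoint_empty _
    refine Set.disjoint_left.2 fun x hx hx' => ?_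
    have haX : a ∈ S \ {v} := ⟨haS, hav⟩
    refine hmin (compIn Adj (S \ {v}) a) ⟨fun x hx => (compIn_subset haX hx).1, fun h => ?_⟩
      (isConnSet_compIn hs haX) (mem_compIn_self _ _) ?_
    · exact (compIn_subset haX (h hvS)).2 rfl
    · exact ReflTransGen.trans (hAc hx) (PathIn.symm hs (hBc hx'))
  · exact (hCS.mono_right hAS).symm
  · exact (hCS.mono_right hBS).symm

/-- Pairwise disjoint, connected and adjacent sets, each containing one of the given roots. -/
def HasRootedTriangle (Adj : V → V → Prop) (H Q : Set V) : Prop :=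
  ∃ A B C : Set V, (A ⊆ H ∧ B ⊆ H ∧ C ⊆ H) ∧
    (IsConnSet Adj A ∧ IsConnSet Adj B ∧ IsConnSet Adj C) ∧
    (Disjoint A B ∧ Disjoint A C ∧ Disjoint B C) ∧
    ((∃ u ∈ A, ∃ w ∈ B, Adj u w) ∧ (∃ u ∈ A, ∃ w ∈ C, Adj u w) ∧ ∃ u ∈ B, ∃ w ∈ C, Adj u w) ∧
    ((A ∩ Q).Nonempty ∧ (B ∩ Q).Nonempty ∧ (C ∩ Q).Nonempty)

theorem hasRootedTriangle_of_joined (hs : ∀ u w, Adj u w → Adj w u) {H Q : Set V}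
    {v p q o : V} {P L O : Set V} (hv : v ∈ H) (hP : IsLeg Adj H v p P) (hL : IsLeg Adj H v q L)
    (hO : IsLeg Adj H v o O) (h1 : Disjoint P L) (h2 : Disjoint P O) (h3 : Disjoint L O)
    (hp : p ∈ Q) (hq : q ∈ Q) (ho : o ∈ Q) (hpv : p ≠ v) (hqv : q ≠ v)
    (hpq : q ∈ compIn Adj (H \ {v}) p) : HasRootedTriangle Adj H Q := by
  obtain ⟨-, hpP, hPH, hvP, hPc, u, huP, huv⟩ := hP.resolve_left fun h => hpv h.1
  obtain ⟨-, hqL, hLH, hvL, hLc, u', huL, huv'⟩ := hL.resolve_left fun h => hqv h.1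
  have hOH : O ⊆ H ∧ v ∉ O := by
    rcases hO with ⟨-, rfl⟩ | h
    · exact ⟨Set.empty_subset _, fun h => h⟩
    · exact ⟨h.2.2.1, h.2.2.2.1⟩
  set X := (H \ {v}) \ (L ∪ O) with hX
  have hPX : P ⊆ X := fun x hx => ⟨⟨hPH hx, fun h => hvP (h ▸ hx)⟩, fun h => h.elim
    (fun h => Set.disjoint_left.1 h1 hx h) fun h => Set.disjoint_left.1 h2 hx h⟩
  have hpX := hPX hpP
  set A := compIn Adj X p with hA
  have hAX : A ⊆ X := compIn_subset hpX
  have hPA : P ⊆ A := fun x hx => (hPc.2 p hpP x hx).mono hPX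
  have hAc : IsConnSet Adj A := isConnSet_compIn hs hpX
  have hpX' : p ∈ H \ {v} := hpX.1
  obtain ⟨a, ha, w, hw, haw⟩ := (isConnSet_compIn hs hpX').exists_adj (S := A)
    (mem_compIn_self _ _) (mem_compIn_self _ _) hpq (fun h => (hAX h).2 (Or.inl hqL))
  have hwLO : w ∈ L ∪ O := by
    by_contra hwLO
    exact hw.2 (mem_compIn_of_adj hpX ha.2 ⟨compIn_subset hpX' hw.1, hwLO⟩ haw)
  have hAH : A ⊆ H := fun x hx => (hAX hx).1.1
  have hAv : v ∉ A := fun h => (hAX h).1.2 rfl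
  have hAL : Disjoint A L := Set.disjoint_left.2 fun x hx h => (hAX hx).2 (Or.inl h)
  have hAO : Disjoint A O := Set.disjoint_left.2 fun x hx h => (hAX hx).2 (Or.inr h)
  rcases hwLO with hwL | hwO
  · have hOi := hO.isConnSet_insert hs
    exact ⟨A, L, insert v O, ⟨hAH, hLH, Set.insert_subset hv hOH.1⟩, ⟨hAc, hLc, hOi.1⟩,
      ⟨hAL, Set.disjoint_insert_right.2 ⟨hAv, hAO⟩, Set.disjoint_insert_right.2 ⟨hvL, h3⟩⟩,
      ⟨⟨a, ha.2, w, hwL, haw⟩, ⟨u, hPA huP, v, Or.inl rfl, huv⟩, ⟨u', huL, v, Or.inl rfl, huv'⟩⟩,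
      ⟨⟨p, mem_compIn_self _ _, hp⟩, ⟨q, hqL, hq⟩, ⟨o, hOi.2, ho⟩⟩⟩
  · have hLi := hL.isConnSet_insert hs
    obtain ⟨-, hoO, -, -, hOc, u'', huO, huv''⟩ := hO.resolve_left fun h => by
      rw [h.2] at hwO; exact hwO
    exact ⟨A, O, insert v L, ⟨hAH, hOH.1, Set.insert_subset hv hLH⟩, ⟨hAc, hOc, hLi.1⟩,
      ⟨hAO, Set.disjoint_insert_right.2 ⟨hAv, hAL⟩, Set.disjoint_insert_right.2 ⟨hOH.2, h3.symm⟩⟩,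
      ⟨⟨a, ha.2, w, hwO, haw⟩, ⟨u, hPA huP, v, Or.inl rfl, huv⟩, ⟨u'', huO, v, Or.inl rfl, huv''⟩⟩,
      ⟨⟨p, mem_compIn_self _ _, hp⟩, ⟨o, hoO, ho⟩, ⟨q, hLi.2, hq⟩⟩⟩

/-- If a connected graph has no triangle minor rooted at three given vertices, then some vertex
separates the three vertices from each other. -/
theorem hasRootedTriangle_or_separated [Finite V] (hs : ∀ u w, Adj u w → Adj w u) {H : Set V}
    (hH : IsConnSet Adj H) {a b c : V} (ha : a ∈ H) (hb : b ∈ H) (hc : c ∈ H) (hab : a ≠ b)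
    (hac : a ≠ c) (hbc : b ≠ c) :
    HasRootedTriangle Adj H {a, b, c} ∨ ∃ v ∈ H, ∀ p ∈ ({a, b, c} : Set V),
      ∀ q ∈ ({a, b, c} : Set V), p ≠ q → p ≠ v → q ≠ v → q ∉ compIn Adj (H \ {v}) p := by
  obtain ⟨v, hv, A, B, C, hA, hB, hC, hAB, hAC, hBC⟩ := exists_tripod hs hH ha hb hc
  by_contra! hcon
  obtain ⟨hT, hsep⟩ := hcon
  obtain ⟨p, hp, q, hq, hpq, hpv, hqv, hj⟩ := hsep v hv
  have ha' : a ∈ ({a, b, c} : Set V) := Or.inl rfl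
  have hb' : b ∈ ({a, b, c} : Set V) := Or.inr (Or.inl rfl)
  have hc' : c ∈ ({a, b, c} : Set V) := Or.inr (Or.inr rfl)
  refine hT ?_
  rcases hp with rfl | rfl | rfl <;> rcases hq with rfl | rfl | rfl
  · exact (hpq rfl).elim
  · exact hasRootedTriangle_of_joined hs hv hA hB hC hAB hAC hBC ha' hb' hc' hpv hqv hj
  · exact hasRootedTriangle_of_joined hs hv hA hC hB hAC hAB hBC.symm ha' hc' hb' hpv hqv hj
  · exact hasRootedTriangle_of_joined hs hv hB hA hC hAB.symm hBC hAC hb' ha' hc' hpv hqv hj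
  · exact (hpq rfl).elim
  · exact hasRootedTriangle_of_joined hs hv hB hC hA hBC hAB.symm hAC.symm hb' hc' ha' hpv hqv hj
  · exact hasRootedTriangle_of_joined hs hv hC hA hB hAC.symm hBC.symm hAB hc' ha' hb' hpv hqv hj
  · exact hasRootedTriangle_of_joined hs hv hC hB hA hBC.symm hAC.symm hAB.symm hc' hb' ha' hpv hqv
      hj
  · exact (hpq rfl).elim

end Cutvertices

/-! ### Edge cuts with two edges -/

section Cuts

variable {D : Type*} [Finite D]

theorem IsMap4.ncard_vertexOf {ρ α : Perm D} (m : IsMap4 ρ α) (d : D) :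
    (vertexOf ρ d).ncard = 4 := by
  have : vertexOf ρ d = {d, ρ d, ρ (ρ d), ρ (ρ (ρ d))} := by
    ext e
    rw [mem_vertexOf, m.sameCycle_iff]
    rfl
  rw [this, Set.ncard_insert_of_notMem, Set.ncard_insert_of_notMem, Set.ncard_pair]
  · exact (m.rot_ne _).symm
  · rintro (h1 | h1)
    · exact m.rot_ne _ h1.symm
    · exact m.rot2_ne _ h1.symm
  · rintro (h1 | h1 | h1)
    · exact m.rot_ne _ h1.symm
    · exact m.rot2_ne _ h1.symm
    · exact m.rot3_ne _ h1.symm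

theorem IsMap4.exists_fourth {ρ α : Perm D} (m : IsMap4 ρ α) {d a b c : D}
    (ha : ρ.SameCycle d a) (hb : ρ.SameCycle d b) (hc : ρ.SameCycle d c) (hab : a ≠ b)
    (hac : a ≠ c) (hbc : b ≠ c) : ∃ w, ρ.SameCycle d w ∧ w ≠ a ∧ w ≠ b ∧ w ≠ c ∧
      ∀ e, ρ.SameCycle d e → e = a ∨ e = b ∨ e = c ∨ e = w := by
  have h4 := m.ncard_vertexOf d
  have h3 : ({a, b, c} : Set D).ncard = 3 := by
    rw [Set.ncard_insert_of_notMem, Set.ncard_pair hbc]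
    rintro (h | h)
    exacts [hab h, hac h]
  have hsub : ({a, b, c} : Set D) ⊆ vertexOf ρ d := by
    rintro e (rfl | rfl | rfl) <;> assumption
  have h1 := Set.ncard_sdiff_add_ncard_of_subset hsub (Set.toFinite _)
  have h5 : (vertexOf ρ d \ {a, b, c}).ncard = 1 := by omega
  obtain ⟨w, hw⟩ := Set.ncard_eq_one.1 h5
  have hwm : w ∈ vertexOf ρ d \ {a, b, c} := by rw [hw]; rfl
  refine ⟨w, hwm.1, fun h => hwm.2 (Or.inl h), fun h => hwm.2 (Or.inr (Or.inl h)),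
    fun h => hwm.2 (Or.inr (Or.inr h)), fun e he => ?_⟩
  by_contra! hcon
  have : e ∈ vertexOf ρ d \ {a, b, c} :=
    ⟨he, by rintro (h | h | h); exacts [hcon.1 h, hcon.2.1 h, hcon.2.2.1 h]⟩
  rw [hw] at this
  exact hcon.2.2.2 this

namespace RootedMap

section Links

variable (R : RootedMap D)

/-- `R` without its root edge has no bridge: deleting a further edge, that of `a`, leaves a
connected graph. -/
def Bridgeless {D : Type*} (R : RootedMap D) : Prop :=
  ∀ a, a ≠ R.root → a ≠ R.flip R.root → ∀ S : Set D, S.Nonempty → (∀ d ∈ S, R.rot d ∈ S) →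
    (∀ d ∈ S, d ≠ R.root → d ≠ R.flip R.root → d ≠ a → d ≠ R.flip a → R.flip d ∈ S) →
    S = Set.univ

/-- The half-edges `x` and `y` are the two ends of a (possibly trivial) chain that passes through
the vertex set `K`. If `K` is empty, then `x` and `y` form an edge. Otherwise the edges of `x` and
`y` form a cut, `K` being the side of the cut that contains neither `x` and `y` nor the root. -/
structure IsLink {D : Type*} (R : RootedMap D) (x y : D) (K : Set D) : Prop where
  vertexSet : IsVertexSet R.rot K
  root_notMem : R.root ∉ K
  left_notMem : x ∉ K
  right_notMem : y ∉ K
  ne : x ≠ y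
  flip_mem : ∀ d, (d ∈ K ∨ d = x ∨ d = y) → (R.flip d ∈ K ∨ R.flip d = x ∨ R.flip d = y)

/-- `x` and `y` are the two ends of a chain. -/
def Link {D : Type*} (R : RootedMap D) (x y : D) : Prop := ∃ K, R.IsLink x y K

/-- The half-edge `x` is linked to the final vertex of the root edge. -/
def LinkedToT {D : Type*} (R : RootedMap D) (x : D) : Prop :=
  ∃ y, R.rot.SameCycle (R.flip R.root) y ∧ R.Link x y

/-- All edges at the initial vertex of the root edge lead, through chains, to its final vertex. -/
def IsDip {D : Type*} (R : RootedMap D) : Prop :=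
  ∀ x, R.rot.SameCycle R.root x → x ≠ R.root → R.LinkedToT x

/-- The half-edge `x` at the initial vertex of the root edge is linked to the final vertex, and the
two remaining half-edges are linked to one further vertex, that of `c`. -/
def IsMate {D : Type*} (R : RootedMap D) (x : D) : Prop :=
  R.rot.SameCycle R.root x ∧ x ≠ R.root ∧ R.LinkedToT x ∧ ∃ c, ¬ R.rot.SameCycle (R.flip R.root) c ∧
    ∀ x', R.rot.SameCycle R.root x' → x' ≠ R.root → x' ≠ x → ∃ y, R.rot.SameCycle c y ∧ R.Link x' y

variable {R} {x y x' y' : D} {K K' : Set D}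

theorem isLink_empty {D : Type*} (R : RootedMap D) (x : D) : R.IsLink x (R.flip x) ∅ where
  vertexSet := IsVertexSet.empty
  root_notMem := fun h => h
  left_notMem := fun h => h
  right_notMem := fun h => h
  ne := (R.flip_ne x).symm
  flip_mem := by
    rintro d (h | rfl | rfl)
    · exact h.elim
    · exact Or.inr (Or.inr rfl)
    · exact Or.inr (Or.inl (R.flip_flip _))

namespace IsLink

theorem symm (h : R.IsLink x y K) : R.IsLink y x K where
  vertexSet := h.vertexSet
  root_notMem := h.root_notMem
  left_notMem := h.right_notMem
  right_notMem := h.left_notMem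
  ne := h.ne.symm
  flip_mem d hd := by
    have := h.flip_mem d (by tauto)
    tauto

/-- The root edge is not part of a chain between half-edges different from the root. -/
theorem flip_root_notMem (h : R.IsLink x y K) (hx : x ≠ R.root) (hy : y ≠ R.root) :
    R.flip R.root ∉ K ∧ R.flip R.root ≠ x ∧ R.flip R.root ≠ y := by
  by_contra! hcon
  have := h.flip_mem (R.flip R.root) (by tauto)
  rw [R.flip_flip] at this
  rcases this with h1 | h1 | h1
  exacts [h.root_notMem h1, hx h1.symm, hy h1.symm]

theorem flip_left_mem (h : R.IsLink x y K) (hne : K.Nonempty) : R.flip x ∈ K := by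
  rcases h.flip_mem x (Or.inr (Or.inl rfl)) with h1 | h1 | h1
  · exact h1
  · exact (R.flip_ne x h1).elim
  · have : K = Set.univ := R.isConn K hne (fun d hd => (h.vertexSet d).2 hd) fun d hd => by
      rcases h.flip_mem d (Or.inl hd) with h2 | h2 | h2
      · exact h2
      · have := congrArg R.flip h2
        rw [R.flip_flip, h1] at this
        exact (h.right_notMem (this ▸ hd)).elim
      · rw [← h1] at h2
        exact (h.left_notMem (R.flip.injective h2 ▸ hd)).elim
    exact (h.root_notMem (this ▸ trivial)).elim

theorem bdry_eq (h : R.IsLink x y K) (hne : K.Nonempty) :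
    bdry R.flip K = {R.flip x, R.flip y} := by
  ext d
  constructor
  · rintro ⟨hd, hd'⟩
    rcases h.flip_mem d (Or.inl hd) with h2 | h2 | h2
    · exact (hd' h2).elim
    · exact Or.inl (by rw [← h2, R.flip_flip])
    · exact Or.inr (by rw [← h2, R.flip_flip]; rfl)
  · rintro (rfl | rfl)
    · exact ⟨h.flip_left_mem hne, by rw [R.flip_flip]; exact h.left_notMem⟩
    · exact ⟨h.symm.flip_left_mem hne, by rw [R.flip_flip]; exact h.right_notMem⟩

end IsLink

theorem isLink_of_bdry {a b : D} (hK : IsVertexSet R.rot K) (hr : R.root ∉ K)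
    (hb : bdry R.flip K = {a, b}) (hab : a ≠ b) : R.IsLink (R.flip a) (R.flip b) K := by
  have ha : a ∈ bdry R.flip K := by rw [hb]; exact Or.inl rfl
  have hb' : b ∈ bdry R.flip K := by rw [hb]; exact Or.inr rfl
  refine ⟨hK, hr, ha.2, hb'.2, fun h => hab (R.flip.injective h), ?_⟩
  rintro d (hd | rfl | rfl)
  · by_cases hd' : R.flip d ∈ K
    · exact Or.inl hd'
    · have : d ∈ bdry R.flip K := ⟨hd, hd'⟩
      rw [hb] at this
      rcases this with rfl | rfl
      · exact Or.inr (Or.inl rfl)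
      · exact Or.inr (Or.inr rfl)
  · rw [R.flip_flip]; exact Or.inl ha.1
  · rw [R.flip_flip]; exact Or.inl hb'.1

theorem Bridgeless.eq_empty_of_isLink (T : R.Bridgeless) (h : R.IsLink R.root y K) : K = ∅ := by
  by_contra hne
  have hne := Set.nonempty_iff_ne_empty.2 hne
  have h1 := h.flip_left_mem hne
  have h2 := h.bdry_eq hne
  refine h.root_notMem ((T (R.flip y) ?_ ?_ K hne (fun d hd => (h.vertexSet d).2 hd) ?_) ▸ trivial)
  · intro h3
    have := h.symm.flip_left_mem hne
    rw [h3] at this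
    exact h.root_notMem this
  · exact fun h3 => h.ne (R.flip.injective h3).symm
  · intro d hd _ h4 h5 _
    by_contra hd'
    have : d ∈ bdry R.flip K := ⟨hd, hd'⟩
    rw [h2] at this
    exact this.elim h4 h5

theorem Bridgeless.not_loop (T : R.Bridgeless) (m : R.Is4)
    (hst : ¬ R.rot.SameCycle R.root (R.flip R.root)) (hx : R.rot.SameCycle R.root x) :
    ¬ R.rot.SameCycle R.root (R.flip x) := by
  intro hx'
  have h1 : x ≠ R.root := fun h => hst (h ▸ hx')
  have h2 : R.flip x ≠ R.root := fun h => hst (by rw [← h, R.flip_flip, h]; exact hx)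
  obtain ⟨w, hw, hwr, -, -, hall⟩ := m.exists_fourth (SameCycle.refl R.rot R.root) hx hx' h1.symm
    h2.symm (R.flip_ne x).symm
  refine hst ((T w hwr (fun h => hst (h ▸ hw)) (vertexOf R.rot R.root) ⟨_, self_mem_vertexOf _ _⟩
    (fun d hd => (isVertexSet_vertexOf _ _ d).2 hd) fun d hd h3 _ h5 _ => ?_).symm ▸ trivial :
    R.flip R.root ∈ vertexOf R.rot R.root)
  rcases hall d hd with rfl | rfl | rfl | rfl
  · exact (h3 rfl).elim
  · exact hx'
  · rw [R.flip_flip]; exact hx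
  · exact (h5 rfl).elim

/-- If two half-edges at the initial vertex are linked to the final vertex, then so is the
third one. -/
theorem Bridgeless.linkedToT_third (T : R.Bridgeless) (m : R.Is4)
    (hst : ¬ R.rot.SameCycle R.root (R.flip R.root)) {x₁ x₂ x₃ : D}
    (h1 : R.rot.SameCycle R.root x₁) (h2 : R.rot.SameCycle R.root x₂)
    (h3 : R.rot.SameCycle R.root x₃) (n1 : x₁ ≠ R.root) (n2 : x₂ ≠ R.root) (n3 : x₃ ≠ R.root)
    (n12 : x₁ ≠ x₂) (n13 : x₁ ≠ x₃) (n23 : x₂ ≠ x₃) (t1 : R.LinkedToT x₁) (t2 : R.LinkedToT x₂) :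
    R.LinkedToT x₃ := by
  obtain ⟨y₁, hy1, K₁, k1⟩ := t1
  obtain ⟨y₂, hy2, K₂, k2⟩ := t2
  have hs : ∀ d, R.rot.SameCycle R.root d → d = R.root ∨ d = x₁ ∨ d = x₂ ∨ d = x₃ := by
    obtain ⟨w, -, -, -, -, hall⟩ := m.exists_fourth h1 h2 h3 n12 n13 n23
    intro d hd
    rcases hall _ (SameCycle.refl _ _) with h | h | h | rfl
    · exact (n1 h.symm).elim
    · exact (n2 h.symm).elim
    · exact (n3 h.symm).elim
    · have := hall d hd; tauto
  have yr : ∀ y, R.rot.SameCycle (R.flip R.root) y → ¬ R.rot.SameCycle R.root y :=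
    fun y hy h => hst (h.trans hy.symm)
  have y1r : y₁ ≠ R.root := fun h => yr _ hy1 (h ▸ SameCycle.refl _ _)
  have y2r : y₂ ≠ R.root := fun h => yr _ hy2 (h ▸ SameCycle.refl _ _)
  obtain ⟨f1, -, f1y⟩ := k1.flip_root_notMem n1 y1r
  obtain ⟨f2, -, f2y⟩ := k2.flip_root_notMem n2 y2r
  have sK1 : ∀ d, R.rot.SameCycle R.root d → d ∉ K₁ := fun d hd h =>
    k1.root_notMem ((k1.vertexSet.mem_iff hd).2 h)
  have sK2 : ∀ d, R.rot.SameCycle R.root d → d ∉ K₂ := fun d hd h =>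
    k2.root_notMem ((k2.vertexSet.mem_iff hd).2 h)
  have tK1 : ∀ d, R.rot.SameCycle (R.flip R.root) d → d ∉ K₁ := fun d hd h =>
    f1 ((k1.vertexSet.mem_iff hd).2 h)
  have tK2 : ∀ d, R.rot.SameCycle (R.flip R.root) d → d ∉ K₂ := fun d hd h =>
    f2 ((k2.vertexSet.mem_iff hd).2 h)
  have hsv := isVertexSet_vertexOf R.rot R.root
  have htv := isVertexSet_vertexOf R.rot (R.flip R.root)
  have y12 : y₁ ≠ y₂ := by
    rintro rfl
    -- otherwise the two chains end in the same edge, and `S` is separated by two edges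
    set S := vertexOf R.rot R.root ∪ (K₁ ∪ K₂) with hS
    have hSv : IsVertexSet R.rot S := hsv.union (k1.vertexSet.union k2.vertexSet)
    have hfr : R.flip R.root ∉ S := by
      rintro (h | h | h)
      exacts [hst h, f1 h, f2 h]
    have hy : ∀ d, R.flip d = y₁ → d = R.flip y₁ := fun d hd => by rw [← hd, R.flip_flip]
    have hb : bdry R.flip S ⊆ {R.root, x₃, R.flip y₁} := by
      rintro d ⟨hd, hd'⟩
      have c1 : (d ∈ K₁ ∨ d = x₁ ∨ d = y₁) → d = R.flip y₁ := fun h => by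
        rcases k1.flip_mem d h with h | h | h
        · exact (hd' (Or.inr (Or.inl h))).elim
        · exact (hd' (Or.inl (h ▸ h1))).elim
        · exact hy d h
      have c2 : (d ∈ K₂ ∨ d = x₂ ∨ d = y₁) → d = R.flip y₁ := fun h => by
        rcases k2.flip_mem d h with h | h | h
        · exact (hd' (Or.inr (Or.inr h))).elim
        · exact (hd' (Or.inl (h ▸ h2))).elim
        · exact hy d h
      rcases hd with h | h | h
      · rcases hs d h with h | h | h | h
        · exact Or.inl h
        · exact Or.inr (Or.inr (c1 (Or.inr (Or.inl h))))
        · exact Or.inr (Or.inr (c2 (Or.inr (Or.inl h))))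
        · exact Or.inr (Or.inl h)
      · exact Or.inr (Or.inr (c1 (Or.inl h)))
      · exact Or.inr (Or.inr (c2 (Or.inl h)))
    obtain ⟨d, hdr, hbd⟩ := m.exists_bdry_eq_pair hSv hb ⟨Or.inl (self_mem_vertexOf _ _), hfr⟩
    have hd : d ∈ bdry R.flip S := by rw [hbd]; exact Or.inr rfl
    refine hfr ((T d hdr (fun h => hfr (h ▸ hd.1)) S ⟨d, hd.1⟩ (fun d hd => (hSv d).2 hd)
      fun e he g1 _ g3 _ => ?_) ▸ trivial)
    by_contra hcon
    have : e ∈ bdry R.flip S := ⟨he, hcon⟩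
    rw [hbd] at this
    exact this.elim g1 g3
  obtain ⟨w, hw, wr, wy1, wy2, hall⟩ := m.exists_fourth (SameCycle.refl R.rot (R.flip R.root)) hy1
    hy2 f1y f2y y12
  -- the complement of the two chains and the two vertices is the third chain
  have key : ∀ d, ¬ (d ∈ (vertexOf R.rot R.root ∪ vertexOf R.rot (R.flip R.root) ∪ (K₁ ∪ K₂))ᶜ ∨
      d = x₃ ∨ d = w) ↔ (d = R.root ∨ d = R.flip R.root) ∨ (d ∈ K₁ ∨ d = x₁ ∨ d = y₁) ∨
        (d ∈ K₂ ∨ d = x₂ ∨ d = y₂) := by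
    intro d
    rw [not_or, Set.mem_compl_iff, not_not, not_or]
    constructor
    · rintro ⟨(h | h) | h | h, n, n'⟩
      · rcases hs d h with h | h | h | h
        · exact Or.inl (Or.inl h)
        · exact Or.inr (Or.inl (Or.inr (Or.inl h)))
        · exact Or.inr (Or.inr (Or.inr (Or.inl h)))
        · exact (n h).elim
      · rcases hall d h with h | h | h | h
        · exact Or.inl (Or.inr h)
        · exact Or.inr (Or.inl (Or.inr (Or.inr h)))
        · exact Or.inr (Or.inr (Or.inr (Or.inr h)))
        · exact (n' h).elim
      · exact Or.inr (Or.inl (Or.inl h))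
      · exact Or.inr (Or.inr (Or.inl h))
    · have a1 : ∀ e, R.rot.SameCycle R.root e → e ≠ w := fun e he h => yr _ hw (h ▸ he)
      have a2 : ∀ e, R.rot.SameCycle (R.flip R.root) e → e ≠ x₃ := fun e he h => yr _ he (h ▸ h3)
      have b1 := SameCycle.refl R.rot R.root
      have b2 := SameCycle.refl R.rot (R.flip R.root)
      rintro ((rfl | rfl) | (h | rfl | rfl) | (h | rfl | rfl))
      · exact ⟨Or.inl (Or.inl b1), n3.symm, a1 _ b1⟩
      · exact ⟨Or.inl (Or.inr b2), a2 _ b2, wr.symm⟩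
      · exact ⟨Or.inr (Or.inl h), fun e => sK1 _ h3 (e ▸ h), fun e => tK1 _ hw (e ▸ h)⟩
      · exact ⟨Or.inl (Or.inl h1), n13, a1 _ h1⟩
      · exact ⟨Or.inl (Or.inr hy1), a2 _ hy1, wy1.symm⟩
      · exact ⟨Or.inr (Or.inr h), fun e => sK2 _ h3 (e ▸ h), fun e => tK2 _ hw (e ▸ h)⟩
      · exact ⟨Or.inl (Or.inl h2), n23, a1 _ h2⟩
      · exact ⟨Or.inl (Or.inr hy2), a2 _ hy2, wy2.symm⟩
  refine ⟨w, hw, _, ((hsv.union htv).union (k1.vertexSet.union k2.vertexSet)).compl,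
    fun h => h (Or.inl (Or.inl (SameCycle.refl _ _))), fun h => h (Or.inl (Or.inl h3)),
    fun h => h (Or.inl (Or.inr hw)), fun h => yr _ hw (h ▸ h3), fun d hd => ?_⟩
  by_contra hcon
  refine (key d).2 ?_ hd
  have := (key _).1 hcon
  rw [R.flip.injective.eq_iff] at this
  rcases this with (h | h) | h | h
  · exact Or.inl (Or.inr (by rw [← h, R.flip_flip]))
  · exact Or.inl (Or.inl h)
  · have := k1.flip_mem _ h
    rw [R.flip_flip] at this
    exact Or.inr (Or.inl this)
  · have := k2.flip_mem _ h
    rw [R.flip_flip] at this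
    exact Or.inr (Or.inr this)

end Links

end RootedMap

end Cuts

/-! ### The vertices next to the initial vertex of the root edge -/

namespace RootedMap

/-- Adjacency of vertices, where a vertex with a loop is adjacent to itself. -/
def VAdj {D : Type*} (R : RootedMap D) (u v : R.Vertex) : Prop :=
  ∃ d, R.vert d = u ∧ R.vert (R.flip d) = v

theorem VAdj.symm {D : Type*} {R : RootedMap D} (u v : R.Vertex) : R.VAdj u v → R.VAdj v u := by
  rintro ⟨d, rfl, rfl⟩
  exact ⟨R.flip d, rfl, by rw [R.flip_flip]⟩

theorem ncard_image_flip {D : Type*} (R : RootedMap D) (S : Set D) :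
    (R.flip '' S).ncard = S.ncard :=
  Set.ncard_image_of_injective _ R.flip.injective

variable {D : Type*} {R : RootedMap D} {x y : D} {K : Set D}

theorem LinkedToT.of_flip (h : R.rot.SameCycle (R.flip R.root) (R.flip x)) : R.LinkedToT x :=
  ⟨_, h, _, R.isLink_empty x⟩

/-- No chain of positive length starts at the initial vertex of the root edge. -/
def Reduced (R : RootedMap D) : Prop :=
  ∀ x y K, R.rot.SameCycle R.root x → x ≠ R.root → R.IsLink x y K → K = ∅

theorem Reduced.linkedToT_iff (h : R.Reduced) (hx : R.rot.SameCycle R.root x) (hr : x ≠ R.root) :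
    R.LinkedToT x ↔ R.rot.SameCycle (R.flip R.root) (R.flip x) := by
  refine ⟨?_, LinkedToT.of_flip⟩
  rintro ⟨y, hy, K, k⟩
  have := h x y K hx hr k
  subst this
  rcases k.flip_mem x (Or.inr (Or.inl rfl)) with h1 | h1 | h1
  · exact h1.elim
  · exact (R.flip_ne x h1).elim
  · rwa [h1]

variable [Finite D]

theorem isVertexConn_of_isConnSet {B : Set R.Vertex} (h : IsConnSet R.VAdj B) :
    IsVertexConn R.rot R.flip (R.vert ⁻¹' B) := by
  obtain ⟨⟨v, hv⟩, h⟩ := h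
  obtain ⟨d, rfl⟩ := R.vert_surjective v
  refine ⟨⟨d, hv⟩, fun S hS hne hSv hSc => hS.antisymm ?_⟩
  obtain ⟨d₀, hd₀⟩ := hne
  have key : ∀ w, PathIn R.VAdj B (R.vert d₀) w → R.vert ⁻¹' {w} ⊆ S := by
    intro w hw
    induction hw with
    | refl => exact fun e he => (hSv.mem_iff (R.vert_eq_iff.1 he)).2 hd₀
    | tail _ h2 ih =>
      obtain ⟨⟨e, rfl, rfl⟩, -, h3⟩ := h2
      exact fun e' he' => (hSv.mem_iff (R.vert_eq_iff.1 he')).2 (hSc e (ih rfl) h3)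
  exact fun e he => key _ (h _ (hS hd₀) _ he) rfl

/-- A cut that separates a neighbour of the initial vertex from the root has at least four edges. -/
theorem Reduced.four_le_ncard (h : R.Reduced) (T : R.Bridgeless) (m : R.Is4)
    (hK : IsVertexSet R.rot K) (hr : R.root ∉ K) {a : D} (ha : a ∈ bdry R.flip K)
    (has : R.rot.SameCycle R.root (R.flip a)) : 4 ≤ (bdry R.flip K).ncard := by
  have h1 := m.even_bdry hK
  have h2 : (bdry R.flip K).ncard ≠ 0 := fun h0 => by
    rw [Set.ncard_eq_zero] at h0
    rw [h0] at ha
    exact ha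
  have h3 : (bdry R.flip K).ncard ≠ 2 := fun h0 => by
    obtain ⟨p, q, hpq, hb⟩ := Set.ncard_eq_two.1 h0
    obtain ⟨b, hab, hb⟩ : ∃ b, a ≠ b ∧ bdry R.flip K = {a, b} := by
      rw [hb] at ha
      rcases ha with rfl | rfl
      · exact ⟨q, hpq, hb⟩
      · exact ⟨p, hpq.symm, by rw [hb, Set.pair_comm]⟩
    have hl := isLink_of_bdry hK hr hb hab
    have hne : K ≠ ∅ := Set.nonempty_iff_ne_empty.1 ⟨a, ha.1⟩
    by_cases har : R.flip a = R.root
    · rw [har] at hl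
      exact hne (T.eq_empty_of_isLink hl)
    · exact hne (h _ _ _ has har hl)
  obtain ⟨k, hk⟩ := h1
  omega

theorem Reduced.isConnSet (h : R.Reduced) (T : R.Bridgeless) (m : R.Is4)
    (hst : ¬ R.rot.SameCycle R.root (R.flip R.root)) : IsConnSet R.VAdj {R.s}ᶜ := by
  have hmem : ∀ d, R.vert d ∈ ({R.s}ᶜ : Set R.Vertex) ↔ ¬ R.rot.SameCycle R.root d := fun d => by
    rw [Set.mem_compl_singleton_iff, Ne, s, R.vert_eq_iff, sameCycle_comm]
  -- every component of the complement of the initial vertex contains the final vertex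
  have key : ∀ u ∈ ({R.s}ᶜ : Set R.Vertex), PathIn R.VAdj {R.s}ᶜ u R.t := by
    intro u hu
    set S := R.vert ⁻¹' (compIn R.VAdj {R.s}ᶜ u) with hS
    have hSv : IsVertexSet R.rot S := R.isVertexSet_preimage_vert _
    have hSs : ∀ d ∈ S, ¬ R.rot.SameCycle R.root d := fun d hd =>
      (hmem d).1 (compIn_subset hu hd)
    have hr : R.root ∉ S := fun h => hSs _ h (SameCycle.refl _ _)
    have hex : ∀ d ∈ bdry R.flip S, R.rot.SameCycle R.root (R.flip d) := by
      intro d hd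
      by_contra hcon
      exact hd.2 (mem_compIn_of_adj hu hd.1 ((hmem _).2 hcon) ⟨d, rfl, rfl⟩)
    obtain ⟨e, rfl⟩ := R.vert_surjective u
    obtain ⟨a, ha⟩ := R.isConn.bdry_nonempty hSv ⟨e, mem_compIn_self _ _⟩ ⟨R.root, hr⟩
    have h4 := h.four_le_ncard T m hSv hr ha (hex a ha)
    have heq : R.flip '' bdry R.flip S = vertexOf R.rot R.root := by
      refine Set.eq_of_subset_of_ncard_le ?_ ?_ (Set.toFinite _)
      · rintro _ ⟨d, hd, rfl⟩
        exact hex d hd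
      · rwa [ncard_image_flip, m.ncard_vertexOf]
    have : R.root ∈ R.flip '' bdry R.flip S := by rw [heq]; exact self_mem_vertexOf _ _
    obtain ⟨d, hd, hdr⟩ := this
    have : R.flip R.root = d := by rw [← hdr, R.flip_flip]
    rw [t, this]
    exact hd.1
  exact ⟨⟨R.t, (hmem _).2 hst⟩, fun u hu w hw =>
    Relation.ReflTransGen.trans (key u hu) ((key w hw).symm VAdj.symm)⟩

/-- Two parts of the map without its initial vertex that are separated by a single vertex, that
of `o`, need more half-edges than there are. -/
theorem Reduced.false_of_separated (h : R.Reduced) (T : R.Bridgeless) (m : R.Is4)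
    {K₁ K₂ : Set D} {e₁ e₂ e₃ o : D} (hK₁ : IsVertexSet R.rot K₁) (hK₂ : IsVertexSet R.rot K₂)
    (hr₁ : R.root ∉ K₁) (hr₂ : R.root ∉ K₂) (h12 : Disjoint K₁ K₂)
    (he₁ : R.rot.SameCycle R.root (R.flip e₁)) (he₂ : R.rot.SameCycle R.root (R.flip e₂))
    (he₃ : R.rot.SameCycle R.root (R.flip e₃)) (k₁ : e₁ ∈ K₁) (k₂ : e₂ ∈ K₂) (n₁ : e₃ ∉ K₁)
    (n₂ : e₃ ∉ K₂) (b₁ : ∀ d ∈ bdry R.flip K₁, R.flip d ∈ vertexOf R.rot R.root ∪ vertexOf R.rot o)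
    (b₂ : ∀ d ∈ bdry R.flip K₂, R.flip d ∈ vertexOf R.rot R.root ∪ vertexOf R.rot o) : False := by
  have c₁ := h.four_le_ncard T m hK₁ hr₁ ⟨k₁, fun h => hr₁ ((hK₁.mem_iff he₁).2 h)⟩ he₁
  have c₂ := h.four_le_ncard T m hK₂ hr₂ ⟨k₂, fun h => hr₂ ((hK₂.mem_iff he₂).2 h)⟩ he₂
  set B := R.flip '' (bdry R.flip K₁ ∪ bdry R.flip K₂) with hB
  have hd : Disjoint (bdry R.flip K₁) (bdry R.flip K₂) :=
    h12.mono (fun d hd => hd.1) fun d hd => hd.1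
  have hBc : B.ncard = (bdry R.flip K₁).ncard + (bdry R.flip K₂).ncard := by
    rw [hB, ncard_image_flip, Set.ncard_union_eq hd]
  have he₃B : R.flip e₃ ∉ B := by
    rintro ⟨d, hd, hde⟩
    rw [R.flip.injective hde] at hd
    exact hd.elim (fun h => n₁ h.1) fun h => n₂ h.1
  have hsub : insert (R.flip e₃) B ⊆ vertexOf R.rot R.root ∪ vertexOf R.rot o := by
    rintro d (rfl | ⟨d, hd | hd, rfl⟩)
    · exact Or.inl he₃
    · exact b₁ d hd
    · exact b₂ d hd
  have h1 := Set.ncard_le_ncard hsub (Set.toFinite _)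
  have h2 := Set.ncard_union_le (vertexOf R.rot R.root) (vertexOf R.rot o)
  rw [m.ncard_vertexOf, m.ncard_vertexOf] at h2
  rw [Set.ncard_insert_of_notMem he₃B] at h1
  omega

/-- The neighbours of the initial vertex lie at no more than two vertices, since otherwise there
would be a `K₄` minor with the initial vertex as one of its branch sets. -/
theorem Reduced.false_of_three (h : R.Reduced) (T : R.Bridgeless) (m : R.Is4)
    (hK4 : ¬ HasK4 R.rot R.flip) (hst : ¬ R.rot.SameCycle R.root (R.flip R.root)) {e : Fin 3 → D}
    (he : ∀ i, R.rot.SameCycle R.root (R.flip (e i)))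
    (hne : ∀ i j, i ≠ j → ¬ R.rot.SameCycle (e i) (e j)) : False := by
  have hmem : ∀ d, R.vert d ∈ ({R.s}ᶜ : Set R.Vertex) ↔ ¬ R.rot.SameCycle R.root d := fun d => by
    rw [Set.mem_compl_singleton_iff, Ne, s, R.vert_eq_iff, sameCycle_comm]
  have hH := h.isConnSet T m hst
  have heH : ∀ i, R.vert (e i) ∈ ({R.s}ᶜ : Set R.Vertex) := fun i => by
    rw [hmem]
    intro h1
    exact T.not_loop m hst h1 (he i)
  have hv : ∀ i j, i ≠ j → R.vert (e i) ≠ R.vert (e j) := fun i j hij h1 =>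
    hne i j hij (R.vert_eq_iff.1 h1)
  rcases hasRootedTriangle_or_separated VAdj.symm hH (heH 0) (heH 1) (heH 2)
    (hv 0 1 (by decide)) (hv 0 2 (by decide)) (hv 1 2 (by decide)) with
    ⟨A, B, C, ⟨hA, hB, hC⟩, ⟨cA, cB, cC⟩, ⟨dAB, dAC, dBC⟩, ⟨aAB, aAC, aBC⟩, qA, qB, qC⟩ |
    ⟨v, hvH, hsep⟩
  · apply hK4
    have hcs : IsVertexConn R.rot R.flip (vertexOf R.rot R.root) := by
      refine ⟨⟨_, self_mem_vertexOf _ _⟩, fun S hS ⟨d, hd⟩ hSv _ => hS.antisymm fun e he => ?_⟩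
      exact (hSv.mem_iff ((SameCycle.symm (hS hd)).trans he)).1 hd
    have disj : ∀ {A B : Set R.Vertex}, Disjoint A B → ∀ d, d ∈ R.vert ⁻¹' A → d ∉ R.vert ⁻¹' B :=
      fun h d h1 h2 => Set.disjoint_left.1 h h1 h2
    have sdisj : ∀ {A : Set R.Vertex}, A ⊆ {R.s}ᶜ → ∀ d, d ∈ R.vert ⁻¹' A →
        d ∉ vertexOf R.rot R.root := fun h d h1 => (hmem d).1 (h h1)
    have adj : ∀ {A B : Set R.Vertex}, (∃ u ∈ A, ∃ w ∈ B, R.VAdj u w) →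
        (∃ d ∈ R.vert ⁻¹' A, R.flip d ∈ R.vert ⁻¹' B) ∧
          ∃ d ∈ R.vert ⁻¹' B, R.flip d ∈ R.vert ⁻¹' A := by
      rintro A B ⟨_, hu, _, hw, d, rfl, rfl⟩
      exact ⟨⟨d, hu, hw⟩, R.flip d, hw, by rw [R.flip_flip]; exact hu⟩
    have sadj : ∀ {A : Set R.Vertex},
        (A ∩ {R.vert (e 0), R.vert (e 1), R.vert (e 2)}).Nonempty →
        (∃ d ∈ R.vert ⁻¹' A, R.flip d ∈ vertexOf R.rot R.root) ∧
          ∃ d ∈ vertexOf R.rot R.root, R.flip d ∈ R.vert ⁻¹' A := by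
      rintro A ⟨u, hu, hu'⟩
      obtain ⟨i, rfl⟩ : ∃ i, u = R.vert (e i) := by
        rcases hu' with h | h | h
        exacts [⟨0, h⟩, ⟨1, h⟩, ⟨2, h⟩]
      exact ⟨⟨e i, hu, he i⟩, R.flip (e i), he i, by rw [R.flip_flip]; exact hu⟩
    refine ⟨![vertexOf R.rot R.root, R.vert ⁻¹' A, R.vert ⁻¹' B, R.vert ⁻¹' C], ?_, ?_, ?_, ?_⟩
    · intro i
      fin_cases i
      exacts [isVertexSet_vertexOf _ _, R.isVertexSet_preimage_vert _,
        R.isVertexSet_preimage_vert _, R.isVertexSet_preimage_vert _]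
    · intro i
      fin_cases i
      exacts [hcs, isVertexConn_of_isConnSet cA, isVertexConn_of_isConnSet cB,
        isVertexConn_of_isConnSet cC]
    · intro i j hij
      fin_cases i <;> fin_cases j
      exacts [(hij rfl).elim, fun d h1 h2 => sdisj hA d h2 h1, fun d h1 h2 => sdisj hB d h2 h1,
        fun d h1 h2 => sdisj hC d h2 h1, sdisj hA, (hij rfl).elim, disj dAB, disj dAC, sdisj hB,
        disj dAB.symm, (hij rfl).elim, disj dBC, sdisj hC, disj dAC.symm, disj dBC.symm,
        (hij rfl).elim]
    · intro i j hij
      fin_cases i <;> fin_cases j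
      exacts [(hij rfl).elim, (sadj qA).2, (sadj qB).2, (sadj qC).2, (sadj qA).1, (hij rfl).elim,
        (adj aAB).1, (adj aAC).1, (sadj qB).1, (adj aAB).2, (hij rfl).elim, (adj aBC).1,
        (sadj qC).1, (adj aAC).2, (adj aBC).2, (hij rfl).elim]
  · obtain ⟨o, rfl⟩ := R.vert_surjective v
    have key : ∀ i j k : Fin 3, i ≠ j → i ≠ k → j ≠ k → R.vert (e i) ≠ R.vert o →
        R.vert (e j) ≠ R.vert o → False := by
      intro i j k hij hik hjk hi hj
      have hQ : ∀ i, R.vert (e i) ∈ ({R.vert (e 0), R.vert (e 1), R.vert (e 2)} :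
          Set R.Vertex) := by
        intro i
        fin_cases i
        exacts [Or.inl rfl, Or.inr (Or.inl rfl), Or.inr (Or.inr rfl)]
      set H' := ({R.s}ᶜ : Set R.Vertex) \ {R.vert o} with hH'
      have hi' : R.vert (e i) ∈ H' := ⟨heH i, hi⟩
      have hj' : R.vert (e j) ∈ H' := ⟨heH j, hj⟩
      have hno : ∀ i j, i ≠ j → R.vert (e i) ≠ R.vert o →
          R.vert (e j) ∉ compIn R.VAdj H' (R.vert (e i)) := by
        intro i j hij hi h1
        by_cases hj : R.vert (e j) = R.vert o
        · have hi' : R.vert (e i) ∈ H' := ⟨heH i, hi⟩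
          exact (compIn_subset hi' h1).2 hj
        · exact hsep _ (hQ i) _ (hQ j) (hv i j hij) hi hj h1
      have hb : ∀ i, R.vert (e i) ∈ H' → ∀ d ∈ bdry R.flip (R.vert ⁻¹'
          compIn R.VAdj H' (R.vert (e i))), R.flip d ∈ vertexOf R.rot R.root ∪
            vertexOf R.rot o := by
        intro i hi d hd
        by_contra hcon
        have hd' : R.vert (R.flip d) ∈ H' := by
          refine ⟨(hmem _).2 fun h => hcon (Or.inl h), fun h => ?_⟩
          exact hcon (Or.inr (R.vert_eq_iff.1 h).symm)
        exact hd.2 (mem_compIn_of_adj hi hd.1 hd' ⟨d, rfl, rfl⟩)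
      have hr : ∀ i, R.vert (e i) ∈ H' →
          R.root ∉ R.vert ⁻¹' compIn R.VAdj H' (R.vert (e i)) := fun i hi h =>
        (compIn_subset hi h).1 rfl
      refine h.false_of_separated T m (R.isVertexSet_preimage_vert _)
        (R.isVertexSet_preimage_vert _) (hr i hi') (hr j hj') ?_ (he i) (he j) (he k)
        (mem_compIn_self _ _) (mem_compIn_self _ _) (hno i k hik hi) (hno j k hjk hj) (hb i hi')
        (hb j hj')
      refine Set.disjoint_left.2 fun d hd hd' => hno i j hij hi ?_
      exact Relation.ReflTransGen.trans hd (PathIn.symm VAdj.symm hd')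
    by_cases h0 : R.vert (e 0) = R.vert o
    · exact key 1 2 0 (by decide) (by decide) (by decide) (fun h => hv 0 1 (by decide)
        (h0.trans (Eq.symm h))) fun h => hv 0 2 (by decide) (h0.trans (Eq.symm h))
    by_cases h1 : R.vert (e 1) = R.vert o
    · exact key 0 2 1 (by decide) (by decide) (by decide) h0
        fun h => hv 1 2 (by decide) (h1.trans (Eq.symm h))
    · exact key 0 1 2 (by decide) (by decide) (by decide) h0 h1

/-- The structure theorem for maps without chains of positive length at the initial vertex. -/
theorem Reduced.isDip_or_isMate (h : R.Reduced) (T : R.Bridgeless) (m : R.Is4)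
    (hK4 : ¬ HasK4 R.rot R.flip) (hst : ¬ R.rot.SameCycle R.root (R.flip R.root)) :
    R.IsDip ∨ ∃ x, R.IsMate x := by
  have three : ∀ a b c, R.rot.SameCycle R.root a → R.rot.SameCycle R.root b →
      R.rot.SameCycle R.root c → ¬ R.rot.SameCycle (R.flip a) (R.flip b) →
      ¬ R.rot.SameCycle (R.flip a) (R.flip c) → R.rot.SameCycle (R.flip b) (R.flip c) := by
    intro a b c ha hb hc hab hac
    by_contra hbc
    refine h.false_of_three T m hK4 hst (e := ![R.flip a, R.flip b, R.flip c]) (fun i => ?_)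
      fun i j hij => ?_
    · fin_cases i <;> simpa [R.flip_flip]
    · fin_cases i <;> fin_cases j
      exacts [(hij rfl).elim, hab, hac, fun h => hab h.symm, (hij rfl).elim, hbc,
        fun h => hac h.symm, fun h => hbc h.symm, (hij rfl).elim]
  have hrr := SameCycle.refl R.rot R.root
  by_cases hL : ∃ x, R.rot.SameCycle R.root x ∧ x ≠ R.root ∧ R.LinkedToT x
  · obtain ⟨x, hx, hxr, hxL⟩ := hL
    by_cases hD : R.IsDip
    · exact Or.inl hD
    refine Or.inr ⟨x, hx, hxr, hxL, ?_⟩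
    unfold IsDip at hD
    push Not at hD
    obtain ⟨x₁, hx1, hx1r, hx1L⟩ := hD
    have hx1x : x₁ ≠ x := fun h => hx1L (h ▸ hxL)
    refine ⟨R.flip x₁, fun h1 => hx1L (LinkedToT.of_flip h1), fun x₂ hx2 hx2r hx2x => ?_⟩
    by_cases h12 : x₂ = x₁
    · subst h12
      exact ⟨_, SameCycle.refl _ _, _, R.isLink_empty _⟩
    have hx2L : ¬ R.LinkedToT x₂ := fun h2 => hx1L (T.linkedToT_third m hst hx hx2 hx1 hxr hx2r
      hx1r hx2x.symm hx1x.symm h12 hxL h2)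
    rw [h.linkedToT_iff hx1 hx1r] at hx1L
    rw [h.linkedToT_iff hx2 hx2r] at hx2L
    exact ⟨_, three _ _ _ hrr hx1 hx2 hx1L hx2L, _, R.isLink_empty _⟩
  · -- all three neighbours would lie at one vertex, and the root edge would be in a cut
    exfalso
    push Not at hL
    have h1 := hL (R.rot R.root) (sameCycle_apply_right.2 hrr) (m.rot_ne _)
    rw [h.linkedToT_iff (sameCycle_apply_right.2 hrr) (m.rot_ne _)] at h1
    have e : ∀ x, R.rot.SameCycle R.root x → x ≠ R.root →
        R.rot.SameCycle (R.flip (R.rot R.root)) (R.flip x) := fun x hx hxr => by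
      have h2 := hL x hx hxr
      rw [h.linkedToT_iff hx hxr] at h2
      exact three _ _ _ hrr (sameCycle_apply_right.2 hrr) hx h1 h2
    obtain ⟨w, hw, hall⟩ : ∃ w, R.rot.SameCycle (R.flip (R.rot R.root)) w ∧
        ∀ d, R.rot.SameCycle (R.flip (R.rot R.root)) d → d ≠ w →
          R.rot.SameCycle R.root (R.flip d) := by
      have i1 : R.rot.SameCycle R.root (R.rot R.root) := sameCycle_apply_right.2 hrr
      have i2 : R.rot.SameCycle R.root (R.rot (R.rot R.root)) := sameCycle_apply_right.2 i1
      have i3 : R.rot.SameCycle R.root (R.rot (R.rot (R.rot R.root))) := sameCycle_apply_right.2 i2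
      obtain ⟨w, hw, -, -, -, hall⟩ := m.exists_fourth (SameCycle.refl R.rot (R.flip (R.rot R.root)))
        (e _ i2 (m.rot2_ne _)) (e _ i3 (m.rot3_ne _))
        (R.flip.injective.ne (m.rot_ne _).symm) (R.flip.injective.ne (m.rot2_ne _).symm)
        (R.flip.injective.ne (m.rot_ne _).symm)
      refine ⟨w, hw, fun d hd hdw => ?_⟩
      rcases hall d hd with rfl | rfl | rfl | rfl
      · rwa [R.flip_flip]
      · rwa [R.flip_flip]
      · rwa [R.flip_flip]
      · exact (hdw rfl).elim
    have hsv := (isVertexSet_vertexOf R.rot R.root).union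
      (isVertexSet_vertexOf R.rot (R.flip (R.rot R.root)))
    have hu := T w (fun h2 => T.not_loop m hst (sameCycle_apply_right.2 hrr) (h2 ▸ hw).symm)
      (fun h2 => h1 (h2 ▸ hw).symm) _ ⟨_, Or.inl (self_mem_vertexOf _ _)⟩
      (fun d hd => (hsv d).2 hd) fun d hd n1 _ n3 _ => ?_
    · have : R.flip R.root ∈ (Set.univ : Set D) := trivial
      rw [← hu] at this
      exact this.elim hst fun h2 => h1 (SameCycle.symm h2)
    · rcases hd with hd | hd
      · exact Or.inr (e d hd n1)
      · exact Or.inl (hall d hd n3)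

end RootedMap

/-! ### Chains and bridges under substitution and isomorphism -/

namespace RootedMap

section Congr

variable {D E : Type*} {R : RootedMap D} {R' : RootedMap E} {e : D ≃ E}

theorem IsLink.congr (h : ∀ d, e (R.rot d) = R'.rot (e d)) (h' : ∀ d, e (R.flip d) = R'.flip (e d))
    (hr : e R.root = R'.root) {x y : D} {K : Set D} (k : R.IsLink x y K) :
    R'.IsLink (e x) (e y) (e.symm ⁻¹' K) where
  vertexSet := k.vertexSet.preimage (symm_comm_of_comm h)
  root_notMem := by
    rw [← hr, Set.mem_preimage, Equiv.symm_apply_apply]; exact k.root_notMem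
  left_notMem := by
    rw [Set.mem_preimage, Equiv.symm_apply_apply]; exact k.left_notMem
  right_notMem := by
    rw [Set.mem_preimage, Equiv.symm_apply_apply]; exact k.right_notMem
  ne := e.injective.ne k.ne
  flip_mem d hd := by
    obtain ⟨d, rfl⟩ := e.surjective d
    have := k.flip_mem d (by simpa [e.injective.eq_iff] using hd)
    rw [← h', Set.mem_preimage, Equiv.symm_apply_apply, e.injective.eq_iff, e.injective.eq_iff]
    exact this

theorem link_congr (h : ∀ d, e (R.rot d) = R'.rot (e d)) (h' : ∀ d, e (R.flip d) = R'.flip (e d))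
    (hr : e R.root = R'.root) {x y : D} : R'.Link (e x) (e y) ↔ R.Link x y := by
  constructor
  · rintro ⟨K, k⟩
    have := k.congr (symm_comm_of_comm h) (symm_comm_of_comm h') (by rw [← hr, e.symm_apply_apply])
    rw [e.symm_apply_apply, e.symm_apply_apply] at this
    exact ⟨_, this⟩
  · rintro ⟨K, k⟩
    exact ⟨_, k.congr h h' hr⟩

theorem linkedToT_congr (h : ∀ d, e (R.rot d) = R'.rot (e d))
    (h' : ∀ d, e (R.flip d) = R'.flip (e d)) (hr : e R.root = R'.root) {x : D} :
    R'.LinkedToT (e x) ↔ R.LinkedToT x := by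
  rw [LinkedToT, e.surjective.exists]
  simp only [← hr, ← h', sameCycle_congr h, link_congr h h' hr, LinkedToT]

theorem isDip_congr (h : ∀ d, e (R.rot d) = R'.rot (e d))
    (h' : ∀ d, e (R.flip d) = R'.flip (e d)) (hr : e R.root = R'.root) :
    R'.IsDip ↔ R.IsDip := by
  rw [IsDip, e.surjective.forall]
  simp only [← hr, sameCycle_congr h, linkedToT_congr h h' hr, e.injective.ne_iff, IsDip]

theorem isMate_congr (h : ∀ d, e (R.rot d) = R'.rot (e d))
    (h' : ∀ d, e (R.flip d) = R'.flip (e d)) (hr : e R.root = R'.root) {x : D} :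
    R'.IsMate (e x) ↔ R.IsMate x := by
  simp only [IsMate, e.surjective.exists, e.surjective.forall, ← hr, ← h', sameCycle_congr h,
    linkedToT_congr h h' hr, e.injective.ne_iff, link_congr h h' hr]

theorem Bridgeless.congr (h : ∀ d, e (R.rot d) = R'.rot (e d))
    (h' : ∀ d, e (R.flip d) = R'.flip (e d)) (hr : e R.root = R'.root) (T : R.Bridgeless) :
    R'.Bridgeless := by
  intro a h1 h2 S hne hρ hα
  obtain ⟨a, rfl⟩ := e.surjective a
  rw [← hr, e.injective.ne_iff] at h1
  rw [← hr, ← h', e.injective.ne_iff] at h2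
  have := T a h1 h2 (e ⁻¹' S) (hne.elim fun d hd => ⟨e.symm d, by simpa using hd⟩)
    (fun d hd => by rw [Set.mem_preimage, h]; exact hρ _ hd) fun d hd g1 g2 g3 g4 => by
      rw [Set.mem_preimage, h']
      refine hα _ hd ?_ ?_ ?_ ?_
      · rwa [← hr, e.injective.ne_iff]
      · rwa [← hr, ← h', e.injective.ne_iff]
      · rwa [e.injective.ne_iff]
      · rwa [← h', e.injective.ne_iff]
  refine Set.eq_univ_of_forall fun d => ?_
  have hd : e.symm d ∈ e ⁻¹' S := this ▸ trivial
  simpa using hd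

end Congr

section Sub

variable {D E : Type*} [Finite D] [Finite E] {R : RootedMap D} {h : D} {R' : RootedMap E}
  {m : R.Is4} {m' : R'.Is4}

/-- The substituted map is connected without its root edge. -/
theorem inr_mem_of_sub (m' : R'.Is4) {S : Set (D ⊕ E)}
    (hρ : ∀ d ∈ S, (R.sub h R' m m').rot d ∈ S)
    (hα : ∀ d, Sum.inr d ∈ S → d ≠ R'.root → d ≠ R'.flip R'.root → Sum.inr (R'.flip d) ∈ S)
    (hne : ∃ d, Sum.inr d ∈ S) (d : E) : Sum.inr d ∈ S := by
  have := R'.isConn.eq_univ_of_off m' R'.root (S := Sum.inr ⁻¹' S) hne (fun d hd => by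
    have := hρ _ hd; rwa [sub_rot_inr] at this) hα
  have hd : d ∈ Sum.inr ⁻¹' S := this ▸ trivial
  exact hd

theorem inl_sameCycle_sub {a b : D} :
    (R.sub h R' m m').rot.SameCycle (Sum.inl a) (Sum.inl b) ↔ R.rot.SameCycle a b :=
  sameCycle_sumCongr_inl

theorem not_inl_sameCycle_sub {a : D} {b : E} :
    ¬ (R.sub h R' m m').rot.SameCycle (Sum.inl a) (Sum.inr b) :=
  not_sameCycle_sumCongr_inl_inr

theorem link_sub_iff {x y : D} : (R.sub h R' m m').Link (Sum.inl x) (Sum.inl y) ↔ R.Link x y := by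
  constructor
  · rintro ⟨K, k⟩
    -- a chain passes either through the whole of the substituted map or through none of it
    have hall : (∃ d, Sum.inr d ∈ K) → ∀ d, Sum.inr d ∈ K := fun hne =>
      inr_mem_of_sub m' (fun d hd => (k.vertexSet d).2 hd) (fun d hd h1 h2 => by
        have := k.flip_mem _ (Or.inl hd)
        rw [sub_flip_inr h1 h2] at this
        simpa using this) hne
    refine ⟨Sum.inl ⁻¹' K, fun d => ?_, k.root_notMem, k.left_notMem, k.right_notMem,
      fun h => k.ne (congrArg _ h), fun d hd => ?_⟩
    · rw [Set.mem_preimage, Set.mem_preimage, ← k.vertexSet (Sum.inl d), sub_rot_inl]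
    have hd' : Sum.inl d ∈ K ∨ (Sum.inl d : D ⊕ E) = Sum.inl x ∨ (Sum.inl d : D ⊕ E) = Sum.inl y := by
      rcases hd with h | rfl | rfl
      exacts [Or.inl h, Or.inr (Or.inl rfl), Or.inr (Or.inr rfl)]
    have h1 := k.flip_mem _ hd'
    have conv : ∀ d : D, (Sum.inl d ∈ K ∨ (Sum.inl d : D ⊕ E) = Sum.inl x ∨
        (Sum.inl d : D ⊕ E) = Sum.inl y) → (d ∈ Sum.inl ⁻¹' K ∨ d = x ∨ d = y) := by
      intro d hd
      simpa using hd
    by_cases e1 : d = h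
    · subst e1
      rw [sub_flip_inl_self] at h1
      have h2 := k.flip_mem _ (Or.inl (hall ⟨_, by simpa using h1⟩ (R'.flip R'.root)))
      rw [sub_flip_inr_flip] at h2
      exact conv _ h2
    by_cases e2 : d = R.flip h
    · subst e2
      rw [sub_flip_inl_flip] at h1
      have h2 := k.flip_mem _ (Or.inl (hall ⟨_, by simpa using h1⟩ R'.root))
      rw [sub_flip_inr_root] at h2
      rw [R.flip_flip]
      exact conv _ h2
    · rw [sub_flip_inl e1 e2] at h1
      exact conv _ h1
  · rintro ⟨K, k⟩
    have hh : (h ∈ K ∨ h = x ∨ h = y) ↔ (R.flip h ∈ K ∨ R.flip h = x ∨ R.flip h = y) := by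
      refine ⟨k.flip_mem h, fun h1 => ?_⟩
      have := k.flip_mem _ h1
      rwa [R.flip_flip] at this
    set K' : Set (D ⊕ E) := {d | Sum.elim (fun d => d ∈ K) (fun _ => h ∈ K ∨ h = x ∨ h = y) d}
      with hK'
    have hl : ∀ d, Sum.inl d ∈ K' ↔ d ∈ K := fun d => Iff.rfl
    have hr : ∀ d : E, Sum.inr d ∈ K' ↔ (h ∈ K ∨ h = x ∨ h = y) := fun d => Iff.rfl
    refine ⟨K', ?_, k.root_notMem, k.left_notMem, k.right_notMem, fun h => k.ne (Sum.inl.inj h), ?_⟩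
    · rintro (d | d)
      · rw [sub_rot_inl, hl, hl]; exact k.vertexSet d
      · rw [sub_rot_inr, hr, hr]
    · rintro (d | d) hd
      · rw [hl, Sum.inl.injEq, Sum.inl.injEq] at hd
        by_cases e1 : d = h
        · subst e1
          rw [sub_flip_inl_self]
          exact Or.inl ((hr _).2 hd)
        by_cases e2 : d = R.flip h
        · subst e2
          rw [sub_flip_inl_flip]
          exact Or.inl ((hr _).2 (hh.2 hd))
        · rw [sub_flip_inl e1 e2, hl, Sum.inl.injEq, Sum.inl.injEq]
          exact k.flip_mem d hd
      · rw [hr] at hd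
        simp only [reduceCtorEq, or_false] at hd
        by_cases e1 : d = R'.root
        · subst e1
          rw [sub_flip_inr_root, hl, Sum.inl.injEq, Sum.inl.injEq]
          exact hd
        by_cases e2 : d = R'.flip R'.root
        · subst e2
          rw [sub_flip_inr_flip, hl, Sum.inl.injEq, Sum.inl.injEq]
          exact hh.1 hd
        · rw [sub_flip_inr e1 e2]
          exact Or.inl ((hr _).2 hd)

variable (h1 : h ≠ R.root) (h2 : h ≠ R.flip R.root)
include h1 h2

theorem flip_root_sub :
    (R.sub h R' m m').flip (R.sub h R' m m').root = Sum.inl (R.flip R.root) := by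
  rw [sub_root, sub_flip_inl h1.symm fun h3 => h2 (by rw [h3, R.flip_flip])]

theorem bridgeless_sub_iff : (R.sub h R' m m').Bridgeless ↔ R.Bridgeless := by
  have hr := flip_root_sub (R' := R') (m := m) (m' := m') h1 h2
  have hf1 : R.flip h ≠ R.root := fun h3 => h2 (by rw [← h3, R.flip_flip])
  have hf2 : R.flip h ≠ R.flip R.root := R.flip.injective.ne h1
  constructor
  · intro T a ha1 ha2 S hne hρ hα
    -- the half-edge to be removed after the substitution
    obtain ⟨a', ha1', ha2', hS'⟩ : ∃ a', a' ≠ R.root ∧ a' ≠ R.flip R.root ∧ ∃ P : Prop,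
        (∀ d ∈ S, d ≠ R.root → d ≠ R.flip R.root → d ≠ h → d ≠ R.flip h → d ≠ a' →
          d ≠ R.flip a' → R.flip d ∈ S) ∧
        (((h ∈ S ↔ P) ∧ (R.flip h ∈ S ↔ P) ∧ a' ≠ h ∧ a' ≠ R.flip h) ∨
          ((h ∈ S ↔ P) ∧ a' = R.flip h)) := by
      by_cases e : a = h ∨ a = R.flip h
      · refine ⟨R.flip h, hf1, hf2, h ∈ S, ?_, Or.inr ⟨Iff.rfl, rfl⟩⟩
        intro d hd g1 g2 g3 g4 _ _
        refine hα d hd g1 g2 ?_ ?_ <;> rcases e with rfl | rfl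
        · exact g3
        · exact g4
        · exact g4
        · rwa [R.flip_flip]
      · push Not at e
        refine ⟨a, ha1, ha2, h ∈ S, fun d hd g1 g2 _ _ => hα d hd g1 g2, Or.inl ⟨Iff.rfl, ?_, e⟩⟩
        have e3 : R.flip h ≠ R.flip a := R.flip.injective.ne e.1.symm
        have e4 : h ≠ R.flip a := fun h3 => e.2 (by rw [h3, R.flip_flip])
        constructor
        · intro h3
          have := hα _ h3 hf1 hf2 e.2.symm e3
          rwa [R.flip_flip] at this
        · exact fun h3 => hα _ h3 h1 h2 e.1.symm e4
    obtain ⟨P, hcl, hP⟩ := hS'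
    set S' : Set (D ⊕ E) := {d | Sum.elim (fun d => d ∈ S) (fun _ => P) d} with hS'
    have hl : ∀ d, Sum.inl d ∈ S' ↔ d ∈ S := fun d => Iff.rfl
    have hrr : ∀ d : E, Sum.inr d ∈ S' ↔ P := fun d => Iff.rfl
    have hPh : h ∈ S ↔ P := by tauto
    have := T (Sum.inl a') (fun h => ha1' (Sum.inl.inj h))
      (by rw [hr]; exact fun h => ha2' (Sum.inl.inj h)) S' (hne.elim fun d hd => ⟨Sum.inl d, hd⟩) ?_ ?_
    · refine Set.eq_univ_of_forall fun d => ?_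
      have : Sum.inl d ∈ S' := this ▸ trivial
      exact this
    · rintro (d | d) hd
      · rw [sub_rot_inl, hl]; exact hρ d hd
      · rw [sub_rot_inr, hrr]; exact hd
    · rintro (d | d) hd g1 g2 g3 g4
      · rw [sub_root, Ne, Sum.inl.injEq] at g1
        rw [hr, Ne, Sum.inl.injEq] at g2
        rw [Ne, Sum.inl.injEq] at g3
        by_cases e1 : d = h
        · subst e1
          rw [sub_flip_inl_self, hrr]
          exact hPh.1 hd
        by_cases e2 : d = R.flip h
        · subst e2
          rw [sub_flip_inl_flip, hrr]
          rw [hl] at hd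
          rcases hP with h3 | h3
          · exact h3.2.1.1 hd
          · exact (g3 h3.2.symm).elim
        · rw [sub_flip_inl e1 e2, hl]
          refine hcl d hd g1 g2 e1 e2 g3 fun h3 => ?_
          rcases hP with h4 | h4
          · rw [sub_flip_inl h4.2.2.1 h4.2.2.2, Ne, Sum.inl.injEq] at g4
            exact g4 h3
          · rw [h4.2, R.flip_flip] at h3
            exact e1 h3
      · rw [hrr] at hd
        by_cases e1 : d = R'.root
        · subst e1
          rw [sub_flip_inr_root, hl]
          exact hPh.2 hd
        by_cases e2 : d = R'.flip R'.root
        · subst e2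
          rw [sub_flip_inr_flip, hl]
          rcases hP with h3 | h3
          · exact h3.2.1.2 hd
          · rw [h3.2, sub_flip_inl_flip] at g4
            exact (g4 rfl).elim
        · rw [sub_flip_inr e1 e2, hrr]
          exact hd
  · intro T a ha1 ha2 S hne hρ hα
    rw [hr] at hα ha2
    have hρl : ∀ d ∈ Sum.inl ⁻¹' S, R.rot d ∈ Sum.inl ⁻¹' S := fun d hd => by
      have := hρ _ hd; rwa [sub_rot_inl] at this
    -- the outer part is connected even without the edge of `h`
    have hout : ∀ b, (b ≠ R.root) → (b ≠ R.flip R.root) →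
        (∀ d, Sum.inl d ∈ S → d ≠ R.root → d ≠ R.flip R.root → d ≠ b → d ≠ R.flip b →
          Sum.inl (R.flip d) ∈ S) → (∃ d, Sum.inl d ∈ S) → ∀ d, Sum.inl d ∈ S := by
      intro b hb1 hb2 hb hex d
      have := T b hb1 hb2 (Sum.inl ⁻¹' S) hex hρl hb
      have hd : d ∈ Sum.inl ⁻¹' S := this ▸ trivial
      exact hd
    have hinr : (∀ d, Sum.inr d ∈ S → d ≠ R'.root → d ≠ R'.flip R'.root →
        Sum.inr (R'.flip d) ∈ S) → (∃ d, Sum.inr d ∈ S) → ∀ d, Sum.inr d ∈ S := fun h3 =>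
      inr_mem_of_sub m' hρ h3
    set F := (R.sub h R' m m').flip with hF
    have i1 : F (Sum.inl h) = Sum.inr R'.root := sub_flip_inl_self
    have i2 : F (Sum.inr R'.root) = Sum.inl h := sub_flip_inr_root
    have i3 : F (Sum.inl (R.flip h)) = Sum.inr (R'.flip R'.root) := sub_flip_inl_flip
    have i4 : F (Sum.inr (R'.flip R'.root)) = Sum.inl (R.flip h) := sub_flip_inr_flip
    -- the two new edges, if they are present
    have e1 : a ≠ Sum.inl h → a ≠ Sum.inr R'.root → (Sum.inl h ∈ S ↔ Sum.inr R'.root ∈ S) := by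
      intro g1 g2
      have g3 : Sum.inl h ≠ F a := fun g => g2 (by
        rw [← i1, g, hF, (R.sub h R' m m').flip_flip])
      have g4 : Sum.inr R'.root ≠ F a := fun g => g1 (by
        rw [← i2, g, hF, (R.sub h R' m m').flip_flip])
      constructor
      · intro hd
        have := hα _ hd (by simpa using h1) (by simpa using h2) g1.symm g3
        rwa [i1] at this
      · intro hd
        have := hα _ hd (by simp) (by simp) g2.symm g4
        rwa [i2] at this
    have e2 : a ≠ Sum.inl (R.flip h) → a ≠ Sum.inr (R'.flip R'.root) →
        (Sum.inl (R.flip h) ∈ S ↔ Sum.inr (R'.flip R'.root) ∈ S) := by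
      intro g1 g2
      have g3 : Sum.inl (R.flip h) ≠ F a := fun g => g2 (by
        rw [← i3, g, hF, (R.sub h R' m m').flip_flip])
      have g4 : Sum.inr (R'.flip R'.root) ≠ F a := fun g => g1 (by
        rw [← i4, g, hF, (R.sub h R' m m').flip_flip])
      constructor
      · intro hd
        have := hα _ hd (by simpa using hf1) (by simpa using hf2) g1.symm g3
        rwa [i3] at this
      · intro hd
        have := hα _ hd (by simp) (by simp) g2.symm g4
        rwa [i4] at this
    have hcase : (∃ b, a = Sum.inr b ∧ b ≠ R'.root ∧ b ≠ R'.flip R'.root) ∨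
        (a = Sum.inl h ∨ a = Sum.inr R'.root) ∨
        (a = Sum.inl (R.flip h) ∨ a = Sum.inr (R'.flip R'.root)) ∨
        ∃ b, a = Sum.inl b ∧ b ≠ h ∧ b ≠ R.flip h := by
      rcases a with a | a
      · by_cases g1 : a = h
        · simp [g1]
        by_cases g2 : a = R.flip h
        · simp [g2]
        · simp [g1, g2]
      · by_cases g1 : a = R'.root
        · simp [g1]
        by_cases g2 : a = R'.flip R'.root
        · simp [g2]
        · simp [g1, g2]
    have huniv : (∀ d, Sum.inl d ∈ S) → (∀ d, Sum.inr d ∈ S) → S = Set.univ := fun g1 g2 =>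
      Set.eq_univ_of_forall (Sum.rec g1 g2)
    have hne' : (∃ d, Sum.inl d ∈ S) ∨ ∃ d, Sum.inr d ∈ S := by
      obtain ⟨d | d, hd⟩ := hne
      exacts [Or.inl ⟨d, hd⟩, Or.inr ⟨d, hd⟩]
    have hin : ∀ d, Sum.inl d ∈ S → d ≠ R.root → d ≠ R.flip R.root → d ≠ h → d ≠ R.flip h →
        Sum.inl d ≠ a → Sum.inl d ≠ F a → Sum.inl (R.flip d) ∈ S := by
      intro d hd g1 g2 g3 g4 g5 g6
      have := hα _ hd (by simpa using g1) (by simpa using g2) g5 g6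
      rwa [hF, sub_flip_inl g3 g4] at this
    have hin' : ∀ d, Sum.inr d ∈ S → d ≠ R'.root → d ≠ R'.flip R'.root →
        Sum.inr d ≠ a → Sum.inr d ≠ F a → Sum.inr (R'.flip d) ∈ S := by
      intro d hd g3 g4 g5 g6
      have := hα _ hd (by simp) (by simp) g5 g6
      rwa [hF, sub_flip_inr g3 g4] at this
    rcases hcase with ⟨b, rfl, b1, b2⟩ | ha | ha | ⟨b, rfl, b1, b2⟩
    · have hFa : F (Sum.inr b) = Sum.inr (R'.flip b) := sub_flip_inr b1 b2
      have hl := hout h h1 h2 fun d hd g1 g2 g3 g4 =>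
        hin d hd g1 g2 g3 g4 (by simp) (by simp [hFa])
      have e1 := e1 (by simp) (by simpa using b1)
      have e2 := e2 (by simp) (by simpa using b2)
      have hr : (∃ d, Sum.inr d ∈ S) → (Sum.inr R'.root ∈ S ↔ Sum.inr (R'.flip R'.root) ∈ S) →
          ∀ d, Sum.inr d ∈ S := by
        intro hex hiff d
        have := R'.isConn.eq_univ_of_off m' b (S := Sum.inr ⁻¹' S) hex (fun d hd => by
          have := hρ _ hd; rwa [sub_rot_inr] at this) fun d hd g1 g2 => by
            by_cases g3 : d = R'.root
            · rw [g3] at hd ⊢; exact hiff.1 hd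
            by_cases g4 : d = R'.flip R'.root
            · rw [g4] at hd ⊢
              rw [R'.flip_flip]; exact hiff.2 hd
            · exact hin' d hd g3 g4 (by simpa using g1) (by simpa [hFa] using g2)
        have hd : d ∈ Sum.inr ⁻¹' S := this ▸ trivial
        exact hd
      by_cases hex : ∃ d, Sum.inl d ∈ S
      · have hl := hl hex
        exact huniv hl (hr ⟨_, e1.1 (hl _)⟩ ⟨fun _ => e2.1 (hl _), fun _ => e1.1 (hl _)⟩)
      · have g1 : Sum.inr R'.root ∉ S := fun g => hex ⟨_, e1.2 g⟩
        have g2 : Sum.inr (R'.flip R'.root) ∉ S := fun g => hex ⟨_, e2.2 g⟩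
        exact (g1 (hr (hne'.resolve_left hex) ⟨fun g => (g1 g).elim, fun g => (g2 g).elim⟩ _)).elim
    · have hFa : F a = Sum.inl h ∨ F a = Sum.inr R'.root := by
        rcases ha with rfl | rfl
        exacts [Or.inr i1, Or.inl i2]
      have hl := hout h h1 h2 fun d hd g1 g2 g3 g4 => hin d hd g1 g2 g3 g4
        (by rcases ha with rfl | rfl <;> simp [g3]) (by rcases hFa with g | g <;> simp [g, g3])
      have hr := hinr fun d hd g1 g2 => hin' d hd g1 g2
        (by rcases ha with rfl | rfl <;> simp [g1]) (by rcases hFa with g | g <;> simp [g, g1])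
      have e2 := e2 (by rcases ha with rfl | rfl <;> simp [(R.flip_ne h).symm])
        (by rcases ha with rfl | rfl <;> simp [(R'.flip_ne R'.root).symm])
      rcases hne' with g | g
      · exact huniv (hl g) (hr ⟨_, e2.1 (hl g _)⟩)
      · exact huniv (hl ⟨_, e2.2 (hr g _)⟩) (hr g)
    · have hFa : F a = Sum.inl (R.flip h) ∨ F a = Sum.inr (R'.flip R'.root) := by
        rcases ha with rfl | rfl
        exacts [Or.inr i3, Or.inl i4]
      have hl := hout h h1 h2 fun d hd g1 g2 g3 g4 => hin d hd g1 g2 g3 g4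
        (by rcases ha with rfl | rfl <;> simp [g4]) (by rcases hFa with g | g <;> simp [g, g4])
      have hr := hinr fun d hd g1 g2 => hin' d hd g1 g2
        (by rcases ha with rfl | rfl <;> simp [g2]) (by rcases hFa with g | g <;> simp [g, g2])
      have e1 := e1 (by rcases ha with rfl | rfl <;> simp [R.flip_ne h])
        (by rcases ha with rfl | rfl <;> simp [R'.flip_ne R'.root])
      rcases hne' with g | g
      · exact huniv (hl g) (hr ⟨_, e1.1 (hl g _)⟩)
      · exact huniv (hl ⟨_, e1.2 (hr g _)⟩) (hr g)
    · have hFa : F (Sum.inl b) = Sum.inl (R.flip b) := sub_flip_inl b1 b2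
      have hr := hinr fun d hd g1 g2 => hin' d hd g1 g2 (by simp) (by simp [hFa])
      have e1 := e1 (by simpa using b1) (by simp)
      have e2 := e2 (by simpa using b2) (by simp)
      have hl := hout b (fun g => ha1 (by rw [g, sub_root])) (by simpa using ha2)
        fun d hd g1 g2 g3 g4 => by
          by_cases g5 : d = h
          · rw [g5] at hd ⊢
            exact e2.2 (hr ⟨_, e1.1 hd⟩ _)
          by_cases g6 : d = R.flip h
          · rw [g6] at hd ⊢
            rw [R.flip_flip]
            exact e1.2 (hr ⟨_, e2.1 hd⟩ _)
          · exact hin d hd g1 g2 g5 g6 (by simpa using g3) (by simpa [hFa] using g4)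
      rcases hne' with g | g
      · exact huniv (hl g) (hr ⟨_, e1.1 (hl g _)⟩)
      · exact huniv (hl ⟨_, e1.2 (hr g _)⟩) (hr g)

theorem linkedToT_sub_iff {x : D} :
    (R.sub h R' m m').LinkedToT (Sum.inl x) ↔ R.LinkedToT x := by
  rw [LinkedToT, flip_root_sub h1 h2]
  constructor
  · rintro ⟨y | y, hy, hl⟩
    · exact ⟨y, inl_sameCycle_sub.1 hy, link_sub_iff.1 hl⟩
    · exact (not_inl_sameCycle_sub hy).elim
  · rintro ⟨y, hy, hl⟩
    exact ⟨Sum.inl y, inl_sameCycle_sub.2 hy, link_sub_iff.2 hl⟩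

theorem isDip_sub_iff : (R.sub h R' m m').IsDip ↔ R.IsDip := by
  constructor
  · intro hd x hx hxr
    exact (linkedToT_sub_iff h1 h2).1 (hd (Sum.inl x) (inl_sameCycle_sub.2 hx)
      fun g => hxr (Sum.inl.inj g))
  · rintro hd (x | x) hx hxr
    · exact (linkedToT_sub_iff h1 h2).2 (hd x (inl_sameCycle_sub.1 hx) fun g => hxr (by rw [g]; rfl))
    · exact (not_inl_sameCycle_sub hx).elim

theorem IsMate.sub {x : D} (hM : R.IsMate x) : (R.sub h R' m m').IsMate (Sum.inl x) := by
  obtain ⟨hx, hxr, hL, c, hc, hall⟩ := hM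
  refine ⟨inl_sameCycle_sub.2 hx, fun g => hxr (Sum.inl.inj g), (linkedToT_sub_iff h1 h2).2 hL,
    Sum.inl c, ?_, ?_⟩
  · rwa [flip_root_sub h1 h2, inl_sameCycle_sub]
  · rintro (x' | x') hx' hxr' hxx'
    · obtain ⟨y, hy, hl⟩ := hall x' (inl_sameCycle_sub.1 hx') (fun g => hxr' (by rw [g]; rfl))
        fun g => hxx' (by rw [g])
      exact ⟨Sum.inl y, inl_sameCycle_sub.2 hy, link_sub_iff.2 hl⟩
    · exact (not_inl_sameCycle_sub hx').elim

end Sub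

end RootedMap

namespace RootedMap

/-- The map is connected without its root edge, which joins two different vertices and is not in a
cut with two edges. -/
structure IsCore {D : Type*} (R : RootedMap D) : Prop where
  bridgeless : R.Bridgeless
  not_loop : ¬ R.rot.SameCycle R.root (R.flip R.root)

theorem IsCore.congr {D E : Type*} {R : RootedMap D} {R' : RootedMap E} (h : R.Iso R')
    (c : R.IsCore) : R'.IsCore := by
  obtain ⟨e, h1, h2, h3⟩ := h
  refine ⟨c.bridgeless.congr h1 h2 h3, fun h => c.not_loop ?_⟩
  rwa [← h3, ← h2, sameCycle_congr h1] at h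

section

variable {D E : Type*} [Finite D] [Finite E] {R : RootedMap D} {h : D} {R' : RootedMap E}
  {m : R.Is4} {m' : R'.Is4}

theorem isCore_sub_iff (h1 : h ≠ R.root) (h2 : h ≠ R.flip R.root) :
    (R.sub h R' m m').IsCore ↔ R.IsCore := by
  constructor
  · intro c
    refine ⟨(bridgeless_sub_iff h1 h2).1 c.bridgeless, fun g => c.not_loop ?_⟩
    rw [flip_root_sub h1 h2]
    exact inl_sameCycle_sub.2 g
  · intro c
    refine ⟨(bridgeless_sub_iff h1 h2).2 c.bridgeless, fun g => c.not_loop ?_⟩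
    rw [flip_root_sub h1 h2] at g
    exact inl_sameCycle_sub.1 g

end

/-- A chain that starts at the initial vertex of the root edge is replaced by an edge: `R` is the
map `out` with `inn` substituted for the edge of the half-edge that corresponds to `x`. -/
theorem IsCore.exists_splitting {D : Type*} [Finite D] {R : RootedMap D} (c : R.IsCore) (m : R.Is4)
    {x y : D} {K : Set D} (k : R.IsLink x y K) (hne : K.Nonempty) (hx : R.rot.SameCycle R.root x)
    (hxr : x ≠ R.root) :
    ∃ (S : R.Splitting K (R.flip x) (R.flip y)) (x' : (Kᶜ : Set D)), (x' : D) = x ∧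
      R.Iso (S.out.sub x' S.inn S.out4 S.inn4) ∧ x' ≠ S.out.root ∧ x' ≠ S.out.flip S.out.root ∧
      (S.out.flip S.out.root : D) = R.flip R.root ∧ (S.out.flip x' : D) = y ∧ S.out.IsCore := by
  obtain ⟨S⟩ := R.exists_splitting m k.vertexSet k.root_notMem (k.bdry_eq hne)
    (R.flip.injective.ne k.ne)
  have hy : y ≠ R.root := by
    rintro rfl
    have := c.bridgeless.eq_empty_of_isLink k.symm
    exact hne.ne_empty this
  set x' : (Kᶜ : Set D) := ⟨R.flip (R.flip x), S.hf₁⟩ with hx'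
  have hxx : (x' : D) = x := R.flip_flip x
  have h1 : x' ≠ S.out.root := fun h => hxr (by rw [← S.out_root, ← h, hxx])
  have h2 : (S.out.flip S.out.root : D) = R.flip R.root := by
    rw [S.out_flip, S.out_root]
    · rw [S.out_root, R.flip_flip]; exact hxr.symm
    · rw [S.out_root, R.flip_flip]; exact hy.symm
  have h3 : x' ≠ S.out.flip S.out.root := fun h => c.not_loop (by rwa [← h2, ← h, hxx])
  refine ⟨S, x', hxx, S.iso, h1, h3, h2, ?_, (isCore_sub_iff h1 h3).1 (c.congr S.iso)⟩
  rw [hx', S.out_flip_cut]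
  exact R.flip_flip y

/-- The structure theorem: either all half-edges at the initial vertex are linked to the final
vertex, or one is, and the other two are linked to a common third vertex. Replacing the chains at
the initial vertex by edges reduces it to `Reduced.isDip_or_isMate`. -/
theorem IsCore.isDip_or_isMate {D : Type*} [Finite D] {R : RootedMap D} (c : R.IsCore) (m : R.Is4)
    (hK4 : ¬ HasK4 R.rot R.flip) : R.IsDip ∨ ∃ x, R.IsMate x := by
  induction hn : Nat.card D using Nat.strong_induction_on generalizing D with
  | _ n ih =>
  subst hn
  by_cases hred : R.Reduced
  · exact hred.isDip_or_isMate c.bridgeless m hK4 c.not_loop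
  unfold Reduced at hred
  push Not at hred
  obtain ⟨x, y, K, hx, hxr, k, hne⟩ := hred
  obtain ⟨S, x₀, -, ⟨e, h1, h2, h3⟩, hroot, hf, -, -, c'⟩ := c.exists_splitting m k hne hx hxr
  have hK4' : ¬ HasK4 S.out.rot S.out.flip := fun h =>
    hK4 ((hasK4_sub.2 (Or.inl h)).congr (symm_comm_of_comm h1) (symm_comm_of_comm h2))
  have hcard : Nat.card (Kᶜ : Set D) < Nat.card D := by
    obtain ⟨d, hd⟩ := hne
    exact Finite.card_subtype_lt (x := d) (fun h => h hd)
  rcases ih _ hcard c' S.out4 hK4' rfl with h | ⟨x', h⟩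
  · exact Or.inl ((isDip_congr h1 h2 h3).1 ((isDip_sub_iff hroot hf).2 h))
  · have := h.sub (R' := S.inn) (m := S.out4) (m' := S.inn4) hroot hf
    rw [← e.apply_symm_apply (Sum.inl x'), isMate_congr h1 h2 h3] at this
    exact Or.inr ⟨_, this⟩

end RootedMap

/-! ### Two parallel edges -/

section Faces

variable {D : Type*} [Finite D] {ρ α : Perm D} {x y p q a b : D}

/-- Two parallel edges form a closed curve on the sphere. Cutting along it splits each of their
two ends into two vertices and disconnects the map. -/
theorem not_isConn_of_parallel [DecidableEq D] (m : IsMap4 ρ α) (pl : Planar ρ α) (hne : x ≠ y)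
    (hxy : ρ.SameCycle x y) (hxy' : ρ.SameCycle (α x) (α y)) (hx : ¬ ρ.SameCycle x (α x)) :
    ¬ IsConn (ρ * swap x y * swap (α x) (α y)) (swap x y * α * swap x y) := by
  intro c
  have d1 : x ≠ α x := (m.flip_ne x).symm
  have d2 : x ≠ α y := fun h => hx (by rw [h]; rw [h] at hxy'; exact hxy'.symm)
  have d3 : y ≠ α x := fun h => hx (h ▸ hxy)
  have d4 : y ≠ α y := (m.flip_ne y).symm
  have hφ : ρ * swap x y * swap (α x) (α y) * (swap x y * α * swap x y) = ρ * α := by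
    have e1 : α * swap x y = swap (α x) (α y) * α := by rw [Equiv.mul_swap_eq_swap_mul]
    have e2 : swap (α x) (α y) * swap x y = swap x y * swap (α x) (α y) := by
      refine (disjoint_swap_swap ?_).commute
      simp [d1.symm, d2.symm, d3.symm, d4.symm, hne]
    calc _ = ρ * swap x y * (swap (α x) (α y) * swap x y) * (α * swap x y) := by
          simp only [mul_assoc]
      _ = ρ * (swap x y * swap x y) * (swap (α x) (α y) * swap (α x) (α y)) * α := by
          rw [e1, e2]; simp only [mul_assoc]
      _ = _ := by simp
  have h1 := c.numCycles_add_le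
  rw [hφ, numCycles_mul_comm (swap x y * α), Equiv.swap_mul_self_mul] at h1
  have h2 := two_mul_numCycles m.flip_flip m.flip_ne
  have h3 := numCycles_mul_swap_of_sameCycle hxy hne
  have h4 : (ρ * swap x y).SameCycle (α x) (α y) := by
    refine (hxy'.mem_of_forall_mem (S := {d | ρ.SameCycle (α x) d ∧
      (ρ * swap x y).SameCycle (α x) d}) ?_ ⟨SameCycle.refl _ _, SameCycle.refl _ _⟩).2
    rintro d ⟨g1, g2⟩
    refine ⟨sameCycle_apply_right.2 g1, ?_⟩
    have : (ρ * swap x y) d = ρ d := by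
      rw [mul_apply, Equiv.swap_apply_of_ne_of_ne]
      · rintro rfl; exact hx g1.symm
      · rintro rfl; exact hx (hxy.trans g1.symm)
    rw [← this]
    exact sameCycle_apply_right.2 g2
  have h5 := numCycles_mul_swap_of_sameCycle h4 (α.injective.ne hne)
  unfold Planar at pl
  omega

/-- Two parallel edges `x, y` with no chain from `p`, one of the other half-edges at their first
end, to another half-edge at one of their ends form a face. -/
theorem IsMap4.digon (m : IsMap4 ρ α) (c : IsConn ρ α) (pl : Planar ρ α) (hne : x ≠ y)
    (hxy : ρ.SameCycle x y) (hxy' : ρ.SameCycle (α x) (α y)) (hx : ¬ ρ.SameCycle x (α x))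
    (hp : ρ.SameCycle x p) (hpx : p ≠ x) (hpy : p ≠ y)
    (hno : ∀ K w, IsVertexSet ρ K → x ∉ K → α x ∉ K → w ≠ p → w ≠ x → w ≠ y → w ≠ α x → w ≠ α y →
      (ρ.SameCycle x w ∨ ρ.SameCycle (α x) w) →
      ¬ ∀ d, (d ∈ K ∨ d = p ∨ d = w) → (α d ∈ K ∨ α d = p ∨ α d = w)) :
    (ρ y = x ∧ ρ (α x) = α y) ∨ (ρ x = y ∧ ρ (α y) = α x) := by
  classical
  have d2 : x ≠ α y := fun h => hx (by rw [h]; rw [h] at hxy'; exact hxy'.symm)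
  have d3 : y ≠ α x := fun h => hx (h ▸ hxy)
  obtain ⟨q, hq, hqx, hqy, hqp, hs⟩ := m.exists_fourth (SameCycle.refl ρ x) hxy hp hne hpx.symm
    hpy.symm
  have d1 : x ≠ α x := (m.flip_ne x).symm
  have d4 : y ≠ α y := (m.flip_ne y).symm
  have hne' : α x ≠ α y := α.injective.ne hne
  have hst : ∀ d, ρ.SameCycle x d → ¬ ρ.SameCycle (α x) d := fun d h h' => hx (h.trans h'.symm)
  obtain ⟨a, ha, hax, hay, b, hb, hbx, hby, hba, ht⟩ : ∃ a, ρ.SameCycle (α x) a ∧ a ≠ α x ∧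
      a ≠ α y ∧ ∃ b, ρ.SameCycle (α x) b ∧ b ≠ α x ∧ b ≠ α y ∧ b ≠ a ∧
        ∀ d, ρ.SameCycle (α x) d → d = α x ∨ d = α y ∨ d = a ∨ d = b := by
    obtain ⟨a, ha, hax, hay⟩ : ∃ a, ρ.SameCycle (α x) a ∧ a ≠ α x ∧ a ≠ α y := by
      have h1 : ρ.SameCycle (α x) (ρ (α x)) := sameCycle_apply_right.2 (SameCycle.refl _ _)
      by_cases h : ρ (α x) = α y
      · refine ⟨ρ (ρ (α x)), sameCycle_apply_right.2 h1, m.rot2_ne _, fun h2 => ?_⟩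
        rw [← h] at h2
        exact m.rot_ne _ h2
      · exact ⟨_, h1, m.rot_ne _, h⟩
    obtain ⟨b, hb, hbx, hby, hba, hall⟩ := m.exists_fourth (SameCycle.refl ρ (α x)) hxy' ha hne'
      hax.symm hay.symm
    exact ⟨a, ha, hax, hay, b, hb, hbx, hby, hba, hall⟩
  set ρ' := ρ * swap x y * swap (α x) (α y) with hρ'
  set α' := swap x y * α * swap x y with hα'
  have r1 : ρ' x = ρ y := by
    rw [hρ', mul_apply, Equiv.swap_apply_of_ne_of_ne d1 d2, mul_apply, Equiv.swap_apply_left]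
  have r2 : ρ' y = ρ x := by
    rw [hρ', mul_apply, Equiv.swap_apply_of_ne_of_ne d3 d4, mul_apply, Equiv.swap_apply_right]
  have r3 : ρ' (α x) = ρ (α y) := by
    rw [hρ', mul_apply, Equiv.swap_apply_left, mul_apply,
      Equiv.swap_apply_of_ne_of_ne d2.symm d4.symm]
  have r4 : ρ' (α y) = ρ (α x) := by
    rw [hρ', mul_apply, Equiv.swap_apply_right, mul_apply,
      Equiv.swap_apply_of_ne_of_ne d1.symm d3.symm]
  have r5 : ∀ d, d ≠ x → d ≠ y → d ≠ α x → d ≠ α y → ρ' d = ρ d := fun d e1 e2 e3 e4 => by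
    rw [hρ', mul_apply, Equiv.swap_apply_of_ne_of_ne e3 e4, mul_apply,
      Equiv.swap_apply_of_ne_of_ne e1 e2]
  have a1 : α' x = α y := by
    rw [hα', mul_apply, Equiv.swap_apply_left, mul_apply,
      Equiv.swap_apply_of_ne_of_ne d2.symm d4.symm]
  have a2 : α' y = α x := by
    rw [hα', mul_apply, Equiv.swap_apply_right, mul_apply,
      Equiv.swap_apply_of_ne_of_ne d1.symm d3.symm]
  have a5 : ∀ d, d ≠ x → d ≠ y → d ≠ α x → d ≠ α y → α' d = α d := fun d e1 e2 e3 e4 => by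
    rw [hα', mul_apply, Equiv.swap_apply_of_ne_of_ne e1 e2, mul_apply,
      Equiv.swap_apply_of_ne_of_ne]
    · exact fun h => e3 (by rw [← h, m.flip_flip])
    · exact fun h => e4 (by rw [← h, m.flip_flip])
  -- a part that consists of the two edges only is a face
  have small : ∀ S, IsVertexSet ρ' S → IsVertexSet α' S → S.Nonempty →
      (∀ d ∈ S, d = x ∨ d = y ∨ d = α x ∨ d = α y) →
      (ρ y = x ∧ ρ (α x) = α y) ∨ (ρ x = y ∧ ρ (α y) = α x) := by
    intro S h1 h2 hSne h3
    have hs' : ∀ d ∈ S, ρ.SameCycle x d → d = x ∨ d = y := fun d hd h => by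
      rcases h3 d hd with rfl | rfl | rfl | rfl
      · exact Or.inl rfl
      · exact Or.inr rfl
      · exact (hx h).elim
      · exact (hst _ h hxy').elim
    have ht' : ∀ d ∈ S, ρ.SameCycle (α x) d → d = α x ∨ d = α y := fun d hd h => by
      rcases h3 d hd with rfl | rfl | rfl | rfl
      · exact (hx h.symm).elim
      · exact (hst _ hxy h).elim
      · exact Or.inl rfl
      · exact Or.inr rfl
    have hxS : x ∈ S ↔ α y ∈ S := by rw [← h2 x, a1]
    have hyS : y ∈ S ↔ α x ∈ S := by rw [← h2 y, a2]
    have hor : x ∈ S ∨ y ∈ S := by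
      obtain ⟨d, hd⟩ := hSne
      rcases h3 d hd with rfl | rfl | rfl | rfl
      exacts [Or.inl hd, Or.inr hd, Or.inr (hyS.2 hd), Or.inl (hxS.2 hd)]
    rcases hor with h | h
    · left
      have g1 := (h1 x).2 h
      have g2 := (h1 (α y)).2 (hxS.1 h)
      rw [r1] at g1
      rw [r4] at g2
      exact ⟨(hs' _ g1 (sameCycle_apply_right.2 hxy)).resolve_right (m.rot_ne _),
        (ht' _ g2 (sameCycle_apply_right.2 (SameCycle.refl _ _))).resolve_left (m.rot_ne _)⟩
    · right
      have g1 := (h1 y).2 h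
      have g2 := (h1 (α x)).2 (hyS.1 h)
      rw [r2] at g1
      rw [r3] at g2
      exact ⟨(hs' _ g1 (sameCycle_apply_right.2 (SameCycle.refl _ _))).resolve_left (m.rot_ne _),
        (ht' _ g2 (sameCycle_apply_right.2 hxy')).resolve_right (m.rot_ne _)⟩
  have hKv : ∀ S, IsVertexSet ρ' S →
      IsVertexSet ρ (S \ (vertexOf ρ x ∪ vertexOf ρ (α x))) := by
    intro S h1 d
    have hv := (isVertexSet_vertexOf ρ x).union (isVertexSet_vertexOf ρ (α x)) d
    refine ⟨fun ⟨g1, g2⟩ => ?_, fun ⟨g1, g2⟩ => ?_⟩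
    all_goals
      have g3 : d ∉ vertexOf ρ x ∪ vertexOf ρ (α x) := by tauto
      have g4 : ρ' d = ρ d := r5 d (by rintro rfl; exact g3 (Or.inl (SameCycle.refl _ _)))
        (by rintro rfl; exact g3 (Or.inl hxy)) (by rintro rfl; exact g3 (Or.inr (SameCycle.refl _ _)))
        (by rintro rfl; exact g3 (Or.inr hxy'))
      have g5 := h1 d
      rw [g4] at g5
      rw [Set.mem_sdiff] at *
      tauto
  have hmem : ∀ S, ∀ d ∈ S, (d = x ∨ d = y ∨ d = α x ∨ d = α y) ∨
      d ∈ S \ (vertexOf ρ x ∪ vertexOf ρ (α x)) ∨ d = p ∨ d = q ∨ d = a ∨ d = b := by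
    intro S d hd
    by_cases h1 : ρ.SameCycle x d
    · have := hs d h1; tauto
    by_cases h2 : ρ.SameCycle (α x) d
    · have := ht d h2; tauto
    · exact Or.inr (Or.inl ⟨hd, fun h => h.elim h1 h2⟩)
  -- the four half-edges `p, q, a, b` do not belong to the two parallel edges
  have hP : ∀ z, z = p ∨ z = q ∨ z = a ∨ z = b → z ≠ x ∧ z ≠ y ∧ z ≠ α x ∧ z ≠ α y ∧
      (ρ.SameCycle x z ∨ ρ.SameCycle (α x) z) := by
    have hs2 : ∀ z, ρ.SameCycle x z → z ≠ α x ∧ z ≠ α y := fun z hz =>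
      ⟨fun h => hx (h ▸ hz), fun h => hst _ hz (h ▸ hxy')⟩
    have ht2 : ∀ z, ρ.SameCycle (α x) z → z ≠ x ∧ z ≠ y := fun z hz =>
      ⟨fun h => hx (h ▸ hz).symm, fun h => hst _ (h ▸ hxy) hz⟩
    rintro z (rfl | rfl | rfl | rfl)
    · exact ⟨hpx, hpy, (hs2 _ hp).1, (hs2 _ hp).2, Or.inl hp⟩
    · exact ⟨hqx, hqy, (hs2 _ hq).1, (hs2 _ hq).2, Or.inl hq⟩
    · exact ⟨(ht2 _ ha).1, (ht2 _ ha).2, hax, hay, Or.inr ha⟩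
    · exact ⟨(ht2 _ hb).1, (ht2 _ hb).2, hbx, hby, Or.inr hb⟩
  have hcl : ∀ S, IsVertexSet α' S → ∀ d ∈ S, d ≠ x → d ≠ y → d ≠ α x → d ≠ α y →
      α d ∈ S \ (vertexOf ρ x ∪ vertexOf ρ (α x)) ∨
        (α d ∈ S ∧ (α d = p ∨ α d = q ∨ α d = a ∨ α d = b)) := by
    intro S h2 d hd e1 e2 e3 e4
    have h3 : α d ∈ S := by rw [← a5 d e1 e2 e3 e4]; exact (h2 d).2 hd
    rcases hmem S (α d) h3 with (h | h | h | h) | h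
    · exact (e3 (by rw [← h, m.flip_flip])).elim
    · exact (e4 (by rw [← h, m.flip_flip])).elim
    · exact (e1 (α.injective h)).elim
    · exact (e2 (α.injective h)).elim
    · exact h.imp_right fun h => ⟨h3, h⟩
  have hK : ∀ S : Set D, x ∉ S \ (vertexOf ρ x ∪ vertexOf ρ (α x)) ∧
      α x ∉ S \ (vertexOf ρ x ∪ vertexOf ρ (α x)) := fun S =>
    ⟨fun h => h.2 (Or.inl (SameCycle.refl _ _)), fun h => h.2 (Or.inr (SameCycle.refl _ _))⟩
  have hKn : ∀ (S : Set D) z, z = p ∨ z = q ∨ z = a ∨ z = b →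
      z ∉ S \ (vertexOf ρ x ∪ vertexOf ρ (α x)) := fun S z hz h => h.2 (hP z hz).2.2.2.2
  have hKe : ∀ (S : Set D) d, d ∈ S \ (vertexOf ρ x ∪ vertexOf ρ (α x)) →
      d ≠ x ∧ d ≠ y ∧ d ≠ α x ∧ d ≠ α y := by
    refine fun S d hd => ⟨?_, ?_, ?_, ?_⟩ <;> rintro rfl
    exacts [(hK S).1 hd, hd.2 (Or.inl hxy), (hK S).2 hd, hd.2 (Or.inr hxy')]
  -- a part that contains exactly one of them would have a boundary with one edge
  have one : ∀ S, IsVertexSet ρ' S → IsVertexSet α' S → ∀ z, z = p ∨ z = q ∨ z = a ∨ z = b →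
      z ∈ S → (∀ w, w = p ∨ w = q ∨ w = a ∨ w = b → w ∈ S → w = z) → False := by
    intro S h1 h2 z hz hzS hz'
    set K := S \ (vertexOf ρ x ∪ vertexOf ρ (α x)) with hKdef
    have hcl' : ∀ d, d ∈ S → d ≠ x → d ≠ y → d ≠ α x → d ≠ α y → α d ∈ K ∨ α d = z :=
      fun d hd e1 e2 e3 e4 => (hcl S h2 d hd e1 e2 e3 e4).imp_right fun h => hz' _ h.2 h.1
    have hb : bdry α K = ∅ := m.bdry_eq_empty_of_subset_singleton (hKv S h1) (a := α z) (by
      rintro d ⟨hd, hd'⟩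
      obtain ⟨e1, e2, e3, e4⟩ := hKe S d hd
      rw [← (hcl' d hd.1 e1 e2 e3 e4).resolve_left hd', m.flip_flip]
      rfl)
    have hKe : ¬ K.Nonempty := fun h => by
      have := c.bdry_nonempty (hKv S h1) h ⟨x, (hK S).1⟩
      rw [hb] at this
      exact Set.not_nonempty_empty this
    obtain ⟨e1, e2, e3, e4, -⟩ := hP z hz
    rcases hcl' z hzS e1 e2 e3 e4 with h | h
    · exact hKe ⟨_, h⟩
    · exact m.flip_ne z h
  -- a part that contains exactly two of them is a chain
  have two : ∀ S, IsVertexSet ρ' S → IsVertexSet α' S → p ∈ S → ∀ w, w ≠ p →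
      w = p ∨ w = q ∨ w = a ∨ w = b → w ∈ S →
      (∀ u, u = p ∨ u = q ∨ u = a ∨ u = b → u ∈ S → u = p ∨ u = w) → False := by
    intro S h1 h2 hpS w hwp hw hwS hall
    obtain ⟨e1, e2, e3, e4, e5⟩ := hP w hw
    refine hno _ w (hKv S h1) (hK S).1 (hK S).2 hwp e1 e2 e3 e4 e5 fun d hd => ?_
    have hd' : d ∈ S ∧ d ≠ x ∧ d ≠ y ∧ d ≠ α x ∧ d ≠ α y := by
      rcases hd with hd | rfl | rfl
      · exact ⟨hd.1, hKe S d hd⟩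
      · obtain ⟨e1, e2, e3, e4, -⟩ := hP d (Or.inl rfl)
        exact ⟨hpS, e1, e2, e3, e4⟩
      · exact ⟨hwS, e1, e2, e3, e4⟩
    exact (hcl S h2 d hd'.1 hd'.2.1 hd'.2.2.1 hd'.2.2.2.1 hd'.2.2.2.2).imp_right
      fun h => hall _ h.2 h.1
  have all : ∀ S, IsVertexSet ρ' S → IsVertexSet α' S → p ∈ S → q ∈ S ∧ a ∈ S ∧ b ∈ S := by
    intro S h1 h2 hpS
    have one' := one _ h1.compl h2.compl
    have two' := two S h1 h2 hpS
    have hap : a ≠ p := fun h => hst _ hp (h ▸ ha)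
    have hbp : b ≠ p := fun h => hst _ hp (h ▸ hb)
    by_cases hqS : q ∈ S <;> by_cases haS : a ∈ S <;> by_cases hbS : b ∈ S
    · exact ⟨hqS, haS, hbS⟩
    · refine (one' b (by tauto) hbS ?_).elim
      rintro u (rfl | rfl | rfl | rfl) hu <;> first | rfl | (exact absurd ‹_› hu)
    · refine (one' a (by tauto) haS ?_).elim
      rintro u (rfl | rfl | rfl | rfl) hu <;> first | rfl | (exact absurd ‹_› hu)
    · refine (two' q hqp (by tauto) hqS ?_).elim
      rintro u (rfl | rfl | rfl | rfl) hu <;> tauto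
    · refine (one' q (by tauto) hqS ?_).elim
      rintro u (rfl | rfl | rfl | rfl) hu <;> first | rfl | (exact absurd ‹_› hu)
    · refine (two' a hap (by tauto) haS ?_).elim
      rintro u (rfl | rfl | rfl | rfl) hu <;> tauto
    · refine (two' b hbp (by tauto) hbS ?_).elim
      rintro u (rfl | rfl | rfl | rfl) hu <;> tauto
    · refine (one S h1 h2 p (by tauto) hpS ?_).elim
      rintro u (rfl | rfl | rfl | rfl) hu <;> tauto
  -- so one of the parts contains none of them
  have none : ∀ S, IsVertexSet ρ' S → IsVertexSet α' S → S.Nonempty → p ∉ S →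
      (ρ y = x ∧ ρ (α x) = α y) ∨ (ρ x = y ∧ ρ (α y) = α x) := by
    intro S h1 h2 hSne hpS
    have hno : ∀ z, z = p ∨ z = q ∨ z = a ∨ z = b → z ∉ S := by
      obtain ⟨g1, g2, g3⟩ := all _ h1.compl h2.compl hpS
      rintro z (rfl | rfl | rfl | rfl) <;> assumption
    refine small S h1 h2 hSne fun d hd => ?_
    rcases hmem S d hd with h | h | h
    · exact h
    · have := c _ ⟨d, h⟩ (fun e he => (hKv S h1 e).2 he) fun e he => by
        obtain ⟨e1, e2, e3, e4⟩ := hKe S e he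
        exact (hcl S h2 e he.1 e1 e2 e3 e4).resolve_right fun h => hno _ h.2 h.1
      exact ((hK S).1 (this ▸ trivial)).elim
    · exact (hno d h hd).elim
  have hnc := not_isConn_of_parallel m pl hne hxy hxy' hx
  rw [IsConn] at hnc
  push Not at hnc
  obtain ⟨S, hSne, h1, h2, hSu⟩ := hnc
  have h1 := IsVertexSet.of_forall_mem h1
  have h2 := IsVertexSet.of_forall_mem h2
  by_cases hpS : p ∈ S
  · refine none _ h1.compl h2.compl ?_ fun h => h hpS
    by_contra h
    exact hSu (Set.compl_empty_iff.1 (Set.not_nonempty_iff_eq_empty.1 h))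
  · exact none _ h1 h2 hSne hpS

/-- If all edges at the vertex of `x` lead to one other vertex, then consecutive ones form faces. -/
theorem IsMap4.dipole (m : IsMap4 ρ α) (c : IsConn ρ α) (pl : Planar ρ α)
    (hx : ¬ ρ.SameCycle x (α x))
    (hall : ∀ z, ρ.SameCycle x z → ρ.SameCycle (α x) (α z)) : ρ (α (ρ x)) = α x := by
  classical
  have hxy : ρ.SameCycle x (ρ x) := sameCycle_apply_right.2 (SameCycle.refl _ _)
  have hne := (m.rot_ne x).symm
  have hst : ∀ d, ρ.SameCycle x d → ¬ ρ.SameCycle (α x) d := fun d h h' => hx (h.trans h'.symm)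
  have d1 : x ≠ α x := (m.flip_ne x).symm
  have d2 : x ≠ α (ρ x) := fun h => hst x (SameCycle.refl _ _) (by
    have := hall _ hxy; rwa [← h] at this)
  have d3 : ρ x ≠ α x := fun h => hst _ hxy (h ▸ SameCycle.refl _ _)
  have d4 : ρ x ≠ α (ρ x) := (m.flip_ne _).symm
  have hnc := not_isConn_of_parallel m pl hne hxy (hall _ hxy) hx
  set ρ' := ρ * swap x (ρ x) * swap (α x) (α (ρ x)) with hρ'
  set α' := swap x (ρ x) * α * swap x (ρ x) with hα'
  have key : ∀ z, ρ.SameCycle x z → z ≠ x → z ≠ ρ x → ρ' z = ρ z ∧ α' z = α z := by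
    intro z hz e1 e2
    constructor
    · rw [hρ', mul_apply, Equiv.swap_apply_of_ne_of_ne, mul_apply,
        Equiv.swap_apply_of_ne_of_ne e1 e2]
      · rintro rfl; exact hst _ hz (SameCycle.refl _ _)
      · rintro rfl; exact hst _ hz (hall _ hxy)
    · rw [hα', mul_apply, Equiv.swap_apply_of_ne_of_ne e1 e2, mul_apply,
        Equiv.swap_apply_of_ne_of_ne]
      · rintro h; exact hst _ (SameCycle.refl _ _) (h ▸ hall _ hz)
      · rintro h; exact hst _ hxy (h ▸ hall _ hz)
  have hxx := SameCycle.refl ρ x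
  have h2 : ρ.SameCycle x (ρ (ρ x)) := sameCycle_apply_right.2 hxy
  have h3 : ρ.SameCycle x (ρ (ρ (ρ x))) := sameCycle_apply_right.2 h2
  obtain ⟨k2, l2⟩ := key _ h2 (m.rot2_ne _) (m.rot_ne _)
  obtain ⟨k3, l3⟩ := key _ h3 (m.rot3_ne _) (m.rot2_ne _)
  rw [m.rot4] at k3
  have k1 : ρ' x = ρ (ρ x) := by
    rw [hρ', mul_apply, Equiv.swap_apply_of_ne_of_ne d1 d2, mul_apply, Equiv.swap_apply_left]
  have k4 : ρ' (α x) = ρ (α (ρ x)) := by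
    rw [hρ', mul_apply, Equiv.swap_apply_left, mul_apply,
      Equiv.swap_apply_of_ne_of_ne d2.symm d4.symm]
  have l1 : α' x = α (ρ x) := by
    rw [hα', mul_apply, Equiv.swap_apply_left, mul_apply,
      Equiv.swap_apply_of_ne_of_ne d2.symm d4.symm]
  have l4 : α' (ρ x) = α x := by
    rw [hα', mul_apply, Equiv.swap_apply_right, mul_apply,
      Equiv.swap_apply_of_ne_of_ne d1.symm d3.symm]
  have ht : ∀ d, ρ.SameCycle (α x) d → ρ.SameCycle x (α d) := by
    have : α '' vertexOf ρ x = vertexOf ρ (α x) := by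
      refine Set.eq_of_subset_of_ncard_le ?_ ?_ (Set.toFinite _)
      · rintro _ ⟨z, hz, rfl⟩
        exact hall z hz
      · rw [Set.ncard_image_of_injective _ α.injective, m.ncard_vertexOf, m.ncard_vertexOf]
    intro d hd
    have hd' : d ∈ α '' vertexOf ρ x := this ▸ hd
    obtain ⟨z, hz, rfl⟩ := hd'
    rw [m.flip_flip]; exact hz
  have hW : ∀ d, ρ.SameCycle x d ∨ ρ.SameCycle (α x) d := by
    intro d
    have := c (vertexOf ρ x ∪ vertexOf ρ (α x)) ⟨x, Or.inl hxx⟩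
      (fun d hd => hd.imp sameCycle_apply_right.2 sameCycle_apply_right.2) fun d hd =>
        hd.symm.imp (ht d) (hall d)
    have hd : d ∈ vertexOf ρ x ∪ vertexOf ρ (α x) := this ▸ trivial
    exact hd
  have main : ∀ S, IsVertexSet ρ' S → IsVertexSet α' S → S ≠ Set.univ → x ∈ S →
      ρ (α (ρ x)) = α x := by
    intro S h1 h2' hSu hxS
    have s2 : ρ (ρ x) ∈ S := k1 ▸ (h1 x).2 hxS
    have s3 : ρ (ρ (ρ x)) ∈ S := k2 ▸ (h1 _).2 s2
    have t1 : α (ρ x) ∈ S := l1 ▸ (h2' x).2 hxS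
    have t2 : α (ρ (ρ x)) ∈ S := l2 ▸ (h2' _).2 s2
    have t3 : α (ρ (ρ (ρ x))) ∈ S := l3 ▸ (h2' _).2 s3
    have s1 : ρ x ∉ S := by
      intro s1
      have t0 : α x ∈ S := l4 ▸ (h2' _).2 s1
      refine hSu (Set.eq_univ_of_forall fun d => ?_)
      rcases hW d with h | h
      · rcases m.sameCycle_iff.1 h with rfl | rfl | rfl | rfl <;> assumption
      · rw [← m.flip_flip d]
        rcases m.sameCycle_iff.1 (ht d h) with h | h | h | h <;> rw [h] <;> assumption
    have t0 : ρ (α (ρ x)) ∉ S := by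
      rw [← k4, h1, ← l4, h2']; exact s1
    have hsc : ρ.SameCycle x (α (ρ (α (ρ x)))) := ht _ (sameCycle_apply_right.2 (hall _ hxy))
    rw [← m.flip_flip (ρ (α (ρ x)))] at t0 ⊢
    rcases m.sameCycle_iff.1 hsc with h | h | h | h
    · rw [h]
    · rw [h] at t0; exact (t0 t1).elim
    · rw [h] at t0; exact (t0 t2).elim
    · rw [h] at t0; exact (t0 t3).elim
  rw [IsConn] at hnc
  push Not at hnc
  obtain ⟨S, hSne, h1, h2', hSu⟩ := hnc
  have h1 := IsVertexSet.of_forall_mem h1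
  have h2' := IsVertexSet.of_forall_mem h2'
  by_cases hxS : x ∈ S
  · exact main S h1 h2' hSu hxS
  · refine main _ h1.compl h2'.compl (fun h => ?_) hxS
    rw [Set.compl_univ_iff] at h
    exact hSne.ne_empty h

/-- The two half-edges of a loop are not opposite to each other at their vertex. -/
theorem IsMap4.flip_ne_rot_rot (m : IsMap4 ρ α) (c : IsConn ρ α) (pl : Planar ρ α) (x : D) :
    α x ≠ ρ (ρ x) := by
  classical
  intro hx
  have hne := (m.flip_ne x).symm
  have hxx : ρ.SameCycle x (α x) := m.sameCycle_iff.2 (Or.inr (Or.inr (Or.inl hx)))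
  set ρ' := ρ * swap x (α x) with hρ'
  set α' := swap x (α x) * α with hα'
  have hnc : ¬ IsConn ρ' α' := by
    intro c'
    have h1 := c'.numCycles_add_le
    have h2 : ρ' * α' = ρ * α := by
      rw [hρ', hα', mul_assoc, Equiv.swap_mul_self_mul]
    have h3 := numCycles_mul_swap_of_sameCycle hxx hne
    have h4 := numCycles_mul_swap_of_sameCycle (f := α)
      (sameCycle_apply_right.2 (SameCycle.refl α x)) hne
    have h5 := two_mul_numCycles m.flip_flip m.flip_ne
    rw [h2, hα', hρ', numCycles_mul_comm (swap x (α x))] at h1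
    unfold Planar at pl
    omega
  have r1 : ρ' x = ρ (ρ (ρ x)) := by rw [hρ', mul_apply, Equiv.swap_apply_left, hx]
  have r2 : ρ' (α x) = ρ x := by rw [hρ', mul_apply, Equiv.swap_apply_right]
  have r5 : ∀ d, d ≠ x → d ≠ α x → ρ' d = ρ d := fun d e1 e2 => by
    rw [hρ', mul_apply, Equiv.swap_apply_of_ne_of_ne e1 e2]
  have a5 : ∀ d, d ≠ x → d ≠ α x → α' d = α d := fun d e1 e2 => by
    rw [hα', mul_apply, Equiv.swap_apply_of_ne_of_ne]
    · exact fun h => e2 (by rw [← h, m.flip_flip])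
    · exact fun h => e1 (α.injective h)
  have n1 : ρ x ≠ α x := by rw [hx]; exact (m.rot_ne _).symm
  have n3 : ρ (ρ (ρ x)) ≠ α x := by rw [hx]; exact m.rot_ne _
  have r3 : ρ' (ρ x) = α x := by rw [r5 _ (m.rot_ne _) n1, hx]
  have r4 : ρ' (ρ (ρ (ρ x))) = x := by rw [r5 _ (m.rot3_ne _) n3, m.rot4]
  -- a part that contains `x` but not `α x` would have a boundary with one edge
  have main : ∀ S, IsVertexSet ρ' S → IsVertexSet α' S → S ≠ Set.univ → x ∉ S := by
    intro S h1 h2 hSu hxS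
    have s3 : ρ (ρ (ρ x)) ∈ S := r1 ▸ (h1 x).2 hxS
    have s2 : α x ∉ S := by
      intro s2
      have s1 : ρ x ∈ S := r2 ▸ (h1 _).2 s2
      refine hSu (c S ⟨x, hxS⟩ (fun d hd => ?_) fun d hd => ?_)
      · by_cases e1 : d = x
        · rwa [e1]
        by_cases e2 : d = α x
        · rw [e2]; rw [hx]; exact s3
        · rw [← r5 d e1 e2]; exact (h1 d).2 hd
      · by_cases e1 : d = x
        · rwa [e1]
        by_cases e2 : d = α x
        · rw [e2, m.flip_flip]; exact hxS
        · rw [← a5 d e1 e2]; exact (h2 d).2 hd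
    have s1 : ρ x ∉ S := by rw [← h1, r3]; exact s2
    set K := S \ vertexOf ρ x with hK
    have hKv : IsVertexSet ρ K := by
      refine IsVertexSet.of_forall_mem fun d hd => ⟨?_, fun h => hd.2 (sameCycle_apply_right.1 h)⟩
      rw [← r5 d (fun h => hd.2 (h ▸ SameCycle.refl _ _)) fun h => hd.2 (h ▸ hxx)]
      exact (h1 d).2 hd.1
    have hmem : ∀ d ∈ S, d ∈ K ∨ d = x ∨ d = ρ (ρ (ρ x)) := by
      intro d hd
      by_cases h : ρ.SameCycle x d
      · rcases m.sameCycle_iff.1 h with h | h | h | h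
        · exact Or.inr (Or.inl h)
        · exact (s1 (h ▸ hd)).elim
        · rw [← hx] at h; exact (s2 (h ▸ hd)).elim
        · exact Or.inr (Or.inr h)
      · exact Or.inl ⟨hd, h⟩
    have hxK : x ∉ K := fun h => h.2 (SameCycle.refl _ _)
    have hb : bdry α K = ∅ := by
      refine m.bdry_eq_empty_of_subset_singleton hKv (a := α (ρ (ρ (ρ x)))) ?_
      rintro d ⟨hd, hd'⟩
      have e1 : d ≠ x := fun h => hxK (h ▸ hd)
      have e2 : d ≠ α x := fun h => s2 (h ▸ hd.1)
      have h3 : α d ∈ S := by rw [← a5 d e1 e2]; exact (h2 d).2 hd.1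
      rcases hmem _ h3 with h | h | h
      · exact (hd' h).elim
      · exact (e2 (by rw [← h, m.flip_flip])).elim
      · rw [← h, m.flip_flip]; rfl
    have hKe : ¬ K.Nonempty := fun h => by
      have := c.bdry_nonempty hKv h ⟨x, hxK⟩
      rw [hb] at this
      exact Set.not_nonempty_empty this
    have h3 : α (ρ (ρ (ρ x))) ∈ S := by rw [← a5 _ (m.rot3_ne _) n3]; exact (h2 _).2 s3
    rcases hmem _ h3 with h | h | h
    · exact hKe ⟨_, h⟩
    · exact n3 (by rw [← m.flip_flip (ρ (ρ (ρ x))), h])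
    · exact m.flip_ne _ h
  rw [IsConn] at hnc
  push Not at hnc
  obtain ⟨S, hSne, h1, h2, hSu⟩ := hnc
  have h1 := IsVertexSet.of_forall_mem h1
  have h2 := IsVertexSet.of_forall_mem h2
  refine main _ h1.compl h2.compl (fun h => ?_) (main S h1 h2 hSu)
  rw [Set.compl_univ_iff] at h
  exact hSne.ne_empty h

namespace RootedMap

variable {R : RootedMap D}

/-- In a map in which exactly one chain joins the two ends of the root edge, there is no chain
between two of the remaining half-edges at these two vertices. -/
theorem IsCore.not_chain (c : R.IsCore) (m : R.Is4) (hx : R.rot.SameCycle R.root x)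
    (hxr : x ≠ R.root)
    (hp : R.rot.SameCycle R.root p) (hpr : p ≠ R.root) (hpx : p ≠ x) (hL : ¬ R.LinkedToT p)
    {K : Set D} {w : D} (hK : IsVertexSet R.rot K) (hr : R.root ∉ K) (hwp : w ≠ p)
    (hwr : w ≠ R.root) (hwx : w ≠ x)
    (hw : R.rot.SameCycle R.root w ∨ R.rot.SameCycle (R.flip R.root) w)
    (hcl : ∀ d, (d ∈ K ∨ d = p ∨ d = w) → (R.flip d ∈ K ∨ R.flip d = p ∨ R.flip d = w)) :
    False := by
  have hr' : R.flip R.root ∉ K := by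
    intro h
    have := hcl _ (Or.inl h)
    rw [R.flip_flip] at this
    rcases this with h | h | h
    exacts [hr h, hpr h.symm, hwr h.symm]
  rcases hw with hw | hw
  · obtain ⟨v, -, -, -, -, hall⟩ := m.exists_fourth hx hp hw hpx.symm hwx.symm hwp.symm
    have hs : ∀ d, R.rot.SameCycle R.root d → d = R.root ∨ d = x ∨ d = p ∨ d = w := by
      intro d hd
      rcases hall _ (SameCycle.refl _ _) with h | h | h | rfl
      · exact (hxr h.symm).elim
      · exact (hpr h.symm).elim
      · exact (hwr h.symm).elim
      · have := hall d hd; tauto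
    have hv := (isVertexSet_vertexOf R.rot R.root).union hK
    have := c.bridgeless x hxr (fun h => c.not_loop (h ▸ hx)) _ ⟨_, Or.inl (self_mem_vertexOf _ _)⟩
      (fun d hd => (hv d).2 hd) fun d hd e1 _ e3 _ => by
        have h1 : R.flip d ∈ K ∨ R.flip d = p ∨ R.flip d = w := by
          refine hcl d ?_
          rcases hd with hd | hd
          · have := hs d hd; tauto
          · exact Or.inl hd
        rcases h1 with h | rfl | rfl
        exacts [Or.inr h, Or.inl hp, Or.inl hw]
    have h2 : R.flip R.root ∈ vertexOf R.rot R.root ∪ K := this ▸ trivial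
    exact h2.elim c.not_loop hr'
  · refine hL ⟨w, hw, K, hK, hr, fun h => ?_, fun h => ?_, hwp.symm, hcl⟩
    · exact hr ((hK.mem_iff hp).2 h)
    · exact hr' ((hK.mem_iff hw).2 h)

/-- If an edge is parallel to the root edge and not all half-edges at the initial vertex are linked
to the final vertex, then the edge forms a digonal face with the root edge, on one of its two sides. -/
theorem IsCore.face_or_face (c : R.IsCore) (m : R.Is4) (hx : R.rot.SameCycle R.root x)
    (hxr : x ≠ R.root) (hx' : R.rot.SameCycle (R.flip R.root) (R.flip x))
    (hp : R.rot.SameCycle R.root p) (hpr : p ≠ R.root) (hpx : p ≠ x) (hL : ¬ R.LinkedToT p) :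
    (R.rot x = R.root ∧ R.rot (R.flip R.root) = R.flip x) ∨
      (R.rot R.root = x ∧ R.rot (R.flip x) = R.flip R.root) :=
  m.digon R.isConn R.isPlanar hxr.symm hx hx' c.not_loop hp hpr hpx
    fun _ _ hK hr _ hwp hwr hwx _ _ hw hcl => c.not_chain m hx hxr hp hpr hpx hL hK hr hwp hwr
      hwx hw hcl

end RootedMap

end Faces

/-! ### Pinching two edges at a new vertex -/

theorem not_sameCycle_of_fixed {D : Type*} {f : Perm D} {x y : D} (h : f y = y) (hne : x ≠ y) :
    ¬ f.SameCycle x y := fun h' => by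
  obtain ⟨n, hn⟩ := h'.symm
  rw [zpow_apply_eq_self_of_apply_eq_self h] at hn
  exact hne hn.symm

section Perm

variable {D : Type*} {ρ α : Perm D} {r k : D}

/-- The rotation after the insertion of a new vertex. -/
def pinchRot (ρ : Perm D) : Perm (D ⊕ Fin 4) := sumCongr ρ (finRotate 4)

variable [DecidableEq D]

/-- The pairing of the half-edges after the edges of `r` and `k` have been cut in the middle and
their four ends have been attached to a new vertex, in the cyclic order `α r, k, α k, r`. It is
conjugate to the disjoint union of `α` and of a pairing of the new half-edges. -/
def pinchFlip (α : Perm D) (r k : D) : Perm (D ⊕ Fin 4) :=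
  swap (Sum.inl r) (Sum.inr 0) * swap (Sum.inl (α k)) (Sum.inr 1) *
    sumCongr α (swap 0 3 * swap 1 2) *
    (swap (Sum.inl r) (Sum.inr 0) * swap (Sum.inl (α k)) (Sum.inr 1))⁻¹

theorem pinchFlip_pinchFlip (hα : ∀ d, α (α d) = d) (d : D ⊕ Fin 4) :
    pinchFlip α r k (pinchFlip α r k d) = d := by
  have h0 : ∀ e, sumCongr α (swap 0 3 * swap 1 2 : Perm (Fin 4))
      (sumCongr α (swap 0 3 * swap 1 2) e) = e := by
    rintro (d | d)
    · simp only [sumCongr_apply, Sum.map_inl, hα]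
    · simp only [sumCongr_apply, Sum.map_inr, Sum.inr.injEq]
      revert d
      decide
  have hsw : ∀ a b c : D ⊕ Fin 4, swap a b (swap a b c) = c := fun a b c => by
    rw [← mul_apply, Equiv.swap_mul_self, one_apply]
  simp only [pinchFlip, mul_apply, mul_inv_rev, Equiv.swap_inv,
    h0, hsw]

section Values

theorem pinchFlip_three : pinchFlip α r k (Sum.inr 3) = Sum.inl r := by
  simp [pinchFlip, Equiv.swap_apply_def]

variable (hα : ∀ d, α (α d) = d) (h1 : k ≠ r) (h2 : k ≠ α r)
include hα

theorem pinchFlip_inl_left : pinchFlip α r k (Sum.inl r) = Sum.inr 3 := by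
  rw [← pinchFlip_three (α := α) (k := k), pinchFlip_pinchFlip hα]

theorem pinchFlip_inl {d : D} (e1 : d ≠ r) (e2 : d ≠ α r) (e3 : d ≠ k) (e4 : d ≠ α k) :
    pinchFlip α r k (Sum.inl d) = Sum.inl (α d) := by
  have e5 : α d ≠ r := fun h => e2 (by rw [← h, hα])
  have e6 : α d ≠ α k := fun h => e3 (α.injective h)
  simp [pinchFlip, Equiv.swap_apply_def, e1, e4, e5, e6]

include h2

theorem pinchFlip_two : pinchFlip α r k (Sum.inr 2) = Sum.inl (α k) := by
  have e3 : α k ≠ r := fun h => h2 (by rw [← h, hα])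
  simp [pinchFlip, Equiv.swap_apply_def, e3]

theorem pinchFlip_inl_flip_right : pinchFlip α r k (Sum.inl (α k)) = Sum.inr 2 := by
  rw [← pinchFlip_two hα h2, pinchFlip_pinchFlip hα]

include h1

theorem pinchFlip_zero (hr : α r ≠ r) : pinchFlip α r k (Sum.inr 0) = Sum.inl (α r) := by
  have e2 : α r ≠ α k := fun h => h1 (α.injective h).symm
  have e3 : r ≠ α k := fun h => h2 (by rw [h, hα])
  simp [pinchFlip, Equiv.swap_apply_def, hr, e2, e3]

theorem pinchFlip_one (hk : α k ≠ k) : pinchFlip α r k (Sum.inr 1) = Sum.inl k := by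
  simp [pinchFlip, Equiv.swap_apply_def, hα, hk.symm, h1]

theorem pinchFlip_inl_flip_left (hr : α r ≠ r) : pinchFlip α r k (Sum.inl (α r)) = Sum.inr 0 := by
  rw [← pinchFlip_zero hα h1 h2 hr, pinchFlip_pinchFlip hα]

theorem pinchFlip_inl_right (hk : α k ≠ k) : pinchFlip α r k (Sum.inl k) = Sum.inr 1 := by
  rw [← pinchFlip_one hα h1 h2 hk, pinchFlip_pinchFlip hα]

end Values

theorem IsMap4.pinch (m : IsMap4 ρ α) : IsMap4 (pinchRot ρ) (pinchFlip α r k) where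
  flip_flip := pinchFlip_pinchFlip m.flip_flip
  flip_ne d hd := by
    rw [pinchFlip, mul_apply, mul_apply, ← eq_inv_iff_eq] at hd
    generalize (swap (Sum.inl r) (Sum.inr 0) * swap (Sum.inl (α k)) (Sum.inr 1) :
      Perm (D ⊕ Fin 4))⁻¹ d = e at hd
    rcases e with e | e
    · rw [sumCongr_apply, Sum.map_inl, Sum.inl.injEq] at hd
      exact m.flip_ne e hd
    · rw [sumCongr_apply, Sum.map_inr, Sum.inr.injEq] at hd
      revert e
      decide
  rot4 d := by
    rcases d with d | d
    · simp [pinchRot, m.rot4]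
    · simp only [pinchRot, sumCongr_apply, Sum.map_inr, Sum.inr.injEq]
      revert d
      decide
  rot2_ne d := by
    rcases d with d | d
    · simp [pinchRot, m.rot2_ne]
    · simp only [pinchRot, sumCongr_apply, Sum.map_inr, Ne, Sum.inr.injEq]
      revert d
      decide

theorem numCycles_finRotate_four : (finRotate 4).numCycles = 1 := by
  rw [numCycles, Nat.card_eq_one_iff_unique]
  refine ⟨⟨fun a b => ?_⟩, ⟨Quotient.mk _ 0⟩⟩
  induction a using Quotient.inductionOn with | _ a
  induction b using Quotient.inductionOn with | _ b
  refine Quotient.sound ((isCycle_finRotate (n := 2)).sameCycle ?_ ?_)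
  · revert a; decide
  · revert b; decide

theorem numCycles_swap_zero_two : (swap 0 2 : Perm (Fin 4)).numCycles = 3 := by
  have := numCycles_mul_swap_of_not (f := (1 : Perm (Fin 4))) (x := 0) (y := 2)
    (by rw [sameCycle_one]; decide)
  rw [one_mul, numCycles_one, Nat.card_fin] at this
  omega

/-- The number of faces after pinching the root edge `r` and the edge of `k` that precedes it around
its final vertex. -/
theorem numCycles_faces_pinch [Finite D] (m : IsMap4 ρ α) (h1 : k ≠ r) (h2 : k ≠ α r)
    (hk : ρ k = α r) :
    (pinchRot ρ * pinchFlip α r k).numCycles = (ρ * α).numCycles + 1 := by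
  have e3 : α k ≠ r := fun h => h2 (by rw [← h, m.flip_flip])
  have e4 : α r ≠ α k := fun h => h1 (α.injective h).symm
  set s₀ : Perm (D ⊕ Fin 4) := swap (Sum.inl r) (Sum.inr 0) with hs₀
  set s₁ : Perm (D ⊕ Fin 4) := swap (Sum.inl (α k)) (Sum.inr 1) with hs₁
  set A : Perm (D ⊕ Fin 4) := sumCongr α (swap 0 3 * swap 1 2) with hA
  set f : Perm (D ⊕ Fin 4) := sumCongr (α * ρ) (swap 0 2) with hf
  have hAP : A * pinchRot ρ = f := by
    rw [hA, pinchRot, hf]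
    ext d
    rcases d with d | d
    · simp
    · have : ∀ d, (swap 0 3 * swap 1 2 : Perm (Fin 4)) (finRotate 4 d) = swap 0 2 d := by decide
      simp only [mul_apply _ _ (Sum.inr d), sumCongr_apply, Sum.map_inr, this]
  have hAs : A * (s₀ * s₁)⁻¹ =
      swap (Sum.inl k) (Sum.inr 2) * swap (Sum.inl (α r)) (Sum.inr 3) * A := by
    have a1 : A (Sum.inl (α k)) = Sum.inl k := by simp [hA, m.flip_flip]
    have a2 : A (Sum.inr 1) = Sum.inr 2 := by
      rw [hA, sumCongr_apply, Sum.map_inr]; congr 1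
    have a3 : A (Sum.inl r) = Sum.inl (α r) := by simp [hA]
    have a4 : A (Sum.inr 0) = Sum.inr 3 := by
      rw [hA, sumCongr_apply, Sum.map_inr]; congr 1
    rw [mul_inv_rev, hs₀, hs₁, Equiv.swap_inv, Equiv.swap_inv, ← mul_assoc,
      Equiv.mul_swap_eq_swap_mul A, a1, a2, mul_assoc, Equiv.mul_swap_eq_swap_mul A, a3, a4,
      mul_assoc]
  have h0 : (pinchRot ρ * pinchFlip α r k).numCycles =
      (f * s₀ * s₁ * swap (Sum.inl k) (Sum.inr 2) *
        swap (Sum.inl (α r)) (Sum.inr 3)).numCycles := by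
    rw [pinchFlip, ← hs₀, ← hs₁, ← hA, mul_assoc (s₀ * s₁), hAs, ← mul_assoc, ← mul_assoc,
      numCycles_mul_comm, ← hAP]
    simp only [mul_assoc]
  have c0 : f.numCycles = (ρ * α).numCycles + 3 := by
    rw [hf, numCycles_sumCongr, numCycles_swap_zero_two, numCycles_mul_comm]
  have f1 : f (Sum.inr 1) = Sum.inr 1 := by
    rw [hf, sumCongr_apply, Sum.map_inr]; congr 1
  have f3 : f (Sum.inr 3) = Sum.inr 3 := by
    rw [hf, sumCongr_apply, Sum.map_inr]; congr 1
  have f0 : f (Sum.inr 0) = Sum.inr 2 := by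
    rw [hf, sumCongr_apply, Sum.map_inr]; congr 1
  have c1 : (f * s₀).numCycles + 1 = f.numCycles :=
    numCycles_mul_swap_of_not not_sameCycle_sumCongr_inl_inr
  have c2 : (f * s₀ * s₁).numCycles + 1 = (f * s₀).numCycles := by
    refine numCycles_mul_swap_of_not (not_sameCycle_of_fixed ?_ (by simp))
    rw [mul_apply, hs₀, Equiv.swap_apply_of_ne_of_ne (by simp) (by simp), f1]
  have c3 : (f * s₀ * s₁ * swap (Sum.inl k) (Sum.inr 2)).numCycles =
      (f * s₀ * s₁).numCycles + 1 := by
    refine numCycles_mul_swap_of_sameCycle ?_ (by simp)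
    have g1 : (f * s₀ * s₁) (Sum.inl k) = Sum.inl r := by
      rw [mul_apply, hs₁, Equiv.swap_apply_of_ne_of_ne (by simpa using (m.flip_ne k).symm) (by simp),
        mul_apply, hs₀, Equiv.swap_apply_of_ne_of_ne (by simpa using h1) (by simp), hf,
        sumCongr_apply, Sum.map_inl, mul_apply, hk, m.flip_flip]
    have g2 : (f * s₀ * s₁) (Sum.inl r) = Sum.inr 2 := by
      rw [mul_apply, hs₁, Equiv.swap_apply_of_ne_of_ne (by simpa using e3.symm) (by simp),
        mul_apply, hs₀, Equiv.swap_apply_left, f0]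
    rw [← g2, ← g1]
    exact sameCycle_apply_right.2 (sameCycle_apply_right.2 (SameCycle.refl _ _))
  have c4 : (f * s₀ * s₁ * swap (Sum.inl k) (Sum.inr 2) *
        swap (Sum.inl (α r)) (Sum.inr 3)).numCycles + 1 =
      (f * s₀ * s₁ * swap (Sum.inl k) (Sum.inr 2)).numCycles := by
    refine numCycles_mul_swap_of_not (not_sameCycle_of_fixed ?_ (by simp))
    rw [mul_apply, Equiv.swap_apply_of_ne_of_ne (by simp) (by simp),
        mul_apply, hs₁, Equiv.swap_apply_of_ne_of_ne (by simp) (by simp),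
        mul_apply, hs₀, Equiv.swap_apply_of_ne_of_ne (by simp) (by simp), f3]
  omega

theorem planar_pinch_iff [Finite D] (m : IsMap4 ρ α) (h1 : k ≠ r) (h2 : k ≠ α r)
    (hk : ρ k = α r) : Planar (pinchRot ρ) (pinchFlip α r k) ↔ Planar ρ α := by
  have e1 := two_mul_numCycles m.flip_flip m.flip_ne
  have e2 := two_mul_numCycles (m.pinch (r := r) (k := k)).flip_flip (m.pinch (r := r) (k := k)).flip_ne
  rw [Nat.card_sum, Nat.card_fin] at e2
  rw [Planar, Planar, numCycles_faces_pinch m h1 h2 hk, pinchRot, numCycles_sumCongr,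
    numCycles_finRotate_four]
  omega

end Perm

section Perm

variable {D : Type*} [Finite D] [DecidableEq D] {ρ α : Perm D} {r k : D}

theorem pinchFlip_inl_cases (hα : ∀ d, α (α d) = d) (h1 : k ≠ r) (h2 : k ≠ α r)
    (hr : α r ≠ r) (hk : α k ≠ k) (d : D) :
    ((d = r ∨ d = α r ∨ d = k ∨ d = α k) ∧ pinchFlip α r k (Sum.inl d) ∉ Set.range Sum.inl ∧
      pinchFlip α r k (Sum.inl (α d)) ∉ Set.range Sum.inl) ∨
    ((d ≠ r ∧ d ≠ α r ∧ d ≠ k ∧ d ≠ α k) ∧ pinchFlip α r k (Sum.inl d) = Sum.inl (α d)) := by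
  by_cases e1 : d = r
  · subst e1
    rw [pinchFlip_inl_left hα, pinchFlip_inl_flip_left hα h1 h2 hr]
    simp
  by_cases e2 : d = α r
  · subst e2
    rw [hα, pinchFlip_inl_left hα, pinchFlip_inl_flip_left hα h1 h2 hr]
    simp
  by_cases e3 : d = k
  · subst e3
    rw [pinchFlip_inl_right hα h1 h2 hk, pinchFlip_inl_flip_right hα h2]
    simp
  by_cases e4 : d = α k
  · subst e4
    rw [hα, pinchFlip_inl_right hα h1 h2 hk, pinchFlip_inl_flip_right hα h2]
    simp
  · exact Or.inr ⟨⟨e1, e2, e3, e4⟩, pinchFlip_inl hα e1 e2 e3 e4⟩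

theorem inr_mem_pinch {S : Set (D ⊕ Fin 4)} (hS : ∀ d ∈ S, pinchRot ρ d ∈ S) (i j : Fin 4)
    (hi : Sum.inr i ∈ S) : Sum.inr j ∈ S := by
  have h : (finRotate 4).SameCycle i j :=
    (isCycle_finRotate (n := 2)).sameCycle ((by decide : ∀ i, finRotate 4 i ≠ i) i)
      ((by decide : ∀ i, finRotate 4 i ≠ i) j)
  exact h.mem_of_forall_mem (S := {i | Sum.inr i ∈ S}) (fun i hi => hS _ hi) hi

theorem IsConn.pinch (m : IsMap4 ρ α) (c : IsConn ρ α) (h1 : k ≠ r) (h2 : k ≠ α r) :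
    IsConn (pinchRot ρ) (pinchFlip α r k) := by
  intro S hne hρ hF
  have hl : ∀ d ∈ Sum.inl ⁻¹' S, ρ d ∈ Sum.inl ⁻¹' S := fun d hd => hρ _ hd
  have f0 := pinchFlip_zero m.flip_flip h1 h2 (m.flip_ne r)
  have f1 := pinchFlip_one m.flip_flip h1 h2 (m.flip_ne k)
  have f2 := pinchFlip_two m.flip_flip h2
  have f3 := pinchFlip_three (α := α) (r := r) (k := k)
  have hv : ∀ i, Sum.inr i ∈ S → r ∈ Sum.inl ⁻¹' S ∧ α r ∈ Sum.inl ⁻¹' S ∧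
      k ∈ Sum.inl ⁻¹' S ∧ α k ∈ Sum.inl ⁻¹' S := fun i hi => by
    have h := fun j => hF _ (inr_mem_pinch hρ i j hi)
    exact ⟨(f3 ▸ h 3 :), (f0 ▸ h 0 :), (f1 ▸ h 1 :), (f2 ▸ h 2 :)⟩
  have hv' : ∀ d, (d = r ∨ d = α r ∨ d = k ∨ d = α k) → d ∈ Sum.inl ⁻¹' S →
      ∀ i, Sum.inr i ∈ S := by
    intro d hd hdS i
    have h := hF _ hdS
    rcases hd with rfl | rfl | rfl | rfl
    · rw [pinchFlip_inl_left m.flip_flip] at h; exact inr_mem_pinch hρ _ _ h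
    · rw [pinchFlip_inl_flip_left m.flip_flip h1 h2 (m.flip_ne _)] at h
      exact inr_mem_pinch hρ _ _ h
    · rw [pinchFlip_inl_right m.flip_flip h1 h2 (m.flip_ne _)] at h
      exact inr_mem_pinch hρ _ _ h
    · rw [pinchFlip_inl_flip_right m.flip_flip h2] at h; exact inr_mem_pinch hρ _ _ h
  have hlne : (Sum.inl ⁻¹' S : Set D).Nonempty := by
    obtain ⟨d | i, hd⟩ := hne
    exacts [⟨d, hd⟩, ⟨_, (hv i hd).1⟩]
  have hu := c _ hlne hl fun d hd => by
    rcases pinchFlip_inl_cases m.flip_flip h1 h2 (m.flip_ne r) (m.flip_ne k) d with ⟨h, -⟩ | ⟨-, h⟩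
    · obtain ⟨g1, g2, g3, g4⟩ := hv 0 (hv' d h hd 0)
      rcases h with rfl | rfl | rfl | rfl
      · exact g2
      · rwa [m.flip_flip]
      · exact g4
      · rwa [m.flip_flip]
    · have := hF _ hd
      rwa [h] at this
  have hall : ∀ d : D, Sum.inl d ∈ S := fun d => by
    have hd : d ∈ Sum.inl ⁻¹' S := hu ▸ trivial
    exact hd
  exact Set.eq_univ_of_forall (Sum.rec hall fun i => hv' r (Or.inl rfl) (hall r) i)

/-- Pinching preserves `K₄` minors, the branch set of the vertex of `k` being extended to the new
vertex. -/
theorem HasK4.pinch (m : IsMap4 ρ α) (h1 : k ≠ r) (h2 : k ≠ α r) (hk : ρ k = α r)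
    (h : HasK4 ρ α) : HasK4 (pinchRot ρ) (pinchFlip α r k) := by
  have hcas := pinchFlip_inl_cases m.flip_flip h1 h2 (m.flip_ne r) (m.flip_ne k)
  have hkr : ρ.SameCycle k (α r) := by
    rw [← hk]; exact sameCycle_apply_right.2 (SameCycle.refl _ _)
  refine h.lift (ι := Sum.inl) Sum.inl_injective (fun _ => rfl)
    (pinchFlip_pinchFlip m.flip_flip) (fun d => ?_) ?_ k (fun d hd => ?_) ⟨k, SameCycle.refl _ _, ?_⟩
  · rcases hcas d with h | h
    · exact Or.inr h.2
    · exact Or.inl h.2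
  · rw [Set.compl_range_inl]
    refine ⟨⟨_, 0, rfl⟩, fun S hS ⟨d, hd⟩ hSv _ => hS.antisymm ?_⟩
    rintro _ ⟨j, rfl⟩
    obtain ⟨i, rfl⟩ := hS hd
    exact inr_mem_pinch (fun d hd => (hSv d).2 hd) i j hd
  · rcases hcas d with ⟨rfl | rfl | rfl | rfl, -⟩ | h
    · exact Or.inr hkr
    · exact Or.inl hkr
    · exact Or.inl (SameCycle.refl _ _)
    · exact Or.inr (by rw [m.flip_flip])
    · rw [h.2] at hd; exact (hd ⟨_, rfl⟩).elim
  · rcases hcas k with h | h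
    · exact h.2.1
    · exact (h.1.2.2.1 rfl).elim

/-- Pinching two parallel edges creates no `K₄` minor, since the new vertex is adjacent to two
adjacent vertices only. -/
theorem HasK4.of_pinch (m : IsMap4 ρ α) (h1 : k ≠ r) (h2 : k ≠ α r) (hk : ρ k = α r)
    (hr : ρ.SameCycle r (α k)) (h : HasK4 (pinchRot ρ) (pinchFlip α r k)) : HasK4 ρ α := by
  have hcas := pinchFlip_inl_cases m.flip_flip h1 h2 (m.flip_ne r) (m.flip_ne k)
  have hkr : ρ.SameCycle k (α r) := by
    rw [← hk]; exact sameCycle_apply_right.2 (SameCycle.refl _ _)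
  obtain ⟨B, hB⟩ := h
  have hend : ∀ d, pinchFlip α r k (Sum.inl d) ∉ Set.range Sum.inl →
      ρ.SameCycle r d ∨ ρ.SameCycle (α r) d := by
    intro d hd
    rcases hcas d with ⟨rfl | rfl | rfl | rfl, -⟩ | h
    · exact Or.inl (SameCycle.refl _ _)
    · exact Or.inr (SameCycle.refl _ _)
    · exact Or.inr hkr.symm
    · exact Or.inl hr
    · rw [h.2] at hd; exact (hd ⟨_, rfl⟩).elim
  refine hB.restrict (ι := Sum.inl) Sum.inl_injective (fun _ => rfl)
    (pinchFlip_pinchFlip m.flip_flip) (fun d => ?_) ?_ ?_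
  · rcases hcas d with h | h
    · exact Or.inr h.2.1
    · exact Or.inl h.2
  · intro d d' hd hd'
    rcases hend d hd with h | h <;> rcases hend d' hd' with h' | h'
    · exact Or.inl (h.symm.trans h')
    · exact Or.inr ⟨r, h.symm, h'⟩
    · exact Or.inr ⟨α r, h.symm, by rwa [m.flip_flip]⟩
    · exact Or.inl (h.symm.trans h')
  · -- the new vertex alone has only two neighbours
    intro i
    by_contra! hi
    have hv : ∀ j, i ≠ j → Sum.inl r ∈ B j ∨ Sum.inl (α r) ∈ B j := by
      intro j hij
      obtain ⟨d | d, hd, hd'⟩ := hB.adj i j hij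
      · exact (hi d hd).elim
      have hc : ∃ e, pinchFlip α r k (Sum.inr d) = Sum.inl e := by
        obtain rfl | rfl | rfl | rfl : d = 0 ∨ d = 1 ∨ d = 2 ∨ d = 3 :=
          (by decide : ∀ d : Fin 4, d = 0 ∨ d = 1 ∨ d = 2 ∨ d = 3) d
        exacts [⟨_, pinchFlip_zero m.flip_flip h1 h2 (m.flip_ne r)⟩,
          ⟨_, pinchFlip_one m.flip_flip h1 h2 (m.flip_ne k)⟩, ⟨_, pinchFlip_two m.flip_flip h2⟩,
          ⟨_, pinchFlip_three⟩]
      obtain ⟨e, he⟩ := hc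
      rw [he] at hd'
      have hpre := (hB.vertexSet j).preimage (ι := Sum.inl) (σ := ρ) fun _ => rfl
      refine (hend e ?_).imp (fun h => (hpre.mem_iff h).2 hd') fun h => (hpre.mem_iff h).2 hd'
      rw [← he, pinchFlip_pinchFlip m.flip_flip]
      simp
    obtain ⟨j₁, j₂, j₃, n1, n2, n3, n12, n13, n23⟩ : ∃ j₁ j₂ j₃ : Fin 4, i ≠ j₁ ∧ i ≠ j₂ ∧ i ≠ j₃ ∧
        j₁ ≠ j₂ ∧ j₁ ≠ j₃ ∧ j₂ ≠ j₃ := by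
      clear hi hv
      revert i
      decide
    have d12 := hB.disj _ _ n12
    have d13 := hB.disj _ _ n13
    have d23 := hB.disj _ _ n23
    rcases hv _ n1 with g1 | g1 <;> rcases hv _ n2 with g2 | g2 <;> rcases hv _ n3 with g3 | g3
    all_goals first
      | exact d12 _ g1 g2
      | exact d13 _ g1 g3
      | exact d23 _ g2 g3

end Perm

namespace RootedMap

variable {D : Type*}

/-- The half-edge that precedes the root edge around its final vertex. -/
def prev (R : RootedMap D) : D := R.rot.symm (R.flip R.root)

theorem rot_prev (R : RootedMap D) : R.rot R.prev = R.flip R.root := R.rot.apply_symm_apply _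

variable [Finite D]

theorem prev_ne (R : RootedMap D) (m : R.Is4) : R.prev ≠ R.flip R.root := fun h =>
  m.rot_ne (R.flip R.root) (by rw [← h, rot_prev, h])

open scoped Classical in
/-- The map obtained by pinching the root edge and the edge that precedes it around its final vertex
at a new vertex. The new root edge leads from the new vertex to the former final vertex. -/
noncomputable def pinch (R : RootedMap D) (m : R.Is4) (h : R.prev ≠ R.root) :
    RootedMap (D ⊕ Fin 4) :=
  ofPerms (m.pinch (r := R.root) (k := R.prev)) (R.isConn.pinch m h (R.prev_ne m))
    ((planar_pinch_iff m h (R.prev_ne m) R.rot_prev).2 R.isPlanar) (Sum.inr 0)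

section Pinch

variable {R : RootedMap D} {m : R.Is4} {h : R.prev ≠ R.root}

@[simp] theorem pinch_root : (R.pinch m h).root = Sum.inr 0 := rfl

@[simp] theorem pinch_rot_inl (d : D) : (R.pinch m h).rot (Sum.inl d) = Sum.inl (R.rot d) := rfl

@[simp] theorem pinch_rot_inr (i : Fin 4) :
    (R.pinch m h).rot (Sum.inr i) = Sum.inr (finRotate 4 i) := rfl

theorem pinch_flip_zero : (R.pinch m h).flip (Sum.inr 0) = Sum.inl (R.flip R.root) := by
  classical exact pinchFlip_zero m.flip_flip h (R.prev_ne m) (m.flip_ne _)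

theorem pinch_flip_one : (R.pinch m h).flip (Sum.inr 1) = Sum.inl R.prev := by
  classical exact pinchFlip_one m.flip_flip h (R.prev_ne m) (m.flip_ne _)

theorem pinch_flip_two : (R.pinch m h).flip (Sum.inr 2) = Sum.inl (R.flip R.prev) := by
  classical exact pinchFlip_two m.flip_flip (R.prev_ne m)

theorem pinch_flip_three : (R.pinch m h).flip (Sum.inr 3) = Sum.inl R.root := by
  classical exact pinchFlip_three

theorem pinch_flip_root : (R.pinch m h).flip (Sum.inl R.root) = Sum.inr 3 := by
  rw [← pinch_flip_three (h := h) (m := m), (R.pinch m h).flip_flip]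

theorem pinch_flip_flip_root : (R.pinch m h).flip (Sum.inl (R.flip R.root)) = Sum.inr 0 := by
  rw [← pinch_flip_zero (h := h) (m := m), (R.pinch m h).flip_flip]

theorem pinch_flip_prev : (R.pinch m h).flip (Sum.inl R.prev) = Sum.inr 1 := by
  rw [← pinch_flip_one (h := h) (m := m), (R.pinch m h).flip_flip]

theorem pinch_flip_flip_prev : (R.pinch m h).flip (Sum.inl (R.flip R.prev)) = Sum.inr 2 := by
  rw [← pinch_flip_two (h := h) (m := m), (R.pinch m h).flip_flip]

theorem pinch_flip_inl {d : D} (e1 : d ≠ R.root) (e2 : d ≠ R.flip R.root) (e3 : d ≠ R.prev)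
    (e4 : d ≠ R.flip R.prev) : (R.pinch m h).flip (Sum.inl d) = Sum.inl (R.flip d) := by
  classical exact pinchFlip_inl m.flip_flip e1 e2 e3 e4

theorem is4_pinch : (R.pinch m h).Is4 := by
  classical exact m.pinch

theorem hasK4_pinch_iff (hr : R.rot.SameCycle R.root (R.flip R.prev)) :
    HasK4 (R.pinch m h).rot (R.pinch m h).flip ↔ HasK4 R.rot R.flip := by
  classical exact ⟨HasK4.of_pinch m h (R.prev_ne m) R.rot_prev hr,
    HasK4.pinch m h (R.prev_ne m) R.rot_prev⟩

theorem inl_sameCycle_pinch {a b : D} :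
    (R.pinch m h).rot.SameCycle (Sum.inl a) (Sum.inl b) ↔ R.rot.SameCycle a b :=
  sameCycle_sumCongr_inl

theorem not_inl_sameCycle_pinch {a : D} {b : Fin 4} :
    ¬ (R.pinch m h).rot.SameCycle (Sum.inl a) (Sum.inr b) :=
  not_sameCycle_sumCongr_inl_inr

theorem Bridgeless.pinch (T : R.Bridgeless) (hr : R.rot.SameCycle R.root (R.flip R.prev)) :
    (R.pinch m h).IsCore := by
  refine ⟨fun a ha1 ha2 S hne hρ hF => ?_, fun h' => ?_⟩
  · set F := (R.pinch m h).flip with hFdef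
    have hFF : ∀ d, F (F d) = d := (R.pinch m h).flip_flip
    rw [pinch_root] at ha1 hF
    rw [pinch_root, pinch_flip_zero] at ha2
    rw [show F (Sum.inr 0) = Sum.inl (R.flip R.root) from pinch_flip_zero] at hF
    have hv : ∀ i j, Sum.inr i ∈ S → Sum.inr j ∈ S := by
      classical exact inr_mem_pinch hρ
    -- the edges at the new vertex other than the root edge
    have hE : ∀ (i : Fin 4) d, F (Sum.inr i) = Sum.inl d → i ≠ 0 → a ≠ Sum.inr i → a ≠ Sum.inl d →
        (Sum.inl d ∈ S ↔ Sum.inr i ∈ S) := by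
      intro i d hid hi e1 e2
      have hid' : F (Sum.inl d) = Sum.inr i := by rw [← hid, hFF]
      constructor
      · intro hd
        have := hF _ hd (by simp) (fun e => ?_) e2.symm fun e => e1 (by rw [← hid', e, hFF])
        · rwa [hid'] at this
        · rw [e, show F (Sum.inl (R.flip R.root)) = Sum.inr 0 from pinch_flip_flip_root] at hid'
          exact hi (Sum.inr.inj hid').symm
      · intro hd
        have := hF _ hd (by simpa using hi) (by simp) e1.symm fun e => e2 (by rw [← hid, e, hFF])
        rwa [hid] at this
    have hE1 := hE 1 R.prev pinch_flip_one (by decide)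
    have hE2 := hE 2 (R.flip R.prev) pinch_flip_two (by decide)
    have hE3 := hE 3 R.root pinch_flip_three (by decide)
    have hl : ∀ d ∈ Sum.inl ⁻¹' S, R.rot d ∈ Sum.inl ⁻¹' S := fun d hd => hρ _ hd
    have hS0 : (∃ d, Sum.inl d ∈ S) → ∀ d, Sum.inl d ∈ S := by
      intro hex d
      suffices Sum.inl ⁻¹' S = (Set.univ : Set D) by
        have hd : d ∈ Sum.inl ⁻¹' S := this ▸ trivial
        exact hd
      by_cases hab : ∃ b, a = Sum.inl b ∧ b ≠ R.root ∧ b ≠ R.prev ∧ b ≠ R.flip R.prev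
      · obtain ⟨b, rfl, b1, b2, b3⟩ := hab
        have b4 : b ≠ R.flip R.root := fun e => ha2 (by rw [e])
        have hFb : F (Sum.inl b) = Sum.inl (R.flip b) := pinch_flip_inl b1 b4 b2 b3
        have hE1 := hE1 (by simp) (by simpa using b2)
        have hE2 := hE2 (by simp) (by simpa using b3)
        have hE3 := hE3 (by simp) (by simpa using b1)
        have hv2 := (IsVertexSet.of_forall_mem hl).mem_iff hr
        have hp : R.prev ∈ Sum.inl ⁻¹' S ↔ R.flip R.root ∈ Sum.inl ⁻¹' S := by
          rw [← R.rot_prev]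
          exact ((IsVertexSet.of_forall_mem hl) _).symm
        refine R.isConn.eq_univ_of_off m b hex hl fun d hd e1 e2 => ?_
        have hd' : Sum.inl d ∈ S := hd
        by_cases g1 : d = R.root
        · rw [g1] at hd' ⊢
          exact hp.1 (hE1.2 (hv _ _ (hE3.1 hd')))
        by_cases g2 : d = R.flip R.root
        · rw [g2, R.flip_flip]
          rw [g2] at hd'
          exact hE3.2 (hv _ _ (hE1.1 (hp.2 hd')))
        by_cases g3 : d = R.prev
        · rw [g3] at hd' ⊢
          exact hE2.2 (hv _ _ (hE1.1 hd'))
        by_cases g4 : d = R.flip R.prev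
        · rw [g4, R.flip_flip]
          rw [g4] at hd'
          exact hE1.2 (hv _ _ (hE2.1 hd'))
        have := hF _ hd' (by simp) (by simpa using g2) (by simpa using e1)
          (by rw [hFb]; simpa using e2)
        rwa [hFdef, pinch_flip_inl g1 g2 g3 g4] at this
      · push Not at hab
        refine T R.prev h (R.prev_ne m) _ hex hl fun d hd g1 g2 g3 g4 => ?_
        have hFd : F (Sum.inl d) = Sum.inl (R.flip d) := pinch_flip_inl g1 g2 g3 g4
        have := hF _ hd (by simp) (by simpa using g2) (fun e => g4 (hab d e.symm g1 g3)) fun e => ?_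
        · rwa [hFd] at this
        · have e' : a = Sum.inl (R.flip d) := by rw [← hFd, e, hFF]
          refine g3 (R.flip.injective (hab _ e' ?_ ?_))
          · exact fun e => g2 (by rw [← e, R.flip_flip])
          · exact fun e => g4 (by rw [← e, R.flip_flip])
    have hiff : (∃ d, Sum.inl d ∈ S) ↔ ∃ i, Sum.inr i ∈ S := by
      by_cases e : a = Sum.inr 1 ∨ a = Sum.inl R.prev
      · have hE2 := hE2 (by rcases e with rfl | rfl <;> simp)
          (by rcases e with rfl | rfl <;> simp [(R.flip_ne R.prev).symm])
        exact ⟨fun hd => ⟨_, hE2.1 (hS0 hd _)⟩, fun ⟨i, hi⟩ => ⟨_, hE2.2 (hv _ _ hi)⟩⟩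
      · push Not at e
        have hE1 := hE1 e.1 e.2
        exact ⟨fun hd => ⟨_, hE1.1 (hS0 hd _)⟩, fun ⟨i, hi⟩ => ⟨_, hE1.2 (hv _ _ hi)⟩⟩
    have hex : ∃ d, Sum.inl d ∈ S := by
      obtain ⟨d | i, hd⟩ := hne
      exacts [⟨d, hd⟩, hiff.2 ⟨i, hd⟩]
    obtain ⟨i, hi⟩ := hiff.1 hex
    exact Set.eq_univ_of_forall (Sum.rec (hS0 hex) fun j => hv i j hi)
  · rw [pinch_root, pinch_flip_zero] at h'
    exact not_inl_sameCycle_pinch h'.symm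

end Pinch

end RootedMap

/-! ### Removing a vertex -/

section Perm

variable {D : Type*} {ρ α : Perm D}

/-- The half-edges around the vertex of `r`, in cyclic order starting from `r`. -/
def around (ρ : Perm D) (r : D) (i : Fin 4) : D := (ρ ^ (i : ℕ)) r

theorem around_finRotate (m : IsMap4 ρ α) (r : D) (i : Fin 4) :
    around ρ r (finRotate 4 i) = ρ (around ρ r i) := by
  fin_cases i
  · rfl
  · rfl
  · rfl
  · exact (m.rot4 r).symm

theorem around_injective (m : IsMap4 ρ α) (r : D) : Function.Injective (around ρ r) := by
  have h1 := m.rot_ne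
  have h2 := m.rot2_ne
  have h3 := m.rot3_ne
  intro i j hij
  by_contra hne
  fin_cases i <;> fin_cases j
  exacts [hne rfl, h1 _ hij.symm, h2 _ hij.symm, h3 _ hij.symm, h1 _ hij, hne rfl, h1 _ hij.symm,
    h2 _ hij.symm, h2 _ hij, h1 _ hij, hne rfl, h1 _ hij.symm, h3 _ hij, h2 _ hij, h1 _ hij,
    hne rfl]

theorem sameCycle_iff_around [Finite D] (m : IsMap4 ρ α) {r d : D} :
    ρ.SameCycle r d ↔ ∃ i, d = around ρ r i := by
  rw [m.sameCycle_iff]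
  constructor
  · rintro (h | h | h | h)
    exacts [⟨0, h⟩, ⟨1, h⟩, ⟨2, h⟩, ⟨3, h⟩]
  · rintro ⟨i, h⟩
    fin_cases i
    exacts [Or.inl h, Or.inr (Or.inl h), Or.inr (Or.inr (Or.inl h)), Or.inr (Or.inr (Or.inr h))]

end Perm

namespace RootedMap

variable {D : Type*} [Finite D] {R : RootedMap D}

/-- If the root edge and its successor form a digonal face, then the map arises by pinching: remove
the initial vertex of the root edge, join the root edge with the edge that precedes it there, and
join the two remaining edges. -/
theorem IsCore.exists_unpinch (c : R.IsCore) (m : R.Is4)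
    (hA : R.rot (R.flip (R.rot R.root)) = R.flip R.root) :
    ∃ (X : RootedMap ((vertexOf R.rot R.root)ᶜ : Set D)) (mX : X.Is4) (hX : X.prev ≠ X.root),
      R.Iso (X.pinch mX hX) ∧ (∀ d, (X.rot d : D) = R.rot d) ∧
      (X.root : D) = R.flip (R.rot (R.rot (R.rot R.root))) ∧
      (X.flip X.root : D) = R.flip R.root ∧ (X.prev : D) = R.flip (R.rot R.root) ∧
      (X.flip X.prev : D) = R.flip (R.rot (R.rot R.root)) := by
  classical
  set V := vertexOf R.rot R.root with hV
  set h : Fin 4 → D := around R.rot R.root with hh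
  have hVv : IsVertexSet R.rot V := isVertexSet_vertexOf _ _
  have hmem : ∀ d, d ∈ V ↔ ∃ i, d = h i := fun d => sameCycle_iff_around m
  have hinj : Function.Injective h := around_injective m _
  have hout : ∀ i, R.flip (h i) ∈ Vᶜ := fun i => c.bridgeless.not_loop m c.not_loop
    ((hmem _).2 ⟨i, rfl⟩)
  -- the involution of the remaining half-edges
  have hσ : ∀ d : (Vᶜ : Set D), ∃ e : (Vᶜ : Set D), ((R.flip d : D) ∉ V ∧ (e : D) = R.flip d) ∨
      ∃ i, (d : D) = R.flip (h i) ∧ (e : D) = R.flip (h (Fin.rev i)) := by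
    intro d
    by_cases hd : (R.flip d : D) ∈ V
    · obtain ⟨i, hi⟩ := (hmem _).1 hd
      exact ⟨⟨_, hout (Fin.rev i)⟩, Or.inr ⟨i, by rw [← hi, R.flip_flip], rfl⟩⟩
    · exact ⟨⟨_, hd⟩, Or.inl ⟨hd, rfl⟩⟩
  choose g hg using hσ
  have g1 : ∀ d : (Vᶜ : Set D), (R.flip d : D) ∉ V → (g d : D) = R.flip d := by
    intro d hd
    rcases hg d with h1 | ⟨i, h1, -⟩
    · exact h1.2
    · rw [h1, R.flip_flip] at hd
      exact (hd ((hmem _).2 ⟨i, rfl⟩)).elim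
  have g2 : ∀ i, (g ⟨_, hout i⟩ : D) = R.flip (h (Fin.rev i)) := by
    intro i
    rcases hg ⟨_, hout i⟩ with h1 | ⟨j, h1, h2⟩
    · rw [R.flip_flip] at h1
      exact (h1.1 ((hmem _).2 ⟨i, rfl⟩)).elim
    · obtain rfl := hinj (R.flip.injective h1)
      exact h2
  have gcase : ∀ d : (Vᶜ : Set D), (R.flip d : D) ∉ V ∨ ∃ i, d = ⟨_, hout i⟩ := by
    intro d
    by_cases hd : (R.flip d : D) ∈ V
    · obtain ⟨i, hi⟩ := (hmem _).1 hd
      exact Or.inr ⟨i, Subtype.ext (by change (d : D) = R.flip (h i); rw [← hi, R.flip_flip])⟩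
    · exact Or.inl hd
  have gg : Function.Involutive g := by
    intro d
    apply Subtype.ext
    rcases gcase d with h1 | ⟨i, rfl⟩
    · rw [g1 (g d), g1 d h1, R.flip_flip]
      rw [g1 d h1, R.flip_flip]
      exact d.2
    · have : g ⟨_, hout i⟩ = ⟨_, hout (Fin.rev i)⟩ := Subtype.ext (g2 i)
      rw [this, g2, Fin.rev_rev]
  set α' := gg.toPerm with hα'
  set ρ' : Perm (Vᶜ : Set D) := R.rot.subtypePerm (fun d => hVv.compl d) with hρ'
  have hr' : ∀ d : (Vᶜ : Set D), (ρ' d : D) = R.rot d := fun d => rfl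
  have mX : IsMap4 ρ' α' := by
    refine ⟨gg, fun d hd => ?_, fun d => Subtype.ext (m.rot4 d), fun d hd =>
      m.rot2_ne d (congrArg Subtype.val hd)⟩
    have hd' : (g d : D) = d := congrArg Subtype.val hd
    rcases gcase d with h1 | ⟨i, rfl⟩
    · rw [g1 d h1] at hd'
      exact R.flip_ne _ hd'
    · rw [g2] at hd'
      have := hinj (R.flip.injective hd')
      exact (by decide : ∀ i : Fin 4, Fin.rev i ≠ i) i this
  set q : Fin 4 → (Vᶜ : Set D) := fun i => ⟨R.flip (h i), hout i⟩ with hq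
  have qinj : Function.Injective q := fun i j hij =>
    hinj (R.flip.injective (congrArg Subtype.val hij))
  have a0 : α' (q 3) = q 0 := Subtype.ext (g2 3)
  have a1 : α' (q 1) = q 2 := Subtype.ext (g2 1)
  have e1 : q 1 ≠ q 3 := qinj.ne (by decide)
  have e2 : q 1 ≠ α' (q 3) := by rw [a0]; exact qinj.ne (by decide)
  have hrot : ρ' (q 1) = α' (q 3) := by
    rw [a0]; exact Subtype.ext hA
  -- the half-edges of the pinched map
  set f : (Vᶜ : Set D) ⊕ Fin 4 → D := Sum.elim Subtype.val h with hf
  have fbij : Function.Bijective f := by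
    constructor
    · rintro (d | i) (e | j) hde
      · exact congrArg _ (Subtype.ext hde)
      · exact (d.2 ((hmem _).2 ⟨j, hde⟩)).elim
      · exact (e.2 ((hmem _).2 ⟨i, hde.symm⟩)).elim
      · exact congrArg _ (hinj hde)
    · intro d
      by_cases hd : d ∈ V
      · obtain ⟨i, hi⟩ := (hmem _).1 hd
        exact ⟨Sum.inr i, hi.symm⟩
      · exact ⟨Sum.inl ⟨d, hd⟩, rfl⟩
  have frot : ∀ d, f (pinchRot ρ' d) = R.rot (f d) := by
    rintro (d | i)
    · rfl
    · exact around_finRotate m _ i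
  have finr : ∀ i, pinchFlip α' (q 3) (q 1) (Sum.inr i) = Sum.inl (q i) := by
    intro i
    obtain rfl | rfl | rfl | rfl : i = 0 ∨ i = 1 ∨ i = 2 ∨ i = 3 :=
      (by decide : ∀ d : Fin 4, d = 0 ∨ d = 1 ∨ d = 2 ∨ d = 3) i
    · rw [pinchFlip_zero mX.flip_flip e1 e2 (mX.flip_ne _), a0]
    · rw [pinchFlip_one mX.flip_flip e1 e2 (mX.flip_ne _)]
    · rw [pinchFlip_two mX.flip_flip e2, a1]
    · rw [pinchFlip_three]
  have fflip : ∀ d, f (pinchFlip α' (q 3) (q 1) d) = R.flip (f d) := by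
    have hinr : ∀ i, f (pinchFlip α' (q 3) (q 1) (Sum.inr i)) = R.flip (h i) := fun i => by
      rw [finr]; rfl
    rintro (d | i)
    · by_cases hd : ∃ i, d = q i
      · obtain ⟨i, rfl⟩ := hd
        rw [← finr, pinchFlip_pinchFlip mX.flip_flip, hinr]
        exact (R.flip_flip _).symm
      · push Not at hd
        rw [pinchFlip_inl mX.flip_flip (hd 3) (by rw [a0]; exact hd 0) (hd 1)
          (by rw [a1]; exact hd 2)]
        rcases gcase d with h1 | ⟨i, h1⟩
        · exact g1 d h1
        · exact (hd i h1).elim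
    · exact hinr i
  set e := Equiv.ofBijective f fbij with he
  have pX : Planar ρ' α' := by
    rw [← planar_pinch_iff mX e1 e2 hrot, planar_congr (e := e) frot fflip]
    exact R.isPlanar
  have cX : IsConn ρ' α' := by
    intro S hne hSρ hSα
    have hSv := IsVertexSet.of_forall_mem hSρ
    have s0 : q 3 ∈ S ↔ q 0 ∈ S := by
      rw [← a0]
      exact ⟨hSα _, fun h0 => by have := hSα _ h0; rwa [mX.flip_flip] at this⟩
    have s1 : q 1 ∈ S ↔ q 2 ∈ S := by
      rw [← a1]
      exact ⟨hSα _, fun h0 => by have := hSα _ h0; rwa [mX.flip_flip] at this⟩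
    have s2 : q 1 ∈ S ↔ q 0 ∈ S := by
      rw [← a0, ← hrot]
      exact (hSv _).symm
    have hS : ∀ i, q i ∈ S ↔ q 0 ∈ S := by
      intro i
      obtain rfl | rfl | rfl | rfl : i = 0 ∨ i = 1 ∨ i = 2 ∨ i = 3 :=
        (by decide : ∀ d : Fin 4, d = 0 ∨ d = 1 ∨ d = 2 ∨ d = 3) i
      exacts [Iff.rfl, s2, s1.symm.trans s2, s0]
    -- the half-edges at the removed vertex are added to the set if it contains their other halves
    have hT : f '' {d | Sum.elim (· ∈ S) (fun _ => q 0 ∈ S) d} = Set.univ := by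
      obtain ⟨d, hd⟩ := hne
      refine R.isConn _ ⟨_, Set.mem_image_of_mem f (show Sum.inl d ∈ _ from hd)⟩ ?_ ?_
      · rintro _ ⟨d | i, hd, rfl⟩
        · exact ⟨Sum.inl (ρ' d), hSρ _ hd, rfl⟩
        · exact ⟨Sum.inr (finRotate 4 i), hd, frot (Sum.inr i)⟩
      · rintro _ ⟨d, hd, rfl⟩
        refine ⟨pinchFlip α' (q 3) (q 1) d, ?_, fflip d⟩
        rcases d with d | i
        · by_cases hdi : ∃ i, d = q i
          · obtain ⟨i, rfl⟩ := hdi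
            rw [← finr, pinchFlip_pinchFlip mX.flip_flip]
            exact (hS i).1 hd
          · push Not at hdi
            rw [pinchFlip_inl mX.flip_flip (hdi 3) (by rw [a0]; exact hdi 0) (hdi 1)
              (by rw [a1]; exact hdi 2)]
            exact hSα _ hd
        · rw [finr]
          exact (hS i).2 hd
    refine Set.eq_univ_of_forall fun d => ?_
    obtain ⟨e, he, hed⟩ := hT.ge (Set.mem_univ (d : D))
    obtain rfl : e = Sum.inl d := fbij.1 hed
    exact he
  obtain ⟨X, xrot, xflip, xroot⟩ : ∃ X : RootedMap (Vᶜ : Set D),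
      X.rot = ρ' ∧ X.flip = α' ∧ X.root = q 3 := ⟨ofPerms mX cX pX (q 3), rfl, rfl, rfl⟩
  have hprev : X.prev = q 1 := by
    rw [prev, Equiv.symm_apply_eq, xrot, xflip, xroot]
    exact hrot.symm
  have mX' : X.Is4 := by rw [← xrot, ← xflip] at mX; exact mX
  have hX : X.prev ≠ X.root := by rw [hprev, xroot]; exact e1
  refine ⟨X, mX', hX, ⟨e.symm, ?_, ?_, ?_⟩, ?_, ?_, ?_, ?_, ?_⟩
  · refine symm_comm_of_comm fun d => ?_
    rw [show R.rot (e d) = f (pinchRot ρ' d) from (frot d).symm, ← xrot]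
    rfl
  · have : (X.pinch mX' hX).flip = pinchFlip α' (q 3) (q 1) := by
      rw [← hprev, ← xflip, ← xroot]
      exact congrArg (fun i : DecidableEq _ => @pinchFlip _ i X.flip X.root X.prev)
        (Subsingleton.elim _ _)
    rw [this]
    exact symm_comm_of_comm fflip
  · rw [Equiv.symm_apply_eq]
    rfl
  · intro d
    rw [xrot]
    rfl
  · rw [xroot]
    rfl
  · rw [xflip, xroot, a0]
    rfl
  · rw [hprev]
    rfl
  · rw [xflip, hprev, a1]
    rfl

end RootedMap

/-! ### Isomorphisms of compositions -/

/-- A bijection between disjoint unions that respects the summands is a sum of bijections. -/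
theorem exists_equiv_of_sum {A B A' B' : Type*} (e : A ⊕ B ≃ A' ⊕ B')
    (h1 : ∀ a, ∃ a', e (Sum.inl a) = Sum.inl a') (h2 : ∀ b, ∃ b', e (Sum.inr b) = Sum.inr b') :
    ∃ (f : A ≃ A') (g : B ≃ B'), (∀ a, e (Sum.inl a) = Sum.inl (f a)) ∧
      ∀ b, e (Sum.inr b) = Sum.inr (g b) := by
  choose f hf using h1
  choose g hg using h2
  refine ⟨Equiv.ofBijective f ⟨fun a b hab => ?_, fun a' => ?_⟩,
    Equiv.ofBijective g ⟨fun a b hab => ?_, fun b' => ?_⟩, hf, hg⟩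
  · exact Sum.inl.inj (e.injective (by rw [hf, hf, hab]))
  · obtain ⟨a | b, h⟩ := e.surjective (Sum.inl a')
    · exact ⟨a, Sum.inl.inj (by rw [← h, hf])⟩
    · simp [hg] at h
  · exact Sum.inr.inj (e.injective (by rw [hg, hg, hab]))
  · obtain ⟨a | b, h⟩ := e.surjective (Sum.inr b')
    · simp [hf] at h
    · exact ⟨b, Sum.inr.inj (by rw [← h, hg])⟩

namespace RootedMap

theorem Iso.refl {D : Type*} (R : RootedMap D) : R.Iso R :=
  ⟨Equiv.refl _, fun _ => rfl, fun _ => rfl, rfl⟩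

theorem Iso.symm {D E : Type*} {R : RootedMap D} {R' : RootedMap E} (h : R.Iso R') : R'.Iso R := by
  obtain ⟨e, h1, h2, h3⟩ := h
  exact ⟨e.symm, symm_comm_of_comm h1, symm_comm_of_comm h2, by rw [← h3, e.symm_apply_apply]⟩

theorem Iso.trans {D E F : Type*} {R : RootedMap D} {R' : RootedMap E} {R'' : RootedMap F}
    (h : R.Iso R') (h' : R'.Iso R'') : R.Iso R'' := by
  obtain ⟨f, h1, h2, h3⟩ := h
  obtain ⟨g, k1, k2, k3⟩ := h'
  exact ⟨f.trans g, fun d => by simp [h1, k1], fun d => by simp [h2, k2], by simp [h3, k3]⟩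

theorem Iso.hasK4 {D E : Type*} {R : RootedMap D} {R' : RootedMap E} (h : R.Iso R')
    (k : HasK4 R.rot R.flip) : HasK4 R'.rot R'.flip := by
  obtain ⟨e, h1, h2, -⟩ := h
  exact k.congr h1 h2

variable {D E D' E' : Type*} [Finite D] [Finite E] [Finite D'] [Finite E']
  {R : RootedMap D} {R₁ : RootedMap E} {m : R.Is4} {m₁ : R₁.Is4} {h : D}
  {R' : RootedMap D'} {R₁' : RootedMap E'} {m' : R'.Is4} {m₁' : R₁'.Is4} {h' : D'}

theorem iso_sub {f : D ≃ D'} (f1 : ∀ d, f (R.rot d) = R'.rot (f d))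
    (f2 : ∀ d, f (R.flip d) = R'.flip (f d)) (f3 : f R.root = R'.root) (hh : f h = h')
    (i : R₁.Iso R₁') : (R.sub h R₁ m m₁).Iso (R'.sub h' R₁' m' m₁') := by
  obtain ⟨g, g1, g2, g3⟩ := i
  subst hh
  refine ⟨Equiv.sumCongr f g, ?_, ?_, by simp [f3]⟩
  · rintro (d | d) <;> simp [f1, g1]
  · rintro (d | d)
    · by_cases h1 : d = h
      · subst h1; simp [g3]
      by_cases h2 : d = R.flip h
      · subst h2; simp [g3, f2, g2]
      rw [sub_flip_inl h1 h2]
      simp only [Equiv.sumCongr_apply, Sum.map_inl, f2]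
      rw [sub_flip_inl (f.injective.ne h1) (by rw [← f2]; exact f.injective.ne h2)]
    · by_cases h1 : d = R₁.root
      · subst h1; simp [g3]
      by_cases h2 : d = R₁.flip R₁.root
      · subst h2; simp [g3, f2, g2]
      rw [sub_flip_inr h1 h2]
      simp only [Equiv.sumCongr_apply, Sum.map_inr, g2]
      rw [sub_flip_inr (by rw [← g3]; exact g.injective.ne h1)
        (by rw [← g3, ← g2]; exact g.injective.ne h2)]

section

variable {e : D ⊕ E ≃ D' ⊕ E'}
  (e1 : ∀ d, e ((R.sub h R₁ m m₁).rot d) = (R'.sub h' R₁' m' m₁').rot (e d))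
  (e2 : ∀ d, e ((R.sub h R₁ m m₁).flip d) = (R'.sub h' R₁' m' m₁').flip (e d))
  (e3 : e (Sum.inl R.root) = Sum.inl R'.root)

include e1 e2 e3 in
theorem inl_mem_of_iso_sub (hh : e (Sum.inl h) = Sum.inl h')
    (hf : e (Sum.inl (R.flip h)) = Sum.inl (R'.flip h')) (d : D) :
    ∃ d', e (Sum.inl d) = Sum.inl d' := by
  have : {d | ∃ d', e (Sum.inl d) = Sum.inl d'} = Set.univ := by
    refine R.isConn _ ⟨R.root, _, e3⟩ ?_ ?_
    · rintro d ⟨d', hd⟩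
      have := e1 (Sum.inl d)
      rw [hd, sub_rot_inl, sub_rot_inl] at this
      exact ⟨_, this⟩
    · rintro d ⟨d', hd⟩
      by_cases h1 : d = h
      · rw [h1]; exact ⟨_, hf⟩
      by_cases h2 : d = R.flip h
      · rw [h2, R.flip_flip]; exact ⟨_, hh⟩
      have := e2 (Sum.inl d)
      rw [hd, sub_flip_inl h1 h2, sub_flip_inl (fun g => h1 ?_) fun g => h2 ?_] at this
      · exact ⟨_, this⟩
      · rw [g, ← hh] at hd
        exact Sum.inl.inj (e.injective hd)
      · rw [g, ← hf] at hd
        exact Sum.inl.inj (e.injective hd)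
  exact this.ge (Set.mem_univ d)

include e1 e2 e3 in
theorem iso_of_sub_of_range (hl : ∀ d, ∃ d', e (Sum.inl d) = Sum.inl d')
    (hr : ∀ d, ∃ d', e (Sum.inr d) = Sum.inr d')
    (hh : e (Sum.inl h) = Sum.inl h') (hf : e (Sum.inl (R.flip h)) = Sum.inl (R'.flip h')) :
    R.Iso R' ∧ R₁.Iso R₁' := by
  obtain ⟨f, g, hf', hg'⟩ := exists_equiv_of_sum e hl hr
  have fh : f h = h' := Sum.inl.inj (by rw [← hf', hh])
  have fh2 : f (R.flip h) = R'.flip h' := Sum.inl.inj (by rw [← hf', hf])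
  have gr : g R₁.root = R₁'.root := Sum.inr.inj (by
    have := e2 (Sum.inl h)
    rwa [sub_flip_inl_self, hh, sub_flip_inl_self, hg'] at this)
  have gr2 : g (R₁.flip R₁.root) = R₁'.flip R₁'.root := Sum.inr.inj (by
    have := e2 (Sum.inl (R.flip h))
    rwa [sub_flip_inl_flip, hf, sub_flip_inl_flip, hg'] at this)
  refine ⟨⟨f, fun d => ?_, fun d => ?_, ?_⟩, ⟨g, fun d => ?_, fun d => ?_, gr⟩⟩
  · have := e1 (Sum.inl d)
    rw [sub_rot_inl, hf', hf', sub_rot_inl] at this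
    exact Sum.inl.inj this
  · by_cases h1 : d = h
    · rw [h1, fh2, fh]
    by_cases h2 : d = R.flip h
    · rw [h2, fh2, R.flip_flip, R'.flip_flip, fh]
    have := e2 (Sum.inl d)
    rw [sub_flip_inl h1 h2, hf', hf', sub_flip_inl] at this
    · exact Sum.inl.inj this
    · rw [← fh]; exact f.injective.ne h1
    · rw [← fh2]; exact f.injective.ne h2
  · exact Sum.inl.inj (by rw [← hf', e3])
  · have := e1 (Sum.inr d)
    rw [sub_rot_inr, hg', hg', sub_rot_inr] at this
    exact Sum.inr.inj this
  · by_cases h1 : d = R₁.root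
    · rw [h1, gr2, gr]
    by_cases h2 : d = R₁.flip R₁.root
    · rw [h2, gr2, R₁.flip_flip, R₁'.flip_flip, gr]
    have := e2 (Sum.inr d)
    rw [sub_flip_inr h1 h2, hg', hg', sub_flip_inr] at this
    · exact Sum.inr.inj this
    · rw [← gr]; exact g.injective.ne h1
    · rw [← gr2]; exact g.injective.ne h2

include e1 e2 e3 in
/-- The two parts of a substitution are determined by the map and the location of the edge. -/
theorem iso_of_sub (hh : e (Sum.inl h) = Sum.inl h')
    (hf : e (Sum.inl (R.flip h)) = Sum.inl (R'.flip h')) : R.Iso R' ∧ R₁.Iso R₁' := by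
  refine iso_of_sub_of_range e1 e2 e3 (inl_mem_of_iso_sub e1 e2 e3 hh hf) (fun d => ?_) hh hf
  rcases hd : e (Sum.inr d) with d' | d'
  · obtain ⟨d'', h''⟩ := inl_mem_of_iso_sub (R := R') (h := h') (R₁ := R₁') (m := m') (m₁ := m₁')
      (R' := R) (h' := h) (R₁' := R₁) (m' := m) (m₁' := m₁) (e := e.symm)
      (symm_comm_of_comm e1) (symm_comm_of_comm e2) (by rw [← e3, e.symm_apply_apply])
      (by rw [← hh, e.symm_apply_apply]) (by rw [← hf, e.symm_apply_apply]) d'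
    rw [← hd, e.symm_apply_apply] at h''
    simp at h''
  · exact ⟨_, rfl⟩

end

/-! ### Series composition -/

/-- The series composition: the edge from the final vertex of the first to the initial vertex of the
second part is a bridge of the map without the root edge. -/
noncomputable def series (R : RootedMap D) (R₁ : RootedMap E) (m : R.Is4) (m₁ : R₁.Is4) :
    RootedMap (D ⊕ E) :=
  R.sub (R.flip R.root) R₁ m m₁

theorem series_root : (R.series R₁ m m₁).root = Sum.inl R.root := rfl

theorem series_flip_root :
    (R.series R₁ m m₁).flip (Sum.inl R.root) = Sum.inr (R₁.flip R₁.root) := by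
  have : R.root = R.flip (R.flip R.root) := (R.flip_flip _).symm
  rw [this, series, sub_flip_inl_flip]

theorem not_bridgeless_series : ¬ (R.series R₁ m m₁).Bridgeless := by
  intro T
  have hne : (Sum.inr R₁.root : D ⊕ E) ≠ (R.series R₁ m m₁).flip (R.series R₁ m m₁).root := by
    rw [series_root, series_flip_root]
    exact fun g => R₁.flip_ne _ (Sum.inr.inj g).symm
  have := T (Sum.inr R₁.root) (by simp [series_root]) hne (Set.range Sum.inr) ⟨_, R₁.root, rfl⟩
    (by rintro _ ⟨d, rfl⟩; exact ⟨_, rfl⟩) (by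
      rintro _ ⟨d, rfl⟩ - h2 h3 -
      rw [series_root, series_flip_root] at h2
      rw [series, sub_flip_inr (fun g => h3 (g ▸ rfl)) fun g => h2 (g ▸ rfl)]
      exact ⟨_, rfl⟩)
  obtain ⟨d, hd⟩ := this.ge (Set.mem_univ (Sum.inl R.root))
  simp at hd

theorem inr_mem_of_iso_series {e : D ⊕ E ≃ D' ⊕ E'}
    (e1 : ∀ d, e ((R.series R₁ m m₁).rot d) = (R'.series R₁' m' m₁').rot (e d))
    (e2 : ∀ d, e ((R.series R₁ m m₁).flip d) = (R'.series R₁' m' m₁').flip (e d))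
    (e3 : e (Sum.inl R.root) = Sum.inl R'.root) (T : R₁.Bridgeless) (d : E) :
    ∃ d', e (Sum.inr d) = Sum.inr d' := by
  suffices {d | ∃ d', e (Sum.inr d) = Sum.inr d'} = Set.univ from this.ge (Set.mem_univ d)
  have er : e (Sum.inr (R₁.flip R₁.root)) = Sum.inr (R₁'.flip R₁'.root) := by
    have := e2 (Sum.inl R.root)
    rwa [e3, series_flip_root, series_flip_root] at this
  have hne : {d | ∃ d', e (Sum.inr d) = Sum.inr d'}.Nonempty := ⟨_, _, er⟩
  have hρ : ∀ d ∈ {d | ∃ d', e (Sum.inr d) = Sum.inr d'},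
      R₁.rot d ∈ {d | ∃ d', e (Sum.inr d) = Sum.inr d'} := by
    rintro d ⟨d', hd⟩
    have := e1 (Sum.inr d)
    rw [hd] at this
    exact ⟨_, this⟩
  have hα : ∀ d ∈ {d | ∃ d', e (Sum.inr d) = Sum.inr d'}, d ≠ R₁.root → d ≠ R₁.flip R₁.root →
      e (Sum.inr d) ≠ Sum.inr R₁'.root → R₁.flip d ∈ {d | ∃ d', e (Sum.inr d) = Sum.inr d'} := by
    rintro d ⟨d', hd⟩ h1 h2 h3
    have := e2 (Sum.inr d)
    rw [series, series, sub_flip_inr h1 h2, hd, sub_flip_inr] at this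
    · exact ⟨_, this⟩
    · rwa [hd, Ne, Sum.inr.injEq] at h3
    · intro g
      rw [g, ← er] at hd
      exact h2 (Sum.inr.inj (e.injective hd))
  by_cases ha : ∃ a, e (Sum.inr a) = Sum.inr R₁'.root ∧ a ≠ R₁.root
  · obtain ⟨a, ha, har⟩ := ha
    refine T a har (fun g => ?_) _ hne hρ fun d hd h1 h2 h3 _ => hα d hd h1 h2 fun g => ?_
    · rw [g, er] at ha
      exact R₁'.flip_ne _ (Sum.inr.inj ha)
    · exact h3 (Sum.inr.inj (e.injective (g.trans ha.symm)))
  · push Not at ha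
    exact R₁.isConn.eq_univ_of_off m₁ R₁.root hne hρ fun d hd h1 h2 =>
      hα d hd h1 h2 fun g => h1 (ha d g)

/-- A series composition determines its parts, if the second part is not a series composition. -/
theorem iso_of_series (i : (R.series R₁ m m₁).Iso (R'.series R₁' m' m₁')) (T : R₁.Bridgeless)
    (T' : R₁'.Bridgeless) : R.Iso R' ∧ R₁.Iso R₁' := by
  obtain ⟨e, e1, e2, e3⟩ := i
  rw [series_root, series_root] at e3
  have hr := inr_mem_of_iso_series e1 e2 e3 T
  have er : e (Sum.inr (R₁.flip R₁.root)) = Sum.inr (R₁'.flip R₁'.root) := by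
    have := e2 (Sum.inl R.root)
    rwa [e3, series_flip_root, series_flip_root] at this
  have hl : ∀ d, ∃ d', e (Sum.inl d) = Sum.inl d' := by
    intro d
    rcases hd : e (Sum.inl d) with d' | d'
    · exact ⟨_, rfl⟩
    · obtain ⟨d'', h''⟩ := inr_mem_of_iso_series (e := e.symm) (symm_comm_of_comm e1)
        (symm_comm_of_comm e2) (by rw [← e3, e.symm_apply_apply]) T' d'
      rw [← hd, e.symm_apply_apply] at h''
      simp at h''
  have hf : e (Sum.inl (R.flip R.root)) = Sum.inl (R'.flip R'.root) := by
    obtain ⟨d, hd⟩ := hr R₁.root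
    obtain ⟨d', hd'⟩ := hl (R.flip R.root)
    have := e2 (Sum.inl (R.flip R.root))
    rw [series, sub_flip_inl_self, hd, hd', series] at this
    by_cases h1 : d' = R'.flip R'.root
    · rw [hd', h1]
    by_cases h2 : d' = R'.flip (R'.flip R'.root)
    · rw [h2, sub_flip_inl_flip, ← er, ← hd] at this
      exact (R₁.flip_ne _ (Sum.inr.inj (e.injective this)).symm).elim
    rw [sub_flip_inl h1 h2] at this
    simp at this
  exact iso_of_sub_of_range e1 e2 e3 hl hr hf (by rw [R.flip_flip, R'.flip_flip]; exact e3)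

theorem exists_isLink_of_not_bridgeless (m : R.Is4) (T : ¬ R.Bridgeless) :
    ∃ y K, R.IsLink R.root y K ∧ K.Nonempty := by
  unfold Bridgeless at T
  push Not at T
  obtain ⟨a, h1, h2, S, hne, hρ, hα, hu⟩ := T
  have hS := IsVertexSet.of_forall_mem hρ
  -- one of the two sides of the cut contains only the end of the root edge
  suffices ∃ K, IsVertexSet R.rot K ∧ R.flip R.root ∈ bdry R.flip K ∧
      bdry R.flip K ⊆ {R.flip R.root, a, R.flip a} by
    obtain ⟨K, hK, hr, hb⟩ := this
    obtain ⟨d, hd, hb'⟩ := m.exists_bdry_eq_pair hK hb hr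
    have hr' := hr.2
    rw [R.flip_flip] at hr'
    have := isLink_of_bdry hK hr' hb' hd.symm
    rw [R.flip_flip] at this
    exact ⟨_, K, this, _, hr.1⟩
  by_cases hr : R.root ∈ bdry R.flip S
  · refine ⟨Sᶜ, hS.compl, ⟨hr.2, fun h => h (by rw [R.flip_flip]; exact hr.1)⟩, fun d hd => ?_⟩
    have hd1 : R.flip d ∈ S := not_not.1 hd.2
    by_contra! hcon
    simp only [Set.mem_insert_iff, Set.mem_singleton_iff, not_or] at hcon
    have h3 := hα _ hd1 (fun g => hcon.1 (by rw [← g, R.flip_flip]))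
      (fun g => hr.2 (by rw [← g]; exact hd1)) (fun g => hcon.2.2 (by rw [← g, R.flip_flip]))
      fun g => hcon.2.1 (R.flip.injective g)
    rw [R.flip_flip] at h3
    exact hd.1 h3
  by_cases hr' : R.flip R.root ∈ bdry R.flip S
  · refine ⟨S, hS, hr', fun d hd => ?_⟩
    by_contra! hcon
    simp only [Set.mem_insert_iff, Set.mem_singleton_iff, not_or] at hcon
    exact hd.2 (hα d hd.1 (fun g => hr (g ▸ hd)) hcon.1 hcon.2.1 hcon.2.2)
  · refine (hu (R.isConn.eq_univ_of_off m a hne hρ fun d hd h3 h4 => ?_)).elim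
    by_contra hd'
    exact hd' (hα d hd (fun g => hr (g ▸ ⟨hd, hd'⟩)) (fun g => hr' (g ▸ ⟨hd, hd'⟩)) h3 h4)

/-- If the map without the root edge has a bridge, then the map is a series composition: the second
part is chosen minimal. -/
theorem exists_series (m : R.Is4) (T : ¬ R.Bridgeless) :
    ∃ (K : Set D) (X : RootedMap (Kᶜ : Set D)) (Y : RootedMap K) (mX : X.Is4) (mY : Y.Is4),
      R.Iso (X.series Y mX mY) ∧ Y.Bridgeless := by
  obtain ⟨K, ⟨⟨y, k⟩, hne⟩, hmin⟩ := WellFounded.has_min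
    (InvImage.wf (fun K : Set D => K.ncard) Nat.lt_wfRel.wf)
    {K | (∃ y, R.IsLink R.root y K) ∧ K.Nonempty} (by
      obtain ⟨y, K, k, hne⟩ := exists_isLink_of_not_bridgeless m T
      exact ⟨K, ⟨y, k⟩, hne⟩)
  obtain ⟨S⟩ := R.exists_splitting m (k₁ := R.flip y) (k₂ := R.flip R.root) k.vertexSet
    k.root_notMem (by rw [k.bdry_eq hne, Set.pair_comm]) (R.flip.injective.ne k.ne.symm)
  have hh : (⟨R.flip (R.flip y), S.hf₁⟩ : (Kᶜ : Set D)) = S.out.flip S.out.root := by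
    have h1 : S.out.flip ⟨R.flip (R.flip y), S.hf₁⟩ = S.out.root := by
      rw [S.out_flip_cut]
      exact Subtype.ext (by rw [S.out_root]; exact R.flip_flip _)
    rw [← h1, S.out.flip_flip]
  refine ⟨K, S.out, S.inn, S.out4, S.inn4, ?_, ?_⟩
  · have := S.iso
    rwa [hh] at this
  · by_contra T'
    obtain ⟨y', K', k', hne'⟩ := exists_isLink_of_not_bridgeless S.inn4 T'
    have hroot : (S.inn.root : D) = R.flip y := congrArg Subtype.val S.inn_root
    have hfroot : (S.inn.flip S.inn.root : D) = R.flip R.root := congrArg Subtype.val S.inn_flip_root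
    have hfl := k'.flip_left_mem hne'
    have hval : ∀ d : K, (d : D) ∈ Subtype.val '' K' ↔ d ∈ K' := fun d => by simp
    have hrn : R.root ∉ Subtype.val '' K' := by
      rintro ⟨d, -, hd⟩
      exact k.root_notMem (hd ▸ d.2)
    -- a chain in the second part that starts with the root edge is a chain of the whole map
    refine hmin (Subtype.val '' K') ⟨⟨y', IsVertexSet.image (ι := Subtype.val) (ρ := R.rot)
      (fun d => S.inn_rot d) Subtype.val_injective k'.vertexSet, hrn, hrn, fun h => k'.right_notMem ((hval _).1 h),
      fun h => k.root_notMem (h ▸ y'.2), fun d hd => ?_⟩, hne'.image _⟩ ?_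
    · by_cases hdr : d = R.root
      · rw [hdr, ← hfroot]
        exact Or.inl ⟨_, hfl, rfl⟩
      obtain ⟨d, hd', rfl⟩ : ∃ d' : K, (d' ∈ K' ∨ d' = y') ∧ (d' : D) = d := by
        rcases hd with ⟨d', hd', rfl⟩ | hd | hd
        · exact ⟨d', Or.inl hd', rfl⟩
        · exact (hdr hd).elim
        · exact ⟨y', Or.inr rfl, hd.symm⟩
      by_cases h2 : (d : D) = R.flip R.root
      · right; left; rw [h2, R.flip_flip]
      by_cases h1 : (d : D) = R.flip y
      · exfalso
        have h1' : d = S.inn.root := Subtype.ext (h1.trans hroot.symm)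
        rcases hd' with hd' | hd'
        · exact k'.root_notMem (h1' ▸ hd')
        · exact k'.ne (h1' ▸ hd')
      have := k'.flip_mem d (hd'.imp_right Or.inr)
      rw [← S.inn_flip d h1 h2]
      rcases this with h3 | h3 | h3
      · exact Or.inl ⟨_, h3, rfl⟩
      · exfalso
        have : d = S.inn.flip S.inn.root := by rw [← h3, S.inn.flip_flip]
        exact h2 (by rw [this, hfroot])
      · exact Or.inr (Or.inr (congrArg _ h3))
    · refine Set.ncard_lt_ncard ⟨?_, fun h => ?_⟩
      · rintro _ ⟨d, -, rfl⟩
        exact d.2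
      · exact k'.root_notMem ((hval _).1 (h S.inn.root.2))

end RootedMap

/-! ### The position of chains parallel to the root edge -/

namespace RootedMap

section

variable {D E : Type*} {R : RootedMap D} {R' : RootedMap E}

theorem Iso.isDip (h : R.Iso R') : R'.IsDip ↔ R.IsDip := by
  obtain ⟨e, h1, h2, h3⟩ := h
  exact isDip_congr h1 h2 h3

theorem prev_congr {e : D ≃ E} (h1 : ∀ d, e (R.rot d) = R'.rot (e d))
    (h2 : ∀ d, e (R.flip d) = R'.flip (e d)) (h3 : e R.root = R'.root) : e R.prev = R'.prev := by
  apply R'.rot.injective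
  rw [R'.rot_prev, ← h1, R.rot_prev, h2, h3]

end

theorem Reduced.flip_eq {D : Type*} {R : RootedMap D} {x y : D} (hR : R.Reduced)
    (hx : R.rot.SameCycle R.root x) (hxr : x ≠ R.root) (k : R.Link x y) : y = R.flip x := by
  obtain ⟨K, k⟩ := k
  have := hR x y K hx hxr k
  subst this
  rcases k.flip_mem x (Or.inr (Or.inl rfl)) with h1 | h1 | h1
  · exact h1.elim
  · exact (R.flip_ne x h1).elim
  · exact h1.symm

/-- The cyclic order around the final vertex of the chains that are parallel to the root edge is
opposite to the one around its initial vertex, and there is no chain in the second position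
unless all edges belong to such chains. -/
theorem IsCore.link_position {D : Type*} [Finite D] {R : RootedMap D} (c : R.IsCore) (m : R.Is4)
    {x y : D} (hx : R.rot.SameCycle R.root x) (hxr : x ≠ R.root)
    (hy : R.rot.SameCycle (R.flip R.root) y) (k : R.Link x y) :
    (x = R.rot R.root ∧ R.rot y = R.flip R.root) ∨
      (x = R.rot (R.rot R.root) ∧ R.rot (R.rot y) = R.flip R.root ∧ R.IsDip) ∨
        (R.rot x = R.root ∧ R.rot (R.flip R.root) = y) := by
  induction hn : Nat.card D using Nat.strong_induction_on generalizing D with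
  | _ n ih =>
  subst hn
  by_cases hred : R.Reduced
  · obtain rfl := hred.flip_eq hx hxr k
    by_cases hd : R.IsDip
    · have hall : ∀ z, R.rot.SameCycle R.root z → R.rot.SameCycle (R.flip R.root) (R.flip z) := by
        intro z hz
        by_cases hzr : z = R.root
        · rw [hzr]
        · exact (hred.linkedToT_iff hz hzr).1 (hd z hz hzr)
      have key : ∀ w, R.rot.SameCycle R.root w → R.rot (R.flip (R.rot w)) = R.flip w := by
        intro w hw
        refine m.dipole R.isConn R.isPlanar (fun h => c.not_loop ?_) fun z hz =>
          (hall _ hw).symm.trans (hall _ (hw.trans hz))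
        exact hw.trans (h.trans (hall _ hw).symm)
      have s1 : R.rot.SameCycle R.root (R.rot R.root) :=
        sameCycle_apply_right.2 (SameCycle.refl _ _)
      have s2 : R.rot.SameCycle R.root (R.rot (R.rot R.root)) := sameCycle_apply_right.2 s1
      have k1 := key _ (SameCycle.refl _ _)
      have k2 := key _ s1
      have k3 := key _ s2
      rcases m.sameCycle_iff.1 hx with rfl | rfl | rfl | rfl
      · exact (hxr rfl).elim
      · exact Or.inl ⟨rfl, k1⟩
      · exact Or.inr (Or.inl ⟨rfl, by rw [k2, k1], hd⟩)
      · exact Or.inr (Or.inr ⟨m.rot4 _, by rw [← k1, ← k2, ← k3, m.rot4]⟩)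
    · unfold IsDip at hd
      push Not at hd
      obtain ⟨p, hp, hpr, hL⟩ := hd
      have hpx : p ≠ x := fun h => hL (h ▸ ⟨_, hy, k⟩)
      rcases c.face_or_face m hx hxr hy hp hpr hpx hL with h | h
      · exact Or.inr (Or.inr h)
      · exact Or.inl ⟨h.1.symm, h.2⟩
  unfold Reduced at hred
  push Not at hred
  obtain ⟨x₀, y₀, K, hx₀, hxr₀, k₀, hne⟩ := hred
  obtain ⟨S, x', -, i, h1, h2, -, -, c'⟩ := c.exists_splitting m k₀ hne hx₀ hxr₀
  have hcard : Nat.card (Kᶜ : Set D) < Nat.card D := by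
    obtain ⟨d, hd⟩ := hne
    exact Finite.card_subtype_lt (x := d) (fun h => h hd)
  have hdip := (isDip_sub_iff (R' := S.inn) (m := S.out4) (m' := S.inn4) h1 h2).symm.trans i.isDip
  have hfr := flip_root_sub (R' := S.inn) (m := S.out4) (m' := S.inn4) h1 h2
  obtain ⟨e, e1, e2, e3⟩ := i
  rw [sub_root] at e3
  have hx2 := (sameCycle_congr e1).2 hx
  have hy2 := (sameCycle_congr e1).2 hy
  have k2 := (link_congr e1 e2 e3).2 k
  have e4 : e (R.flip R.root) = Sum.inl (S.out.flip S.out.root) := by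
    rw [e2, e3, ← sub_root (m := S.out4) (m' := S.inn4), hfr]
  rw [e3] at hx2
  rw [e4] at hy2
  obtain ⟨x₁, hx₁⟩ : ∃ x₁, e x = Sum.inl x₁ := by
    rcases hd : e x with d | d
    · exact ⟨d, rfl⟩
    · rw [hd] at hx2; exact (not_inl_sameCycle_sub hx2).elim
  obtain ⟨y₁, hy₁⟩ : ∃ y₁, e y = Sum.inl y₁ := by
    rcases hd : e y with d | d
    · exact ⟨d, rfl⟩
    · rw [hd] at hy2; exact (not_inl_sameCycle_sub hy2).elim
  rw [hx₁] at hx2 k2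
  rw [hy₁] at hy2 k2
  have := ih _ hcard c' S.out4 (inl_sameCycle_sub.1 hx2)
    (fun h => hxr (e.injective (by rw [hx₁, h, e3]))) (inl_sameCycle_sub.1 hy2)
    (link_sub_iff.1 k2) rfl
  have inl : ∀ {a b : (Kᶜ : Set D)}, a = b ↔ (Sum.inl a : (Kᶜ : Set D) ⊕ K) = Sum.inl b :=
    Sum.inl_injective.eq_iff.symm
  rw [inl, inl, inl, inl, inl, inl] at this
  simpa only [← sub_rot_inl (m := S.out4) (m' := S.inn4) (h := x'), ← hx₁, ← hy₁, ← e3, ← e4, ← e1,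
    e.injective.eq_iff, hdip] using this

/-- The edge that follows the root edge around its initial vertex belongs to a chain that ends with
the edge that precedes the root edge around its final vertex. -/
def FrontLink {D : Type*} (R : RootedMap D) : Prop := R.Link (R.rot R.root) R.prev

/-- The edge that follows the root edge around its initial vertex forms a face with it. -/
def FrontEdge {D : Type*} (R : RootedMap D) : Prop := R.flip (R.rot R.root) = R.prev

theorem FrontEdge.frontLink {D : Type*} {R : RootedMap D} (h : R.FrontEdge) : R.FrontLink := by
  rw [FrontLink, ← show _ = _ from h]
  exact ⟨_, R.isLink_empty _⟩

section

variable {D E : Type*} {R : RootedMap D} {R' : RootedMap E}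

theorem Iso.frontLink (i : R.Iso R') : R.FrontLink ↔ R'.FrontLink := by
  obtain ⟨e, h1, h2, h3⟩ := i
  rw [FrontLink, FrontLink, ← prev_congr h1 h2 h3, ← h3, ← h1, link_congr h1 h2 h3]

theorem Iso.frontEdge (i : R.Iso R') : R.FrontEdge ↔ R'.FrontEdge := by
  obtain ⟨e, h1, h2, h3⟩ := i
  rw [FrontEdge, FrontEdge, ← prev_congr h1 h2 h3, ← h3, ← h1, ← h2, e.injective.eq_iff]

theorem Iso.prev_eq_root (i : R.Iso R') : R.prev = R.root ↔ R'.prev = R'.root := by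
  obtain ⟨e, h1, h2, h3⟩ := i
  rw [← prev_congr h1 h2 h3, ← h3, e.injective.eq_iff]

end

section Sub

variable {D E D' E' : Type*} [Finite D] [Finite E] [Finite D'] [Finite E']
  {R : RootedMap D} {R₁ : RootedMap E} {m : R.Is4} {m₁ : R₁.Is4}
  {R' : RootedMap D'} {R₁' : RootedMap E'} {m' : R'.Is4} {m₁' : R₁'.Is4}

theorem FrontEdge.rot_root_ne (h : R.FrontEdge) (hp : R.prev ≠ R.root) :
    R.rot R.root ≠ R.flip R.root := by
  intro h'
  rw [FrontEdge, h', R.flip_flip] at h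
  exact hp h.symm

theorem prev_sub {h : D} (h1 : h ≠ R.root) (h2 : h ≠ R.flip R.root) :
    (R.sub h R₁ m m₁).prev = Sum.inl R.prev := by
  apply (R.sub h R₁ m m₁).rot.injective
  rw [rot_prev, flip_root_sub h1 h2, sub_rot_inl, rot_prev]

theorem frontLink_sub (h : R.FrontEdge) (hp : R.prev ≠ R.root) :
    (R.sub (R.rot R.root) R₁ m m₁).FrontLink := by
  rw [FrontLink, prev_sub (m.rot_ne _) (h.rot_root_ne hp), sub_root, sub_rot_inl, link_sub_iff]
  exact h.frontLink

theorem not_frontEdge_sub (hp : R.rot R.root ≠ R.flip R.root) :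
    ¬ (R.sub (R.rot R.root) R₁ m m₁).FrontEdge := by
  rw [FrontEdge, prev_sub (m.rot_ne _) hp, sub_root, sub_rot_inl, sub_flip_inl_self]
  simp

theorem FrontEdge.iso_of_sub (h : R.FrontEdge) (hp : R.prev ≠ R.root) (h' : R'.FrontEdge)
    (hp' : R'.prev ≠ R'.root)
    (i : (R.sub (R.rot R.root) R₁ m m₁).Iso (R'.sub (R'.rot R'.root) R₁' m' m₁')) :
    R.Iso R' ∧ R₁.Iso R₁' := by
  obtain ⟨e, e1, e2, e3⟩ := i
  rw [sub_root, sub_root] at e3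
  have hpe := prev_congr e1 e2 e3
  rw [prev_sub (m.rot_ne _) (h.rot_root_ne hp), prev_sub (m'.rot_ne _) (h'.rot_root_ne hp')] at hpe
  refine RootedMap.iso_of_sub e1 e2 e3 ?_ ?_
  · have := e1 (Sum.inl R.root)
    rwa [e3] at this
  · rw [show R.flip (R.rot R.root) = R.prev from h, show R'.flip (R'.rot R'.root) = R'.prev from h']
    exact hpe

/-- A front chain of positive length arises from a front edge by substitution. -/
theorem FrontLink.exists_sub (h : R.FrontLink) (m : R.Is4) (hp : R.prev ≠ R.root)
    (hF : ¬ R.FrontEdge) :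
    ∃ (K : Set D) (X : RootedMap (Kᶜ : Set D)) (Y : RootedMap K) (mX : X.Is4) (mY : Y.Is4),
      R.Iso (X.sub (X.rot X.root) Y mX mY) ∧ X.FrontEdge ∧ X.prev ≠ X.root := by
  obtain ⟨K, k⟩ := h
  have hne : K.Nonempty := by
    rw [Set.nonempty_iff_ne_empty]
    rintro rfl
    rcases k.flip_mem _ (Or.inr (Or.inl rfl)) with h1 | h1 | h1
    · exact h1
    · exact R.flip_ne _ h1
    · exact hF h1
  obtain ⟨S⟩ := R.exists_splitting m k.vertexSet k.root_notMem (k.bdry_eq hne)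
    (R.flip.injective.ne k.ne)
  have h1 : (⟨R.flip (R.flip (R.rot R.root)), S.hf₁⟩ : (Kᶜ : Set D)) = S.out.rot S.out.root :=
    Subtype.ext (by rw [S.out_rot, S.out_root]; exact R.flip_flip _)
  have hF : S.out.FrontEdge := by
    apply S.out.rot.injective
    rw [rot_prev, ← h1, S.out_flip_cut]
    apply Subtype.ext
    rw [S.out_rot, S.out_flip, S.out_root]
    · change R.rot (R.flip (R.flip R.prev)) = _
      rw [R.flip_flip, R.rot_prev]
    · rw [S.out_root, R.flip_flip]; exact (m.rot_ne _).symm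
    · rw [S.out_root, R.flip_flip]; exact hp.symm
  refine ⟨K, S.out, S.inn, S.out4, S.inn4, ?_, hF, ?_⟩
  · have := S.iso
    rwa [h1] at this
  · rw [← show _ = _ from hF, ← h1, S.out_flip_cut]
    intro g
    have := congrArg Subtype.val g
    rw [S.out_root] at this
    exact hp ((R.flip_flip _).symm.trans this)

end Sub

section Loop

variable {D : Type*} [Finite D] {R : RootedMap D}

theorem bridgeless_of_loop (m : R.Is4) (h : R.rot.SameCycle R.root (R.flip R.root)) :
    R.Bridgeless := by
  intro a _ _ S hne hρ hα
  have hr := (IsVertexSet.of_forall_mem hρ).mem_iff h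
  refine R.isConn.eq_univ_of_off m a hne hρ fun d hd h1 h2 => ?_
  by_cases h3 : d = R.root
  · rw [h3] at hd ⊢; exact hr.1 hd
  by_cases h4 : d = R.flip R.root
  · rw [h4] at hd ⊢; rw [R.flip_flip]; exact hr.2 hd
  exact hα d hd h3 h4 h1 h2

/-- The ends of a root edge that is a loop are consecutive around their vertex. -/
theorem loop_iff (m : R.Is4) : R.rot.SameCycle R.root (R.flip R.root) ↔
    R.rot R.root = R.flip R.root ∨ R.rot (R.flip R.root) = R.root := by
  constructor
  · intro h
    rcases m.sameCycle_iff.1 h with h | h | h | h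
    · exact (R.flip_ne _ h).elim
    · exact Or.inl h.symm
    · exact (m.flip_ne_rot_rot R.isConn R.isPlanar _ h).elim
    · exact Or.inr (by rw [h, m.rot4])
  · rintro (h | h)
    · rw [← h]; exact sameCycle_apply_right.2 (SameCycle.refl _ _)
    · have : R.rot.SameCycle (R.flip R.root) (R.rot (R.flip R.root)) :=
        sameCycle_apply_right.2 (SameCycle.refl _ _)
      rw [h] at this
      exact this.symm

theorem prev_eq_root_iff : R.prev = R.root ↔ R.rot R.root = R.flip R.root := by
  rw [← R.rot.injective.eq_iff, R.rot_prev, eq_comm]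

theorem frontLink_of_loop (m : R.Is4) (h : R.rot (R.flip R.root) = R.root) : R.FrontLink := by
  have hf : R.flip R.root = R.rot (R.rot (R.rot R.root)) := by
    rw [← R.rot.injective.eq_iff, h, m.rot4]
  have hp : R.prev = R.rot (R.rot R.root) := by
    rw [← R.rot.injective.eq_iff, rot_prev, hf]
  rw [FrontLink, hp]
  have hv : ∀ d, R.rot.SameCycle R.root d ↔ _ := fun d => m.sameCycle_iff
  refine ⟨(vertexOf R.rot R.root)ᶜ, (isVertexSet_vertexOf _ _).compl,
    fun h => h (self_mem_vertexOf _ _), fun h => h ((hv _).2 (Or.inr (Or.inl rfl))),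
    fun h => h ((hv _).2 (Or.inr (Or.inr (Or.inl rfl)))), (m.rot_ne _).symm, ?_⟩
  -- the half-edges in question are those outside the root edge
  have key : ∀ d, (d ∈ (vertexOf R.rot R.root)ᶜ ∨ d = R.rot R.root ∨ d = R.rot (R.rot R.root)) ↔
      d ≠ R.root ∧ d ≠ R.flip R.root := by
    intro d
    have : d ∈ (vertexOf R.rot R.root)ᶜ ↔ ¬ R.rot.SameCycle R.root d := Iff.rfl
    rw [this, hv, hf]
    constructor
    · rintro (h | rfl | rfl)
      · tauto
      · exact ⟨m.rot_ne _, (m.rot2_ne _).symm⟩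
      · exact ⟨m.rot2_ne _, (m.rot_ne _).symm⟩
    · tauto
  intro d hd
  rw [key] at hd ⊢
  exact ⟨fun h => hd.2 (by rw [← h, R.flip_flip]), fun h => hd.1 (R.flip.injective h)⟩

end Loop

end RootedMap

/-! ### Pinching and composition -/

namespace RootedMap

variable {D E D' : Type*} [Finite D] [Finite E] [Finite D'] {R : RootedMap D} {R' : RootedMap D'}
  {m : R.Is4} {m' : R'.Is4} {h : R.prev ≠ R.root} {h' : R'.prev ≠ R'.root}

theorem forall_fin_four {p : Fin 4 → Prop} (h0 : p 0) (h1 : p 1) (h2 : p 2) (h3 : p 3) (i : Fin 4) :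
    p i := by
  obtain rfl | rfl | rfl | rfl : i = 0 ∨ i = 1 ∨ i = 2 ∨ i = 3 :=
    (by decide : ∀ d : Fin 4, d = 0 ∨ d = 1 ∨ d = 2 ∨ d = 3) i
  exacts [h0, h1, h2, h3]

/-- If a bijection is compatible with the matchings on one end of each edge, it is so on the other.
-/
theorem comm_flip {D D' : Type*} {R : RootedMap D} {R' : RootedMap D'} {f : D → D'} {d d' : D}
    (hd : R.flip d = d') (h : f (R.flip d) = R'.flip (f d)) : f (R.flip d') = R'.flip (f d') := by
  rw [← hd, R.flip_flip, h, R'.flip_flip]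

theorem Iso.pinch (i : R.Iso R') : (R.pinch m h).Iso (R'.pinch m' h') := by
  obtain ⟨e, e1, e2, e3⟩ := i
  have e4 := prev_congr e1 e2 e3
  refine ⟨Equiv.sumCongr e (Equiv.refl _), ?_, ?_, rfl⟩
  · rintro (d | i)
    · simp [e1]
    · rfl
  have hi : ∀ i, Equiv.sumCongr e (Equiv.refl _) ((R.pinch m h).flip (Sum.inr i)) =
      (R'.pinch m' h').flip (Equiv.sumCongr e (Equiv.refl _) (Sum.inr i)) := by
    refine forall_fin_four ?_ ?_ ?_ ?_
    · simp [pinch_flip_zero, e2, e3]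
    · simp [pinch_flip_one, e4]
    · simp [pinch_flip_two, e2, e4]
    · simp [pinch_flip_three, e3]
  rintro (d | i)
  · by_cases h1 : d = R.root
    · rw [h1]; exact comm_flip pinch_flip_three (hi 3)
    by_cases h2 : d = R.flip R.root
    · rw [h2]; exact comm_flip pinch_flip_zero (hi 0)
    by_cases h3 : d = R.prev
    · rw [h3]; exact comm_flip pinch_flip_one (hi 1)
    by_cases h4 : d = R.flip R.prev
    · rw [h4]; exact comm_flip pinch_flip_two (hi 2)
    rw [pinch_flip_inl h1 h2 h3 h4, Equiv.sumCongr_apply, Sum.map_inl, Equiv.sumCongr_apply,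
      Sum.map_inl, pinch_flip_inl, e2]
    · rw [← e3]; exact e.injective.ne h1
    · rw [← e3, ← e2]; exact e.injective.ne h2
    · rw [← e4]; exact e.injective.ne h3
    · rw [← e4, ← e2]; exact e.injective.ne h4
  · exact hi i

theorem iso_of_pinch (i : (R.pinch m h).Iso (R'.pinch m' h')) : R.Iso R' := by
  obtain ⟨e, e1, e2, e3⟩ := i
  have hr : ∀ i, e (Sum.inr i) = Sum.inr i := by
    have step : ∀ i, e (Sum.inr i) = Sum.inr i →
        e (Sum.inr (finRotate 4 i)) = Sum.inr (finRotate 4 i) := fun i hi => by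
      rw [← pinch_rot_inr (m := m) (h := h), e1, hi, pinch_rot_inr]
    exact forall_fin_four e3 (step 0 e3) (step 1 (step 0 e3)) (step 2 (step 1 (step 0 e3)))
  obtain ⟨f, g, hf, -⟩ := exists_equiv_of_sum e (fun d => by
    rcases hd : e (Sum.inl d) with d' | i
    · exact ⟨_, rfl⟩
    · rw [← hr, e.injective.eq_iff] at hd
      simp at hd) fun i => ⟨i, hr i⟩
  have key : ∀ {i a a'}, (R.pinch m h).flip (Sum.inr i) = Sum.inl a →
      (R'.pinch m' h').flip (Sum.inr i) = Sum.inl a' → f a = a' := fun {i a a'} ha ha' =>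
    Sum.inl.inj (by rw [← hf, ← ha, e2, hr, ha'])
  have f1 := key pinch_flip_three pinch_flip_three
  have f2 := key pinch_flip_zero pinch_flip_zero
  have f3 := key pinch_flip_one pinch_flip_one
  have f4 := key pinch_flip_two pinch_flip_two
  refine ⟨f, fun d => ?_, fun d => ?_, f1⟩
  · apply Sum.inl_injective (β := Fin 4)
    rw [← hf, ← pinch_rot_inl (m := m) (h := h), e1, hf, pinch_rot_inl]
  by_cases h1 : d = R.root
  · rw [h1, f1, f2]
  by_cases h2 : d = R.flip R.root
  · rw [h2, f2, R.flip_flip, R'.flip_flip, f1]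
  by_cases h3 : d = R.prev
  · rw [h3, f3, f4]
  by_cases h4 : d = R.flip R.prev
  · rw [h4, f4, R.flip_flip, R'.flip_flip, f3]
  apply Sum.inl_injective (β := Fin 4)
  rw [← hf, ← pinch_flip_inl (m := m) (h := h) h1 h2 h3 h4, e2, hf, pinch_flip_inl]
  · rw [← f1]; exact f.injective.ne h1
  · rw [← f2]; exact f.injective.ne h2
  · rw [← f3]; exact f.injective.ne h3
  · rw [← f4]; exact f.injective.ne h4

/-- Pinching commutes with the substitution for the edge that precedes the root edge around its
final vertex. -/
theorem iso_pinch_sub {R₁ : RootedMap E} {m₁ : R₁.Is4} {x : D} (h1 : x ≠ R.root)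
    (h2 : x ≠ R.flip R.root) (hx : R.flip x = R.prev)
    (mA : (R.sub x R₁ m m₁).Is4) (hA : (R.sub x R₁ m m₁).prev ≠ (R.sub x R₁ m m₁).root) :
    ((R.sub x R₁ m m₁).pinch mA hA).Iso ((R.pinch m h).sub (Sum.inl x) R₁ is4_pinch m₁) := by
  set A := R.sub x R₁ m m₁ with hAdef
  set B := R.pinch m h with hB
  have hx' : R.flip R.prev = x := by rw [← hx, R.flip_flip]
  have a1 : A.flip A.root = Sum.inl (R.flip R.root) := flip_root_sub h1 h2
  have a2 : A.prev = Sum.inl R.prev := prev_sub h1 h2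
  have a3 : A.flip A.prev = Sum.inr (R₁.flip R₁.root) := by rw [a2, ← hx, sub_flip_inl_flip]
  have a4 : A.root = Sum.inl R.root := rfl
  have b2 : B.flip (Sum.inl x) = Sum.inr 2 := by rw [← hx']; exact pinch_flip_flip_prev
  set φ : (D ⊕ E) ⊕ Fin 4 ≃ (D ⊕ Fin 4) ⊕ E := (Equiv.sumAssoc D E (Fin 4)).trans
    ((Equiv.sumCongr (Equiv.refl D) (Equiv.sumComm E (Fin 4))).trans
      (Equiv.sumAssoc D (Fin 4) E).symm) with hφ
  have φ1 : ∀ d, φ (Sum.inl (Sum.inl d)) = Sum.inl (Sum.inl d) := fun d => rfl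
  have φ2 : ∀ d, φ (Sum.inl (Sum.inr d)) = Sum.inr d := fun d => rfl
  have φ3 : ∀ i, φ (Sum.inr i) = Sum.inl (Sum.inr i) := fun d => rfl
  have hi : ∀ i, φ ((A.pinch mA hA).flip (Sum.inr i)) =
      (B.sub (Sum.inl x) R₁ is4_pinch m₁).flip (φ (Sum.inr i)) := by
    refine forall_fin_four ?_ ?_ ?_ ?_
    · rw [pinch_flip_zero, a1, φ1, φ3, sub_flip_inl (by simp) (by rw [b2]; simp), pinch_flip_zero]
    · rw [pinch_flip_one, a2, φ1, φ3, sub_flip_inl (by simp) (by rw [b2]; simp), pinch_flip_one]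
    · rw [pinch_flip_two, a3, φ2, φ3, ← b2, sub_flip_inl_flip]
    · rw [pinch_flip_three, a4, φ1, φ3, sub_flip_inl (by simp) (by rw [b2]; simp), pinch_flip_three]
  have hx2 : (A.pinch mA hA).flip (Sum.inl (Sum.inl x)) = Sum.inl (Sum.inr R₁.root) := by
    rw [pinch_flip_inl, hAdef, sub_flip_inl_self]
    · simpa [a4] using h1
    · simpa [a1] using h2
    · rw [a2, ← hx]; simpa using (R.flip_ne x).symm
    · rw [a3]; simp
  have hxc : φ ((A.pinch mA hA).flip (Sum.inl (Sum.inl x))) =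
      (B.sub (Sum.inl x) R₁ is4_pinch m₁).flip (φ (Sum.inl (Sum.inl x))) := by
    rw [hx2, φ2, φ1, sub_flip_inl_self]
  refine ⟨φ, ?_, ?_, rfl⟩
  · rintro ((d | d) | i) <;> rfl
  rintro ((d | d) | i)
  · by_cases d1 : d = R.root
    · rw [d1]; exact comm_flip pinch_flip_three (hi 3)
    by_cases d2 : d = R.flip R.root
    · rw [d2]; exact comm_flip (pinch_flip_zero.trans (by rw [a1])) (hi 0)
    by_cases d3 : d = R.prev
    · rw [d3]; exact comm_flip (pinch_flip_one.trans (by rw [a2])) (hi 1)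
    by_cases d4 : d = x
    · rw [d4]; exact hxc
    have g1 : A.flip (Sum.inl d) = Sum.inl (R.flip d) := sub_flip_inl d4 (by rwa [hx])
    rw [pinch_flip_inl (R := A) (by simpa [a4] using d1) (by simpa [a1] using d2) (by simpa [a2] using d3)
      (by simp [a3]), g1, φ1, φ1, sub_flip_inl (by simpa using d4) (by rw [b2]; simp),
      pinch_flip_inl d1 d2 d3 (by rwa [hx'])]
  · by_cases d1 : d = R₁.root
    · rw [d1]; exact comm_flip hx2 hxc
    by_cases d2 : d = R₁.flip R₁.root
    · rw [d2]; exact comm_flip (pinch_flip_two.trans (by rw [a3])) (hi 2)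
    have g1 : A.flip (Sum.inr d) = Sum.inr (R₁.flip d) := sub_flip_inr d1 d2
    rw [pinch_flip_inl (R := A) (by simp [a4]) (by simp [a1]) (by simp [a2]) (by simpa [a3] using d2), g1,
      φ2, φ2, sub_flip_inr d1 d2]
  · exact hi i

theorem prev_series {R₁ : RootedMap E} {m₁ : R₁.Is4} :
    (R₁.series R m₁ m).prev = Sum.inr R.prev := by
  apply (R₁.series R m₁ m).rot.injective
  rw [rot_prev, series_root, series_flip_root, series, sub_rot_inr, rot_prev]

/-- Pinching a series composition amounts to a substitution into the pinched second part. -/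
theorem iso_pinch_series {R₁ : RootedMap E} {m₁ : R₁.Is4} (mA : (R₁.series R m₁ m).Is4)
    (hA : (R₁.series R m₁ m).prev ≠ (R₁.series R m₁ m).root) :
    ((R₁.series R m₁ m).pinch mA hA).Iso ((R.pinch m h).sub (Sum.inr 3) R₁ is4_pinch m₁) := by
  set A := R₁.series R m₁ m with hAdef
  set B := R.pinch m h with hB
  have a1 : A.flip A.root = Sum.inr (R.flip R.root) := series_flip_root
  have a2 : A.prev = Sum.inr R.prev := prev_series
  have a3 : A.flip A.prev = Sum.inr (R.flip R.prev) := by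
    rw [a2]; exact sub_flip_inr h (R.prev_ne m)
  have a4 : A.root = Sum.inl R₁.root := rfl
  have b3 : B.flip (Sum.inr 3) = Sum.inl R.root := pinch_flip_three
  set φ : (E ⊕ D) ⊕ Fin 4 ≃ (D ⊕ Fin 4) ⊕ E := (Equiv.sumAssoc E D (Fin 4)).trans
    (Equiv.sumComm E (D ⊕ Fin 4)) with hφ
  have φ1 : ∀ d, φ (Sum.inl (Sum.inl d)) = Sum.inr d := fun d => rfl
  have φ2 : ∀ d, φ (Sum.inl (Sum.inr d)) = Sum.inl (Sum.inl d) := fun d => rfl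
  have φ3 : ∀ i, φ (Sum.inr i) = Sum.inl (Sum.inr i) := fun d => rfl
  have hi : ∀ i, φ ((A.pinch mA hA).flip (Sum.inr i)) =
      (B.sub (Sum.inr 3) R₁ is4_pinch m₁).flip (φ (Sum.inr i)) := by
    refine forall_fin_four ?_ ?_ ?_ ?_
    · rw [pinch_flip_zero, a1, φ2, φ3, sub_flip_inl (by simp) (by rw [b3]; simp), pinch_flip_zero]
    · rw [pinch_flip_one, a2, φ2, φ3, sub_flip_inl (by simp) (by rw [b3]; simp), pinch_flip_one]
    · rw [pinch_flip_two, a3, φ2, φ3, sub_flip_inl (by simp) (by rw [b3]; simp), pinch_flip_two]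
    · rw [pinch_flip_three, a4, φ1, φ3, sub_flip_inl_self]
  have hx2 : (A.pinch mA hA).flip (Sum.inl (Sum.inr R.root)) =
      Sum.inl (Sum.inl (R₁.flip R₁.root)) := by
    rw [pinch_flip_inl, hAdef, series, sub_flip_inr_root]
    · simp [a4]
    · simpa [a1] using (R.flip_ne _).symm
    · simpa [a2] using h.symm
    · rw [a3]
      exact fun g => R.prev_ne m (by rw [Sum.inr.inj g, R.flip_flip])
  have hxc : φ ((A.pinch mA hA).flip (Sum.inl (Sum.inr R.root))) =
      (B.sub (Sum.inr 3) R₁ is4_pinch m₁).flip (φ (Sum.inl (Sum.inr R.root))) := by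
    rw [hx2, φ1, φ2, ← b3, sub_flip_inl_flip]
  refine ⟨φ, ?_, ?_, rfl⟩
  · rintro ((d | d) | i) <;> rfl
  rintro ((d | d) | i)
  · by_cases d1 : d = R₁.root
    · rw [d1]; exact comm_flip pinch_flip_three (hi 3)
    by_cases d2 : d = R₁.flip R₁.root
    · rw [d2]; exact comm_flip hx2 hxc
    have g1 : A.flip (Sum.inl d) = Sum.inl (R₁.flip d) :=
      sub_flip_inl d2 (by rwa [R₁.flip_flip])
    rw [pinch_flip_inl (R := A) (by simpa [a4] using d1) (by simp [a1]) (by simp [a2]) (by simp [a3]), g1,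
      φ1, φ1, sub_flip_inr d1 d2]
  · by_cases d1 : d = R.root
    · rw [d1]; exact hxc
    by_cases d2 : d = R.flip R.root
    · rw [d2]; exact comm_flip (pinch_flip_zero.trans (by rw [a1])) (hi 0)
    by_cases d3 : d = R.prev
    · rw [d3]; exact comm_flip (pinch_flip_one.trans (by rw [a2])) (hi 1)
    by_cases d4 : d = R.flip R.prev
    · rw [d4]; exact comm_flip (pinch_flip_two.trans (by rw [a3])) (hi 2)
    have g1 : A.flip (Sum.inr d) = Sum.inr (R.flip d) := sub_flip_inr d1 d2
    rw [pinch_flip_inl (R := A) (by simp [a4]) (by simpa [a1] using d2) (by simpa [a2] using d3)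
      (by simpa [a3] using d4), g1, φ2, φ2, sub_flip_inl (by simp) (by rw [b3]; simpa using d1),
      pinch_flip_inl d1 d2 d3 d4]
  · exact hi i

end RootedMap

/-! ### Chains in pinched maps -/

namespace RootedMap

variable {D E : Type*} [Finite D] [Finite E] {R : RootedMap D} {m : R.Is4} {h : R.prev ≠ R.root}

/-- A chain that returns to the initial vertex of the root edge would leave a bridge there. -/
theorem IsCore.not_link_loop (c : R.IsCore) (m : R.Is4) {x y : D} (hx : R.rot.SameCycle R.root x)
    (hxr : x ≠ R.root) (hy : R.rot.SameCycle R.root y) : ¬ R.Link x y := by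
  rintro ⟨K, k⟩
  have hyr : y ≠ R.root := by
    rintro rfl
    have := c.bridgeless.eq_empty_of_isLink k.symm
    subst this
    rcases k.flip_mem _ (Or.inr (Or.inr rfl)) with h1 | h1 | h1
    · exact h1
    · exact c.not_loop (h1 ▸ hx)
    · exact R.flip_ne _ h1
  obtain ⟨w, hw, hwr, -, -, hall⟩ :=
    m.exists_fourth (SameCycle.refl R.rot R.root) hx hy hxr.symm hyr.symm k.ne
  have hf := k.flip_root_notMem hxr hyr
  have hu := c.bridgeless w hwr (fun g => c.not_loop (g ▸ hw)) (vertexOf R.rot R.root ∪ K)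
    ⟨_, Or.inl (self_mem_vertexOf _ _)⟩
    (fun d hd => (((isVertexSet_vertexOf _ _).union k.vertexSet) d).2 hd) (by
      have hxy : ∀ d, (d ∈ K ∨ d = x ∨ d = y) → d ∈ vertexOf R.rot R.root ∪ K := by
        rintro d (hd | rfl | rfl)
        exacts [Or.inr hd, Or.inl hx, Or.inl hy]
      rintro d (hd | hd) h1 - h2 -
      · rcases hall d hd with h3 | h3 | h3 | h3
        · exact (h1 h3).elim
        · exact hxy _ (k.flip_mem d (Or.inr (Or.inl h3)))
        · exact hxy _ (k.flip_mem d (Or.inr (Or.inr h3)))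
        · exact (h2 h3).elim
      · exact hxy _ (k.flip_mem d (Or.inl hd)))
  rcases hu.ge (Set.mem_univ (R.flip R.root)) with h1 | h1
  · exact c.not_loop h1
  · exact hf.1 h1

theorem inr_sameCycle_pinch (i j : Fin 4) :
    (R.pinch m h).rot.SameCycle (Sum.inr i) (Sum.inr j) := by
  have step : ∀ i, (R.pinch m h).rot.SameCycle (Sum.inr 0) (Sum.inr i) →
      (R.pinch m h).rot.SameCycle (Sum.inr 0) (Sum.inr (finRotate 4 i)) := fun i hi => by
    rw [← pinch_rot_inr (m := m) (h := h)]
    exact sameCycle_apply_right.2 hi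
  have h0 := SameCycle.refl (R.pinch m h).rot (Sum.inr 0)
  have : ∀ i, (R.pinch m h).rot.SameCycle (Sum.inr 0) (Sum.inr i) :=
    forall_fin_four h0 (step 0 h0) (step 1 (step 0 h0)) (step 2 (step 1 (step 0 h0)))
  exact (this i).symm.trans (this j)

theorem eq_inr_of_sameCycle_pinch {i : Fin 4} {x : D ⊕ Fin 4}
    (hx : (R.pinch m h).rot.SameCycle (Sum.inr i) x) : ∃ j, x = Sum.inr j := by
  rcases x with d | j
  · exact (not_inl_sameCycle_pinch hx.symm).elim
  · exact ⟨j, rfl⟩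

theorem IsLink.inr_notMem {x y : D ⊕ Fin 4} {K : Set (D ⊕ Fin 4)} (k : (R.pinch m h).IsLink x y K)
    (i : Fin 4) : Sum.inr i ∉ K := fun hi =>
  k.root_notMem ((k.vertexSet.mem_iff (inr_sameCycle_pinch i 0)).1 hi)

/-- A chain cannot pass through the half-edges next to the new vertex, except at its ends. -/
theorem IsLink.flip_ne_inr {x y : D ⊕ Fin 4} {K : Set (D ⊕ Fin 4)}
    (k : (R.pinch m h).IsLink x y K) {d : D ⊕ Fin 4} (hd : d ∈ K ∨ d = x ∨ d = y) {i : Fin 4}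
    (hx : x ≠ Sum.inr i) (hy : y ≠ Sum.inr i) : (R.pinch m h).flip d ≠ Sum.inr i := by
  intro hi
  rcases k.flip_mem d hd with h1 | h1 | h1
  · rw [hi] at h1; exact k.inr_notMem i h1
  · exact hx (h1.symm.trans hi)
  · exact hy (h1.symm.trans hi)

theorem Bridgeless.eq_root_of_link_pinch (T : R.Bridgeless) {y : D}
    (k : (R.pinch m h).Link (Sum.inr 3) (Sum.inl y)) : y = R.root := by
  obtain ⟨K, k⟩ := k
  have hflip : ∀ d, Sum.inl d ∈ K ∨ d = y → d ≠ R.root →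
      Sum.inl (R.flip d) ∈ K ∨ R.flip d = y := by
    intro d hd hr
    have hd' : (Sum.inl d : D ⊕ Fin 4) ∈ K ∨ (Sum.inl d : D ⊕ Fin 4) = Sum.inr 3 ∨
        (Sum.inl d : D ⊕ Fin 4) = Sum.inl y :=
      hd.imp_right fun g => Or.inr (congrArg _ g)
    have hn : ∀ i : Fin 4, i ≠ 3 → (R.pinch m h).flip (Sum.inl d) ≠ Sum.inr i := fun i hi =>
      k.flip_ne_inr hd' (by simpa using hi.symm) (by simp)
    have := k.flip_mem _ hd'
    rw [pinch_flip_inl hr] at this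
    · simpa using this
    · rintro rfl; exact hn 0 (by decide) pinch_flip_flip_root
    · rintro rfl; exact hn 1 (by decide) pinch_flip_prev
    · rintro rfl; exact hn 2 (by decide) pinch_flip_flip_prev
  have hK : ∀ d ∈ Sum.inl ⁻¹' K, R.rot d ∈ Sum.inl ⁻¹' K := fun d hd => (k.vertexSet _).2 hd
  by_contra hy
  have h3 := k.flip_mem (Sum.inr 3) (Or.inr (Or.inl rfl))
  rw [pinch_flip_three] at h3
  have hr : R.root ∈ Sum.inl ⁻¹' K := by
    rcases h3 with h3 | h3 | h3
    · exact h3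
    · simp at h3
    · exact (hy (Sum.inl.inj h3).symm).elim
  have hu : Sum.inl ⁻¹' K = (Set.univ : Set D) := by
    have hα : ∀ d ∈ Sum.inl ⁻¹' K, d ≠ R.root → d ≠ R.flip y → R.flip d ∈ Sum.inl ⁻¹' K := by
      intro d hd h1 h2
      rcases hflip d (Or.inl hd) h1 with h4 | h4
      · exact h4
      · exact (h2 (by rw [← h4, R.flip_flip])).elim
    by_cases hyf : y = R.flip R.root
    · refine R.isConn.eq_univ_of_off m R.root ⟨_, hr⟩ hK fun d hd h1 _ => hα d hd h1 fun g => h1 ?_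
      rw [g, hyf, R.flip_flip]
    · exact T y hy hyf _ ⟨_, hr⟩ hK fun d hd h1 _ _ h2 => hα d hd h1 h2
  exact k.right_notMem (show y ∈ Sum.inl ⁻¹' K from hu ▸ trivial)

theorem link_of_link_pinch {y : D} (k : (R.pinch m h).Link (Sum.inr 2) (Sum.inl y)) :
    R.Link R.prev y ∧ y ≠ R.root := by
  obtain ⟨K, k⟩ := k
  have hn : ∀ d, Sum.inl d ∈ K ∨ d = y → ∀ i : Fin 4, i ≠ 2 →
      (R.pinch m h).flip (Sum.inl d) ≠ Sum.inr i := fun d hd i hi =>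
    k.flip_ne_inr (hd.imp_right fun g => Or.inr (congrArg _ g)) (by simpa using hi.symm) (by simp)
  refine ⟨⟨Sum.inl ⁻¹' K, fun d => k.vertexSet (Sum.inl d),
    fun g => hn _ (Or.inl g) 3 (by decide) pinch_flip_root,
    fun g => hn _ (Or.inl g) 1 (by decide) pinch_flip_prev, k.right_notMem, ?_, fun d hd => ?_⟩, ?_⟩
  · rintro rfl
    exact hn _ (Or.inr rfl) 1 (by decide) pinch_flip_prev
  · by_cases h1 : d = R.prev
    · subst h1
      have := k.flip_mem (Sum.inr 2) (Or.inr (Or.inl rfl))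
      rw [pinch_flip_two] at this
      rcases this with h1 | h1 | h1
      · exact Or.inl h1
      · simp at h1
      · exact Or.inr (Or.inr (Sum.inl.inj h1))
    by_cases h2 : d = R.flip R.prev
    · rw [h2, R.flip_flip]; exact Or.inr (Or.inl rfl)
    have hd' : Sum.inl d ∈ K ∨ d = y := by tauto
    have := k.flip_mem (Sum.inl d) (hd'.imp_right fun g => Or.inr (congrArg _ g))
    rw [pinch_flip_inl _ _ h1 h2] at this
    · rcases this with h1 | h1 | h1
      · exact Or.inl h1
      · simp at h1
      · exact Or.inr (Or.inr (Sum.inl.inj h1))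
    · rintro rfl; exact hn _ hd' 3 (by decide) pinch_flip_root
    · rintro rfl; exact hn _ hd' 0 (by decide) pinch_flip_flip_root
  · rintro rfl
    exact hn _ (Or.inr rfl) 3 (by decide) pinch_flip_root

theorem prev_pinch : (R.pinch m h).prev = Sum.inl R.prev := by
  apply (R.pinch m h).rot.injective
  rw [rot_prev, pinch_root, pinch_flip_zero, pinch_rot_inl, R.rot_prev]

theorem frontEdge_pinch : (R.pinch m h).FrontEdge := by
  rw [FrontEdge, prev_pinch]
  exact pinch_flip_one

/-- If all half-edges at the new vertex are linked to the final vertex, then in particular the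
half-edge that leads back along the old root edge is, and its chain has no interior. -/
theorem Bridgeless.loop_of_isDip_pinch (T : R.Bridgeless) (hd : (R.pinch m h).IsDip) :
    R.rot.SameCycle R.root (R.flip R.root) := by
  obtain ⟨y, hy, k⟩ := hd (Sum.inr 3) (inr_sameCycle_pinch _ _) (by simp)
  rw [pinch_root, pinch_flip_zero] at hy
  rcases y with y | y
  · rw [inl_sameCycle_pinch, T.eq_root_of_link_pinch k] at hy
    exact hy.symm
  · exact (not_inl_sameCycle_pinch hy).elim

theorem isDip_pinch_of_loop (T : (R.pinch m h).IsCore)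
    (hl : R.rot.SameCycle R.root (R.flip R.root)) : (R.pinch m h).IsDip := by
  have l3 : (R.pinch m h).LinkedToT (Sum.inr 3) := LinkedToT.of_flip (by
    rw [pinch_root, pinch_flip_zero, pinch_flip_three, inl_sameCycle_pinch]
    exact hl.symm)
  have l1 : (R.pinch m h).LinkedToT (Sum.inr 1) := LinkedToT.of_flip (by
    rw [pinch_root, pinch_flip_zero, pinch_flip_one, inl_sameCycle_pinch, ← R.rot_prev]
    exact sameCycle_apply_left.2 (SameCycle.refl _ _))
  have l2 := T.bridgeless.linkedToT_third is4_pinch T.not_loop (inr_sameCycle_pinch _ _)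
    (inr_sameCycle_pinch _ _) (inr_sameCycle_pinch _ 2) (by simp) (by simp) (by simp) (by simp)
    (by simp) (by simp) l1 l3
  intro x hx hxr
  obtain ⟨j, rfl⟩ := eq_inr_of_sameCycle_pinch hx
  revert hxr
  exact forall_fin_four (p := fun j => Sum.inr j ≠ (R.pinch m h).root → (R.pinch m h).LinkedToT _)
    (fun g => (g rfl).elim) (fun _ => l1) (fun _ => l2) (fun _ => l3) j

/-- By the structure theorem, if the pinched map has no bridge and no `K₄`, then the two edges that
were pinched are separated from the remaining map by a chain. -/
theorem Bridgeless.frontLink_of_pinch (T : R.Bridgeless) (m : R.Is4) {h : R.prev ≠ R.root}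
    (c : (R.pinch m h).IsCore) (hK : ¬ HasK4 (R.pinch m h).rot (R.pinch m h).flip) :
    R.FrontLink := by
  by_cases hl : R.rot.SameCycle R.root (R.flip R.root)
  · rcases (loop_iff m).1 hl with h1 | h1
    · exact (h (prev_eq_root_iff.2 h1)).elim
    · exact frontLink_of_loop m h1
  have hnd : ¬ (R.pinch m h).IsDip := fun hd => hl (T.loop_of_isDip_pinch hd)
  obtain ⟨x, hx, hxr, ⟨y, hy, k⟩, w, -, hw⟩ := (c.isDip_or_isMate is4_pinch hK).resolve_left hnd
  have hx1 : x = Sum.inr 1 := by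
    rcases c.link_position is4_pinch hx hxr hy k with h1 | h1 | ⟨h1, -⟩
    · exact h1.1
    · exact (hnd h1.2.2).elim
    · exfalso
      have hx3 : x = Sum.inr 3 := (R.pinch m h).rot.injective h1
      subst hx3
      rw [pinch_root, pinch_flip_zero] at hy
      rcases y with y | y
      · rw [inl_sameCycle_pinch, T.eq_root_of_link_pinch k] at hy
        exact hl hy.symm
      · exact not_inl_sameCycle_pinch hy
  subst hx1
  have hin : ∀ i : Fin 4, i ≠ 0 → i ≠ 1 → ∃ z, (R.pinch m h).rot.SameCycle w (Sum.inl z) ∧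
      (R.pinch m h).Link (Sum.inr i) (Sum.inl z) := by
    intro i h0 h1
    obtain ⟨z | z, hz, k⟩ := hw (Sum.inr i) (inr_sameCycle_pinch _ _) (by simpa using h0)
      (by simpa using h1)
    · exact ⟨z, hz, k⟩
    · -- the chain would form a loop at the new vertex
      exact (c.not_link_loop is4_pinch (inr_sameCycle_pinch _ _) (by simpa using h0)
        (inr_sameCycle_pinch _ _) k).elim
  obtain ⟨z₃, hz3, k3⟩ := hin 3 (by decide) (by decide)
  obtain ⟨z₂, hz2, k2⟩ := hin 2 (by decide) (by decide)
  obtain rfl := T.eq_root_of_link_pinch k3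
  obtain ⟨k2, hne⟩ := link_of_link_pinch k2
  have c' : R.IsCore := ⟨T, hl⟩
  have hp : R.rot.SameCycle (R.flip R.root) R.prev := by
    rw [← R.rot_prev]; exact sameCycle_apply_left.2 (SameCycle.refl _ _)
  have k2' : R.Link z₂ R.prev := by
    obtain ⟨K, k⟩ := k2
    exact ⟨K, k.symm⟩
  rcases c'.link_position m (inl_sameCycle_pinch.1 (hz3.symm.trans hz2)) hne hp k2' with
    h1 | h1 | h1
  · rw [h1.1] at k2'; exact k2'
  · rw [R.rot_prev] at h1
    exact (m.rot_ne _ h1.2.1).elim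
  · have h2 := congrArg R.rot h1.2
    rw [R.rot_prev] at h2
    exact (m.rot2_ne _ h2).elim

/-! ### Maps in which the root edge bounds a triangle or a digon -/

theorem hasK4_pinch_of (k : HasK4 R.rot R.flip) :
    HasK4 (R.pinch m h).rot (R.pinch m h).flip := by
  classical exact HasK4.pinch m h (R.prev_ne m) R.rot_prev k

theorem FrontEdge.sameCycle (hF : R.FrontEdge) : R.rot.SameCycle R.root (R.flip R.prev) := by
  rw [← show _ = R.prev from hF, R.flip_flip]
  exact sameCycle_apply_right.2 (SameCycle.refl _ _)

theorem FrontLink.isCore_pinch (hF : R.FrontLink) (T : R.Bridgeless) :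
    (R.pinch m h).IsCore ∧
      (HasK4 (R.pinch m h).rot (R.pinch m h).flip → HasK4 R.rot R.flip) := by
  by_cases hE : R.FrontEdge
  · exact ⟨T.pinch hE.sameCycle, (hasK4_pinch_iff hE.sameCycle).1⟩
  obtain ⟨K, X, Y, mX, mY, i, hE, hXp⟩ := hF.exists_sub m h hE
  have g1 : X.rot X.root ≠ X.root := mX.rot_ne _
  have g2 := hE.rot_root_ne hXp
  have hA : (X.sub (X.rot X.root) Y mX mY).prev ≠ (X.sub (X.rot X.root) Y mX mY).root :=
    fun g => h (i.prev_eq_root.2 g)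
  have j : (R.pinch m h).Iso ((X.pinch mX hXp).sub (Sum.inl (X.rot X.root)) Y is4_pinch mY) :=
    (i.pinch (m' := is4_sub) (h' := hA)).trans (iso_pinch_sub g1 g2 hE _ _)
  have TX : X.Bridgeless := by
    obtain ⟨e, e1, e2, e3⟩ := i
    exact (bridgeless_sub_iff g1 g2).1 (T.congr e1 e2 e3)
  refine ⟨IsCore.congr j.symm ((isCore_sub_iff (by simp) ?_).2 (TX.pinch hE.sameCycle)),
    fun hK => ?_⟩
  · rw [pinch_root, pinch_flip_zero]
    simpa using g2
  · exact i.symm.hasK4 (hasK4_sub.2 ((hasK4_sub.1 (j.hasK4 hK)).imp_left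
      (hasK4_pinch_iff hE.sameCycle).1))

theorem prev_series_ne {R₁ : RootedMap E} {m₁ : R₁.Is4} :
    (R₁.series R m₁ m).prev ≠ (R₁.series R m₁ m).root := by
  rw [prev_series, series_root]
  simp

section Series

variable {R₁ : RootedMap E} {m₁ : R₁.Is4} {mA : (R₁.series R m₁ m).Is4}
  {hA : (R₁.series R m₁ m).prev ≠ (R₁.series R m₁ m).root}

theorem isCore_pinch_series_iff :
    ((R₁.series R m₁ m).pinch mA hA).IsCore ↔ (R.pinch m h).IsCore := by
  have i := iso_pinch_series (m := m) (h := h) mA hA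
  rw [← isCore_sub_iff (R := R.pinch m h) (m := is4_pinch) (m' := m₁) (h := Sum.inr 3) (by simp)
    (by rw [pinch_root, pinch_flip_zero]; simp)]
  exact ⟨IsCore.congr i, IsCore.congr i.symm⟩

theorem isDip_pinch_series_iff :
    ((R₁.series R m₁ m).pinch mA hA).IsDip ↔ (R.pinch m h).IsDip := by
  have i := iso_pinch_series (m := m) (h := h) mA hA
  rw [← isDip_sub_iff (R := R.pinch m h) (m := is4_pinch) (m' := m₁) (h := Sum.inr 3) (by simp)
    (by rw [pinch_root, pinch_flip_zero]; simp)]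
  exact i.isDip.symm

theorem hasK4_pinch_series_iff (h : R.prev ≠ R.root) :
    HasK4 ((R₁.series R m₁ m).pinch mA hA).rot ((R₁.series R m₁ m).pinch mA hA).flip ↔
      HasK4 (R.pinch m h).rot (R.pinch m h).flip ∨ HasK4 R₁.rot R₁.flip := by
  have i := iso_pinch_series (m := m) (h := h) mA hA
  rw [← hasK4_sub (R := R.pinch m h) (m := is4_pinch) (m' := m₁) (h := Sum.inr 3)]
  exact ⟨i.hasK4, i.symm.hasK4⟩

/-- If the second part of a pinched series composition had its root in a face of degree one, its
vertices would be attached by a bridge. -/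
theorem prev_ne_of_bridgeless_pinch_series
    (T : ((R₁.series R m₁ m).pinch mA hA).Bridgeless) : R.prev ≠ R.root := by
  intro hp
  set A := R₁.series R m₁ m with hAdef
  have a1 : A.flip A.root = Sum.inr (R.flip R.root) := series_flip_root
  have a2 : A.prev = Sum.inr R.root := by rw [hAdef, prev_series, hp]
  have a3 : A.flip A.prev = Sum.inl (R₁.flip R₁.root) := by
    rw [a2]; exact sub_flip_inr_root
  have a4 : A.root = Sum.inl R₁.root := rfl
  have := T (Sum.inl (Sum.inr R.root)) (by simp)
    (by rw [pinch_root, pinch_flip_zero, a1]; simpa using (R.flip_ne _).symm)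
    (Set.range fun d => Sum.inl (Sum.inr d)) ⟨_, R.root, rfl⟩
    (by rintro _ ⟨d, rfl⟩; exact ⟨R.rot d, rfl⟩) (by
      rintro _ ⟨d, rfl⟩ - h2 h3 -
      rw [pinch_root, pinch_flip_zero, a1] at h2
      have d1 : d ≠ R.root := fun g => h3 (by rw [g])
      have d2 : d ≠ R.flip R.root := fun g => h2 (by rw [g])
      refine ⟨R.flip d, ?_⟩
      rw [pinch_flip_inl (R := A) (by simp [a4]) (by simpa [a1] using d2) (by simpa [a2] using d1)
        (by simp [a3]), hAdef, series, sub_flip_inr d1 d2])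
  obtain ⟨d, hd⟩ := this.ge (Set.mem_univ (Sum.inr 0))
  simp at hd

end Series

end RootedMap

/-! ### Counting isomorphism classes -/

open RootedMap

/-- Two types have the same cardinality if they are related by a bijective correspondence, given as
a relation. -/
theorem card_eq_of_rel {α β : Type*} (r : α → β → Prop) (h1 : ∀ a, ∃ b, r a b)
    (h2 : ∀ b, ∃ a, r a b) (h3 : ∀ a b a' b', r a b → r a' b' → (a = a' ↔ b = b')) :
    Nat.card α = Nat.card β := by
  choose f hf using h1
  refine Nat.card_eq_of_bijective f ⟨fun a a' h => (h3 _ _ _ _ (hf a) (hf a')).2 h, fun b => ?_⟩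
  obtain ⟨a, ha⟩ := h2 b
  exact ⟨a, (h3 _ _ _ _ (hf a) ha).1 rfl⟩

/-- A finite 4-regular rooted map on an arbitrary type of half-edges. -/
structure Net : Type 1 where
  carrier : Type
  finite : Finite carrier
  map : RootedMap carrier
  is4 : map.Is4

namespace Net

instance (A : Net) : Finite A.carrier := A.finite

instance setoid : Setoid Net where
  r A B := A.map.Iso B.map
  iseqv := ⟨fun _ => Iso.refl _, Iso.symm, Iso.trans⟩

/-- The number of edges different from the root edge. -/
noncomputable def size (A : Net) : ℕ := Nat.card A.carrier / 2 - 1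

theorem card_carrier (A : Net) : Nat.card A.carrier = 2 * (A.size + 1) := by
  have h1 := two_mul_numCycles A.map.flip_flip A.map.flip_ne
  have h2 : 0 < Nat.card A.carrier := Nat.card_pos_iff.2 ⟨⟨A.map.root⟩, A.finite⟩
  rw [size]
  omega

theorem size_eq {A : Net} {n : ℕ} (h : Nat.card A.carrier = 2 * (n + 1)) : A.size = n := by
  have := A.card_carrier
  omega

theorem size_congr {A B : Net} (h : A ≈ B) : A.size = B.size := by
  obtain ⟨e, -⟩ := h
  rw [size, size, Nat.card_congr e]

theorem exists_equiv (A : Net) {E : Type} (e : A.carrier ≃ E) :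
    ∃ (R : RootedMap E) (m : R.Is4), A ≈ ⟨E, Finite.of_equiv _ e, R, m⟩ := by
  have : Finite E := Finite.of_equiv _ e
  have h1 : ∀ (f : Perm A.carrier) d, e (f d) = e.permCongr f (e d) := fun f d => by simp
  exact ⟨ofPerms (A.is4.congr (h1 _) (h1 _)) (A.map.isConn.congr (h1 _) (h1 _))
    ((planar_congr (h1 _) (h1 _)).1 A.map.isPlanar) (e A.map.root), A.is4.congr (h1 _) (h1 _),
    e, h1 _, h1 _, rfl⟩

/-- The isomorphism classes of the maps of size `n` with the property `p`. -/
def classes (p : Net → Prop) (n : ℕ) : Set (Quotient Net.setoid) :=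
  {q | ∃ A, ⟦A⟧ = q ∧ p A ∧ A.size = n}

theorem finite_classes (p : Net → Prop) (n : ℕ) : (classes p n).Finite := by
  refine (Set.finite_range fun R : {R : RootedMap (Fin (2 * (n + 1))) // R.Is4} =>
    (⟦⟨_, inferInstance, R.1, R.2⟩⟧ : Quotient Net.setoid)).subset ?_
  rintro _ ⟨A, rfl, -, hA⟩
  obtain ⟨R, m, h⟩ := A.exists_equiv (Finite.equivFinOfCardEq (by rw [A.card_carrier, hA]))
  exact ⟨⟨R, m⟩, (Quotient.sound h).symm⟩

/-- The generating function of the isomorphism classes of the maps with the property `p`. -/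
noncomputable def gf (p : Net → Prop) : PowerSeries ℤ :=
  PowerSeries.mk fun n => ((classes p n).ncard : ℤ)

/-- The property depends only on the isomorphism class. -/
def Invariant (p : Net → Prop) : Prop := ∀ ⦃A B⦄, A ≈ B → p A → p B

theorem gf_add {p p₁ p₂ : Net → Prop} (h : ∀ A, p A ↔ p₁ A ∨ p₂ A) (h₁ : Invariant p₁)
    (hd : ∀ A, p₁ A → ¬ p₂ A) : gf p = gf p₁ + gf p₂ := by
  ext n
  simp only [gf, PowerSeries.coeff_mk, map_add]
  rw [show classes p n = classes p₁ n ∪ classes p₂ n from ?_, Set.ncard_union_eq ?_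
    (finite_classes _ _) (finite_classes _ _), Nat.cast_add]
  · rw [Set.disjoint_left]
    rintro _ ⟨A, rfl, hA, -⟩ ⟨B, hB, hB', -⟩
    exact hd B (h₁ (Quotient.exact hB.symm) hA) hB'
  · ext q
    constructor
    · rintro ⟨A, rfl, hA, hn⟩
      exact ((h A).1 hA).imp (fun g => ⟨A, rfl, g, hn⟩) fun g => ⟨A, rfl, g, hn⟩
    · rintro (⟨A, rfl, hA, hn⟩ | ⟨A, rfl, hA, hn⟩)
      exacts [⟨A, rfl, (h A).2 (Or.inl hA), hn⟩, ⟨A, rfl, (h A).2 (Or.inr hA), hn⟩]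

/-- If `r` relates each map with the property `p` to the result of an injective construction, which
adds `k` edges, then the generating function of the results is obtained by a shift. -/
theorem gf_of_unary {p p' : Net → Prop} {k : ℕ} (r : Net → Net → Prop)
    (ht : ∀ A, p A → ∃ B, r A B) (hm : ∀ A B, p A → r A B → p' B ∧ B.size = A.size + k)
    (hi : ∀ A A' B B', p A → p A' → r A B → r A' B' → (A ≈ A' ↔ B ≈ B'))
    (hs : ∀ B, p' B → ∃ A, p A ∧ r A B) : gf p' = PowerSeries.X ^ k * gf p := by
  ext n
  rw [PowerSeries.coeff_X_pow_mul']
  simp only [gf, PowerSeries.coeff_mk]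
  split_ifs with hk
  · rw [← Nat.card_coe_set_eq, ← Nat.card_coe_set_eq, Nat.cast_inj, eq_comm]
    refine card_eq_of_rel (fun q q' => ∃ A B, ⟦A⟧ = q.1 ∧ p A ∧ ⟦B⟧ = q'.1 ∧ r A B) ?_ ?_ ?_
    · rintro ⟨_, A, rfl, hA, hn⟩
      obtain ⟨B, hB⟩ := ht A hA
      obtain ⟨h1, h2⟩ := hm A B hA hB
      exact ⟨⟨_, B, rfl, h1, by omega⟩, A, B, rfl, hA, rfl, hB⟩
    · rintro ⟨_, B, rfl, hB, hn⟩
      obtain ⟨A, hA, hAB⟩ := hs B hB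
      obtain ⟨h1, h2⟩ := hm A B hA hAB
      exact ⟨⟨_, A, rfl, hA, by omega⟩, A, B, rfl, hA, rfl, hAB⟩
    · rintro ⟨q, hq⟩ ⟨s, hs⟩ ⟨q', hq'⟩ ⟨s', hs'⟩ ⟨A, B, rfl, hA, rfl, hAB⟩
        ⟨A', B', rfl, hA', rfl, hAB'⟩
      rw [Subtype.mk.injEq, Subtype.mk.injEq, Quotient.eq, Quotient.eq]
      exact hi A A' B B' hA hA' hAB hAB'
  · rw [Nat.cast_eq_zero, Set.ncard_eq_zero (finite_classes _ _), Set.eq_empty_iff_forall_notMem]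
    rintro _ ⟨B, rfl, hB, hn⟩
    obtain ⟨A, hA, hAB⟩ := hs B hB
    have := (hm A B hA hAB).2
    omega

/-- If `r` relates each pair of maps with the properties `p₁` and `p₂` to the result of an injective
construction, which adds `k` edges, then the generating function of the results is a product. -/
theorem gf_of_binary {p₁ p₂ p' : Net → Prop} {k : ℕ} (r : Net → Net → Net → Prop)
    (ht : ∀ A A', p₁ A → p₂ A' → ∃ B, r A A' B)
    (hm : ∀ A A' B, p₁ A → p₂ A' → r A A' B → p' B ∧ B.size = A.size + A'.size + k)
    (hi : ∀ A A' C C' B D, p₁ A → p₂ A' → p₁ C → p₂ C' → r A A' B → r C C' D →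
      (A ≈ C ∧ A' ≈ C' ↔ B ≈ D))
    (hs : ∀ B, p' B → ∃ A A', p₁ A ∧ p₂ A' ∧ r A A' B) :
    gf p' = PowerSeries.X ^ k * (gf p₁ * gf p₂) := by
  ext n
  rw [PowerSeries.coeff_X_pow_mul']
  simp only [gf, PowerSeries.coeff_mk, PowerSeries.coeff_mul]
  split_ifs with hk
  · have hf : ∀ p i, Finite (classes p i) := fun p i => (finite_classes p i).to_subtype
    have hc : Nat.card (Σ ij : Finset.HasAntidiagonal.antidiagonal (n - k),
        classes p₁ ij.1.1 × classes p₂ ij.1.2) =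
        ∑ ij ∈ Finset.HasAntidiagonal.antidiagonal (n - k),
          (classes p₁ ij.1).ncard * (classes p₂ ij.2).ncard := by
      rw [Nat.card_sigma, ← Finset.sum_coe_sort (Finset.HasAntidiagonal.antidiagonal (n - k))]
      simp only [Nat.card_prod, Nat.card_coe_set_eq]
    rw [← Nat.card_coe_set_eq (classes p' n)]
    simp only [← Nat.cast_mul, ← Nat.cast_sum]
    rw [← hc, Nat.cast_inj, eq_comm]
    refine card_eq_of_rel (fun q q' => ∃ A A' B, ⟦A⟧ = q.2.1.1 ∧ ⟦A'⟧ = q.2.2.1 ∧ p₁ A ∧ p₂ A' ∧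
      ⟦B⟧ = q'.1 ∧ r A A' B) ?_ ?_ ?_
    · rintro ⟨⟨ij, hij⟩, ⟨_, A, rfl, hA, hn⟩, ⟨_, A', rfl, hA', hn'⟩⟩
      obtain ⟨B, hB⟩ := ht A A' hA hA'
      obtain ⟨h1, h2⟩ := hm A A' B hA hA' hB
      rw [Finset.HasAntidiagonal.mem_antidiagonal] at hij
      dsimp only at hn hn'
      exact ⟨⟨_, B, rfl, h1, by omega⟩, A, A', B, rfl, rfl, hA, hA', rfl, hB⟩
    · rintro ⟨_, B, rfl, hB, hn⟩
      obtain ⟨A, A', hA, hA', hAB⟩ := hs B hB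
      obtain ⟨h1, h2⟩ := hm A A' B hA hA' hAB
      exact ⟨⟨⟨(A.size, A'.size), Finset.HasAntidiagonal.mem_antidiagonal.2 (by omega)⟩,
        ⟨_, A, rfl, hA, rfl⟩,
        ⟨_, A', rfl, hA', rfl⟩⟩, A, A', B, rfl, rfl, hA, hA', rfl, hAB⟩
    · rintro ⟨⟨⟨i, j⟩, hij⟩, ⟨q, hq⟩, ⟨s, hs⟩⟩ ⟨B, hB⟩ ⟨⟨⟨i', j'⟩, hij'⟩, ⟨q', hq'⟩, ⟨s', hs'⟩⟩
        ⟨D, hD⟩ ⟨A, A', B, rfl, rfl, hA, hA', rfl, hr⟩ ⟨C, C', D, rfl, rfl, hC, hC', rfl, hr'⟩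
      have key := hi A A' C C' B D hA hA' hC hC' hr hr'
      have hsz : ∀ {p i} {A : Net}, (⟦A⟧ : Quotient Net.setoid) ∈ classes p i →
          A.size = i := by
        rintro p i A ⟨B, hB, -, rfl⟩
        exact size_congr (Quotient.exact hB.symm)
      have e1 : A.size = i := hsz hq
      have e2 : A'.size = j := hsz hs
      have e3 : C.size = i' := hsz hq'
      have e4 : C'.size = j' := hsz hs'
      rw [Subtype.mk.injEq, Quotient.eq]
      refine Iff.trans ?_ key
      constructor
      · intro h
        exact ⟨Quotient.exact (congrArg (fun x => x.2.1.1) h),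
          Quotient.exact (congrArg (fun x => x.2.2.1) h)⟩
      · rintro ⟨h1, h2⟩
        obtain rfl : i = i' := by rw [← e1, ← e3, size_congr h1]
        obtain rfl : j = j' := by rw [← e2, ← e4, size_congr h2]
        congr 2
        · exact Subtype.ext (Quotient.sound h1)
        · exact Subtype.ext (Quotient.sound h2)
  · rw [Nat.cast_eq_zero, Set.ncard_eq_zero (finite_classes _ _), Set.eq_empty_iff_forall_notMem]
    rintro _ ⟨B, rfl, hB, hn⟩
    obtain ⟨A, A', hA, hA', hAB⟩ := hs B hB
    have := (hm A A' B hA hA' hAB).2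
    omega

/-- The maps on `Fin (2 * (n + 1))` represent all isomorphism classes of maps of size `n`. -/
theorem genFun_eq_gf {C : ∀ ⦃D : Type⦄, RootedMap D → Prop} {p : Net → Prop}
    (hC : ∀ (D : Type) [Finite D] (R : RootedMap D), C R ↔ ∃ m : R.Is4, p ⟨D, inferInstance, R, m⟩)
    (hp : Invariant p) : genFun C = gf p := by
  ext n
  simp only [genFun, gf, PowerSeries.coeff_mk]
  rw [← Nat.card_coe_set_eq, Nat.cast_inj]
  refine card_eq_of_rel (fun a q => ∃ (R : {R : RootedMap (Fin (2 * (n + 1))) // C R})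
    (m : R.1.Is4), Quotient.mk _ R = a ∧ ⟦⟨_, inferInstance, R.1, m⟩⟧ = q.1) ?_ ?_ ?_
  · intro a
    induction a using Quotient.inductionOn with | _ R
    obtain ⟨m, hR⟩ := (hC _ _).1 R.2
    exact ⟨⟨_, _, rfl, hR, size_eq (by simp)⟩, R, m, rfl, rfl⟩
  · rintro ⟨_, A, rfl, hA, hn⟩
    obtain ⟨R, m, h⟩ := A.exists_equiv (Finite.equivFinOfCardEq (by rw [A.card_carrier, hn]))
    exact ⟨_, ⟨R, (hC _ _).2 ⟨m, hp h hA⟩⟩, m, rfl, (Quotient.sound h).symm⟩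
  · rintro a ⟨q, hq⟩ a' ⟨q', hq'⟩ ⟨R, m, rfl, rfl⟩ ⟨R', m', rfl, rfl⟩
    rw [Subtype.mk.injEq, Quotient.eq, Quotient.eq]
    rfl

end Net

/-! ### Reflection -/

section Perm

variable {D : Type*} {ρ α : Perm D}

theorem isVertexSet_symm_iff {K : Set D} : IsVertexSet ρ.symm K ↔ IsVertexSet ρ K := by
  constructor
  · intro h d
    have := h (ρ d)
    rw [Equiv.symm_apply_apply] at this
    exact this.symm
  · intro h d
    have := h (ρ.symm d)
    rw [Equiv.apply_symm_apply] at this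
    exact this.symm

theorem sameCycle_symm_iff {a b : D} : SameCycle ρ.symm a b ↔ SameCycle ρ a b := sameCycle_inv

theorem IsMap4.symm (m : IsMap4 ρ α) : IsMap4 ρ.symm α where
  flip_flip := m.flip_flip
  flip_ne := m.flip_ne
  rot4 d := by simp only [Equiv.symm_apply_eq, m.rot4]
  rot2_ne d h := m.rot2_ne d (by rw [Equiv.symm_apply_eq, Equiv.symm_apply_eq] at h; exact h.symm)

theorem IsConn.symm [Finite D] (c : IsConn ρ α) : IsConn ρ.symm α := fun S hne hρ hα =>
  c S hne (fun d hd => ((isVertexSet_symm_iff.1 (IsVertexSet.of_forall_mem hρ)) d).2 hd) hα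

theorem Planar.symm [Finite D] (hα : ∀ d, α (α d) = d) (p : Planar ρ α) : Planar ρ.symm α := by
  have h1 : α⁻¹ = α := by ext d; rw [inv_eq_iff_eq, hα]
  have h2 : (ρ⁻¹ * α).numCycles = (ρ * α).numCycles := by
    rw [← numCycles_inv, mul_inv_rev, inv_inv, h1, numCycles_mul_comm]
  change Planar ρ⁻¹ α
  rw [Planar, numCycles_inv, h2]
  exact p

theorem HasK4.symm (h : HasK4 ρ α) : HasK4 ρ.symm α := by
  obtain ⟨B, hB⟩ := h
  exact ⟨B, fun i => isVertexSet_symm_iff.2 (hB.vertexSet i), fun i => ⟨(hB.conn i).1,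
    fun S h1 h2 h3 => (hB.conn i).2 S h1 h2 (isVertexSet_symm_iff.1 h3)⟩, hB.disj, hB.adj⟩

end Perm

namespace RootedMap

variable {D : Type*} [Finite D] {R : RootedMap D}

/-- The mirror image of a map. -/
def reflect (R : RootedMap D) (m : R.Is4) : RootedMap D :=
  ofPerms m.symm R.isConn.symm (R.isPlanar.symm m.flip_flip) R.root

variable {m : R.Is4}

theorem is4_reflect : (R.reflect m).Is4 := m.symm

theorem Iso.reflect {E : Type*} [Finite E] {R' : RootedMap E} {m' : R'.Is4} (i : R.Iso R') :
    (R.reflect m).Iso (R'.reflect m') := by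
  obtain ⟨e, h1, h2, h3⟩ := i
  refine ⟨e, fun d => ?_, h2, h3⟩
  change e (R.rot.symm d) = R'.rot.symm (e d)
  rw [Equiv.eq_symm_apply, ← h1, Equiv.apply_symm_apply]

theorem Link.reflect {x y : D} (k : R.Link x y) : (R.reflect m).Link x y := by
  obtain ⟨K, k⟩ := k
  exact ⟨K, isVertexSet_symm_iff.2 k.vertexSet, k.root_notMem, k.left_notMem, k.right_notMem, k.ne,
    k.flip_mem⟩

theorem link_reflect_iff {x y : D} : (R.reflect m).Link x y ↔ R.Link x y :=
  ⟨fun h => h.reflect (m := is4_reflect), fun h => h.reflect⟩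

theorem sameCycle_reflect_iff {x y : D} :
    (R.reflect m).rot.SameCycle x y ↔ R.rot.SameCycle x y := sameCycle_symm_iff

theorem isDip_reflect_iff : (R.reflect m).IsDip ↔ R.IsDip := by
  unfold IsDip LinkedToT
  simp only [sameCycle_reflect_iff, link_reflect_iff]
  rfl

theorem Bridgeless.reflect (T : R.Bridgeless) : (R.reflect m).Bridgeless :=
  fun a h1 h2 S hne hρ hα => T a h1 h2 S hne (fun d hd =>
    ((isVertexSet_symm_iff.1 (IsVertexSet.of_forall_mem hρ)) d).2 hd) hα

theorem isCore_reflect_iff : (R.reflect m).IsCore ↔ R.IsCore :=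
  ⟨fun c => ⟨c.bridgeless.reflect (m := is4_reflect), fun h => c.not_loop
    (sameCycle_reflect_iff.2 h)⟩, fun c => ⟨c.bridgeless.reflect, fun h => c.not_loop
    (sameCycle_reflect_iff.1 h)⟩⟩

theorem hasK4_reflect_iff :
    HasK4 (R.reflect m).rot (R.reflect m).flip ↔ HasK4 R.rot R.flip :=
  ⟨HasK4.symm, HasK4.symm⟩

theorem frontLink_reflect_iff :
    (R.reflect m).FrontLink ↔ R.Link (R.rot.symm R.root) (R.rot (R.flip R.root)) :=
  link_reflect_iff

theorem frontEdge_reflect_iff :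
    (R.reflect m).FrontEdge ↔ R.flip (R.rot.symm R.root) = R.rot (R.flip R.root) := Iff.rfl

/-! ### The chains parallel to the root edge -/

theorem IsCore.prev_ne_root (c : R.IsCore) (m : R.Is4) : R.prev ≠ R.root := fun h =>
  c.not_loop ((loop_iff m).2 (Or.inl (prev_eq_root_iff.1 h)))

theorem sameCycle_prev {D : Type*} (R : RootedMap D) : R.rot.SameCycle (R.flip R.root) R.prev := by
  rw [← R.rot_prev]
  exact sameCycle_apply_left.2 (SameCycle.refl _ _)

theorem IsCore.link_cases (c : R.IsCore) (m : R.Is4) {x y : D} (hx : R.rot.SameCycle R.root x)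
    (hxr : x ≠ R.root) (hy : R.rot.SameCycle (R.flip R.root) y) (k : R.Link x y) :
    (x = R.rot R.root ∧ y = R.prev) ∨ (x = R.rot (R.rot R.root) ∧ R.IsDip) ∨
      (x = R.rot.symm R.root ∧ y = R.rot (R.flip R.root)) := by
  rcases c.link_position m hx hxr hy k with h | h | h
  · exact Or.inl ⟨h.1, R.rot.injective (by rw [h.2, rot_prev])⟩
  · exact Or.inr (Or.inl ⟨h.1, h.2.2⟩)
  · exact Or.inr (Or.inr ⟨by rw [Equiv.eq_symm_apply, h.1], h.2.symm⟩)

theorem IsCore.frontLink_of_isDip (c : R.IsCore) (m : R.Is4) (hd : R.IsDip) : R.FrontLink := by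
  have h1 : R.rot.SameCycle R.root (R.rot R.root) := sameCycle_apply_right.2 (SameCycle.refl _ _)
  obtain ⟨y, hy, k⟩ := hd _ h1 (m.rot_ne _)
  rcases c.link_cases m h1 (m.rot_ne _) hy k with h | h | h
  · rw [h.2] at k; exact k
  · exact (m.rot_ne _ h.1.symm).elim
  · exact (m.rot2_ne _ (by rw [h.1, Equiv.apply_symm_apply])).elim

/-- The mirror image of `FrontLink`. -/
def BackLink {D : Type*} (R : RootedMap D) : Prop :=
  R.Link (R.rot.symm R.root) (R.rot (R.flip R.root))

theorem IsCore.frontLink_or_backLink (c : R.IsCore) (m : R.Is4) (hK : ¬ HasK4 R.rot R.flip)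
    (hd : ¬ R.IsDip) : R.FrontLink ∨ R.BackLink := by
  obtain ⟨x, hx, hxr, ⟨y, hy, k⟩, -⟩ := (c.isDip_or_isMate m hK).resolve_left hd
  rcases c.link_cases m hx hxr hy k with ⟨rfl, rfl⟩ | h | ⟨rfl, rfl⟩
  · exact Or.inl k
  · exact (hd h.2).elim
  · exact Or.inr k

theorem IsCore.isDip_of_frontLink_of_backLink (c : R.IsCore) (m : R.Is4) (h1 : R.FrontLink)
    (h3 : R.BackLink) : R.IsDip := by
  have s1 : R.rot.SameCycle R.root (R.rot R.root) := sameCycle_apply_right.2 (SameCycle.refl _ _)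
  have s2 : R.rot.SameCycle R.root (R.rot (R.rot R.root)) := sameCycle_apply_right.2 s1
  have e3 : R.rot.symm R.root = R.rot (R.rot (R.rot R.root)) := by
    rw [Equiv.symm_apply_eq, m.rot4]
  have s3 : R.rot.SameCycle R.root (R.rot.symm R.root) := by
    rw [e3]; exact sameCycle_apply_right.2 s2
  have l1 : R.LinkedToT (R.rot R.root) := ⟨_, R.sameCycle_prev, h1⟩
  have l3 : R.LinkedToT (R.rot.symm R.root) :=
    ⟨_, sameCycle_apply_right.2 (SameCycle.refl _ _), h3⟩
  have l2 := c.bridgeless.linkedToT_third m c.not_loop s1 s3 s2 (m.rot_ne _)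
    (by rw [e3]; exact m.rot3_ne _) (m.rot2_ne _) (by rw [e3]; exact (m.rot2_ne _).symm)
    (m.rot_ne _).symm (by rw [e3]; exact m.rot_ne _) l1 l3
  intro x hx hxr
  rcases m.sameCycle_iff.1 hx with rfl | rfl | rfl | rfl
  exacts [(hxr rfl).elim, l1, l2, e3 ▸ l3]

/-- The maps in which some edge is parallel to the root edge, apart from those in which all edges at
the initial vertex belong to parallel chains. -/
theorem IsCore.exists_parallel_iff (c : R.IsCore) (m : R.Is4) (hd : ¬ R.IsDip) :
    (∃ x, R.rot.SameCycle R.root x ∧ x ≠ R.root ∧ R.rot.SameCycle (R.flip R.root) (R.flip x)) ↔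
      R.FrontEdge ∨ (R.reflect m).FrontEdge := by
  constructor
  · rintro ⟨x, hx, hxr, hy⟩
    rcases c.link_cases m hx hxr hy ⟨_, R.isLink_empty x⟩ with ⟨rfl, h⟩ | h | ⟨rfl, h⟩
    · exact Or.inl h
    · exact (hd h.2).elim
    · exact Or.inr h
  · rintro (h | h)
    · exact ⟨_, sameCycle_apply_right.2 (SameCycle.refl _ _), m.rot_ne _,
        (show _ = R.prev from h).symm ▸ R.sameCycle_prev⟩
    · rw [frontEdge_reflect_iff] at h
      refine ⟨R.rot.symm R.root, ?_, fun g => m.rot_ne R.root ?_, ?_⟩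
      · exact sameCycle_symm_iff.1 (sameCycle_apply_right.2 (SameCycle.refl _ _))
      · rw [Equiv.symm_apply_eq] at g; exact g.symm
      · rw [h]; exact sameCycle_apply_right.2 (SameCycle.refl _ _)

end RootedMap

/-! ### Generating functions of the constructions -/

theorem RootedMap.Iso.bridgeless {D E : Type*} {R : RootedMap D} {R' : RootedMap E} (i : R.Iso R')
    (T : R.Bridgeless) : R'.Bridgeless := by
  obtain ⟨e, h1, h2, h3⟩ := i
  exact T.congr h1 h2 h3

theorem RootedMap.Iso.loop {D E : Type*} {R : RootedMap D} {R' : RootedMap E} (i : R.Iso R') :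
    R.rot.SameCycle R.root (R.flip R.root) ↔ R'.rot.SameCycle R'.root (R'.flip R'.root) := by
  obtain ⟨e, h1, h2, h3⟩ := i
  rw [← h3, ← h2, sameCycle_congr h1]

namespace Net

/-- The map has no `K₄` minor. -/
def NoK4 (A : Net) : Prop := ¬ HasK4 A.map.rot A.map.flip

/-- The root edge is a loop. -/
def IsLoop (A : Net) : Prop := A.map.rot.SameCycle A.map.root (A.map.flip A.map.root)

theorem invariant_noK4 : Invariant NoK4 := fun _ _ i h k => h (Iso.hasK4 (Iso.symm i) k)

theorem invariant_isLoop : Invariant IsLoop := fun _ _ i h => (Iso.loop i).1 h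

theorem Invariant.not {p : Net → Prop} (h : Invariant p) : Invariant fun A => ¬ p A :=
  fun _ _ i hA hB => hA (h (Setoid.symm i) hB)

theorem Invariant.and {p q : Net → Prop} (h : Invariant p) (h' : Invariant q) :
    Invariant fun A => p A ∧ q A := fun _ _ i hA => ⟨h i hA.1, h' i hA.2⟩

theorem Invariant.iff {p : Net → Prop} (h : Invariant p) (b : Prop) : Invariant fun A => p A ↔ b :=
  fun _ _ i hA => ⟨fun g => hA.1 (h (Setoid.symm i) g), fun g => h i (hA.2 g)⟩

/-- The maps without `K₄` minor and without bridge in the network, in which the successor of the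
root edge starts a chain along a face of the root edge. -/
def Fan (κ : Net → Prop) (A : Net) : Prop :=
  NoK4 A ∧ A.map.Bridgeless ∧ A.map.prev ≠ A.map.root ∧ A.map.FrontLink ∧ κ A

/-- The maps of `Fan` in which the chain is an edge. -/
def EdgeFan (κ : Net → Prop) (A : Net) : Prop :=
  NoK4 A ∧ A.map.Bridgeless ∧ A.map.prev ≠ A.map.root ∧ A.map.FrontEdge ∧ κ A

/-- The map `B` arises by substituting `A'` for the edge that follows the root edge of `A`. -/
def SubRel (A A' B : Net) : Prop :=
  (A.map.sub (A.map.rot A.map.root) A'.map A.is4 A'.is4).Iso B.map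

/-- The map `B` is the series composition of `A` and `A'`. -/
def SeriesRel (A A' B : Net) : Prop := (A.map.series A'.map A.is4 A'.is4).Iso B.map

/-- The map `B` arises from `A` by pinching. -/
def PinchRel (A B : Net) : Prop :=
  ∃ h : A.map.prev ≠ A.map.root, (A.map.pinch A.is4 h).Iso B.map

variable {κ : Net → Prop}

theorem invariant_fan (hκ : Invariant κ) : Invariant (Fan κ) := fun _ _ i ⟨h1, h2, h3, h4, h5⟩ =>
  ⟨invariant_noK4 i h1, Iso.bridgeless i h2, fun g => h3 ((Iso.prev_eq_root i).2 g),
    (Iso.frontLink i).1 h4, hκ i h5⟩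

theorem invariant_edgeFan (hκ : Invariant κ) : Invariant (EdgeFan κ) :=
  fun _ _ i ⟨h1, h2, h3, h4, h5⟩ =>
  ⟨invariant_noK4 i h1, Iso.bridgeless i h2, fun g => h3 ((Iso.prev_eq_root i).2 g),
    (Iso.frontEdge i).1 h4, hκ i h5⟩

theorem invariant_frontEdge : Invariant fun A => A.map.FrontEdge :=
  fun _ _ i h => (Iso.frontEdge i).1 h

/-- A front chain is either an edge or an edge in which a map has been substituted. -/
theorem gf_fan (hκ : Invariant κ) (hs : ∀ A A' B : Net, A.map.prev ≠ A.map.root → A.map.FrontEdge →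
    SubRel A A' B → (κ A ↔ κ B)) :
    gf (Fan κ) = gf (EdgeFan κ) + PowerSeries.X * (gf (EdgeFan κ) * gf NoK4) := by
  rw [gf_add (p₁ := EdgeFan κ) (p₂ := fun A => Fan κ A ∧ ¬ A.map.FrontEdge) (fun A => ?_)
    (invariant_edgeFan hκ) fun A h h' => h'.2 h.2.2.2.1]
  · congr 1
    rw [← pow_one (PowerSeries.X : PowerSeries ℤ)]
    refine gf_of_binary SubRel (fun A A' _ _ => ⟨⟨_, inferInstance,
      A.map.sub (A.map.rot A.map.root) A'.map A.is4 A'.is4, is4_sub⟩, Iso.refl _⟩) ?_ ?_ ?_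
    · intro A A' B ⟨h1, h2, h3, h4, h5⟩ h' i
      have g1 := A.is4.rot_ne A.map.root
      have g2 := h4.rot_root_ne h3
      refine ⟨((invariant_fan hκ).and invariant_frontEdge.not) (A := ⟨_, inferInstance,
        A.map.sub (A.map.rot A.map.root) A'.map A.is4 A'.is4, is4_sub⟩) i ⟨⟨fun k => ?_,
        (bridgeless_sub_iff (m := A.is4) (m' := A'.is4) g1 g2).2 h2, ?_,
        frontLink_sub (m := A.is4) (m₁ := A'.is4) h4 h3, (hs A A' ⟨_, inferInstance,
        A.map.sub (A.map.rot A.map.root) A'.map A.is4 A'.is4, is4_sub⟩ h3 h4 (Iso.refl _)).1 h5⟩,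
        not_frontEdge_sub (m := A.is4) (m₁ := A'.is4) g2⟩, size_eq ?_⟩
      · exact ((hasK4_sub (m := A.is4) (m' := A'.is4)).1 k).elim h1 h'
      · rw [prev_sub g1 g2, sub_root]
        exact fun g => h3 (Sum.inl.inj g)
      · obtain ⟨e, -⟩ := i
        rw [← Nat.card_congr e, Nat.card_sum, card_carrier, card_carrier]
        ring
    · intro A A' C C' B D ⟨_, _, h3, h4, _⟩ _ ⟨_, _, g3, g4, _⟩ _ i j
      constructor
      · rintro ⟨⟨e, e1, e2, e3⟩, k'⟩
        exact i.symm.trans ((iso_sub e1 e2 e3 (by rw [e1, e3]) k').trans j)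
      · intro k
        exact h4.iso_of_sub h3 g4 g3 (i.trans (Iso.trans k j.symm))
    · rintro B ⟨⟨h1, h2, h3, h4, h5⟩, h6⟩
      obtain ⟨K, X, Y, mX, mY, i, hE, hX⟩ := h4.exists_sub B.is4 h3 h6
      have hk : ¬ (HasK4 X.rot X.flip ∨ HasK4 Y.rot Y.flip) := fun k =>
        h1 (i.symm.hasK4 (hasK4_sub.2 k))
      exact ⟨⟨_, inferInstance, X, mX⟩, ⟨_, inferInstance, Y, mY⟩, ⟨fun k => hk (Or.inl k),
        (bridgeless_sub_iff (mX.rot_ne _) (hE.rot_root_ne hX)).1 (i.bridgeless h2), hX, hE,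
        (hs ⟨_, inferInstance, X, mX⟩ ⟨_, inferInstance, Y, mY⟩ B hX hE i.symm).2 h5⟩,
        fun k => hk (Or.inr k), i.symm⟩
  · constructor
    · rintro ⟨h1, h2, h3, h4, h5⟩
      by_cases h : A.map.FrontEdge
      · exact Or.inl ⟨h1, h2, h3, h, h5⟩
      · exact Or.inr ⟨⟨h1, h2, h3, h4, h5⟩, h⟩
    · rintro (⟨h1, h2, h3, h4, h5⟩ | h)
      exacts [⟨h1, h2, h3, h4.frontLink, h5⟩, h.1]

theorem subRel_isLoop_iff {A A' B : Net} (h : A.map.prev ≠ A.map.root) (hE : A.map.FrontEdge)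
    (i : SubRel A A' B) : IsLoop A ↔ IsLoop B := by
  rw [IsLoop, IsLoop, ← Iso.loop i, flip_root_sub (A.is4.rot_ne _) (hE.rot_root_ne h), sub_root,
    inl_sameCycle_sub]

theorem subRel_isDip_iff {A A' B : Net} (h : A.map.prev ≠ A.map.root) (hE : A.map.FrontEdge)
    (i : SubRel A A' B) : A.map.IsDip ↔ B.map.IsDip := by
  rw [Iso.isDip i, isDip_sub_iff (A.is4.rot_ne _) (hE.rot_root_ne h)]

/-- The series compositions whose second part has the property `q`. -/
def Series (q : Net → Prop) (B : Net) : Prop := ∃ A A', NoK4 A ∧ q A' ∧ SeriesRel A A' B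

theorem gf_series {q : Net → Prop} (hq : ∀ A, q A → A.map.Bridgeless) :
    gf (Series q) = PowerSeries.X * (gf NoK4 * gf q) := by
  rw [← pow_one (PowerSeries.X : PowerSeries ℤ)]
  refine gf_of_binary SeriesRel (fun A A' _ _ => ⟨⟨_, inferInstance,
    A.map.series A'.map A.is4 A'.is4, is4_sub⟩, Iso.refl _⟩) ?_ ?_ fun B h => h
  · intro A A' B h h' i
    refine ⟨⟨A, A', h, h', i⟩, size_eq ?_⟩
    obtain ⟨e, -⟩ := i
    rw [← Nat.card_congr e, Nat.card_sum, card_carrier, card_carrier]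
    ring
  · intro A A' C C' B D _ h _ h' i j
    constructor
    · rintro ⟨⟨e, e1, e2, e3⟩, k'⟩
      exact i.symm.trans ((iso_sub e1 e2 e3 (by rw [e2, e3]) k').trans j)
    · intro k
      exact iso_of_series (i.trans (Iso.trans k j.symm)) (hq _ h) (hq _ h')

theorem Series.not_bridgeless {q : Net → Prop} {B : Net} (h : Series q B) : ¬ B.map.Bridgeless := by
  obtain ⟨A, A', -, -, i⟩ := h
  exact fun T => not_bridgeless_series (i.symm.bridgeless T)

theorem not_bridgeless_iff_series (B : Net) : NoK4 B ∧ ¬ B.map.Bridgeless ↔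
    Series (fun A => NoK4 A ∧ A.map.Bridgeless) B := by
  constructor
  · rintro ⟨h1, h2⟩
    obtain ⟨K, X, Y, mX, mY, i, T⟩ := exists_series B.is4 h2
    have hk : ¬ (HasK4 X.rot X.flip ∨ HasK4 Y.rot Y.flip) := fun k =>
      h1 (i.symm.hasK4 (hasK4_sub.2 k))
    exact ⟨⟨_, inferInstance, X, mX⟩, ⟨_, inferInstance, Y, mY⟩, fun k => hk (Or.inl k),
      ⟨fun k => hk (Or.inr k), T⟩, i.symm⟩
  · intro h
    refine ⟨fun k => ?_, h.not_bridgeless⟩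
    obtain ⟨A, A', h1, h2, i⟩ := h
    exact (hasK4_sub.1 (i.symm.hasK4 k)).elim h1 h2.1

/-! ### Pinched maps -/

theorem isCore_iff {A : Net} : A.map.IsCore ↔ A.map.Bridgeless ∧ ¬ IsLoop A :=
  ⟨fun c => ⟨c.bridgeless, c.not_loop⟩, fun h => ⟨h.1, h.2⟩⟩

/-- The root edge is not a loop, and `b` tells whether all half-edges at its initial vertex are
linked to its final vertex. For a map that arises by pinching, this means that the root edge of the smaller
map is a loop (`b` true) or not (`b` false). -/
def PinchedProp (b : Prop) (A : Net) : Prop := ¬ IsLoop A ∧ (A.map.IsDip ↔ b)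

theorem invariant_pinchedProp (b : Prop) : Invariant (PinchedProp b) :=
  invariant_isLoop.not.and (Invariant.iff (fun _ _ i h => (Iso.isDip i).2 h) b)

theorem fan_pinch {b : Prop} {A : Net} (h : Fan (fun A => IsLoop A ↔ b) A)
    (hp : A.map.prev ≠ A.map.root) :
    (A.map.pinch A.is4 hp).IsCore ∧
      ¬ HasK4 (A.map.pinch A.is4 hp).rot (A.map.pinch A.is4 hp).flip ∧
      ((A.map.pinch A.is4 hp).IsDip ↔ b) := by
  obtain ⟨h1, h2, h3, h4, h5⟩ := h
  obtain ⟨c, hk⟩ := h4.isCore_pinch (m := A.is4) (h := hp) h2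
  exact ⟨c, fun k => h1 (hk k), Iff.trans ⟨h2.loop_of_isDip_pinch, isDip_pinch_of_loop c⟩ h5⟩

theorem fan_of_pinch {b : Prop} {A : Net} (T : A.map.Bridgeless) (hp : A.map.prev ≠ A.map.root)
    (c : (A.map.pinch A.is4 hp).IsCore)
    (hk : ¬ HasK4 (A.map.pinch A.is4 hp).rot (A.map.pinch A.is4 hp).flip)
    (hd : (A.map.pinch A.is4 hp).IsDip ↔ b) : Fan (fun A => IsLoop A ↔ b) A :=
  ⟨fun k => hk (hasK4_pinch_of k), T, hp, T.frontLink_of_pinch A.is4 c hk,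
    Iff.trans ⟨isDip_pinch_of_loop c, T.loop_of_isDip_pinch⟩ hd⟩

/-- The maps with a front edge arise by pinching from a map with a front chain, or from a series
composition that ends with such a map. The smaller map has a loop as its root edge exactly if all
half-edges at the initial vertex of the pinched map are linked to its final vertex. -/
theorem gf_edgeFan_pinchedProp (b : Prop) : gf (EdgeFan (PinchedProp b)) =
    PowerSeries.X ^ 2 * (gf (Fan fun A => IsLoop A ↔ b) +
      PowerSeries.X * (gf NoK4 * gf (Fan fun A => IsLoop A ↔ b))) := by
  rw [← gf_series fun A h => h.2.1, ← gf_add (p := fun A => Fan (fun A => IsLoop A ↔ b) A ∨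
    Series (Fan fun A => IsLoop A ↔ b) A) (fun _ => Iff.rfl) (invariant_fan (invariant_isLoop.iff b))
    fun A h h' => h'.not_bridgeless h.2.1]
  refine gf_of_unary PinchRel ?_ ?_ ?_ ?_
  · intro A hA
    have hp : A.map.prev ≠ A.map.root := by
      rcases hA with h | ⟨Y, Z, -, -, i⟩
      · exact h.2.2.1
      · exact fun g => prev_series_ne ((Iso.prev_eq_root i).2 g)
    exact ⟨⟨_, inferInstance, A.map.pinch A.is4 hp, is4_pinch⟩, hp, Iso.refl _⟩
  · rintro A B hA ⟨hp, i⟩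
    have hsz : B.size = A.size + 2 := by
      apply size_eq
      obtain ⟨e, -⟩ := i
      rw [← Nat.card_congr e, Nat.card_sum, card_carrier, Nat.card_fin]
      ring
    suffices (A.map.pinch A.is4 hp).IsCore ∧
        ¬ HasK4 (A.map.pinch A.is4 hp).rot (A.map.pinch A.is4 hp).flip ∧
        ((A.map.pinch A.is4 hp).IsDip ↔ b) by
      obtain ⟨c, hk, hd⟩ := this
      exact ⟨invariant_edgeFan (invariant_pinchedProp b) (A := ⟨_, inferInstance,
        A.map.pinch A.is4 hp, is4_pinch⟩) i ⟨hk, c.bridgeless, c.prev_ne_root is4_pinch,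
        frontEdge_pinch (m := A.is4) (h := hp), c.not_loop, hd⟩, hsz⟩
    rcases hA with h | ⟨Y, Z, hY, hZ, j⟩
    · exact fan_pinch h hp
    · obtain ⟨c, hk, hd⟩ := fan_pinch hZ hZ.2.2.1
      have j' : ((Y.map.series Z.map Y.is4 Z.is4).pinch is4_sub prev_series_ne).Iso
          (A.map.pinch A.is4 hp) := j.pinch
      refine ⟨IsCore.congr j' (isCore_pinch_series_iff.2 c), fun k => ?_,
        j'.isDip.trans (isDip_pinch_series_iff.trans hd)⟩
      exact ((hasK4_pinch_series_iff hZ.2.2.1).1 (j'.symm.hasK4 k)).elim hk hY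
  · rintro A A' B B' - - ⟨hp, i⟩ ⟨hp', i'⟩
    exact ⟨fun k => i.symm.trans ((Iso.pinch k).trans i'), fun k =>
      iso_of_pinch (i.trans (Iso.trans k i'.symm))⟩
  · rintro B ⟨h1, h2, h3, h4, h5, h6⟩
    obtain ⟨X, mX, hX, i, -⟩ := IsCore.exists_unpinch ⟨h2, h5⟩ B.is4 (by
      rw [show _ = _ from h4, rot_prev])
    have c := IsCore.congr i ⟨h2, h5⟩
    have hd : (X.pinch mX hX).IsDip ↔ b := i.isDip.trans h6
    have hk : ¬ HasK4 (X.pinch mX hX).rot (X.pinch mX hX).flip := fun k => h1 (i.symm.hasK4 k)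
    refine ⟨⟨_, inferInstance, X, mX⟩, ?_, hX, i.symm⟩
    by_cases T : X.Bridgeless
    · exact Or.inl (fan_of_pinch (A := ⟨_, inferInstance, X, mX⟩) T hX c hk hd)
    · obtain ⟨K, Y, Z, mY, mZ, j, TZ⟩ := exists_series mX T
      have j' : (X.pinch mX hX).Iso ((Y.series Z mY mZ).pinch is4_sub prev_series_ne) := j.pinch
      have c' := IsCore.congr j' c
      have hZ := prev_ne_of_bridgeless_pinch_series c'.bridgeless
      have hk' := not_or.1 fun k => hk (j'.symm.hasK4 ((hasK4_pinch_series_iff hZ).2 k))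
      refine Or.inr ⟨⟨_, inferInstance, Y, mY⟩, ⟨_, inferInstance, Z, mZ⟩, hk'.2,
        fan_of_pinch (A := ⟨_, inferInstance, Z, mZ⟩) TZ hZ ((isCore_pinch_series_iff).1 c') hk'.1
        (isDip_pinch_series_iff.symm.trans (j'.isDip.trans hd)), j.symm⟩

end Net

/-! ### The map with one vertex -/

theorem isMap4_loop : IsMap4 (finRotate 4) (swap 0 3 * swap 1 2 : Perm (Fin 4)) :=
  ⟨by decide, by decide, by decide, by decide⟩

theorem sameCycle_finRotate_four (i j : Fin 4) : (finRotate 4).SameCycle i j := by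
  refine (isCycle_finRotate (n := 2)).sameCycle ?_ ?_
  · revert i; decide
  · revert j; decide

theorem planar_loop : Planar (finRotate 4) (swap 0 3 * swap 1 2 : Perm (Fin 4)) := by
  have h1 := numCycles_mul_swap_of_sameCycle (sameCycle_finRotate_four 0 3) (by decide)
  have h2 : (finRotate 4 * swap 0 3).SameCycle 1 2 :=
    sameCycle_apply_right.2 (SameCycle.refl (finRotate 4 * swap 0 3) 1)
  have h3 := numCycles_mul_swap_of_sameCycle h2 (by decide)
  have h4 := two_mul_numCycles isMap4_loop.flip_flip isMap4_loop.flip_ne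
  rw [Nat.card_fin] at h4
  rw [Planar, ← mul_assoc, h3, h1, numCycles_finRotate_four]
  omega

namespace Net

/-- The map with one vertex and two loops, in which the other end of the root edge comes just before
the root in the rotation. -/
noncomputable def loop : Net where
  carrier := Fin 4
  finite := inferInstance
  map := ofPerms isMap4_loop (fun _ ⟨i, hi⟩ hρ _ => Set.eq_univ_of_forall fun j =>
    (sameCycle_finRotate_four i j).mem_of_forall_mem hρ hi) planar_loop 0
  is4 := isMap4_loop

theorem edgeFan_loop : EdgeFan IsLoop loop := by
  refine ⟨?_, bridgeless_of_loop loop.is4 (sameCycle_finRotate_four _ _), ?_, ?_,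
    sameCycle_finRotate_four _ _⟩
  · rintro ⟨B, hB⟩
    obtain ⟨i, hi⟩ := (hB.conn 0).1
    obtain ⟨j, hj⟩ := (hB.conn 1).1
    exact hB.disj 0 1 (by decide) i hi
      (((hB.vertexSet 1).mem_iff (sameCycle_finRotate_four i j)).2 hj)
  · rw [Ne, prev_eq_root_iff]
    change ¬ finRotate 4 0 = (swap 0 3 * swap 1 2 : Perm (Fin 4)) 0
    decide
  · apply loop.map.rot.injective
    rw [rot_prev]
    change finRotate 4 ((swap 0 3 * swap 1 2 : Perm (Fin 4)) (finRotate 4 0)) =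
      (swap 0 3 * swap 1 2 : Perm (Fin 4)) 0
    decide

theorem equiv_loop_of_edgeFan {A : Net} (h : EdgeFan IsLoop A) : loop ≈ A := by
  obtain ⟨-, -, h1, h2, h3⟩ := h
  obtain ⟨D, _, R, m⟩ := A
  have h4 : R.rot (R.flip R.root) = R.root :=
    ((loop_iff m).1 h3).resolve_left fun g => h1 (prev_eq_root_iff.2 g)
  have a0 : R.flip (around R.rot R.root 0) = around R.rot R.root 3 :=
    R.rot.injective (h4.trans (m.rot4 _).symm)
  have a1 : R.flip (around R.rot R.root 1) = around R.rot R.root 2 :=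
    R.rot.injective ((congrArg R.rot h2).trans (R.rot_prev.trans a0))
  have hflip : ∀ i, around R.rot R.root ((swap 0 3 * swap 1 2 : Perm (Fin 4)) i) =
      R.flip (around R.rot R.root i) :=
    forall_fin_four a0.symm a1.symm (by rw [← a1, R.flip_flip]; rfl) (by rw [← a0, R.flip_flip]; rfl)
  have hrot : ∀ i, around R.rot R.root (finRotate 4 i) = R.rot (around R.rot R.root i) :=
    around_finRotate m _
  have hsurj : Set.range (around R.rot R.root) = Set.univ :=
    R.isConn _ ⟨_, 0, rfl⟩ (by rintro _ ⟨i, rfl⟩; exact ⟨_, hrot i⟩)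
      (by rintro _ ⟨i, rfl⟩; exact ⟨_, hflip i⟩)
  exact ⟨Equiv.ofBijective _ ⟨around_injective m _, Set.range_eq_univ.1 hsurj⟩, hrot, hflip, rfl⟩

theorem gf_edgeFan_isLoop : gf (EdgeFan IsLoop) = PowerSeries.X := by
  ext n
  rw [gf, PowerSeries.coeff_mk, PowerSeries.coeff_X]
  have hs : loop.size = 1 := size_eq (Nat.card_fin 4)
  have key : classes (EdgeFan IsLoop) n = if n = 1 then {⟦loop⟧} else ∅ := by
    ext q
    constructor
    · rintro ⟨A, rfl, hA, rfl⟩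
      have := equiv_loop_of_edgeFan hA
      rw [if_pos (by rw [← size_congr this, hs])]
      exact (Quotient.sound this).symm
    · split_ifs with h
      · rintro rfl
        exact ⟨_, rfl, edgeFan_loop, by rw [hs, h]⟩
      · exact fun h => h.elim
  rw [key]
  split_ifs <;> simp

/-! ### The equations -/

/-- The mirror image of a map. -/
def mirror (A : Net) : Net := ⟨A.carrier, A.finite, A.map.reflect A.is4, is4_reflect⟩

theorem gf_mirror {p : Net → Prop} (hp : Invariant p) : gf (fun A => p A.mirror) = gf p := by
  have hmm : ∀ A : Net, A.mirror.mirror ≈ A := fun A => Iso.refl A.map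
  have hc : ∀ {A B : Net}, A ≈ B → A.mirror ≈ B.mirror := fun {A B} i =>
    Iso.reflect (m := A.is4) (m' := B.is4) i
  rw [gf_of_unary (p := p) (k := 0) (fun A B => A.mirror ≈ B) (fun A _ => ⟨_, Setoid.refl _⟩) ?_ ?_
    ?_, pow_zero, one_mul]
  · intro A B hA i
    exact ⟨hp (Setoid.trans (Setoid.symm (hmm A)) (hc i)) hA, (size_congr i).symm⟩
  · intro A A' B B' _ _ i i'
    refine ⟨fun k => Setoid.trans (Setoid.symm i) (Setoid.trans (hc k) i'), fun k => ?_⟩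
    exact Setoid.trans (Setoid.symm (hmm A)) (Setoid.trans (hc (Setoid.trans i
      (Setoid.trans k (Setoid.symm i')))) (hmm A'))
  · intro B hB
    exact ⟨B.mirror, hB, hmm B⟩

/-- The maps without `K₄` minor whose root edge is not a loop and whose network has no bridge. -/
def Core (A : Net) : Prop := NoK4 A ∧ A.map.IsCore

/-- The maps of `Core` with an edge parallel to the root edge in which not all edges at the initial
vertex start chains to the final vertex. -/
def CoreParallel (A : Net) : Prop := Core A ∧ ¬ A.map.IsDip ∧
  ∃ x, A.map.rot.SameCycle A.map.root x ∧ x ≠ A.map.root ∧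
    A.map.rot.SameCycle (A.map.flip A.map.root) (A.map.flip x)

theorem fan_pinchedProp_iff {A : Net} {b : Prop} : Fan (PinchedProp b) A ↔
    Core A ∧ A.map.FrontLink ∧ (A.map.IsDip ↔ b) :=
  ⟨fun ⟨h1, h2, _, h4, h5, h6⟩ => ⟨⟨h1, h2, h5⟩, h4, h6⟩,
    fun ⟨⟨h1, c⟩, h4, h6⟩ => ⟨h1, c.bridgeless, c.prev_ne_root A.is4, h4, c.not_loop, h6⟩⟩

theorem edgeFan_pinchedProp_iff {A : Net} {b : Prop} : EdgeFan (PinchedProp b) A ↔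
    Core A ∧ A.map.FrontEdge ∧ (A.map.IsDip ↔ b) :=
  ⟨fun ⟨h1, h2, _, h4, h5, h6⟩ => ⟨⟨h1, h2, h5⟩, h4, h6⟩,
    fun ⟨⟨h1, c⟩, h4, h6⟩ => ⟨h1, c.bridgeless, c.prev_ne_root A.is4, h4, c.not_loop, h6⟩⟩

theorem core_mirror {A : Net} : Core A.mirror ↔ Core A :=
  and_congr (not_congr (hasK4_reflect_iff (m := A.is4))) (isCore_reflect_iff (m := A.is4))

theorem invariant_core : Invariant Core :=
  invariant_noK4.and fun _ _ i c => IsCore.congr i c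

/-- In a map of `Core`, either all chains are parallel to the root edge, and one of them is the
front chain, or exactly one is, which is the front chain of the map or of its mirror image. -/
theorem gf_core : gf Core =
    gf (Fan (PinchedProp True)) + 2 * gf (Fan (PinchedProp False)) := by
  have hi := fun b => invariant_fan (invariant_pinchedProp b)
  rw [two_mul]
  nth_rw 2 [← gf_mirror (hi False)]
  rw [← gf_add (p := fun A => Core A ∧ ¬ A.map.IsDip) (p₁ := Fan (PinchedProp False))
    (fun A => ?_) (hi False) fun A h h' => ?_]
  · refine gf_add (fun A => ?_) (hi True) fun A h h' => ?_
    · rw [fan_pinchedProp_iff, iff_true]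
      constructor
      · intro h
        by_cases hd : A.map.IsDip
        · exact Or.inl ⟨h, h.2.frontLink_of_isDip A.is4 hd, hd⟩
        · exact Or.inr ⟨h, hd⟩
      · rintro (h | h) <;> exact h.1
    · exact h'.2 ((fan_pinchedProp_iff.1 h).2.2.2 trivial)
  · simp only [fan_pinchedProp_iff, iff_false, core_mirror]
    have h1 : A.mirror.map.IsDip ↔ A.map.IsDip := isDip_reflect_iff (m := A.is4)
    have h2 : A.mirror.map.FrontLink ↔ A.map.BackLink :=
      frontLink_reflect_iff (m := A.is4)
    rw [h1, h2]
    constructor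
    · rintro ⟨h, hd⟩
      exact (h.2.frontLink_or_backLink A.is4 h.1 hd).imp (fun g => ⟨h, g, hd⟩) fun g => ⟨h, g, hd⟩
    · rintro (h | h) <;> exact ⟨h.1, h.2.2⟩
  · rw [fan_pinchedProp_iff, iff_false] at h h'
    exact h.2.2 (h.1.2.isDip_of_frontLink_of_backLink A.is4 h.2.1
      ((frontLink_reflect_iff (m := A.is4)).1 h'.2.1))

theorem gf_coreParallel : gf CoreParallel = 2 * gf (EdgeFan (PinchedProp False)) := by
  have hi := invariant_edgeFan (invariant_pinchedProp False)
  rw [two_mul]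
  nth_rw 2 [← gf_mirror hi]
  refine gf_add (fun A => ?_) hi fun A h h' => ?_
  · simp only [edgeFan_pinchedProp_iff, iff_false, core_mirror]
    have h1 : A.mirror.map.IsDip ↔ A.map.IsDip := isDip_reflect_iff (m := A.is4)
    rw [h1, CoreParallel]
    constructor
    · rintro ⟨h, hd, hx⟩
      exact ((h.2.exists_parallel_iff A.is4 hd).1 hx).imp (fun g => ⟨h, g, hd⟩) fun g => ⟨h, g, hd⟩
    · rintro (h | h)
      · exact ⟨h.1, h.2.2, (h.1.2.exists_parallel_iff A.is4 h.2.2).2 (Or.inl h.2.1)⟩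
      · exact ⟨h.1, h.2.2, (h.1.2.exists_parallel_iff A.is4 h.2.2).2 (Or.inr h.2.1)⟩
  · rw [edgeFan_pinchedProp_iff, iff_false] at h h'
    exact h.2.2 (h.1.2.isDip_of_frontLink_of_backLink A.is4 h.2.1.frontLink
      ((frontLink_reflect_iff (m := A.is4)).1 h'.2.1.frontLink))

theorem gf_isLoop : gf (fun A => NoK4 A ∧ IsLoop A) = 2 * gf (Fan IsLoop) := by
  have hi := invariant_fan invariant_isLoop
  rw [two_mul]
  nth_rw 2 [← gf_mirror hi]
  have hf : ∀ A : Net, Fan IsLoop A ↔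
      NoK4 A ∧ IsLoop A ∧ A.map.rot (A.map.flip A.map.root) = A.map.root := by
    intro A
    constructor
    · rintro ⟨h1, -, h3, -, h5⟩
      exact ⟨h1, h5, ((loop_iff A.is4).1 h5).resolve_left fun g => h3 (prev_eq_root_iff.2 g)⟩
    · rintro ⟨h1, h5, h⟩
      refine ⟨h1, bridgeless_of_loop A.is4 h5, fun g => ?_, frontLink_of_loop A.is4 h, h5⟩
      rw [prev_eq_root_iff] at g
      rw [← g] at h
      exact A.is4.rot2_ne _ h
  have hm : ∀ A : Net, Fan IsLoop A.mirror ↔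
      NoK4 A ∧ IsLoop A ∧ A.map.rot A.map.root = A.map.flip A.map.root := by
    intro A
    rw [hf]
    refine and_congr (not_congr (hasK4_reflect_iff (m := A.is4)))
      (and_congr (sameCycle_reflect_iff (m := A.is4)) ?_)
    exact (Equiv.symm_apply_eq _).trans eq_comm
  refine gf_add (fun A => ?_) hi fun A h h' => ?_
  · rw [hf, hm, ← and_or_left, ← and_or_left]
    refine and_congr_right fun _ => ⟨fun h => ⟨h, ((loop_iff A.is4).1 h).symm⟩, fun h => h.1⟩
  · rw [hf] at h
    rw [hm] at h'
    have := h.2.2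
    rw [← h'.2.2] at this
    exact A.is4.rot2_ne _ this

end Net

/-! ### The four classes in terms of half-edges -/

namespace RootedMap

variable {D : Type*} [Finite D] (R : RootedMap D)

theorem reachable_graphMinus_iff (A : Set R.Edge) (d e : D) :
    (R.graphMinus A).Reachable (R.vert d) (R.vert e) ↔ ∀ S : Set D, IsVertexSet R.rot S → d ∈ S →
      (∀ x ∈ S, R.edge x ∉ A → R.flip x ∈ S) → e ∈ S := by
  constructor
  · intro h S hS hd hc
    refine h.of_forall_adj (P := fun v => ∀ x, R.vert x = v → x ∈ S) ?_ (fun x hx => ?_) e rfl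
    · rintro _ _ ⟨-, x, hx, rfl, rfl⟩ hP y hy
      exact (hS.mem_iff (R.vert_eq_iff.1 hy)).2 (hc x (hP x rfl) hx)
    · exact (hS.mem_iff (R.vert_eq_iff.1 hx)).2 hd
  · intro h
    refine h {x | (R.graphMinus A).Reachable (R.vert d) (R.vert x)} (IsVertexSet.of_forall_mem
      fun x hx => ?_) (SimpleGraph.Reachable.refl _) fun x hx hxA => ?_
    · have h1 : R.vert (R.rot x) = R.vert x :=
        R.vert_eq_iff.2 (sameCycle_apply_left.2 (SameCycle.refl _ _))
      rw [Set.mem_ofPred_eq, h1]; exact hx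
    · by_cases h1 : R.vert x = R.vert (R.flip x)
      · rw [Set.mem_ofPred_eq, ← h1]; exact hx
      · exact SimpleGraph.Reachable.trans hx (SimpleGraph.Adj.reachable ⟨h1, x, hxA, rfl, rfl⟩)

theorem edge_notMem_rootEdge_iff {d : D} : R.edge d ∉ ({R.rootEdge} : Set R.Edge) ↔
    d ≠ R.root ∧ d ≠ R.flip R.root := by
  rw [Set.mem_singleton_iff, rootEdge, eq_comm, edge_eq_iff, not_or]

variable {R}

theorem network_connected (m : R.Is4) : R.network.Connected := by
  have : Nonempty R.Vertex := ⟨R.s⟩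
  refine ⟨fun u v => ?_⟩
  obtain ⟨d, rfl⟩ := R.vert_surjective u
  obtain ⟨e, rfl⟩ := R.vert_surjective v
  refine (R.reachable_graphMinus_iff _ d e).2 fun S hS hd hc => ?_
  rw [R.isConn.eq_univ_of_off m R.root ⟨d, hd⟩ (fun x hx => (hS x).2 hx) fun x hx h1 h2 =>
    hc x hx (R.edge_notMem_rootEdge_iff.2 ⟨h1, h2⟩)]
  trivial

theorem networkHasBridge_iff (m : R.Is4) : R.NetworkHasBridge ↔ ¬ R.Bridgeless := by
  have key : ∀ a d, R.edge d ∉ ({R.rootEdge, R.edge a} : Set R.Edge) ↔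
      (d ≠ R.root ∧ d ≠ R.flip R.root) ∧ d ≠ a ∧ d ≠ R.flip a := fun a d => by
    rw [← edge_notMem_rootEdge_iff, Set.mem_insert_iff, not_or, Set.mem_singleton_iff,
      Set.mem_singleton_iff, eq_comm (b := R.edge a), edge_eq_iff, not_or]
  constructor
  · rintro ⟨a, ha, h⟩ T
    obtain ⟨h1, h2⟩ := R.edge_notMem_rootEdge_iff.1 ha
    refine h ((R.reachable_graphMinus_iff _ _ _).2 fun S hS haS hc => ?_)
    rw [T a h1 h2 S ⟨a, haS⟩ (fun d hd => (hS d).2 hd) fun d hd g1 g2 g3 g4 =>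
      hc d hd ((key a d).2 ⟨⟨g1, g2⟩, g3, g4⟩)]
    trivial
  · intro h
    by_contra hB
    refine h fun a h1 h2 S hne hρ hc => ?_
    have hS := IsVertexSet.of_forall_mem hρ
    have hr : ∀ b, R.edge b ∉ ({R.rootEdge} : Set R.Edge) → (∀ d, d ≠ b ∧ d ≠ R.flip b →
        d ≠ a ∧ d ≠ R.flip a) → b ∈ S → R.flip b ∈ S := by
      intro b hb hab hbS
      by_contra hbS'
      refine hB ⟨b, hb, fun hR => hbS' ?_⟩
      refine (R.reachable_graphMinus_iff _ _ _).1 hR S hS hbS fun d hd hd' => ?_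
      obtain ⟨⟨g1, g2⟩, g3⟩ := (key b d).1 hd'
      exact hc d hd g1 g2 (hab d g3).1 (hab d g3).2
    refine R.isConn.eq_univ_of_off m R.root hne hρ fun d hd g1 g2 => ?_
    by_cases g3 : d = a
    · subst g3
      exact hr d (R.edge_notMem_rootEdge_iff.2 ⟨g1, g2⟩) (fun _ h => h) hd
    by_cases g4 : d = R.flip a
    · refine hr d (R.edge_notMem_rootEdge_iff.2 ⟨g1, g2⟩) (fun e he => ?_) hd
      rw [g4, R.flip_flip] at he
      exact he.symm
    exact hc d hd g1 g2 g3 g4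

theorem s_eq_t_iff : R.s = R.t ↔ R.rot.SameCycle R.root (R.flip R.root) := R.vert_eq_iff

theorem vert_mem_inner_iff {d : D} : R.vert d ∈ ({R.s, R.t}ᶜ : Set R.Vertex) ↔
    ¬ R.rot.SameCycle R.root d ∧ ¬ R.rot.SameCycle (R.flip R.root) d := by
  rw [Set.mem_compl_iff, Set.mem_insert_iff, not_or, Set.mem_singleton_iff, s, t, vert_eq_iff,
    vert_eq_iff, sameCycle_comm, sameCycle_comm (y := R.flip R.root)]

theorem mem_of_innerGraph_preconnected (h : R.innerGraph.Preconnected) {d e : D}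
    (hd : R.vert d ∈ ({R.s, R.t}ᶜ : Set R.Vertex)) (he : R.vert e ∈ ({R.s, R.t}ᶜ : Set R.Vertex))
    {S : Set D} (hS : IsVertexSet R.rot S) (hdS : d ∈ S)
    (hc : ∀ x ∈ S, R.vert (R.flip x) ∈ ({R.s, R.t}ᶜ : Set R.Vertex) → R.flip x ∈ S) : e ∈ S := by
  refine (h ⟨_, hd⟩ ⟨_, he⟩).of_forall_adj (P := fun v => ∀ x, R.vert x = v.1 → x ∈ S) ?_
    (fun x hx => ?_) e rfl
  · rintro ⟨_, hu⟩ ⟨_, hv⟩ ⟨_, x, -, hxu, hxv⟩ hP y hy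
    refine (hS.mem_iff (R.vert_eq_iff.1 (hy.trans hxv.symm))).2 (hc x (hP x hxu) ?_)
    rw [hxv]; exact hv
  · exact (hS.mem_iff (R.vert_eq_iff.1 hx)).2 hdS

theorem innerGraph_preconnected (h : ∀ S : Set D, IsVertexSet R.rot S → S.Nonempty →
    (∀ d ∈ S, R.vert d ∈ ({R.s, R.t}ᶜ : Set R.Vertex)) →
    (∀ x ∈ S, R.vert (R.flip x) ∈ ({R.s, R.t}ᶜ : Set R.Vertex) → R.flip x ∈ S) →
    ∀ e, R.vert e ∈ ({R.s, R.t}ᶜ : Set R.Vertex) → e ∈ S) : R.innerGraph.Preconnected := by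
  rintro ⟨u, hu⟩ ⟨v, hv⟩
  obtain ⟨d, rfl⟩ := R.vert_surjective u
  obtain ⟨e, rfl⟩ := R.vert_surjective v
  refine (h {x | ∃ hx : R.vert x ∈ ({R.s, R.t}ᶜ : Set R.Vertex),
    R.innerGraph.Reachable ⟨R.vert d, hu⟩ ⟨R.vert x, hx⟩} ?_ ⟨d, hu, SimpleGraph.Reachable.refl _⟩
    (fun x ⟨hx, _⟩ => hx) ?_ e hv).2
  · refine IsVertexSet.of_forall_mem ?_
    rintro x ⟨hx, hr⟩
    have h1 : R.vert (R.rot x) = R.vert x :=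
      R.vert_eq_iff.2 (sameCycle_apply_left.2 (SameCycle.refl _ _))
    refine ⟨h1 ▸ hx, ?_⟩
    convert hr using 2
  · rintro x ⟨hx, hr⟩ hx'
    refine ⟨hx', ?_⟩
    by_cases heq : R.vert x = R.vert (R.flip x)
    · convert hr using 2
      exact heq.symm
    · refine hr.trans (SimpleGraph.Adj.reachable ⟨heq, x, ?_, rfl, rfl⟩)
      refine R.edge_notMem_rootEdge_iff.2 ⟨?_, ?_⟩
      · rintro rfl
        exact (vert_mem_inner_iff.1 hx).1 (SameCycle.refl _ _)
      · rintro rfl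
        exact (vert_mem_inner_iff.1 hx).2 (SameCycle.refl _ _)

/-- The edges that join the ends of the root edge correspond to their half-edges at the initial
vertex. -/
theorem numRootParallel_eq (hst : ¬ R.rot.SameCycle R.root (R.flip R.root)) : R.numRootParallel =
    {d | R.rot.SameCycle R.root d ∧ R.rot.SameCycle (R.flip R.root) (R.flip d)}.ncard := by
  have hset : {e : R.Edge | ∃ d, R.edge d = e ∧ R.vert d = R.s ∧ R.vert (R.flip d) = R.t} =
      R.edge '' {d | R.rot.SameCycle R.root d ∧ R.rot.SameCycle (R.flip R.root) (R.flip d)} := by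
    ext e
    have key : ∀ d, (R.vert d = R.s ∧ R.vert (R.flip d) = R.t) ↔
        R.rot.SameCycle R.root d ∧ R.rot.SameCycle (R.flip R.root) (R.flip d) := fun d => by
      rw [s, t, vert_eq_iff, vert_eq_iff, sameCycle_comm, sameCycle_comm (y := R.flip R.root)]
    constructor
    · rintro ⟨d, rfl, hd⟩
      exact ⟨d, (key d).1 hd, rfl⟩
    · rintro ⟨d, hd, rfl⟩
      exact ⟨d, rfl, (key d).2 hd⟩
  rw [numRootParallel, hset, Set.InjOn.ncard_image]
  rintro d ⟨hd, -⟩ e ⟨-, he⟩ hde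
  rcases R.edge_eq_iff.1 hde with rfl | rfl
  · rfl
  · rw [R.flip_flip] at he
    exact (hst (hd.trans he.symm)).elim

/-- A chain of positive length between the ends of the root edge, whose interior does not contain
all remaining vertices, disconnects the network without these two vertices. -/
theorem Bridgeless.not_preconnected (T : R.Bridgeless) (m : R.Is4)
    (hst : ¬ R.rot.SameCycle R.root (R.flip R.root)) {x x' : D} (hx : R.rot.SameCycle R.root x)
    (hx' : R.rot.SameCycle R.root x') (hne : x' ≠ x)
    (hp : ¬ R.rot.SameCycle (R.flip R.root) (R.flip x))
    (hp' : ¬ R.rot.SameCycle (R.flip R.root) (R.flip x')) (hL : R.LinkedToT x) :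
    ¬ R.innerGraph.Preconnected := by
  intro hc
  obtain ⟨y, hy, K, k⟩ := hL
  have hK : R.flip x ∈ K := by
    rcases k.flip_mem x (Or.inr (Or.inl rfl)) with h | h | h
    · exact h
    · exact (R.flip_ne x h).elim
    · exact (hp (h ▸ hy)).elim
  have h1 := mem_of_innerGraph_preconnected hc
    (vert_mem_inner_iff.2 ⟨T.not_loop m hst hx, hp⟩)
    (vert_mem_inner_iff.2 ⟨T.not_loop m hst hx', hp'⟩) k.vertexSet hK fun d hd hd' => by
      obtain ⟨g1, g2⟩ := vert_mem_inner_iff.1 hd'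
      rcases k.flip_mem d (Or.inl hd) with h | h | h
      · exact h
      · exact (g1 (h ▸ hx)).elim
      · exact (g2 (h ▸ hy)).elim
  have h2 := k.flip_mem _ (Or.inl h1)
  rw [R.flip_flip] at h2
  rcases h2 with h | h | h
  · exact k.root_notMem ((k.vertexSet.mem_iff hx').2 h)
  · exact hne h
  · exact hst (hx'.trans (h ▸ hy.symm))

theorem IsCore.not_preconnected_or_of_isDip (c : R.IsCore) (m : R.Is4) (hd : R.IsDip) :
    ¬ R.innerGraph.Preconnected ∨ 3 ≤ R.numRootParallel := by
  have s1 : R.rot.SameCycle R.root (R.rot R.root) := sameCycle_apply_right.2 (SameCycle.refl _ _)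
  have s2 : R.rot.SameCycle R.root (R.rot (R.rot R.root)) := sameCycle_apply_right.2 s1
  have s3 : R.rot.SameCycle R.root (R.rot (R.rot (R.rot R.root))) := sameCycle_apply_right.2 s2
  have key : ∀ a b, R.rot.SameCycle R.root a → R.rot.SameCycle R.root b → a ≠ R.root →
      b ≠ R.root → b ≠ a → ¬ (¬ R.innerGraph.Preconnected ∨ 3 ≤ R.numRootParallel) →
      (R.rot.SameCycle (R.flip R.root) (R.flip a) ↔
        ¬ R.rot.SameCycle (R.flip R.root) (R.flip b)) := by
    intro a b ha hb har hbr hab hcon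
    rw [not_or, numRootParallel_eq c.not_loop] at hcon
    constructor
    · refine fun h1 h2 => hcon.2 ?_
      rw [← Set.ncard_eq_three.2 ⟨R.root, a, b, har.symm, hbr.symm, hab.symm, rfl⟩]
      refine Set.ncard_le_ncard ?_ (Set.toFinite _)
      rintro d (rfl | rfl | rfl)
      exacts [⟨SameCycle.refl _ _, SameCycle.refl _ _⟩, ⟨ha, h1⟩, ⟨hb, h2⟩]
    · intro h1
      by_contra h2
      exact hcon.1 (c.bridgeless.not_preconnected m c.not_loop ha hb hab h2 h1 (hd a ha har))
  by_contra hcon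
  have k1 := key _ _ s1 s2 (m.rot_ne _) (m.rot2_ne _) (m.rot_ne _) hcon
  have k2 := key _ _ s1 s3 (m.rot_ne _) (m.rot3_ne _) (m.rot2_ne _) hcon
  have k3 := key _ _ s2 s3 (m.rot2_ne _) (m.rot3_ne _) (m.rot_ne _) hcon
  tauto

theorem IsCore.not_preconnected_of_not_isDip (c : R.IsCore) (m : R.Is4)
    (hK : ¬ HasK4 R.rot R.flip) (hd : ¬ R.IsDip)
    (hp : ∀ x, R.rot.SameCycle R.root x → x ≠ R.root →
      ¬ R.rot.SameCycle (R.flip R.root) (R.flip x)) : ¬ R.innerGraph.Preconnected := by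
  obtain ⟨x, hx, hxr, hL, -⟩ := (c.isDip_or_isMate m hK).resolve_left hd
  have s1 : R.rot.SameCycle R.root (R.rot R.root) := sameCycle_apply_right.2 (SameCycle.refl _ _)
  have s2 : R.rot.SameCycle R.root (R.rot (R.rot R.root)) := sameCycle_apply_right.2 s1
  by_cases h : x = R.rot R.root
  · exact c.bridgeless.not_preconnected m c.not_loop hx s2 (h ▸ m.rot_ne _) (hp _ hx hxr)
      (hp _ s2 (m.rot2_ne _)) hL
  · exact c.bridgeless.not_preconnected m c.not_loop hx s1 (Ne.symm h) (hp _ hx hxr)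
      (hp _ s1 (m.rot_ne _)) hL

/-- If exactly one chain joins the ends of the root edge, and this chain is an edge, then the
remaining vertices form a connected graph: otherwise, by parity, two of the four edges that leave
the two end vertices would be the ends of a chain. -/
theorem IsCore.connected_of_parallel (c : R.IsCore) (m : R.Is4) (hd : ¬ R.IsDip) {x : D}
    (hx : R.rot.SameCycle R.root x) (hxr : x ≠ R.root)
    (hxt : R.rot.SameCycle (R.flip R.root) (R.flip x)) :
    R.innerGraph.Connected ∧ R.numRootParallel = 2 := by
  have hxL : R.LinkedToT x := LinkedToT.of_flip hxt
  have hL : ∀ p, R.rot.SameCycle R.root p → p ≠ R.root → p ≠ x → ¬ R.LinkedToT p := by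
    intro p hp hpr hpx hpL
    refine hd fun q hq hqr => ?_
    by_cases h1 : q = x
    · exact h1 ▸ hxL
    by_cases h2 : q = p
    · exact h2 ▸ hpL
    exact c.bridgeless.linkedToT_third m c.not_loop hx hp hq hxr hpr hqr hpx.symm (Ne.symm h1)
      (Ne.symm h2) hxL hpL
  have hnum : R.numRootParallel = 2 := by
    rw [numRootParallel_eq c.not_loop, ← Set.ncard_pair hxr.symm]
    congr 1
    ext d
    constructor
    · rintro ⟨h1, h2⟩
      by_contra hcon
      rw [Set.mem_insert_iff, not_or] at hcon
      exact hL d h1 hcon.1 hcon.2 (LinkedToT.of_flip h2)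
    · rintro (rfl | rfl)
      exacts [⟨SameCycle.refl _ _, SameCycle.refl _ _⟩, ⟨hx, hxt⟩]
  obtain ⟨p, hp, hpr, hpx⟩ : ∃ p, R.rot.SameCycle R.root p ∧ p ≠ R.root ∧ p ≠ x := by
    have s1 : R.rot.SameCycle R.root (R.rot R.root) := sameCycle_apply_right.2 (SameCycle.refl _ _)
    by_cases h : x = R.rot R.root
    · exact ⟨_, sameCycle_apply_right.2 s1, m.rot2_ne _, h ▸ m.rot_ne _⟩
    · exact ⟨_, s1, m.rot_ne _, Ne.symm h⟩
  have hpi : R.vert (R.flip p) ∈ ({R.s, R.t}ᶜ : Set R.Vertex) :=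
    vert_mem_inner_iff.2 ⟨c.bridgeless.not_loop m c.not_loop hp,
      fun h => hL p hp hpr hpx (LinkedToT.of_flip h)⟩
  -- the half-edges at the two ends of the root edge that lead to the remaining vertices
  set W : Set D := (vertexOf R.rot R.root ∪ vertexOf R.rot (R.flip R.root)) \
    {R.root, x, R.flip R.root, R.flip x} with hW
  have hWcard : W.ncard ≤ 4 := by
    have hst : ∀ a b, R.rot.SameCycle R.root a → R.rot.SameCycle (R.flip R.root) b → a ≠ b :=
      fun a b ha hb h => c.not_loop (ha.trans (h ▸ hb.symm))
    have hr := SameCycle.refl R.rot R.root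
    have hr' := SameCycle.refl R.rot (R.flip R.root)
    have h4 : ({R.root, x, R.flip R.root, R.flip x} : Set D).ncard = 4 := by
      rw [Set.ncard_insert_of_notMem, Set.ncard_eq_three.2 ⟨x, R.flip R.root, R.flip x,
        hst _ _ hx hr', hst _ _ hx hxt, fun h => hxr (R.flip.injective h).symm, rfl⟩]
      rintro (h | h | h)
      exacts [hxr h.symm, hst _ _ hr hr' h, hst _ _ hr hxt h]
    have h8 := Set.ncard_union_le (vertexOf R.rot R.root) (vertexOf R.rot (R.flip R.root))
    rw [m.ncard_vertexOf, m.ncard_vertexOf] at h8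
    have := Set.ncard_sdiff_add_ncard_of_subset
      (s := ({R.root, x, R.flip R.root, R.flip x} : Set D))
      (t := vertexOf R.rot R.root ∪ vertexOf R.rot (R.flip R.root)) (by
        rintro d (rfl | rfl | rfl | rfl)
        exacts [Or.inl hr, Or.inl hx, Or.inr hr', Or.inr hxt]) (Set.toFinite _)
    rw [hW]
    omega
  have hbW : ∀ S : Set D, (∀ d ∈ S, R.vert d ∈ ({R.s, R.t}ᶜ : Set R.Vertex)) →
      (∀ x ∈ S, R.vert (R.flip x) ∈ ({R.s, R.t}ᶜ : Set R.Vertex) → R.flip x ∈ S) →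
      ∀ d ∈ bdry R.flip S, R.flip d ∈ W := by
    rintro S hSi hSc d ⟨hdS, hdS'⟩
    have h1 := vert_mem_inner_iff.1 (hSi d hdS)
    refine ⟨?_, ?_⟩
    · by_contra hcon
      exact hdS' (hSc d hdS (vert_mem_inner_iff.2 (not_or.1 hcon)))
    · rintro (h | h | h | h)
      · exact h1.2 (by rw [← h, R.flip_flip])
      · exact h1.2 (by rw [← h, R.flip_flip] at hxt; exact hxt)
      · exact h1.1 (by rw [R.flip.injective h])
      · exact h1.1 (by rw [R.flip.injective h]; exact hx)
  have key : ∀ S S' : Set D, IsVertexSet R.rot S → IsVertexSet R.rot S' → S'.Nonempty →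
      (∀ d ∈ S, R.vert d ∈ ({R.s, R.t}ᶜ : Set R.Vertex)) →
      (∀ d ∈ S', R.vert d ∈ ({R.s, R.t}ᶜ : Set R.Vertex)) →
      (∀ x ∈ S, R.vert (R.flip x) ∈ ({R.s, R.t}ᶜ : Set R.Vertex) → R.flip x ∈ S) →
      (∀ x ∈ S', R.vert (R.flip x) ∈ ({R.s, R.t}ᶜ : Set R.Vertex) → R.flip x ∈ S') →
      (∀ d ∈ S, d ∉ S') → R.flip p ∉ S := by
    intro S S' hS hS' hne' hSi hSi' hSc hSc' hdisj hpS
    have hrS : R.root ∉ S := fun h => (vert_mem_inner_iff.1 (hSi _ h)).1 (SameCycle.refl _ _)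
    have hpb : R.flip p ∈ bdry R.flip S :=
      ⟨hpS, fun h => (vert_mem_inner_iff.1 (hSi _ h)).1 (by rw [R.flip_flip]; exact hp)⟩
    have hb1 : 0 < (bdry R.flip S).ncard := (Set.ncard_pos (Set.toFinite _)).2 ⟨_, hpb⟩
    have hb2 : 0 < (bdry R.flip S').ncard := (Set.ncard_pos (Set.toFinite _)).2
      (R.isConn.bdry_nonempty hS' hne' ⟨R.root, fun h =>
        (vert_mem_inner_iff.1 (hSi' _ h)).1 (SameCycle.refl _ _)⟩)
    have hsum : (bdry R.flip S).ncard + (bdry R.flip S').ncard ≤ 4 := by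
      rw [← Set.ncard_union_eq (Set.disjoint_left.2 fun d hd hd' => hdisj d hd.1 hd'.1),
        ← R.ncard_image_flip]
      refine (Set.ncard_le_ncard ?_ (Set.toFinite _)).trans hWcard
      rintro _ ⟨d, hd | hd, rfl⟩
      exacts [hbW S hSi hSc d hd, hbW S' hSi' hSc' d hd]
    obtain ⟨i, hi⟩ := m.even_bdry hS
    obtain ⟨j, hj⟩ := m.even_bdry hS'
    obtain ⟨b, hbne, hb⟩ : ∃ b, b ≠ R.flip p ∧ bdry R.flip S = {R.flip p, b} := by
      obtain ⟨a, b, hab, he⟩ := Set.ncard_eq_two.1 (show (bdry R.flip S).ncard = 2 by omega)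
      rw [he] at hpb
      rcases hpb with h | h
      · exact ⟨b, h ▸ hab.symm, h ▸ he⟩
      · exact ⟨a, (show R.flip p = b from h) ▸ hab,
          (show R.flip p = b from h) ▸ he.trans (Set.pair_comm _ _)⟩
    have hbb : b ∈ bdry R.flip S := by rw [hb]; exact Or.inr rfl
    obtain ⟨hbW1, hbW2⟩ := hbW S hSi hSc b hbb
    refine c.not_chain m hx hxr hp hpr hpx (hL p hp hpr hpx) hS hrS (w := R.flip b)
      (fun h => hbne (by rw [← h, R.flip_flip])) (fun h => hbW2 (Or.inl h))
      (fun h => hbW2 (Or.inr (Or.inl h))) hbW1 ?_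
    rintro d (hd | rfl | rfl)
    · by_cases hd' : R.flip d ∈ S
      · exact Or.inl hd'
      have : d ∈ bdry R.flip S := ⟨hd, hd'⟩
      rw [hb] at this
      rcases this with rfl | rfl
      · exact Or.inr (Or.inl (R.flip_flip _))
      · exact Or.inr (Or.inr rfl)
    · exact Or.inl hpS
    · rw [R.flip_flip]; exact Or.inl hbb.1
  have : Nonempty ({R.s, R.t}ᶜ : Set R.Vertex) := ⟨⟨_, hpi⟩⟩
  refine ⟨⟨innerGraph_preconnected fun S hS hne hSi hSc e he => ?_⟩, hnum⟩
  by_contra heS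
  have hV := R.isVertexSet_preimage_vert {R.s, R.t}ᶜ
  set S' : Set D := R.vert ⁻¹' {R.s, R.t}ᶜ \ S
  have hSc' : ∀ x ∈ S', R.vert (R.flip x) ∈ ({R.s, R.t}ᶜ : Set R.Vertex) → R.flip x ∈ S' := by
    rintro d ⟨hd, hd'⟩ hi
    refine ⟨hi, fun h => hd' ?_⟩
    rw [← R.flip_flip d]
    exact hSc _ h (by rw [R.flip_flip]; exact hd)
  by_cases hpS : R.flip p ∈ S
  · exact key S S' hS (hV.diff hS) ⟨e, he, heS⟩ hSi (fun d hd => hd.1) hSc hSc'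
      (fun d hd hd' => hd'.2 hd) hpS
  · exact key S' S (hV.diff hS) hS hne (fun d hd => hd.1) hSi hSc' hSc (fun d hd => hd.2)
      ⟨hpi, hpS⟩

end RootedMap

/-! ### The generating functions of the classes -/

namespace Net

theorem core_iff {A : Net} :
    Core A ↔ NoK4 A ∧ A.map.s ≠ A.map.t ∧ A.map.NetworkTwoEdgeConnected := by
  rw [Core, isCore_iff, NetworkTwoEdgeConnected, networkHasBridge_iff A.is4, not_not, Ne,
    s_eq_t_iff, and_comm (a := ¬ _)]
  exact and_congr_right fun _ => and_congr_left fun _ =>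
    ⟨fun h => ⟨network_connected A.is4, h⟩, fun h => h.2⟩

theorem Core.inner {A : Net} (h : Core A) :
    (CoreParallel A → A.map.innerGraph.Connected ∧ A.map.numRootParallel = 2) ∧
    (¬ CoreParallel A → ¬ A.map.innerGraph.Preconnected ∨ 3 ≤ A.map.numRootParallel) := by
  refine ⟨fun ⟨_, hd, x, hx, hxr, hxt⟩ => h.2.connected_of_parallel A.is4 hd hx hxr hxt,
    fun hC => ?_⟩
  by_cases hd : A.map.IsDip
  · exact h.2.not_preconnected_or_of_isDip A.is4 hd
  · exact Or.inl (h.2.not_preconnected_of_not_isDip A.is4 h.1 hd fun x hx hxr hxt =>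
      hC ⟨h, hd, x, hx, hxr, hxt⟩)

theorem coreParallel_iff {A : Net} : CoreParallel A ↔
    Core A ∧ A.map.innerGraph.Connected ∧ A.map.numRootParallel = 2 := by
  refine ⟨fun h => ⟨h.1, h.1.inner.1 h⟩, fun ⟨h, h1, h2⟩ => ?_⟩
  by_contra hC
  rcases h.inner.2 hC with g | g
  · exact g h1.preconnected
  · omega

theorem not_coreParallel_iff {A : Net} : Core A ∧ ¬ CoreParallel A ↔
    Core A ∧ (¬ A.map.innerGraph.Preconnected ∨ 3 ≤ A.map.numRootParallel) := by
  refine and_congr_right fun h => ⟨h.inner.2, fun hC g => ?_⟩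
  obtain ⟨h1, h2⟩ := h.inner.1 g
  rcases hC with hC | hC
  · exact hC h1.preconnected
  · omega

theorem invariant_coreParallel : Invariant CoreParallel := by
  rintro A B i ⟨h1, h2, x, hx, hxr, hxt⟩
  refine ⟨invariant_core i h1, fun h => h2 ((Iso.isDip i).1 h), ?_⟩
  obtain ⟨e, e1, e2, e3⟩ := i
  refine ⟨e x, ?_, fun h => hxr (e.injective (h.trans e3.symm)), ?_⟩
  · rw [← e3, sameCycle_congr e1]; exact hx
  · rw [← e3, ← e2, ← e2, sameCycle_congr e1]; exact hxt

theorem invariant_bridgeless : Invariant fun A => A.map.Bridgeless :=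
  fun _ _ i h => Iso.bridgeless i h

/-- A class of rooted maps is described by a property of the 4-regular maps without `K₄` minor. -/
theorem genFun_eq_gf_and {C : ∀ ⦃D : Type⦄, RootedMap D → Prop} {p q : Net → Prop}
    (hC : ∀ (D : Type) (R : RootedMap D), C R → R.ClassM)
    (h : ∀ A : Net, NoK4 A → (C A.map ↔ q A)) (hp : ∀ A, p A ↔ NoK4 A ∧ q A) (hi : Invariant p) :
    genFun C = gf p := by
  refine genFun_eq_gf (fun D _ R => ⟨fun hR => ?_, fun ⟨m, hR⟩ => ?_⟩) hi
  · obtain ⟨h1, h2⟩ := hC D R hR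
    have m := R.isFourRegular_iff.1 h1
    have hk := R.isK4MinorFree_iff.1 h2
    exact ⟨m, (hp _).2 ⟨hk, (h ⟨D, inferInstance, R, m⟩ hk).1 hR⟩⟩
  · obtain ⟨hk, hq⟩ := (hp _).1 hR
    exact (h ⟨D, inferInstance, R, m⟩ hk).2 hq

theorem NoK4.classM {A : Net} (h : NoK4 A) : A.map.ClassM :=
  ⟨A.map.isFourRegular_iff.2 A.is4, A.map.isK4MinorFree_iff.2 h⟩

theorem genM_eq : genM = gf NoK4 :=
  genFun_eq_gf_and (q := fun _ => True) (fun _ _ h => h)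
    (fun _ h => ⟨fun _ => trivial, fun _ => h.classM⟩)
    (fun _ => (and_iff_left trivial).symm) invariant_noK4

theorem genU_eq : genU = gf fun A => NoK4 A ∧ IsLoop A :=
  genFun_eq_gf_and (fun _ _ h => h.1)
    (fun A h => ⟨fun g => A.map.s_eq_t_iff.1 g.2, fun g => ⟨h.classM, s_eq_t_iff.2 g⟩⟩)
    (fun _ => Iff.rfl) (invariant_noK4.and invariant_isLoop)

theorem genS_eq : genS = gf fun A => NoK4 A ∧ ¬ A.map.Bridgeless :=
  genFun_eq_gf_and (fun _ _ h => h.1)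
    (fun A h => ⟨fun g => (networkHasBridge_iff A.is4).1 g.2.2,
      fun g => ⟨h.classM, network_connected A.is4, (networkHasBridge_iff A.is4).2 g⟩⟩)
    (fun _ => Iff.rfl) (invariant_noK4.and invariant_bridgeless.not)

theorem genP_eq : genP = gf fun A => Core A ∧ ¬ CoreParallel A :=
  genFun_eq_gf_and (fun _ _ h => h.1) (fun _ h => and_iff_right h.classM)
    (fun _ => by rw [not_coreParallel_iff, core_iff, and_assoc, and_assoc])
    (invariant_core.and invariant_coreParallel.not)

theorem genF_eq : genF = gf CoreParallel :=
  genFun_eq_gf_and (fun _ _ h => h.1) (fun _ h => and_iff_right h.classM)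
    (fun _ => by rw [coreParallel_iff, core_iff, and_assoc, and_assoc]) invariant_coreParallel

theorem gf_noK4 : gf NoK4 = gf (fun A => NoK4 A ∧ ¬ A.map.Bridgeless) +
    gf fun A => NoK4 A ∧ A.map.Bridgeless :=
  gf_add (fun _ => by rw [← and_or_left, or_comm, and_iff_left (em _)])
    (invariant_noK4.and invariant_bridgeless.not) fun _ h h' => h.2 h'.2

theorem gf_bridgeless : gf (fun A => NoK4 A ∧ A.map.Bridgeless) =
    gf (fun A => NoK4 A ∧ IsLoop A) + gf Core := by
  refine gf_add (fun A => ?_) (invariant_noK4.and invariant_isLoop) fun A h h' => h'.2.not_loop h.2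
  rw [Core, isCore_iff]
  have : IsLoop A → A.map.Bridgeless := bridgeless_of_loop A.is4
  tauto

theorem gf_core_eq_add : gf Core = gf (fun A => Core A ∧ ¬ CoreParallel A) + gf CoreParallel :=
  gf_add (fun A => ⟨fun h => by tauto, fun h => h.elim (fun g => g.1) fun g => g.1⟩)
    (invariant_core.and invariant_coreParallel.not) fun _ h h' => h.2 h'

theorem gf_fan_isLoop : gf (Fan IsLoop) = PowerSeries.X + PowerSeries.X *
    (PowerSeries.X * gf NoK4) := by
  rw [gf_fan invariant_isLoop fun _ _ _ => subRel_isLoop_iff, gf_edgeFan_isLoop]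

theorem gf_fan_pinchedProp (b : Prop) : gf (Fan (PinchedProp b)) = gf (EdgeFan (PinchedProp b)) +
    PowerSeries.X * (gf (EdgeFan (PinchedProp b)) * gf NoK4) :=
  gf_fan (invariant_pinchedProp b) fun _ _ _ hp hE i => and_congr
    (not_congr (subRel_isLoop_iff hp hE i)) (iff_congr (subRel_isDip_iff hp hE i) Iff.rfl)

theorem gf_fan_not_isLoop : gf (Fan fun A => IsLoop A ↔ False) =
    gf (Fan (PinchedProp True)) + gf (Fan (PinchedProp False)) := by
  refine gf_add (fun A => ?_) (invariant_fan (invariant_pinchedProp _)) fun A h h' =>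
    h'.2.2.2.2.2.1 (h.2.2.2.2.2.2 trivial)
  rw [Fan, Fan, Fan, PinchedProp, PinchedProp]
  tauto

end Net

open RootedMap PowerSeries in
theorem proposition3 :
    genM = genU + genS + genP + genF ∧
    genU = 2 * X ^ 2 * genM + 2 * X ∧
    genS = X * (genM - genS) * genM ∧
    genP = X ^ 3 * (1 + X * genM) ^ 3 + X * genF * genM ∧
    genF = (X + X ^ 2 * genM) ^ 2 * (genF + 2 * X * (X + X ^ 2 * genM) ^ 2) := by
  have hM := Net.gf_noK4
  have hT := Net.gf_bridgeless
  have hU := Net.gf_isLoop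
  have hl := Net.gf_fan_isLoop
  have hC := Net.gf_core
  have hPF := Net.gf_core_eq_add
  have hF := Net.gf_coreParallel
  have hD := Net.gf_fan_pinchedProp True
  have hE := Net.gf_fan_pinchedProp False
  have hD0 := Net.gf_edgeFan_pinchedProp True
  have hE0 := Net.gf_edgeFan_pinchedProp False
  have hn := Net.gf_fan_not_isLoop
  have hS : Net.gf (fun A => Net.NoK4 A ∧ ¬ A.map.Bridgeless) =
      X * (Net.gf Net.NoK4 * Net.gf fun A => Net.NoK4 A ∧ A.map.Bridgeless) := by
    rw [← Net.gf_series fun _ h => h.2]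
    exact congrArg Net.gf (funext fun A => propext (Net.not_bridgeless_iff_series A))
  simp only [iff_true] at hD0
  rw [← Net.genM_eq, ← Net.genS_eq] at hM hS
  rw [← Net.genU_eq] at hT hU
  rw [← Net.genM_eq] at hl hD hE hD0 hE0
  rw [← Net.genP_eq, ← Net.genF_eq] at hPF
  rw [← Net.genF_eq] at hF
  have hDval : Net.gf (Net.Fan (Net.PinchedProp True)) = X ^ 3 * (1 + X * genM) ^ 3 := by
    rw [hD, hD0, hl]
    ring
  refine ⟨?_, ?_, ?_, ?_, ?_⟩
  · linear_combination hM + hT + hPF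
  · rw [hU, hl]
    ring
  · linear_combination hS - X * genM * hM
  · linear_combination hC - hPF + 2 * hE + hDval - (1 + X * genM) * hF
  · linear_combination hF + 2 * hE0 + (2 * X ^ 2 * (1 + X * genM)) * (hn + hDval + hE) -
      X ^ 2 * (1 + X * genM) ^ 2 * hF
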